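/- **Setting.** Let $T,n,N\ge 0$, $\mu\ge1$ be integers, $a(0),\dots,a(N)\in\mathbb C^T$, and $A_N\vec\xi=\sum_{k=0}^N a(k)^\top\vec\xi(k)$. A spectral density is an integrable function on $(-\pi,\pi]$ with values that are a.e. positive semidefinite Hermitian $T\times T$ matrices. Let $\vec\xi$ be a $\mathbb C^T$-valued sequence with mean-zero stationary $n$th increments $\xi^{(n)}_p(k,s)=\sum_{l=0}^n(-1)^l\binom nl\xi_p(k-ls)$ of spectral density $f$, i.e. $E\,\xi_p^{(n)}(k+m,s_1)\overline{\xi_q^{(n)}(k,s_2)}=\frac1{2\pi}\int_{-\pi}^{\pi}e^{i\lambda m}(1-e^{-is_1\lambda})^n(1-e^{is_2\lambda})^n\lambda^{-2n}f_{pq}(\lambda)d\lambda$, and let $\vec\eta$ be a mean-zero stationary sequence with spectral density $g$, $E\,\eta_p(k+m)\overline{\eta_q(k)}=\frac1{2\pi}\int_{-\pi}^{\pi}e^{i\lambda m}g_{pq}(\lambda)d\lambda$, uncorrelated with the increments of $\vec\xi$. Put $\vec\zeta=\vec\xi+\vec\eta$, $p=f+\lambda^{2n}g$, $\kappa(\lambda)=(1-e^{-i\lambda\mu})^n(i\lambda)^{-n}$,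 $w(\lambda)=|1-e^{i\lambda\mu}|^{2n}|\lambda|^{-2n}$. Let $d_\mu(k)$ be the coefficients of $\big(\sum_{j\ge0} x^{\mu j}\big)^n$, $b(k)=\sum_{m=k}^N d_\mu(m-k)a(m)$ for $0\le k\le N$ and $b(k)=0$ for $k>N$, and $v(k)=\sum_{0\le l\le n,\ 0\le l\mu+k\le N}(-1)^l\binom nl b(l\mu+k)$ for $-\mu n\le k\le -1$. Then $A_N\vec\xi=H_N\vec\xi-V_N\vec\zeta$ with $H_N\vec\xi=\sum_{k=0}^N b(k)^\top\vec\zeta^{(n)}(k,\mu)-\sum_{k=0}^N a(k)^\top\vec\eta(k)$ and $V_N\vec\zeta=\sum_{k=-\mu n}^{-1}v(k)^\top\vec\zeta(k)$. Linear estimates are $\hat H-V_N\vec\zeta$ with $\hat H$ in the closed linear span in $L_2(\Omega)$ of the increments $\zeta^{(n)}_l(k,\mu)$, $1\le l\le T$, $k\le-1$ or $k\ge N+\mu n+1$ (these involve no values at the times $0,\dots,N$). The spectral characteristic $h$ of the estimate is the element of the subspace $L(f,g)$ of $L_2(p)$, closed and generated by $e^{i\lambda k}\kappa(\lambda)\delta_l$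 for the same $k,l$, which corresponds to $\hat H$ under the isometry $e^{i\lambda k}\kappa\,\delta_l\leftrightarrow\zeta_l^{(n)}(k,\mu)$. Here $L_2(p)$ has the inner product $\int h_1^\top p\,\overline{h_2}\,d\lambda$. Let $\Delta(h;f,g)$ be the mean square error of that estimate of $A_N\vec\xi$, and $\Delta(f,g)=\min_{h\in L(f,g)}\Delta(h;f,g)$. For a class $\mathcal D$ of pairs $(f,g)$ put $H_{\mathcal D}=\bigcap_{(f,g)\in\mathcal D}L(f,g)$. A pair $(f_0,g_0)\in\mathcal D$ is least favorable in $\mathcal D$ if it maximizes $\Delta(f,g)$ over $\mathcal D$. A characteristic $h^0\in H_{\mathcal D}$ is minimax-robust if it minimizes $\sup_{(f,g)\in\mathcal D}\Delta(h;f,g)$ over $h\in H_{\mathcal D}$. A pair $(f,g)$ satisfies the minimality condition if $p(\lambda)$ is invertible for a.e. $\lambda$ and $\int_{-\pi}^{\pi}w^{-1}\operatorname{Tr}[p^{-1}]d\lambda<\infty$. For such a pair put $A(\lambda)=\sum_{k=0}^N a(k)e^{i\lambda k}$, $B(\lambda)=\sum_{k=0}^N b(k)e^{i\lambda k}$, and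 let $C(\lambda)=\sum_{k=0}^{N+\mu n}c(k)e^{i\lambda k}$ have the coefficients determined by the linear system $$\frac1{2\pi}\int_{-\pi}^{\pi}e^{-ij\lambda}w^{-1}\big[(1-e^{i\lambda\mu})^nA^\top g+C^\top\big]p^{-1}d\lambda=b(j)^\top,\qquad 0\le j\le N+\mu n.$$ Define $$h_{\mu,N}(f,g)^\top=\kappa B^\top-(-i\lambda)^nA^\top g\,p^{-1}-\frac{(-i\lambda)^n}{(1-e^{i\lambda\mu})^n}C^\top p^{-1}.\qquad(*)$$ **Classes.** Let $g_1$ be a spectral density, $P$ a $T\times T$ matrix, $p,p_k,\delta,\delta_k,\delta_i^j$ real numbers ($1\le k,i,j\le T$; the number $p$ is not to be confused with the density above), $B_1,B_2$ positive semidefinite Hermitian matrices, $\langle B,f\rangle=\sum_{i,j}B_{ij}f_{ij}$. The classes $\mathcal D^k_{f0}$ and $\mathcal D^k_{1\delta}$, $k=1,2,3,4$, consist of the spectral densities $f$, respectively $g$, such that 1. $\frac1{2\pi}\int wf\,d\lambda=P$; respectively $\frac1{2\pi}\int|\operatorname{Tr}(g-g_1)|d\lambda\le\delta$; 2. $\frac1{2\pi}\int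 w\operatorname{Tr}f\,d\lambda=p$; respectively $\frac1{2\pi}\int|g_{kk}-g^1_{kk}|d\lambda\le\delta_k$ for all $k$; 3. $\frac1{2\pi}\int wf_{kk}\,d\lambda=p_k$ for all $k$; respectively $\frac1{2\pi}\int|\langle B_2,g-g_1\rangle|d\lambda\le\delta$; 4. $\frac1{2\pi}\int w\langle B_1,f\rangle d\lambda=p$; respectively $\frac1{2\pi}\int|g_{ij}-g^1_{ij}|d\lambda\le\delta_i^j$ for all $i,j$. **Equations.** For $(f_0,g_0)$, with $p_0=f_0+\lambda^{2n}g_0$ and $A,C$ formed for $(f_0,g_0)$, let $q_f=(1-e^{i\lambda\mu})^nA^\top g_0+C^\top$ and $q_g=(1-e^{i\lambda\mu})^nA^\top f_0-\lambda^{2n}C^\top$ (row vectors). The $k$th system of equations is $$q_f^*q_f=(wp_0)M(wp_0),\qquad q_g^*q_g=(|1-e^{i\lambda\mu}|^np_0)\,R(\lambda)\,(|1-e^{i\lambda\mu}|^np_0)\qquad\text{for a.e. }\lambda,$$ with Lagrange multipliers and functions as follows, where every neighbourhood constraint with a nonzero multiplier holds with equality for $g_0$ (complementary slackness): 1. $M=\vec\alpha\vec\alpha^*$,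 $\vec\alpha\in\mathbb C^T$; $R=\beta^2\gamma(\lambda)I$; 2. $M=\alpha^2I$; $R=\operatorname{diag}(\beta_k^2\gamma_k(\lambda))$; 3. $M=\operatorname{diag}(\alpha_k^2)$; $R=\beta^2\gamma(\lambda)B_2^\top$; 4. $M=\alpha^2B_1^\top$; $R=\{\beta_{ij}\gamma_{ij}(\lambda)\}$ with constants $\beta_{ij}\ge0$. Here $\alpha,\alpha_k,\beta,\beta_k$ are real constants, $|\gamma|,|\gamma_k|,|\gamma_{ij}|\le1$, and wherever the argument is nonzero, $\gamma=\operatorname{sign}\operatorname{Tr}(g_0-g_1)$ in case 1, $\gamma_k=\operatorname{sign}(g^0_{kk}-g^1_{kk})$ in case 2, $\gamma=\operatorname{sign}\langle B_2,g_0-g_1\rangle$ in case 3, $\gamma_{ij}=(g^0_{ij}-g^1_{ij})/|g^0_{ij}-g^1_{ij}|$ in case 4. **Theorem 4.1.** Let $k\in\{1,2,3,4\}$, $\mathcal D=\mathcal D^k_{f0}\times\mathcal D^k_{1\delta}$, let $(f_0,g_0)\in\mathcal D$ satisfy the minimality condition, and let $h^0=h_{\mu,N}(f_0,g_0)$ be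 given by $(*)$. Let $\Delta_{\mathcal D}(f,g)=-\Delta(h^0;f,g)$ for $(f,g)\in\mathcal D$ and $\Delta_{\mathcal D}=+\infty$ outside $\mathcal D$. Then: (a) $h^0\in L(f_0,g_0)$ and $\Delta(h^0;f_0,g_0)=\Delta(f_0,g_0)$. (b) If $(f_0,g_0)$ solves the $k$th system of equations, then it is least favorable in $\mathcal D$, $h^0\in H_{\mathcal D}$, $0\in\partial\Delta_{\mathcal D}(f_0,g_0)$, and $h^0$ is minimax-robust. (c) Conversely, if $(f_0,g_0)$ is least favorable in $\mathcal D$, $f_0$ and $g_0$ are positive definite a.e., and the numbers among $\delta,\delta_k,\delta_i^j$ that define $\mathcal D^k_{1\delta}$ are positive (with $\delta_i^j=\delta_j^i$ for $k=4$), then $(f_0,g_0)$ solves the $k$th system of equations. (d) If $h^0\in H_{\mathcal D}$, then $(f_0,g_0)$ is least favorable in $\mathcal D$ if and only if $0\in\partial\Delta_{\mathcal D}(f_0,g_0)$, and in this case $h^0$ is minimax-robust. -/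

import Mathlib

open MeasureTheory Matrix
open scoped ENNReal ComplexConjugate ComplexOrder

namespace RobustInterpolation

noncomputable section

/-- A matrix-valued function of the frequency `x ∈ (-π, π]` (values outside are irrelevant). -/
abbrev Density (T : ℕ) := ℝ → Matrix (Fin T) (Fin T) ℂ

/-- Lebesgue measure on the frequency interval. -/
def freq : Measure ℝ := volume.restrict (Set.Ioc (-Real.pi) Real.pi)

/-- The normalised integral `(1 / 2π) ∫_{-π}^{π} F(x) dx`. -/
def mean (F : ℝ → ℂ) : ℂ := (1 / (2 * Real.pi) : ℂ) * ∫ x, F x ∂freq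

/-- The normalised integral `(1 / 2π) ∫_{-π}^{π} F(x) dx` of a real function. -/
def meanR (F : ℝ → ℝ) : ℝ := 1 / (2 * Real.pi) * ∫ x, F x ∂freq

/-- The exponential `e^{i x m}`. -/
def ee (m : ℤ) (x : ℝ) : ℂ := Complex.exp (Complex.I * (x * m))

/-- A spectral density: an integrable function with positive semidefinite Hermitian values. -/
structure IsSpectralDensity {T : ℕ} (f : Density T) : Prop where
  integrable : ∀ i j, Integrable (fun x => f x i j) freq
  posSemidef : ∀ᵐ x ∂freq, (f x).PosSemidef

/-- The data of the estimation problem: the order `n` and the step `μ > 0` of the increments, the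
number `N` (the values at the times `0, …, N` are not observed), and the coefficients
`a(0), …, a(N)` of the functional `A_N ξ = ∑_{k=0}^N a(k)ᵀ ξ(k)`. -/
structure Problem (T : ℕ) where
  n : ℕ
  N : ℕ
  μ : ℕ
  μ_pos : 0 < μ
  a : ℕ → Fin T → ℂ

/-- The `n`-th increment `∑_{l=0}^n (-1)^l C(n,l) ζ(k - l s)` with step `s`, by components. -/
def incr {T : ℕ} {Ω : Type} (n : ℕ) (s : ℤ) (ζ : ℤ → Fin T → Ω → ℂ) (k : ℤ) (p : Fin T) (ω : Ω) :
    ℂ :=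
  ∑ l ∈ Finset.range (n + 1), (-1) ^ l * (n.choose l : ℂ) * ζ (k - l * s) p ω

/-- `ξ` is a vector sequence with stationary `n`-th increments of mean zero and spectral density
`f`, and `η` is a stationary vector sequence of mean zero and spectral density `g`, uncorrelated
with `ξ`. -/
structure IsModel {T : ℕ} {Ω : Type} [MeasurableSpace Ω] (n : ℕ) (f g : Density T)
    (P : Measure Ω) (ξ η : ℤ → Fin T → Ω → ℂ) : Prop where
  prob : IsProbabilityMeasure P
  meas : ∀ k p, AEStronglyMeasurable (ξ k p) P
  incr_memLp : ∀ s k p, MemLp (incr n s ξ k p) 2 P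
  noise_memLp : ∀ k p, MemLp (η k p) 2 P
  incr_mean : ∀ s k p, ∫ ω, incr n s ξ k p ω ∂P = 0
  noise_mean : ∀ k p, ∫ ω, η k p ω ∂P = 0
  incr_cov : ∀ (s₁ s₂ k m : ℤ) (p q : Fin T),
    ∫ ω, incr n s₁ ξ (k + m) p ω * conj (incr n s₂ ξ k q ω) ∂P =
      mean fun x => ee m x * (1 - ee (-s₁) x) ^ n * (1 - ee s₂ x) ^ n / (x : ℂ) ^ (2 * n) * f x p q
  noise_cov : ∀ (k m : ℤ) (p q : Fin T),
    ∫ ω, η (k + m) p ω * conj (η k q ω) ∂P = mean fun x => ee m x * g x p q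
  uncorrelated : ∀ (s k j : ℤ) (p q : Fin T), ∫ ω, incr n s ξ k p ω * conj (η j q ω) ∂P = 0

/-- The squared norm `∫ h(x)ᵀ p(x) conj(h(x)) dx` of the space `L₂(p)`. -/
def sqNorm {T : ℕ} (p : Density T) (h : ℝ → Fin T → ℂ) : ℝ≥0∞ :=
  ∫⁻ x, ENNReal.ofReal (h x ⬝ᵥ (p x *ᵥ star (h x))).re ∂freq

/-- Spectral density `f(x) + x^{2n} g(x)` of the observed sequence `ξ + η`. -/
def obsDensity {T : ℕ} (n : ℕ) (f g : Density T) : Density T :=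
  fun x => f x + ((x : ℂ) ^ (2 * n)) • g x

namespace Problem

variable {T : ℕ} (S : Problem T)

/-- Times `k` whose increment `ζ^{(n)}(k, μ)` involves only observed values on one side of the
gap `{0, …, N}`: `k ≤ -1` or `k ≥ N + μ n + 1`. -/
def obsTimes : Set ℤ := {k | k ≤ -1 ∨ (S.N : ℤ) + S.μ * S.n + 1 ≤ k}

/-- `(1 - e^{-i x μ})^n / (i x)^n`. -/
def kern (x : ℝ) : ℂ := (1 - ee (-S.μ) x) ^ S.n / (Complex.I * x) ^ S.n

/-- `(1 - e^{i x μ})^n`. -/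
def fac (x : ℝ) : ℂ := (1 - ee S.μ x) ^ S.n

/-- The weight `|1 - e^{i x μ}|^{2n} / |x|^{2n}`. -/
def weight (x : ℝ) : ℝ := ‖1 - ee S.μ x‖ ^ (2 * S.n) / |x| ^ (2 * S.n)

/-- The inverse weight `x^{2n} / |1 - e^{i x μ}|^{2n}`. -/
def invWeight (x : ℝ) : ℝ := x ^ (2 * S.n) / ‖1 - ee S.μ x‖ ^ (2 * S.n)

/-- The coefficient `d_μ(k)` of `x^k` in `(∑_j x^{μ j})^n`. -/
def d (k : ℕ) : ℂ :=
  PowerSeries.coeff k ((PowerSeries.mk fun j => if S.μ ∣ j then (1 : ℂ) else 0) ^ S.n)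

/-- `b(k) = ∑_{m=k}^N d_μ(m-k) a(m)`; it vanishes for `k > N`. -/
def b (k : ℕ) (p : Fin T) : ℂ := ∑ m ∈ Finset.Icc k S.N, S.d (m - k) * S.a m p

/-- The coefficient `v(-j)`, `1 ≤ j ≤ μ n`, of the functional of the initial values. -/
def v (j : ℕ) (p : Fin T) : ℂ :=
  ∑ l ∈ (Finset.range (S.n + 1)).filter (fun l => j ≤ l * S.μ ∧ l * S.μ - j ≤ S.N),
    (-1) ^ l * (S.n.choose l : ℂ) * S.b (l * S.μ - j) p

/-- The functional `A_N ξ`. -/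
def target {Ω : Type} (ξ : ℤ → Fin T → Ω → ℂ) (ω : Ω) : ℂ :=
  ∑ k ∈ Finset.range (S.N + 1), ∑ p, S.a k p * ξ k p ω

/-- The functional `V_N ζ = ∑_{k=-μn}^{-1} v(k)ᵀ ζ(k)` of the observed initial values. -/
def initial {Ω : Type} (ζ : ℤ → Fin T → Ω → ℂ) (ω : Ω) : ℂ :=
  ∑ j ∈ Finset.Icc 1 (S.μ * S.n), ∑ p, S.v j p * ζ (-(j : ℤ)) p ω

/-- A finite linear combination of increments `ζ_p^{(n)}(k, μ)`. -/
def combo {Ω : Type} (ζ : ℤ → Fin T → Ω → ℂ) (c : ℤ × Fin T →₀ ℂ) (ω : Ω) : ℂ :=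
  c.sum fun kp z => z * incr S.n S.μ ζ kp.1 kp.2 ω

/-- The function of the frequency corresponding to the combination `combo`. -/
def comboChar (c : ℤ × Fin T →₀ ℂ) (x : ℝ) : Fin T → ℂ :=
  c.sum fun kp z => Pi.single kp.2 (z * (ee kp.1 x * S.kern x))

/-- Combinations of the observed increments. -/
def IsObserved (c : ℤ × Fin T →₀ ℂ) : Prop := ∀ kp ∈ c.support, kp.1 ∈ S.obsTimes

/-- `h` belongs to the closed subspace of `L₂(f + x^{2n} g)` generated by the functions
`e^{ixk} (1 - e^{-ixμ})^n (ix)^{-n} δ_l` with `k ≤ -1` or `k ≥ N + μ n + 1`. -/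
def InObs (f g : Density T) (h : ℝ → Fin T → ℂ) : Prop :=
  AEStronglyMeasurable h freq ∧ ∀ ε : ℝ≥0∞, 0 < ε → ∃ c, S.IsObserved c ∧
    sqNorm (obsDensity S.n f g) (fun x => h x - S.comboChar c x) < ε

/-- `Y` is the linear estimate `Ĥ_N ξ - V_N ζ` of `A_N ξ` with the spectral characteristic `h`,
where `ζ = ξ + η` and `Ĥ_N ξ = ∫ hᵀ dZ`. The stochastic integral is the isometric image of `h`: it
is approximated in mean square by the combinations of observed increments whose functions of the
frequency approximate `h` in `L₂(f + x^{2n} g)`. -/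
def IsEstimate {Ω : Type} [MeasurableSpace Ω] (f g : Density T) (P : Measure Ω)
    (ξ η : ℤ → Fin T → Ω → ℂ) (h : ℝ → Fin T → ℂ) (Y : Ω → ℂ) : Prop :=
  AEStronglyMeasurable Y P ∧ AEStronglyMeasurable h freq ∧
    ∀ ε : ℝ≥0∞, 0 < ε → ∃ c, S.IsObserved c ∧
      sqNorm (obsDensity S.n f g) (fun x => h x - S.comboChar c x) < ε ∧
      ∫⁻ ω, ‖Y ω + S.initial (ξ + η) ω - S.combo (ξ + η) c ω‖ₑ ^ 2 ∂P < ε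

/-- The mean square error `Δ(h; f, g) = E |A_N ξ - Â_N ξ|²` of the linear estimate with spectral
characteristic `h` when the spectral densities are `f`, `g`. It depends on the second order
structure only, so all the models with these densities have the same value; the supremum
picks it. It is used for `h` with `InObs f g h`. -/
def mse (f g : Density T) (h : ℝ → Fin T → ℂ) : ℝ≥0∞ :=
  ⨆ (Ω : Type) (_ : MeasurableSpace Ω) (P : Measure Ω) (ξ : ℤ → Fin T → Ω → ℂ)
    (η : ℤ → Fin T → Ω → ℂ) (_ : IsModel S.n f g P ξ η) (Y : Ω → ℂ)
    (_ : S.IsEstimate f g P ξ η h Y), ∫⁻ ω, ‖S.target ξ ω - Y ω‖ₑ ^ 2 ∂P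

/-- The mean square error `Δ(f, g)` of the optimal linear estimate. -/
def minMse (f g : Density T) : ℝ≥0∞ := ⨅ (h : ℝ → Fin T → ℂ) (_ : S.InObs f g h), S.mse f g h

/-- The minimality condition (including that `f + x^{2n} g` is invertible almost everywhere). -/
def Minimality (f g : Density T) : Prop :=
  (∀ᵐ x ∂freq, IsUnit (obsDensity S.n f g x).det) ∧
    Integrable (fun x => (S.invWeight x : ℂ) * ((obsDensity S.n f g x)⁻¹).trace) freq

/-- `A_N(e^{ix}) = ∑_{k=0}^N a(k) e^{ixk}`. -/
def polyA (x : ℝ) : Fin T → ℂ := ∑ k ∈ Finset.range (S.N + 1), ee k x • S.a k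

/-- `B_{μ,N}(e^{ix}) = ∑_{k=0}^N b(k) e^{ixk}`. -/
def polyB (x : ℝ) : Fin T → ℂ := ∑ k ∈ Finset.range (S.N + 1), ee k x • S.b k

/-- Index set of the vectors of dimension `(N + μ n + 1) T`. -/
abbrev Idx := Fin (S.N + S.μ * S.n + 1) × Fin T

/-- The block matrix `P_N^μ` of Fourier coefficients of `x^{2n} |1 - e^{ixμ}|^{-2n} p(x)^{-1}`
(transposed blocks, since they act on columns, whereas `p⁻¹` multiplies row vectors from the
right). -/
def matP (f g : Density T) : Matrix S.Idx S.Idx ℂ := fun j k =>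
  mean fun x => ee ((k.1 : ℤ) - j.1) x * S.invWeight x * (obsDensity S.n f g x)⁻¹ k.2 j.2

/-- The vector `T_N^μ a_N^μ`: the Fourier coefficients with indices `0, …, N + μ n` of
`x^{2n} |1 - e^{ixμ}|^{-2n} (1 - e^{ixμ})^n A_N(e^{ix})ᵀ g(x) p(x)^{-1}`. -/
def vecTa (f g : Density T) : S.Idx → ℂ := fun j =>
  mean fun x => ee (-(j.1 : ℤ)) x * S.invWeight x * S.fac x *
    (S.polyA x ᵥ* (g x * (obsDensity S.n f g x)⁻¹)) j.2

/-- The vector `[D_N^μ a_N]_{+μn}`: the `b(k)`, `0 ≤ k ≤ N`, completed by zeros. -/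
def vecDa : S.Idx → ℂ := fun j => if (j.1 : ℕ) ≤ S.N then S.b j.1 j.2 else 0

/-- The vector `(P_N^μ)⁻¹ [D_N^μ a_N]_{+μn} - (P_N^μ)⁻¹ T_N^μ a_N^μ`. -/
def vecC (f g : Density T) : S.Idx → ℂ := (S.matP f g)⁻¹ *ᵥ (S.vecDa - S.vecTa f g)

/-- `C_{μ,N}(e^{ix}) = ∑_{k=0}^{N+μn} c(k) e^{ixk}`. -/
def polyC (f g : Density T) (x : ℝ) : Fin T → ℂ := fun p =>
  ∑ k : Fin (S.N + S.μ * S.n + 1), ee (k : ℕ) x * S.vecC f g (k, p)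

/-- The spectral characteristic `h_{μ,N}(f, g)` given by the explicit formula. -/
def specChar (f g : Density T) (x : ℝ) : Fin T → ℂ :=
  S.kern x • S.polyB x
    - (-(Complex.I * x)) ^ S.n • (S.polyA x ᵥ* (g x * (obsDensity S.n f g x)⁻¹))
    - ((-(Complex.I * x)) ^ S.n / S.fac x) • (S.polyC f g x ᵥ* (obsDensity S.n f g x)⁻¹)

/-- Least favorable pair of spectral densities in the class `D`. -/
def LeastFavorable (D : Set (Density T × Density T)) (f₀ g₀ : Density T) : Prop :=
  (f₀, g₀) ∈ D ∧ ∀ f g, (f, g) ∈ D → S.minMse f g ≤ S.minMse f₀ g₀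

/-- The set `H_D` of the characteristics that are admissible for all the densities in `D`. -/
def robustSet (D : Set (Density T × Density T)) : Set (ℝ → Fin T → ℂ) :=
  {h | ∀ f g, (f, g) ∈ D → S.InObs f g h}

/-- The maximal error `sup_{(f,g) ∈ D} Δ(h; f, g)`. -/
def worstMse (D : Set (Density T × Density T)) (h : ℝ → Fin T → ℂ) : ℝ≥0∞ :=
  ⨆ (f : Density T) (g : Density T) (_ : (f, g) ∈ D), S.mse f g h

/-- Minimax-robust spectral characteristic. -/
def IsMinimax (D : Set (Density T × Density T)) (h₀ : ℝ → Fin T → ℂ) : Prop :=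
  h₀ ∈ S.robustSet D ∧ ∀ h ∈ S.robustSet D, S.worstMse D h₀ ≤ S.worstMse D h

open Classical in
/-- The functional `Δ_D(f, g) = -Δ(h₀; f, g) + δ(f, g | D)`. -/
def extremalFunctional (D : Set (Density T × Density T)) (h₀ : ℝ → Fin T → ℂ)
    (f g : Density T) : EReal :=
  if (f, g) ∈ D then -(S.mse f g h₀ : EReal) else ⊤

/-- `0` is a subgradient of `Δ_D` at `(f₀, g₀)`, that is, `Δ_D ≥ Δ_D(f₀, g₀)` everywhere. -/
def ZeroMemSubdifferential (D : Set (Density T × Density T)) (h₀ : ℝ → Fin T → ℂ)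
    (f₀ g₀ : Density T) : Prop :=
  ∀ f g, S.extremalFunctional D h₀ f₀ g₀ ≤ S.extremalFunctional D h₀ f g

end Problem

/-- `⟨B, f⟩ = ∑_{i,j} B_{ij} f_{ij}`. -/
def pairing {T : ℕ} (B f : Matrix (Fin T) (Fin T) ℂ) : ℂ := ∑ i, ∑ j, B i j * f i j

/-- The given quantities which define the classes of spectral densities. -/
structure ClassData (T : ℕ) where
  P : Matrix (Fin T) (Fin T) ℂ
  p : ℝ
  pk : Fin T → ℝ
  B₁ : Matrix (Fin T) (Fin T) ℂ
  B₂ : Matrix (Fin T) (Fin T) ℂ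
  g₁ : Density T
  δ : ℝ
  δk : Fin T → ℝ
  δij : Fin T → Fin T → ℝ

namespace Problem

variable {T : ℕ} (S : Problem T)

/-- The four moment constraints on `f`. -/
def MomentConstraint (c : ClassData T) (f : Density T) : Fin 4 → Prop
  | 0 => ∀ i j, mean (fun x => S.weight x * f x i j) = c.P i j
  | 1 => mean (fun x => S.weight x * (f x).trace) = c.p
  | 2 => ∀ k, mean (fun x => S.weight x * f x k k) = c.pk k
  | 3 => mean (fun x => S.weight x * pairing c.B₁ (f x)) = c.p

/-- The four classes of the densities `f`. -/
def classF (c : ClassData T) (k : Fin 4) : Set (Density T) :=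
  {f | IsSpectralDensity f ∧ S.MomentConstraint c f k}

end Problem

/-- The four `L₁` neighbourhood constraints on `g`. -/
def NbhdConstraint {T : ℕ} (c : ClassData T) (g : Density T) : Fin 4 → Prop
  | 0 => meanR (fun x => ‖(g x - c.g₁ x).trace‖) ≤ c.δ
  | 1 => ∀ k, meanR (fun x => ‖(g x - c.g₁ x) k k‖) ≤ c.δk k
  | 2 => meanR (fun x => ‖pairing c.B₂ (g x - c.g₁ x)‖) ≤ c.δ
  | 3 => ∀ i j, meanR (fun x => ‖(g x - c.g₁ x) i j‖) ≤ c.δij i j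

/-- The four classes of the densities `g`. -/
def classG {T : ℕ} (c : ClassData T) (k : Fin 4) : Set (Density T) :=
  {g | IsSpectralDensity g ∧ NbhdConstraint c g k}

/-- `|γ| ≤ 1` and `γ = sign t` where `t ≠ 0`, for a real-valued `t` (given as a complex number). -/
def IsSignOf (γ : ℝ → ℝ) (t : ℝ → ℂ) : Prop :=
  ∀ᵐ x ∂freq, |γ x| ≤ 1 ∧ (t x ≠ 0 → γ x = Real.sign (t x).re)

/-- `|γ| ≤ 1` and `γ = t / |t|` where `t ≠ 0`. -/
def IsPhaseOf (γ t : ℝ → ℂ) : Prop :=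
  ∀ᵐ x ∂freq, ‖γ x‖ ≤ 1 ∧ (t x ≠ 0 → γ x = t x / ‖t x‖)

/-- For a row vector `q`, the matrix `q* q`. -/
def gram {T : ℕ} (q : Fin T → ℂ) : Matrix (Fin T) (Fin T) ℂ := vecMulVec (star q) q

namespace Problem

variable {T : ℕ} (S : Problem T)

/-- The row vector `(1 - e^{ixμ})^n A_N(e^{ix})ᵀ g(x) + C_{μ,N}(e^{ix})ᵀ`. -/
def rowF (f g : Density T) (x : ℝ) : Fin T → ℂ :=
  S.fac x • (S.polyA x ᵥ* g x) + S.polyC f g x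

/-- The row vector `(1 - e^{ixμ})^n A_N(e^{ix})ᵀ f(x) - x^{2n} C_{μ,N}(e^{ix})ᵀ`. -/
def rowG (f g : Density T) (x : ℝ) : Fin T → ℂ :=
  S.fac x • (S.polyA x ᵥ* f x) - ((x : ℂ) ^ (2 * S.n)) • S.polyC f g x

/-- `|1 - e^{ixμ}|^{2n} |x|^{-2n} (f(x) + x^{2n} g(x))`. -/
def sideF (f g : Density T) (x : ℝ) : Matrix (Fin T) (Fin T) ℂ :=
  (S.weight x : ℂ) • obsDensity S.n f g x

/-- `|1 - e^{ixμ}|^n (f(x) + x^{2n} g(x))`. -/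
def sideG (f g : Density T) (x : ℝ) : Matrix (Fin T) (Fin T) ℂ :=
  ((‖1 - ee S.μ x‖ : ℂ) ^ S.n) • obsDensity S.n f g x

/-- The equation `q* q = W M W` for `q = rowF`, `W = sideF`. -/
def EqF (f g : Density T) (M : Matrix (Fin T) (Fin T) ℂ) : Prop :=
  ∀ᵐ x ∂freq, gram (S.rowF f g x) = S.sideF f g x * M * S.sideF f g x

/-- The equation `q* q = W M W` for `q = rowG`, `W = sideG`. -/
def EqG (f g : Density T) (M : Density T) : Prop :=
  ∀ᵐ x ∂freq, gram (S.rowG f g x) = S.sideG f g x * M x * S.sideG f g x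

/-- The four equations on the densities that come from the moment constraints on `f`, with
their Lagrange multipliers. -/
def MultiplierF (c : ClassData T) (f g : Density T) : Fin 4 → Prop
  | 0 => ∃ α : Fin T → ℂ, S.EqF f g (vecMulVec α (star α))
  | 1 => ∃ α : ℝ, S.EqF f g (((α ^ 2 : ℝ) : ℂ) • 1)
  | 2 => ∃ α : Fin T → ℝ, S.EqF f g (diagonal fun k => ((α k ^ 2 : ℝ) : ℂ))
  | 3 => ∃ α : ℝ, S.EqF f g (((α ^ 2 : ℝ) : ℂ) • c.B₁ᵀ)

/-- The four systems that come from the neighbourhood constraints on `g`, with their Lagrange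
multipliers. The constraint has to be attained unless its multiplier vanishes. -/
def MultiplierG (c : ClassData T) (f g : Density T) : Fin 4 → Prop
  | 0 => ∃ (β : ℝ) (γ : ℝ → ℝ), IsSignOf γ (fun x => (g x - c.g₁ x).trace) ∧
      S.EqG f g (fun x => ((β ^ 2 * γ x : ℝ) : ℂ) • 1) ∧
      (β ≠ 0 → meanR (fun x => ‖(g x - c.g₁ x).trace‖) = c.δ)
  | 1 => ∃ (β : Fin T → ℝ) (γ : Fin T → ℝ → ℝ),
      (∀ k, IsSignOf (γ k) (fun x => (g x - c.g₁ x) k k)) ∧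
      S.EqG f g (fun x => diagonal fun k => ((β k ^ 2 * γ k x : ℝ) : ℂ)) ∧
      ∀ k, β k ≠ 0 → meanR (fun x => ‖(g x - c.g₁ x) k k‖) = c.δk k
  | 2 => ∃ (β : ℝ) (γ : ℝ → ℝ), IsSignOf γ (fun x => pairing c.B₂ (g x - c.g₁ x)) ∧
      S.EqG f g (fun x => ((β ^ 2 * γ x : ℝ) : ℂ) • c.B₂ᵀ) ∧
      (β ≠ 0 → meanR (fun x => ‖pairing c.B₂ (g x - c.g₁ x)‖) = c.δ)
  | 3 => ∃ (β : Fin T → Fin T → ℝ) (γ : Fin T → Fin T → ℝ → ℂ), (∀ i j, 0 ≤ β i j) ∧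
      (∀ i j, IsPhaseOf (γ i j) (fun x => (g x - c.g₁ x) i j)) ∧
      S.EqG f g (fun x => of fun i j => (β i j : ℂ) * γ i j x) ∧
      ∀ i j, β i j ≠ 0 → meanR (fun x => ‖(g x - c.g₁ x) i j‖) = c.δij i j

end Problem

/-- The radii which occur in the `k`-th neighbourhood are positive; in the entrywise
neighbourhood they are symmetric, as the values of the densities are Hermitian. -/
def ClassData.RadiiPos {T : ℕ} (c : ClassData T) : Fin 4 → Prop
  | 0 => 0 < c.δ
  | 1 => ∀ k, 0 < c.δk k
  | 2 => 0 < c.δ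
  | 3 => ∀ i j, 0 < c.δij i j ∧ c.δij i j = c.δij j i

end

end RobustInterpolation

/-! The problem is least squares in a Hilbert space of functions of the frequency. A characteristic
`h` leaves two residuals: `resF h = κB - h`, weighted by `f`, and `resG h = (iλ)^n resF h - A`,
weighted by `g`. Its error is `err f g h`, the mean of the two quadratic forms. That `err` is the
probabilistic error (`mse_eq_err`) rests on two facts: a canonical model, with random frequency,
coordinate and sign, attains it; and in any model the estimate is a limit of finite combinations,
whose errors depend on second moments only.

Optimality. Off a null set `h⁰ = κ(B - Y)` with `Y = w⁻¹ q_f p⁻¹` (`rowY`). The linear system for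
`C` says that `B - Y` has no harmonics with the indices `0, …, N + μn` of the gap, and this puts
`h⁰` into the closed span of the observed harmonics (`inObs_of_fourier`). The residuals of `h⁰`,
tested against harmonics, produce `C` (`resF_vecMul_add`), whose frequencies all lie in the gap; so
the error is orthogonal to the observed harmonics, and the Pythagorean theorem `err_eq_add_specChar`
follows.

Sufficiency. With `h⁰` fixed, the error is linear in the pair of densities, with coefficient
matrices `w · gram Y` and `gram (resG h⁰)` (`errDensity_specChar`). Multiplied by `p⁻¹` on both
sides, the equations say that `gram Y = M` and `gram (resG h⁰) = R` (`eqF_iff`, `eqG_iff`): they are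
the Lagrange conditions for a linear functional on a convex class. A constant `M` of the stated form
makes the part of `f` constant on its class; `|γ| ≤ 1` and complementary slackness make `g₀` maximal
for the part of `g`. A constant Gram matrix also bounds `Y`, so `h⁰` is admissible for the whole
class, and `saddle` applies.

Necessity. A least favorable pair maximises the minimal error, not the error of `h⁰`, and `h⁰` need
not be admissible elsewhere. `err_le_of_leastFavorable` bridges this: nearly optimal characteristics
for pairs on a segment issuing from `(f₀, g₀)` tend to `h⁰` almost everywhere, by the Pythagorean
theorem, and Fatou's lemma gives the saddle inequality for `err`. Positive definiteness leaves room
(`margin`) for small Hermitian perturbations, and the variational lemmas `ae_const_of_variation` and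
`exists_multiplier` yield the multipliers. -/

namespace RobustInterpolation

noncomputable section

/-! ### Measurable square roots of matrix functions. -/

section Sqrt
open scoped MatrixOrder Matrix.Norms.L2Operator

/-- The positive square root is continuous on the closed cone of positive semidefinite matrices; a
pointwise choice of factors need not be measurable. Such a factor turns the quadratic form of a
density into a sum of squares of measurable functions. -/
theorem exists_aestronglyMeasurable_sqrt {T : ℕ} {μ : Measure ℝ} {f : Density T}
    (hm : ∀ i j, AEStronglyMeasurable (fun x => f x i j) μ)
    (hf : ∀ᵐ x ∂μ, (f x).PosSemidef) :
    ∃ Q : Density T, (∀ i j, AEStronglyMeasurable (fun x => Q x i j) μ) ∧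
      ∀ᵐ x ∂μ, f x = Q x * (Q x)ᴴ := by
  let _ : MeasurableSpace (Matrix (Fin T) (Fin T) ℂ) := borel _
  have : BorelSpace (Matrix (Fin T) (Fin T) ℂ) := ⟨rfl⟩
  have hcl : IsClosed {A : Matrix (Fin T) (Fin T) ℂ | 0 ≤ A} := CStarAlgebra.isClosed_nonneg
  have hc : ContinuousOn (fun A : Matrix (Fin T) (Fin T) ℂ => CFC.sqrt A) {A | 0 ≤ A} := by
    have : ContinuousOn (fun A : Matrix (Fin T) (Fin T) ℂ => cfc NNReal.sqrt A) {A | 0 ≤ A} :=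
      ContinuousOn.cfc_nnreal_of_mem_nhdsSet (s := Set.univ) NNReal.sqrt Filter.univ_mem
        continuousOn_id (fun x hx => hx) (NNReal.continuous_sqrt.continuousOn)
    refine this.congr fun A hA => ?_
    exact CFC.sqrt_eq_cfc 
  have hfm : AEStronglyMeasurable f μ := by
    have : f = fun x => ∑ i, ∑ j, (f x i j) • Matrix.single i j (1 : ℂ) := by
      funext x
      conv_lhs => rw [matrix_eq_sum_single (f x)]
      simp [smul_single]
    rw [this]
    exact Finset.aestronglyMeasurable_fun_sum _ fun i _ =>
      Finset.aestronglyMeasurable_fun_sum _ fun j _ => (hm i j).smul_const _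
  -- Extended by zero off the cone, the root is Borel on all matrices; `f` takes values in the cone
  -- only almost everywhere.
  have hφ : Measurable
      (Set.indicator {A : Matrix (Fin T) (Fin T) ℂ | 0 ≤ A} fun A => CFC.sqrt A) := by
    classical
    rw [← Set.piecewise_eq_indicator]
    exact hc.measurable_piecewise continuousOn_const hcl.measurableSet
  refine ⟨fun x => Set.indicator {A : Matrix (Fin T) (Fin T) ℂ | 0 ≤ A} (fun A => CFC.sqrt A) (f x), ?_, ?_⟩
  · intro i j
    have h1 := hφ.comp_aemeasurable hfm.aemeasurable
    have hij : Measurable (fun A : Matrix (Fin T) (Fin T) ℂ => A i j) :=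
      (continuous_id.matrix_elem i j).measurable
    exact (hij.comp_aemeasurable h1).aestronglyMeasurable
  · filter_upwards [hf] with x hx
    have h0 : 0 ≤ f x := Matrix.nonneg_iff_posSemidef.2 hx
    rw [Set.indicator_of_mem (by exact h0)]
    have h2 : (CFC.sqrt (f x))ᴴ = CFC.sqrt (f x) := (CFC.sqrt_nonneg (f x)).isSelfAdjoint
    rw [h2, CFC.sqrt_mul_sqrt_self _ h0]
end Sqrt

/-! ### Uniqueness of Fourier coefficients. -/

/-- Uniqueness of Fourier coefficients of integrable functions. -/
theorem ae_eq_zero_of_fourier_eq_zero {ψ : ℝ → ℂ} (hψ : Integrable ψ freq)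
    (h : ∀ k : ℤ, ∫ x, ee k x * ψ x ∂freq = 0) : ∀ᵐ x ∂freq, ψ x = 0 := by
  have hpi := Real.pi_pos
  have : Fact (0 < 2 * Real.pi) := ⟨by positivity⟩
  have hint : ∀ F : C(AddCircle (2 * Real.pi), ℂ), Integrable (fun x : ℝ => F (x : AddCircle (2*Real.pi)) * ψ x) freq := by
    intro F
    refine hψ.bdd_mul (c := ‖F‖) ?_ (Filter.Eventually.of_forall fun x => F.norm_coe_le_norm _)
    exact (F.continuous.comp (AddCircle.continuous_mk' _)).aestronglyMeasurable
  have hΛ : ∀ F : C(AddCircle (2 * Real.pi), ℂ), ∫ x, F (x : AddCircle (2*Real.pi)) * ψ x ∂freq = 0 := by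
    -- Integration against `ψ` is a functional on the continuous functions of the circle, bounded by
    -- the `L₁` norm of `ψ`. It kills the exponentials, whose span is dense.
    let ℓ : C(AddCircle (2 * Real.pi), ℂ) →L[ℂ] ℂ := LinearMap.mkContinuous
      { toFun := fun F => ∫ x, F (x : AddCircle (2*Real.pi)) * ψ x ∂freq
        map_add' := by
          intro F G
          simp only [ContinuousMap.add_apply, add_mul]
          exact integral_add (hint F) (hint G)
        map_smul' := by
          intro c F
          simp only [ContinuousMap.smul_apply, smul_eq_mul, mul_assoc, RingHom.id_apply]
          exact integral_const_mul _ _ } (∫ x, ‖ψ x‖ ∂freq) (by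
        intro F
        simp only [LinearMap.coe_mk, AddHom.coe_mk]
        refine (norm_integral_le_integral_norm _).trans ?_
        rw [mul_comm (∫ x, ‖ψ x‖ ∂freq), ← integral_const_mul]
        refine integral_mono (hint F).norm (hψ.norm.const_mul _) fun x => ?_
        simp only [norm_mul]
        gcongr
        exact F.norm_coe_le_norm _)
    have h0 : (Submodule.span ℂ (Set.range <| @fourier (2 * Real.pi))).topologicalClosure ≤ LinearMap.ker ℓ.toLinearMap := by
      refine Submodule.topologicalClosure_minimal _ ?_ ℓ.isClosed_ker
      rw [Submodule.span_le]
      rintro _ ⟨k, rfl⟩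
      show ∫ x, fourier k (x : AddCircle (2*Real.pi)) * ψ x ∂freq = 0
      rw [← h k]
      congr 1; funext x; congr 1
      rw [fourier_coe_apply, ee]
      congr 1
      push_cast
      field_simp
    rw [span_fourier_closure_eq_top] at h0
    intro F
    exact h0 (Submodule.mem_top (x := F))
  have hloc : LocallyIntegrableOn ψ (Set.Ioo (-Real.pi) Real.pi) volume :=
    (IntegrableOn.locallyIntegrableOn (show IntegrableOn ψ (Set.Ioc (-Real.pi) Real.pi) volume from hψ)).mono_set Set.Ioo_subset_Ioc_self
  have key := isOpen_Ioo.ae_eq_zero_of_integral_contDiff_smul_eq_zero hloc (by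
    intro g hg hgc hgs
    have hga : ∀ x, x ∉ Set.Ioo (-Real.pi) Real.pi → g x = 0 := fun x hx =>
      image_eq_zero_of_notMem_tsupport fun h => hx (hgs h)
    -- A test function supported in the open interval vanishes at both ends, so it descends to the
    -- circle.
    let F : C(AddCircle (2 * Real.pi), ℂ) := ⟨AddCircle.liftIoc (2 * Real.pi) (-Real.pi) (fun x => (g x : ℂ)),
      AddCircle.liftIoc_continuous (by rw [hga _ (by simp), hga _ (by simp only [Set.mem_Ioo, not_and, not_lt]; intro; linarith)]) (Complex.continuous_ofReal.comp hg.continuous).continuousOn⟩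
    have h1 := hΛ F
    have h2 : ∫ x, g x • ψ x ∂volume = ∫ x in Set.Ioc (-Real.pi) Real.pi, g x • ψ x := by
      rw [setIntegral_eq_integral_of_forall_compl_eq_zero]
      intro x hx
      rw [hga x fun h => hx (Set.Ioo_subset_Ioc_self h), zero_smul]
    rw [h2, ← h1]
    refine setIntegral_congr_fun measurableSet_Ioc fun x hx => ?_
    have : F (x : AddCircle (2*Real.pi)) = g x := AddCircle.liftIoc_coe_apply (p := 2 * Real.pi) (a := -Real.pi)
      (f := fun x => (g x : ℂ))
      ⟨hx.1, hx.2.trans (le_of_eq (by ring))⟩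
    simp only [this, Complex.real_smul])
  rw [freq, ← Measure.restrict_congr_set (Ioo_ae_eq_Ioc (μ := volume) (a := -Real.pi) (b := Real.pi))]
  exact (ae_restrict_iff' measurableSet_Ioo).2 key

/-! ### Quadratic forms of positive matrices. -/

/-- The quadratic form `h ↦ hᵀ A conj(h)` of a Hermitian matrix. -/
def qf {ι : Type*} [Fintype ι] (A : Matrix ι ι ℂ) (h : ι → ℂ) : ℝ := (h ⬝ᵥ (A *ᵥ star h)).re

section Qf

variable {ι : Type*} [Fintype ι]

theorem qf_eq_sum (A : Matrix ι ι ℂ) (h : ι → ℂ) :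
    qf A h = (∑ i, ∑ j, h i * A i j * conj (h j)).re := by
  simp only [qf, dotProduct, mulVec, Finset.mul_sum, Pi.star_apply, mul_assoc, RCLike.star_def]

theorem qf_add (A B : Matrix ι ι ℂ) (h : ι → ℂ) : qf (A + B) h = qf A h + qf B h := by
  simp [qf, add_mulVec, dotProduct_add]

theorem qf_sub (A B : Matrix ι ι ℂ) (h : ι → ℂ) : qf (A - B) h = qf A h - qf B h := by
  simp [qf, sub_mulVec, dotProduct_sub]

theorem qf_smul (c : ℝ) (A : Matrix ι ι ℂ) (h : ι → ℂ) : qf ((c : ℂ) • A) h = c * qf A h := by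
  simp [qf, smul_mulVec, dotProduct_smul]

theorem qf_vec_smul (z : ℂ) (A : Matrix ι ι ℂ) (h : ι → ℂ) :
    qf A (z • h) = ‖z‖ ^ 2 * qf A h := by
  have : star (z • h) = conj z • star h := by ext; simp
  rw [qf, this, mulVec_smul, dotProduct_smul, smul_dotProduct, smul_eq_mul, smul_eq_mul,
    ← mul_assoc, Complex.conj_mul', ← Complex.ofReal_pow, Complex.re_ofReal_mul, qf]

theorem qf_nonneg {A : Matrix ι ι ℂ} (hA : A.PosSemidef) (h : ι → ℂ) : 0 ≤ qf A h := by
  simpa [qf] using hA.re_dotProduct_nonneg (star h)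

theorem qf_mul_conjTranspose {κ : Type*} [Fintype κ] (Q : Matrix ι κ ℂ) (h : ι → ℂ) :
    qf (Q * Qᴴ) h = ∑ m, ‖(h ᵥ* Q) m‖ ^ 2 := by
  rw [qf, ← mulVec_mulVec, dotProduct_mulVec, ← star_vecMul, dotProduct, Complex.re_sum]
  refine Finset.sum_congr rfl fun m _ => ?_
  rw [Pi.star_apply, RCLike.star_def, Complex.mul_conj', ← Complex.ofReal_pow, Complex.ofReal_re]

theorem exists_eq_mul_conjTranspose {A : Matrix ι ι ℂ} (hA : A.PosSemidef) :
    ∃ Q : Matrix ι ι ℂ, A = Q * Qᴴ := by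
  classical
  open scoped MatrixOrder Matrix.Norms.L2Operator in
  have h0 : 0 ≤ A := Matrix.nonneg_iff_posSemidef.2 hA
  refine ⟨CFC.sqrt A, ?_⟩
  have h2 : (CFC.sqrt A)ᴴ = CFC.sqrt A := (CFC.sqrt_nonneg A).isSelfAdjoint
  rw [h2, CFC.sqrt_mul_sqrt_self _ h0]

theorem re_diag_nonneg {A : Matrix ι ι ℂ} (hA : A.PosSemidef) (i : ι) : 0 ≤ (A i i).re :=
  (Complex.le_def.1 hA.diag_nonneg).1

theorem re_trace_nonneg {A : Matrix ι ι ℂ} (hA : A.PosSemidef) : 0 ≤ A.trace.re :=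
  (Complex.le_def.1 hA.trace_nonneg).1

theorem re_diag_le_re_trace {A : Matrix ι ι ℂ} (hA : A.PosSemidef) (i : ι) :
    (A i i).re ≤ A.trace.re := by
  rw [trace, Complex.re_sum]
  exact Finset.single_le_sum (f := fun i => (A.diag i).re) (fun j _ => re_diag_nonneg hA j)
    (Finset.mem_univ i)

/-- With `A = Q Qᴴ`, the inequality `2xy ≤ x² + y²` bounds the entry by the mean of two diagonal
entries. -/
theorem norm_entry_le_re_trace {A : Matrix ι ι ℂ} (hA : A.PosSemidef) (i j : ι) :
    ‖A i j‖ ≤ A.trace.re := by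
  obtain ⟨Q, rfl⟩ := exists_eq_mul_conjTranspose hA
  have hd : ∀ i, ((Q * Qᴴ) i i).re = ∑ m, ‖Q i m‖ ^ 2 := by
    intro i
    rw [mul_apply, Complex.re_sum]
    refine Finset.sum_congr rfl fun m _ => ?_
    rw [conjTranspose_apply, RCLike.star_def, Complex.mul_conj', ← Complex.ofReal_pow,
      Complex.ofReal_re]
  have h1 : ‖(Q * Qᴴ) i j‖ ≤ ∑ m, ‖Q i m‖ * ‖Q j m‖ := by
    rw [mul_apply]
    refine (norm_sum_le _ _).trans (le_of_eq ?_)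
    simp
  have h2 : ∑ m, ‖Q i m‖ * ‖Q j m‖ ≤ ∑ m, (‖Q i m‖ ^ 2 + ‖Q j m‖ ^ 2) / 2 :=
    Finset.sum_le_sum fun m _ => by nlinarith [sq_nonneg (‖Q i m‖ - ‖Q j m‖)]
  have h3 : ∑ m, (‖Q i m‖ ^ 2 + ‖Q j m‖ ^ 2) / 2
      = (((Q * Qᴴ) i i).re + ((Q * Qᴴ) j j).re) / 2 := by
    rw [hd, hd, ← Finset.sum_add_distrib, Finset.sum_div]
  have := re_diag_le_re_trace hA i
  have := re_diag_le_re_trace hA j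
  linarith

theorem qf_le_re_trace_mul {A : Matrix ι ι ℂ} (hA : A.PosSemidef) (h : ι → ℂ) :
    qf A h ≤ A.trace.re * (∑ i, ‖h i‖) ^ 2 := by
  rw [qf_eq_sum, sq, Finset.sum_mul_sum, Finset.mul_sum]
  refine (Complex.re_le_norm _).trans ((norm_sum_le _ _).trans ?_)
  refine Finset.sum_le_sum fun i _ => (norm_sum_le _ _).trans ?_
  rw [Finset.mul_sum]
  refine Finset.sum_le_sum fun j _ => ?_
  rw [norm_mul, norm_mul, RCLike.norm_conj]
  nlinarith [norm_entry_le_re_trace hA i j, mul_nonneg (norm_nonneg (h i)) (norm_nonneg (h j))]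

variable [DecidableEq ι]

/-- With `A = Q Qᴴ`, write `h = (h Q) Q⁻¹` and apply the Cauchy–Schwarz inequality: the first factor
gives `qf A h`, the second the diagonal entry of `A⁻¹`. -/
theorem sq_norm_le_qf_mul {A : Matrix ι ι ℂ} (hA : A.PosDef) (h : ι → ℂ) (i : ι) :
    ‖h i‖ ^ 2 ≤ qf A h * A⁻¹.trace.re := by
  obtain ⟨Q, hQ⟩ := exists_eq_mul_conjTranspose hA.posSemidef
  have hu : IsUnit Q := by
    rw [Matrix.isUnit_iff_isUnit_det]
    have := (Matrix.isUnit_iff_isUnit_det _).1 hA.isUnit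
    rw [hQ, det_mul] at this
    exact isUnit_of_mul_isUnit_left this
  have hud := (Matrix.isUnit_iff_isUnit_det _).1 hu
  have h1 : h i = ∑ m, (h ᵥ* Q) m * Q⁻¹ m i := by
    have : h = (h ᵥ* Q) ᵥ* Q⁻¹ := by
      rw [vecMul_vecMul, Matrix.mul_nonsing_inv _ hud, vecMul_one]
    conv_lhs => rw [this]
    rfl
  have h2 : (A⁻¹ i i).re = ∑ m, ‖Q⁻¹ m i‖ ^ 2 := by
    rw [hQ, Matrix.mul_inv_rev, mul_apply, Complex.re_sum]
    refine Finset.sum_congr rfl fun m _ => ?_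
    rw [← conjTranspose_nonsing_inv, conjTranspose_apply, RCLike.star_def, Complex.conj_mul',
      ← Complex.ofReal_pow, Complex.ofReal_re]
  have h3 : ‖h i‖ ^ 2 ≤ qf A h * (A⁻¹ i i).re := by
    rw [h2, hQ, qf_mul_conjTranspose, h1]
    have : ‖∑ m, (h ᵥ* Q) m * Q⁻¹ m i‖ ≤ ∑ m, ‖(h ᵥ* Q) m‖ * ‖Q⁻¹ m i‖ :=
      (norm_sum_le _ _).trans (le_of_eq (by simp))
    exact (pow_le_pow_left₀ (norm_nonneg _) this 2).trans
      (Finset.sum_mul_sq_le_sq_mul_sq _ _ _)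
  exact h3.trans (mul_le_mul_of_nonneg_left (re_diag_le_re_trace hA.inv.posSemidef i)
    (qf_nonneg hA.posSemidef h))

theorem qf_vecMul_inv {A : Matrix ι ι ℂ} (hA : A.PosDef) (h : ι → ℂ) :
    qf A (h ᵥ* A⁻¹) = qf A⁻¹ h := by
  have hd := (Matrix.isUnit_iff_isUnit_det _).1 hA.isUnit
  rw [qf, star_vecMul, hA.inv.isHermitian.eq, mulVec_mulVec, Matrix.mul_nonsing_inv _ hd,
    one_mulVec, ← dotProduct_mulVec, qf]

/-- With `P = (F + G)⁻¹` the left side is the form of `G P G`, and `G - G P G = G P F P G + (1 - G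
P) G (1 - P G)` is a sum of positive semidefinite matrices. With `F = f` and `G = x^{2n} g` this
controls the noise part of the explicit characteristic. -/
theorem qf_vecMul_mul_inv_le {F G : Matrix ι ι ℂ} (hF : F.PosSemidef) (hG : G.PosSemidef)
    (hp : (F + G).PosDef) (h : ι → ℂ) : qf (F + G) (h ᵥ* (G * (F + G)⁻¹)) ≤ qf G h := by
  have hd := (Matrix.isUnit_iff_isUnit_det _).1 hp.isUnit
  set P := (F + G)⁻¹ with hP
  have hPh : Pᴴ = P := hp.inv.isHermitian.eq
  have e1 : qf (F + G) (h ᵥ* (G * P)) = qf (G * P * G) h := by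
    rw [← vecMul_vecMul, hP, qf_vecMul_inv hp, ← hP, qf, star_vecMul, hG.isHermitian.eq,
      ← dotProduct_mulVec, mulVec_mulVec, mulVec_mulVec, qf, Matrix.mul_assoc]
  have h1 : (G * P * F * P * G).PosSemidef := by
    have := hF.mul_mul_conjTranspose_same (G * P)
    rwa [conjTranspose_mul, hPh, hG.isHermitian.eq, ← Matrix.mul_assoc] at this
  have h2 : ((1 - G * P) * G * (1 - P * G)).PosSemidef := by
    have := hG.mul_mul_conjTranspose_same (1 - G * P)
    rwa [conjTranspose_sub, conjTranspose_mul, hPh, hG.isHermitian.eq, conjTranspose_one] at this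
  have e2 : G - G * P * G = G * P * F * P * G + (1 - G * P) * G * (1 - P * G) := by
    have e3 : G * P * F * P * G = G * P * G - G * P * G * P * G := by
      have : F = (F + G) - G := by abel
      conv_lhs => rw [this]
      rw [Matrix.mul_sub, Matrix.sub_mul, Matrix.sub_mul, hP,
        Matrix.nonsing_inv_mul_cancel_right (h := hd), ← hP]
    rw [e3]
    noncomm_ring
  have h3 := qf_nonneg (h1.add h2) h
  rw [← e2, qf_sub] at h3
  linarith

end Qf

/-! ### Exponentials on the frequency interval. -/

instance : IsFiniteMeasure freq := by unfold freq; infer_instance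

instance : NullSingletonClass freq := by unfold freq; infer_instance

theorem ee_zero (x : ℝ) : ee 0 x = 1 := by simp [ee]

theorem ee_add (m k : ℤ) (x : ℝ) : ee (m + k) x = ee m x * ee k x := by
  rw [ee, ee, ee, ← Complex.exp_add]
  congr 1
  push_cast
  ring

theorem ee_mul_ee_neg (m : ℤ) (x : ℝ) : ee m x * ee (-m) x = 1 := by
  rw [← ee_add, add_neg_cancel, ee_zero]

theorem conj_ee (m : ℤ) (x : ℝ) : conj (ee m x) = ee (-m) x := by
  rw [ee, ee, ← Complex.exp_conj]
  simp

theorem norm_ee (m : ℤ) (x : ℝ) : ‖ee m x‖ = 1 := by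
  have : Complex.I * (x * m) = ((x * m : ℝ) : ℂ) * Complex.I := by push_cast; ring
  rw [ee, this, Complex.norm_exp_ofReal_mul_I]

theorem ee_nat_mul (l : ℕ) (m : ℤ) (x : ℝ) : ee (l * m) x = ee m x ^ l := by
  rw [ee, ee, ← Complex.exp_nat_mul]
  congr 1
  push_cast
  ring

theorem continuous_ee (m : ℤ) : Continuous (ee m) := by
  unfold ee
  fun_prop

theorem integral_ee (m : ℤ) : ∫ x, ee m x ∂freq = if m = 0 then (2 * Real.pi : ℂ) else 0 := by
  have hpi := Real.pi_pos
  rw [freq, ← intervalIntegral.integral_of_le (by linarith)]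
  split_ifs with h
  · simp only [h, ee_zero]
    simp
    ring
  · have hc : Complex.I * m ≠ 0 := by simpa using h
    have := integral_exp_mul_complex (a := -Real.pi) (b := Real.pi) hc
    have h2 : (fun x : ℝ => ee m x) = fun x : ℝ => Complex.exp (Complex.I * m * x) := by
      funext x
      rw [ee]
      congr 1
      ring
    rw [h2, this, div_eq_zero_iff]
    left
    rw [sub_eq_zero, Complex.exp_eq_exp_iff_exists_int]
    exact ⟨m, by push_cast; ring⟩

theorem ae_ne_zero : ∀ᵐ x ∂freq, x ≠ 0 := by
  simp [ae_iff]

theorem integrable_ee_mul {u : ℝ → ℂ} (hu : Integrable u freq) (m : ℤ) :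
    Integrable (fun x => ee m x * u x) freq :=
  hu.bdd_mul (c := 1) (continuous_ee m).aestronglyMeasurable
    (Filter.Eventually.of_forall fun x => (norm_ee m x).le)

theorem integrable_ee (m : ℤ) : Integrable (ee m) freq := by
  simpa using integrable_ee_mul (integrable_const (1 : ℂ)) m

/-- An integrable function whose Fourier coefficients vanish outside a finite window is
orthogonal to the functions whose coefficients vanish on this window. -/
theorem integral_mul_eq_zero_of_fourier {M : ℕ} {u ψ : ℝ → ℂ} (hu : Integrable u freq)
    (hψ : Integrable ψ freq) (h1 : ∀ j : ℕ, j < M → ∫ x, ee (-j) x * u x ∂freq = 0)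
    (h2 : ∀ k : ℤ, k < 0 ∨ (M : ℤ) ≤ k → ∫ x, ee k x * ψ x ∂freq = 0) :
    Integrable (fun x => u x * ψ x) freq ∧ ∫ x, u x * ψ x ∂freq = 0 := by
  have hpi := Real.pi_pos
  -- `φ` is the trigonometric polynomial carrying the coefficients of `ψ` in the window. By
  -- uniqueness `ψ = φ` almost everywhere, so `u ψ` is a finite combination of the `e^{-ikx} u`; its
  -- integrability comes out rather than being assumed.
  let c : ℕ → ℂ := fun k => 1 / (2 * Real.pi) * ∫ x, ee k x * ψ x ∂freq
  let φ : ℝ → ℂ := fun x => ∑ k ∈ Finset.range M, c k * ee (-k) x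
  have hφ : Integrable φ freq :=
    integrable_finsetSum _ fun k _ => (integrable_ee _).const_mul _
  have hφe : ∀ m : ℤ, ∫ x, ee m x * φ x ∂freq = ∫ x, ee m x * ψ x ∂freq := by
    intro m
    have e1 : ∀ x, ee m x * φ x = ∑ k ∈ Finset.range M, c k * ee (m - k) x := by
      intro x
      simp only [φ, Finset.mul_sum, sub_eq_add_neg, ee_add]
      exact Finset.sum_congr rfl fun k _ => by ring
    simp only [e1]
    rw [integral_finsetSum _ fun k _ => (integrable_ee _).const_mul _]
    simp only [integral_const_mul, integral_ee]
    by_cases hm : m < 0 ∨ (M : ℤ) ≤ m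
    · rw [h2 m hm]
      refine Finset.sum_eq_zero fun k hk => ?_
      rw [if_neg, mul_zero]
      have := Finset.mem_range.1 hk
      omega
    · push Not at hm
      obtain ⟨l, rfl⟩ := Int.eq_ofNat_of_zero_le hm.1
      rw [Finset.sum_eq_single l]
      · simp only [sub_self, if_true, c]
        field_simp
      · intro k _ hk
        rw [if_neg, mul_zero]
        omega
      · intro hl
        exfalso
        apply hl
        simpa using hm.2
  have hz : ∀ᵐ x ∂freq, ψ x - φ x = 0 := by
    refine ae_eq_zero_of_fourier_eq_zero (hψ.sub hφ) fun k => ?_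
    have := integral_sub (integrable_ee_mul hψ k) (integrable_ee_mul hφ k)
    rw [hφe, sub_self] at this
    rw [← this]
    simp only [mul_sub]
  have heq : ∀ᵐ x ∂freq, ∑ k ∈ Finset.range M, c k * (ee (-k) x * u x) = u x * ψ x := by
    filter_upwards [hz] with x hx
    rw [sub_eq_zero.1 hx, Finset.mul_sum]
    exact Finset.sum_congr rfl fun k _ => by ring
  have hi : ∀ k ∈ Finset.range M, Integrable (fun x => c k * (ee (-k) x * u x)) freq :=
    fun k _ => (integrable_ee_mul hu _).const_mul _
  refine ⟨(integrable_finsetSum _ hi).congr heq, ?_⟩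
  rw [← integral_congr_ae heq, integral_finsetSum _ hi]
  refine Finset.sum_eq_zero fun k hk => ?_
  rw [integral_const_mul, h1 k (Finset.mem_range.1 hk), mul_zero]

theorem eq_zero_of_trig_sum_ae_eq_zero {M : ℕ} {c : Fin M → ℂ}
    (h : ∀ᵐ x ∂freq, ∑ k : Fin M, ee (k : ℕ) x * c k = 0) : c = 0 := by
  have hpi := Real.pi_pos
  funext m
  have h1 : ∫ x, ∑ k : Fin M, c k * ee ((k : ℕ) - (m : ℕ)) x ∂freq = 0 := by
    rw [← integral_zero ℝ ℂ (μ := freq)]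
    refine integral_congr_ae ?_
    filter_upwards [h] with x hx
    have : ∑ k : Fin M, c k * ee ((k : ℕ) - (m : ℕ)) x
        = ee (-(m : ℕ)) x * ∑ k : Fin M, ee (k : ℕ) x * c k := by
      rw [Finset.mul_sum]
      refine Finset.sum_congr rfl fun k _ => ?_
      rw [sub_eq_add_neg, ee_add]
      ring
    rw [this, hx, mul_zero]
  rw [integral_finsetSum _ fun k _ => (integrable_ee _).const_mul _] at h1
  simp only [integral_const_mul, integral_ee] at h1
  rw [Finset.sum_eq_single m] at h1
  · have h2 : (Real.pi : ℂ) ≠ 0 := by exact_mod_cast hpi.ne'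
    simpa [h2] using h1
  · intro k _ hk
    rw [if_neg, mul_zero]
    intro h3
    apply hk
    ext
    omega
  · simp

/-! ### The kernel of the increments and the weight. -/

namespace Problem

variable {T : ℕ} (S : Problem T)

theorem norm_one_sub_ee_le (m : ℤ) (x : ℝ) : ‖1 - ee m x‖ ≤ |x| * |(m : ℝ)| := by
  have := Real.norm_exp_I_mul_ofReal_sub_one_le (x := x * m)
  rw [norm_sub_rev, ee]
  rw [Real.norm_eq_abs, abs_mul] at this
  exact_mod_cast this

theorem conj_one_sub_ee (m : ℤ) (x : ℝ) : conj (1 - ee m x) = 1 - ee (-m) x := by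
  rw [map_sub, map_one, conj_ee]

theorem conj_fac (x : ℝ) : conj (S.fac x) = (1 - ee (-S.μ) x) ^ S.n := by
  rw [fac, map_pow, conj_one_sub_ee]

theorem norm_fac (x : ℝ) : ‖S.fac x‖ = ‖1 - ee S.μ x‖ ^ S.n := by rw [fac, norm_pow]

theorem kern_eq (x : ℝ) : S.kern x = conj (S.fac x) / (Complex.I * x) ^ S.n := by
  rw [kern, conj_fac]

theorem conj_kern (x : ℝ) : conj (S.kern x) = S.fac x / (-(Complex.I * x)) ^ S.n := by
  rw [kern_eq, map_div₀, Complex.conj_conj, map_pow]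
  simp

theorem norm_kern (x : ℝ) : ‖S.kern x‖ = ‖1 - ee S.μ x‖ ^ S.n / |x| ^ S.n := by
  rw [kern_eq, norm_div, RCLike.norm_conj, norm_fac, norm_pow]
  simp

theorem norm_kern_sq (x : ℝ) : ‖S.kern x‖ ^ 2 = S.weight x := by
  rw [norm_kern, div_pow, weight, ← pow_mul, ← pow_mul, mul_comm S.n]

/-- The zero of the increment filter at the origin cancels the pole of `(ix)^{-n}`. The conventional
value at `x = 0` obeys the bound as well. -/
theorem norm_kern_le (x : ℝ) : ‖S.kern x‖ ≤ (S.μ : ℝ) ^ S.n := by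
  rw [norm_kern, ← div_pow]
  refine pow_le_pow_left₀ (by positivity) ?_ _
  refine div_le_of_le_mul₀ (abs_nonneg _) (by positivity) ?_
  have := norm_one_sub_ee_le S.μ x
  simpa [mul_comm] using this

theorem weight_nonneg (x : ℝ) : 0 ≤ S.weight x := by
  rw [← norm_kern_sq]
  positivity

theorem weight_le (x : ℝ) : S.weight x ≤ ((S.μ : ℝ) ^ S.n) ^ 2 := by
  rw [← norm_kern_sq]
  exact pow_le_pow_left₀ (norm_nonneg _) (S.norm_kern_le x) 2

theorem measurable_kern : Measurable S.kern := by
  have h := continuous_ee (-S.μ)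
  unfold kern
  exact ((measurable_const.sub h.measurable).pow_const _).div
    (by fun_prop)

theorem continuous_fac : Continuous S.fac := by
  have h := continuous_ee S.μ
  unfold fac
  fun_prop

theorem measurable_weight : Measurable S.weight := by
  have : S.weight = fun x => ‖S.kern x‖ ^ 2 := by
    funext x
    rw [norm_kern_sq]
  rw [this]
  exact S.measurable_kern.norm.pow_const 2

theorem measurable_invWeight : Measurable S.invWeight := by
  have h := continuous_ee S.μ
  unfold invWeight
  exact (by fun_prop : Measurable fun x : ℝ => x ^ (2 * S.n)).div
    (by fun_prop)

theorem ae_one_sub_ee_ne_zero : ∀ᵐ x ∂freq, 1 - ee S.μ x ≠ 0 := by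
  have hc : ({x : ℝ | 1 - ee S.μ x = 0}).Countable := by
    refine (Set.countable_range fun m : ℤ => 2 * Real.pi * m / S.μ).mono ?_
    intro x hx
    have hx' : ee S.μ x = 1 := (sub_eq_zero.1 hx).symm
    rw [ee, Complex.exp_eq_one_iff] at hx'
    obtain ⟨m, hm⟩ := hx'
    refine ⟨m, ?_⟩
    have hμ : (S.μ : ℝ) ≠ 0 := by exact_mod_cast S.μ_pos.ne'
    have h1 : (x : ℂ) * S.μ = 2 * Real.pi * m := by
      have h2 : Complex.I * (x * S.μ) = Complex.I * (2 * Real.pi * m) := by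
        push_cast at hm ⊢
        rw [hm]
        ring
      exact mul_left_cancel₀ Complex.I_ne_zero h2
    have h3 : x * S.μ = 2 * Real.pi * m := by exact_mod_cast h1
    show 2 * Real.pi * m / S.μ = x
    rw [← h3]
    field_simp
  rw [ae_iff]
  simp only [ne_eq, not_not]
  exact hc.measure_zero _

/-- The generic frequencies, at which the weight is not degenerate. -/
def Generic (x : ℝ) : Prop := x ≠ 0 ∧ 1 - ee S.μ x ≠ 0

theorem ae_generic : ∀ᵐ x ∂freq, S.Generic x := by
  filter_upwards [ae_ne_zero, S.ae_one_sub_ee_ne_zero] with x h1 h2 using ⟨h1, h2⟩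

variable {S}

theorem Generic.fac_ne {x : ℝ} (hx : S.Generic x) : S.fac x ≠ 0 := pow_ne_zero _ hx.2

theorem Generic.conj_fac_ne {x : ℝ} (hx : S.Generic x) : conj (S.fac x) ≠ 0 := by
  simpa using hx.fac_ne

theorem Generic.ix_ne {x : ℝ} (hx : S.Generic x) : (Complex.I * x) ^ S.n ≠ 0 :=
  pow_ne_zero _ (mul_ne_zero Complex.I_ne_zero (by exact_mod_cast hx.1))

theorem Generic.kern_ne {x : ℝ} (hx : S.Generic x) : S.kern x ≠ 0 := by
  rw [kern_eq]
  exact div_ne_zero hx.conj_fac_ne hx.ix_ne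

theorem ix_pow_mul (n : ℕ) (x : ℝ) :
    (-(Complex.I * x)) ^ n * (Complex.I * x) ^ n = (x : ℂ) ^ (2 * n) := by
  rw [← mul_pow, pow_mul]
  congr 1
  linear_combination (-(x : ℂ) ^ 2) * Complex.I_sq

theorem Generic.weight_pos {x : ℝ} (hx : S.Generic x) : 0 < S.weight x := by
  rw [← norm_kern_sq]
  exact pow_pos (norm_pos_iff.2 hx.kern_ne) 2

theorem invWeight_eq (x : ℝ) : S.invWeight x = (S.weight x)⁻¹ := by
  rw [invWeight, weight, inv_div, pow_mul |x|, sq_abs, ← pow_mul]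

theorem invWeight_nonneg (x : ℝ) : 0 ≤ S.invWeight x := by
  rw [invWeight_eq]
  exact inv_nonneg.2 (S.weight_nonneg x)

end Problem

/-! ### Unobserved values expressed through increments. -/

namespace Problem

variable {T : ℕ} (S : Problem T)

/-- This is the geometric series in `X ^ μ`; `1 - X ^ μ` is the symbol of the difference with step
`μ`. -/
theorem mk_dvd_mul_one_sub :
    (PowerSeries.mk fun j => if S.μ ∣ j then (1 : ℂ) else 0) * (1 - PowerSeries.X ^ S.μ) = 1 := by
  ext r
  rw [mul_sub, mul_one, map_sub, PowerSeries.coeff_mul_X_pow', PowerSeries.coeff_mk,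
    PowerSeries.coeff_one]
  have hμ := S.μ_pos
  by_cases hr : S.μ ≤ r
  · have h1 : S.μ ∣ r - S.μ ↔ S.μ ∣ r := by
      rw [← Nat.dvd_add_self_right (m := S.μ) (n := r - S.μ), Nat.sub_add_cancel hr]
    have h2 : r ≠ 0 := by omega
    simp [hr, h1, h2]
  · have h1 : S.μ ∣ r ↔ r = 0 :=
      ⟨fun h => by
        by_contra h0
        exact hr (Nat.le_of_dvd (Nat.pos_of_ne_zero h0) h), fun h => h ▸ dvd_zero _⟩
    simp [hr, h1]

/-- Coefficients of the `n`-th power of the geometric series identity: convolution with `d` inverts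
the `n`-fold difference. -/
theorem sum_choose_mul_d (r : ℕ) :
    ∑ l ∈ Finset.range (S.n + 1), (-1) ^ l * (S.n.choose l : ℂ) *
      (if l * S.μ ≤ r then S.d (r - l * S.μ) else 0) = if r = 0 then 1 else 0 := by
  have h1 : (1 - PowerSeries.X ^ S.μ : PowerSeries ℂ) ^ S.n
      = ∑ l ∈ Finset.range (S.n + 1),
        PowerSeries.C ((-1) ^ l * (S.n.choose l : ℂ)) * PowerSeries.X ^ (l * S.μ) := by
    rw [sub_eq_neg_add, add_pow]
    refine Finset.sum_congr rfl fun l _ => ?_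
    rw [one_pow, mul_one, neg_pow, ← pow_mul, mul_comm S.μ l, map_mul, map_pow, map_neg, map_one,
      map_natCast]
    ring
  have h2 := congrArg (PowerSeries.coeff r) (congrArg (· ^ S.n) S.mk_dvd_mul_one_sub)
  simp only [mul_pow, one_pow, PowerSeries.coeff_one] at h2
  rw [← h2, h1, Finset.mul_sum, map_sum]
  refine Finset.sum_congr rfl fun l _ => ?_
  rw [mul_left_comm, PowerSeries.coeff_C_mul, PowerSeries.coeff_mul_X_pow', d]

/-- `b` is an `n`-fold sum of `a`, so the `n`-fold difference gives `a` back. -/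
theorem sum_choose_mul_b {m : ℕ} (hm : m ≤ S.N) (p : Fin T) :
    ∑ l ∈ Finset.range (S.n + 1), (-1) ^ l * (S.n.choose l : ℂ) * S.b (m + l * S.μ) p
      = S.a m p := by
  have h1 : ∀ l, S.b (m + l * S.μ) p
      = ∑ i ∈ Finset.Icc m S.N,
        (if l * S.μ ≤ i - m then S.d (i - m - l * S.μ) else 0) * S.a i p := by
    intro l
    rw [b]
    refine Finset.sum_subset_zero_on_sdiff ?_ ?_ ?_
    · exact Finset.Icc_subset_Icc_left (Nat.le_add_right _ _)
    · intro i hi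
      simp only [Finset.mem_sdiff, Finset.mem_Icc, not_and, not_le] at hi
      rw [if_neg, zero_mul]
      omega
    · intro i hi
      simp only [Finset.mem_Icc] at hi
      rw [if_pos (by omega), Nat.sub_sub]
  simp only [h1, Finset.mul_sum]
  rw [Finset.sum_comm]
  have h2 : ∀ i ∈ Finset.Icc m S.N, ∑ l ∈ Finset.range (S.n + 1), (-1) ^ l * (S.n.choose l : ℂ) *
      ((if l * S.μ ≤ i - m then S.d (i - m - l * S.μ) else 0) * S.a i p)
      = (if i = m then 1 else 0) * S.a i p := by
    intro i hi
    have := S.sum_choose_mul_d (i - m)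
    simp only [Finset.mem_Icc] at hi
    have hiff : i - m = 0 ↔ i = m := by omega
    simp only [hiff] at this
    rw [← this, Finset.sum_mul]
    exact Finset.sum_congr rfl fun l _ => by ring
  rw [Finset.sum_congr rfl h2]
  simp [hm]

theorem b_eq_zero {k : ℕ} (hk : S.N < k) (p : Fin T) : S.b k p = 0 := by
  rw [b, Finset.Icc_eq_empty (by omega), Finset.sum_empty]

/-- Summation by parts. The terms that land at the times `0, …, N` recombine to `a` by
`sum_choose_mul_b`; those that land at times `-j` are collected in `v`. -/
theorem sum_b_mul_incr (z : ℤ → ℂ) (p : Fin T) :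
    ∑ k ∈ Finset.range (S.N + 1), S.b k p *
        ∑ l ∈ Finset.range (S.n + 1), (-1) ^ l * (S.n.choose l : ℂ) * z (k - l * S.μ)
      = ∑ k ∈ Finset.range (S.N + 1), S.a k p * z k
        + ∑ j ∈ Finset.Icc 1 (S.μ * S.n), S.v j p * z (-(j : ℤ)) := by
  -- `b` extended by zero to negative indices, so that the terms at time `-j` can be written for
  -- every `j`, whatever the sign of `lμ - j`.
  let β : ℤ → ℂ := fun k => if 0 ≤ k then S.b k.toNat p else 0
  have h1 : ∀ l ∈ Finset.range (S.n + 1),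
      ∑ k ∈ Finset.range (S.N + 1), S.b k p * z (k - l * S.μ)
        = ∑ m ∈ Finset.range (S.N + 1), S.b (m + l * S.μ) p * z m
          + ∑ j ∈ Finset.Icc 1 (S.μ * S.n), β (l * S.μ - j) * z (-(j : ℤ)) := by
    intro l hl
    have hl' : l * S.μ ≤ S.μ * S.n := by
      rw [mul_comm]
      exact Nat.mul_le_mul_left _ (by simpa [Nat.lt_succ_iff] using hl)
    rw [← Finset.sum_filter_add_sum_filter_not (Finset.range (S.N + 1)) (fun k => l * S.μ ≤ k)]
    congr 1
    · rw [← Finset.sum_filter_add_sum_filter_not (Finset.range (S.N + 1))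
        (fun k => k + l * S.μ ≤ S.N)]
      rw [Finset.sum_eq_zero (s := Finset.filter (fun k => ¬(k + l * S.μ ≤ S.N)) _), add_zero]
      · refine Finset.sum_bij' (fun k _ => k - l * S.μ) (fun k _ => k + l * S.μ) ?_ ?_ ?_ ?_ ?_
        · intro k hk
          simp only [Finset.mem_filter, Finset.mem_range] at hk ⊢
          omega
        · intro k hk
          simp only [Finset.mem_filter, Finset.mem_range] at hk ⊢
          omega
        · intro k hk
          simp only [Finset.mem_filter, Finset.mem_range] at hk ⊢
          omega
        · intro k hk
          simp
        · intro k hk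
          simp only [Finset.mem_filter, Finset.mem_range] at hk ⊢
          rw [Nat.sub_add_cancel hk.2]
          congr 2
          push_cast [hk.2]
          rfl
      · intro k hk
        simp only [Finset.mem_filter, Finset.mem_range] at hk
        rw [S.b_eq_zero (by omega), zero_mul]
    · rw [← Finset.sum_filter_add_sum_filter_not (Finset.Icc 1 (S.μ * S.n))
        (fun j => j ≤ l * S.μ ∧ l * S.μ - j ≤ S.N)]
      rw [Finset.sum_eq_zero
        (s := Finset.filter (fun j => ¬(j ≤ l * S.μ ∧ l * S.μ - j ≤ S.N)) _), add_zero]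
      · refine Finset.sum_bij' (fun k _ => l * S.μ - k) (fun k _ => l * S.μ - k) ?_ ?_ ?_ ?_ ?_
        · intro k hk
          simp only [Finset.mem_filter, Finset.mem_range, Finset.mem_Icc] at hk ⊢
          omega
        · intro k hk
          simp only [Finset.mem_filter, Finset.mem_range, Finset.mem_Icc] at hk ⊢
          omega
        · intro k hk
          simp only [Finset.mem_filter, Finset.mem_range] at hk ⊢
          omega
        · intro k hk
          simp only [Finset.mem_filter, Finset.mem_Icc] at hk ⊢
          omega
        · intro k hk
          simp only [Finset.mem_filter, Finset.mem_range, not_le] at hk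
          have e1 : ((l * S.μ - k : ℕ) : ℤ) = l * S.μ - k := by
            push_cast [hk.2.le]
            rfl
          simp only [β, e1]
          rw [if_pos (by omega)]
          congr 2
          · omega
          · ring
      · intro j hj
        simp only [Finset.mem_filter, Finset.mem_Icc, not_and, not_le] at hj
        have hj2 := hj.2
        simp only [β]
        split_ifs with h
        · have h' : (j : ℤ) ≤ ((l * S.μ : ℕ) : ℤ) := by push_cast; linarith
          have h'' : j ≤ l * S.μ := by exact_mod_cast h'
          rw [S.b_eq_zero, zero_mul]
          have := hj2 h''
          have e1 : ((l : ℤ) * S.μ - j).toNat = l * S.μ - j := by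
            have : ((l : ℤ) * S.μ - j) = ((l * S.μ - j : ℕ) : ℤ) := by
              push_cast [h'']
              rfl
            rw [this, Int.toNat_natCast]
          omega
        · rw [zero_mul]
  have h2 : ∑ k ∈ Finset.range (S.N + 1), S.b k p *
        ∑ l ∈ Finset.range (S.n + 1), (-1) ^ l * (S.n.choose l : ℂ) * z (k - l * S.μ)
      = ∑ l ∈ Finset.range (S.n + 1), (-1) ^ l * (S.n.choose l : ℂ) *
        ∑ k ∈ Finset.range (S.N + 1), S.b k p * z (k - l * S.μ) := by
    simp only [Finset.mul_sum]
    rw [Finset.sum_comm]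
    exact Finset.sum_congr rfl fun l _ => Finset.sum_congr rfl fun k _ => by ring
  rw [h2, Finset.sum_congr rfl fun l hl => by rw [h1 l hl]]
  simp only [mul_add, Finset.sum_add_distrib]
  congr 1
  · simp only [Finset.mul_sum]
    rw [Finset.sum_comm]
    refine Finset.sum_congr rfl fun m hm => ?_
    rw [← S.sum_choose_mul_b (Nat.lt_succ_iff.1 (Finset.mem_range.1 hm)) p, Finset.sum_mul]
    exact Finset.sum_congr rfl fun l _ => by ring
  · simp only [Finset.mul_sum]
    rw [Finset.sum_comm]
    refine Finset.sum_congr rfl fun j hj => ?_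
    rw [v, Finset.sum_mul, Finset.sum_filter]
    refine Finset.sum_congr rfl fun l _ => ?_
    have e0 : j ≤ l * S.μ → ((l : ℤ) * S.μ - j) = ((l * S.μ - j : ℕ) : ℤ) := fun h => by
      push_cast [h]
      rfl
    by_cases hj1 : j ≤ l * S.μ
    · simp only [β, e0 hj1, Int.toNat_natCast, Int.natCast_nonneg, if_true, hj1, true_and]
      split_ifs with hN
      · ring
      · rw [S.b_eq_zero (by omega)]
        ring
    · have : ¬ (0 ≤ (l : ℤ) * S.μ - j) := by
        intro h
        apply hj1
        have h' : (j : ℤ) ≤ ((l * S.μ : ℕ) : ℤ) := by push_cast; linarith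
        exact_mod_cast h'
      simp only [β, if_neg this, hj1, false_and, if_false]
      ring

/-- The functional of the unobserved values through increments. -/
theorem target_add_initial {Ω : Type} (ζ : ℤ → Fin T → Ω → ℂ) (ω : Ω) :
    S.target ζ ω + S.initial ζ ω
      = ∑ k ∈ Finset.range (S.N + 1), ∑ p, S.b k p * incr S.n S.μ ζ k p ω := by
  rw [target, initial, Finset.sum_comm, Finset.sum_comm (s := Finset.Icc 1 (S.μ * S.n)),
    ← Finset.sum_add_distrib, Finset.sum_comm (s := Finset.range (S.N + 1))]
  refine Finset.sum_congr rfl fun p _ => ?_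
  rw [← S.sum_b_mul_incr (fun k => ζ k p ω) p]
  rfl

end Problem

/-! ### A probability space with prescribed second moments. -/

section RandomPhase

variable (ι : Type) [Fintype ι]

/-- The additional index `none` keeps the index set nonempty, so that the law below has total mass
one even for empty `ι`, that is, for `T = 0`. -/
instance : MeasurableSpace (Option ι) := ⊤

instance : MeasurableSingletonClass (Option ι) := ⟨fun _ => trivial⟩

/-- The law of a uniformly distributed frequency with an independent uniformly distributed index
and sign. -/
def phaseLaw : Measure (ℝ × (Option ι × Bool)) :=
  ENNReal.ofReal (1 / (2 * Real.pi * Fintype.card (Option ι × Bool))) •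
    ∑ θ : Option ι × Bool, freq.map fun x => (x, θ)

variable {ι}

/-- The random variable of a vector function of the frequency: a uniformly chosen coordinate with
a random sign, normalised. -/
def phaseVar (v : ℝ → ι → ℂ) (ω : ℝ × (Option ι × Bool)) : ℂ :=
  (Real.sqrt (Fintype.card (Option ι)) : ℂ) * (if ω.2.2 then 1 else -1) *
    ω.2.1.elim 0 (v ω.1)

theorem measurableEmbedding_pair (θ : Option ι × Bool) :
    MeasurableEmbedding fun x : ℝ => (x, θ) :=
  MeasurableEmbedding.id.prodMk_right θ

theorem lintegral_phaseLaw (F : ℝ × (Option ι × Bool) → ℝ≥0∞) :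
    ∫⁻ ω, F ω ∂phaseLaw ι = ENNReal.ofReal (1 / (2 * Real.pi * Fintype.card (Option ι × Bool))) *
      ∑ θ : Option ι × Bool, ∫⁻ x, F (x, θ) ∂freq := by
  rw [phaseLaw, lintegral_smul_measure, lintegral_finsetSum_measure]
  simp only [(measurableEmbedding_pair _).lintegral_map, smul_eq_mul]

theorem aestronglyMeasurable_phaseLaw {F : ℝ × (Option ι × Bool) → ℂ}
    (h : ∀ θ, AEStronglyMeasurable (fun x => F (x, θ)) freq) :
    AEStronglyMeasurable F (phaseLaw ι) := by
  rw [phaseLaw, ← Measure.sum_fintype]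
  refine AEStronglyMeasurable.smul_measure ?_ _
  rw [aestronglyMeasurable_sum_measure_iff]
  intro θ
  rw [(measurableEmbedding_pair θ).aestronglyMeasurable_map_iff]
  exact h θ

theorem integral_phaseLaw {F : ℝ × (Option ι × Bool) → ℂ}
    (h : ∀ θ, Integrable (fun x => F (x, θ)) freq) :
    ∫ ω, F ω ∂phaseLaw ι = (1 / (2 * Real.pi * Fintype.card (Option ι × Bool)) : ℂ) *
      ∑ θ : Option ι × Bool, ∫ x, F (x, θ) ∂freq := by
  rw [phaseLaw, integral_smul_measure, integral_finsetSum_measure]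
  · rw [ENNReal.toReal_ofReal (by positivity)]
    simp only [(measurableEmbedding_pair _).integral_map, Complex.real_smul]
    push_cast
    rfl
  · intro θ _
    rw [(measurableEmbedding_pair θ).integrable_map_iff]
    exact h θ

instance : IsProbabilityMeasure (phaseLaw ι) := by
  refine ⟨?_⟩
  have hpi := Real.pi_pos
  rw [← lintegral_one, lintegral_phaseLaw]
  have h1 : freq Set.univ = ENNReal.ofReal (2 * Real.pi) := by
    rw [freq, Measure.restrict_apply_univ, Real.volume_Ioc]
    congr 1
    ring
  simp only [lintegral_one, h1, Finset.sum_const, Finset.card_univ, nsmul_eq_mul]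
  have hc : (0 : ℝ) < Fintype.card (Option ι × Bool) := by exact_mod_cast Fintype.card_pos
  rw [← ENNReal.ofReal_natCast, ← ENNReal.ofReal_mul (by positivity),
    ← ENNReal.ofReal_mul (by positivity), ← ENNReal.ofReal_one]
  congr 1
  field_simp

theorem phaseVar_apply (v : ℝ → ι → ℂ) (x : ℝ) (o : Option ι) (b : Bool) :
    phaseVar v (x, (o, b)) =
      (Real.sqrt (Fintype.card (Option ι)) : ℂ) * (if b then 1 else -1) * o.elim 0 (v x) := rfl

theorem aestronglyMeasurable_phaseVar {v : ℝ → ι → ℂ}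
    (hv : ∀ m, AEStronglyMeasurable (fun x => v x m) freq) :
    AEStronglyMeasurable (phaseVar v) (phaseLaw ι) := by
  refine aestronglyMeasurable_phaseLaw fun θ => ?_
  obtain ⟨o, b⟩ := θ
  cases o with
  | none => simp only [phaseVar_apply, Option.elim_none, mul_zero]; exact aestronglyMeasurable_const
  | some m => simp only [phaseVar_apply, Option.elim_some]; exact (hv m).const_mul _

/-- A coordinate is drawn with probability `1 / card`, which the square of the factor `√card`
undoes; the sign has modulus one and `none` contributes nothing. What remains is the uniform
frequency. -/
theorem lintegral_phaseVar {v : ℝ → ι → ℂ}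
    (hv : ∀ m, AEStronglyMeasurable (fun x => v x m) freq) :
    ∫⁻ ω, ‖phaseVar v ω‖ₑ ^ 2 ∂phaseLaw ι
      = ENNReal.ofReal (1 / (2 * Real.pi)) * ∫⁻ x, ∑ m, ‖v x m‖ₑ ^ 2 ∂freq := by
  have hpi := Real.pi_pos
  rw [lintegral_phaseLaw, lintegral_finsetSum' _ fun m _ => (hv m).enorm.pow_const 2]
  set K := Fintype.card (Option ι) with hK
  have hKp : (0 : ℝ) < K := by exact_mod_cast Fintype.card_pos
  have h1 : ∀ m b, ∫⁻ x, ‖phaseVar v (x, (some m, b))‖ₑ ^ 2 ∂freq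
      = ENNReal.ofReal K * ∫⁻ x, ‖v x m‖ₑ ^ 2 ∂freq := by
    intro m b
    rw [← lintegral_const_mul' _ _ ENNReal.ofReal_ne_top]
    refine lintegral_congr fun x => ?_
    have : ‖(if b then 1 else -1 : ℂ)‖ₑ = 1 := by cases b <;> simp
    rw [phaseVar_apply, Option.elim_some, enorm_mul, enorm_mul, this, mul_one, mul_pow, ← hK]
    congr 1
    rw [← ofReal_norm, ← ENNReal.ofReal_pow (norm_nonneg _), Complex.norm_real,
      Real.norm_eq_abs, sq_abs, Real.sq_sqrt hKp.le]
  have h0 : ∀ b, ∫⁻ x, ‖phaseVar v (x, (none, b))‖ₑ ^ 2 ∂freq = 0 := by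
    intro b
    simp [phaseVar_apply]
  rw [Fintype.sum_prod_type, Fintype.sum_option]
  simp only [Fintype.sum_bool, h1, h0]
  rw [add_zero, zero_add, Finset.sum_add_distrib,
    ← Finset.mul_sum, ← two_mul, ← mul_assoc, ← mul_assoc]
  congr 1
  rw [Fintype.card_prod, Fintype.card_bool, ← hK, ← ENNReal.ofReal_ofNat 2,
    ← ENNReal.ofReal_mul (by positivity), ← ENNReal.ofReal_mul (by positivity)]
  congr 1
  push_cast
  field_simp

theorem memLp_phaseVar {v : ℝ → ι → ℂ} (hv : ∀ m, MemLp (fun x => v x m) 2 freq) :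
    MemLp (phaseVar v) 2 (phaseLaw ι) := by
  refine ⟨aestronglyMeasurable_phaseVar fun m => (hv m).1, ?_⟩
  rw [eLpNorm_lt_top_iff_lintegral_rpow_enorm_lt_top two_ne_zero ENNReal.ofNat_ne_top]
  simp only [ENNReal.toReal_ofNat, ENNReal.rpow_ofNat]
  rw [lintegral_phaseVar fun m => (hv m).1,
    lintegral_finsetSum' _ fun m _ => (hv m).1.enorm.pow_const 2]
  refine ENNReal.mul_lt_top ENNReal.ofReal_lt_top (ENNReal.sum_lt_top.2 fun m _ => ?_)
  have := (eLpNorm_lt_top_iff_lintegral_rpow_enorm_lt_top two_ne_zero ENNReal.ofNat_ne_top).1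
    (hv m).2
  simpa using this

/-- The two signs are equally likely and cancel. -/
theorem integral_phaseVar {v : ℝ → ι → ℂ} (hv : ∀ m, MemLp (fun x => v x m) 2 freq) :
    ∫ ω, phaseVar v ω ∂phaseLaw ι = 0 := by
  have hi : ∀ m, Integrable (fun x => v x m) freq := fun m =>
    (hv m).integrable (by norm_num)
  rw [integral_phaseLaw]
  · rw [Fintype.sum_prod_type]
    refine mul_eq_zero_of_right _ (Finset.sum_eq_zero fun o _ => ?_)
    simp [phaseVar_apply, integral_neg]
  · rintro ⟨o, b⟩
    cases o with
    | none => simp [phaseVar_apply]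
    | some m => simp only [phaseVar_apply, Option.elim_some]; exact (hi m).const_mul _

/-- Both variables see the same coordinate and the same sign, so the sign squares away and distinct
coordinates never meet. -/
theorem integral_phaseVar_mul_conj {v w : ℝ → ι → ℂ} (hv : ∀ m, MemLp (fun x => v x m) 2 freq)
    (hw : ∀ m, MemLp (fun x => w x m) 2 freq) :
    ∫ ω, phaseVar v ω * conj (phaseVar w ω) ∂phaseLaw ι
      = mean fun x => ∑ m, v x m * conj (w x m) := by
  have hpi := Real.pi_pos
  have hi : ∀ m, Integrable (fun x => v x m * conj (w x m)) freq := fun m =>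
    (hv m).integrable_mul (hw m).star
  set K := Fintype.card (Option ι) with hK
  have hKp : (0 : ℝ) < K := by exact_mod_cast Fintype.card_pos
  have h1 : ∀ m b x, phaseVar v (x, (some m, b)) * conj (phaseVar w (x, (some m, b)))
      = (K : ℂ) * (v x m * conj (w x m)) := by
    intro m b x
    have h2 : (Real.sqrt K : ℂ) * Real.sqrt K = K := by
      rw [← Complex.ofReal_mul, Real.mul_self_sqrt hKp.le]
      simp
    rw [← h2]
    cases b <;> simp [phaseVar_apply, ← hK] <;> ring
  rw [integral_phaseLaw]
  · rw [Fintype.sum_prod_type, Fintype.sum_option]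
    have h0 : ∀ b, ∫ x, phaseVar v (x, (none, b)) * conj (phaseVar w (x, (none, b))) ∂freq = 0 := by
      intro b
      simp [phaseVar_apply]
    simp only [Fintype.sum_bool, h1, h0, mean, integral_finsetSum _ fun m _ => hi m]
    simp only [integral_const_mul]
    rw [add_zero, zero_add, Finset.sum_add_distrib, ← Finset.mul_sum, ← two_mul, ← mul_assoc,
      ← mul_assoc]
    congr 1
    have h3 : (K : ℂ) ≠ 0 := by exact_mod_cast hKp.ne'
    have h4 : (Real.pi : ℂ) ≠ 0 := by exact_mod_cast hpi.ne'
    rw [Fintype.card_prod, Fintype.card_bool, ← hK]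
    push_cast
    field_simp
  · rintro ⟨o, b⟩
    cases o with
    | none => simp [phaseVar_apply]
    | some m => simp only [h1]; exact (hi m).const_mul _

theorem phaseVar_congr {v w : ℝ → ι → ℂ} {ω : ℝ × (Option ι × Bool)} (h : v ω.1 = w ω.1) :
    phaseVar v ω = phaseVar w ω := by
  simp only [phaseVar, h]

end RandomPhase

section RandomPhase

variable {ι : Type} [Fintype ι]

theorem ae_phaseLaw {q : ℝ → Prop} (h : ∀ᵐ x ∂freq, q x) : ∀ᵐ ω ∂phaseLaw ι, q ω.1 := by
  rw [phaseLaw]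
  refine Measure.ae_smul_measure ?_ _
  rw [← Measure.sum_fintype, Measure.ae_sum_iff]
  intro θ
  rw [(measurableEmbedding_pair θ).ae_map_iff]
  exact h

end RandomPhase

/-! ### Factors of the densities and the canonical model. -/

/-- `Q` is a measurable factor of the density `f`. -/
structure IsFactor {T : ℕ} (f Q : Density T) : Prop where
  meas : ∀ i j, AEStronglyMeasurable (fun x => Q x i j) freq
  eq : ∀ᵐ x ∂freq, f x = Q x * (Q x)ᴴ

theorem IsSpectralDensity.exists_isFactor {T : ℕ} {f : Density T} (hf : IsSpectralDensity f) :
    ∃ Q, IsFactor f Q := by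
  obtain ⟨Q, h1, h2⟩ := exists_aestronglyMeasurable_sqrt (fun i j => (hf.integrable i j).1)
    hf.posSemidef
  exact ⟨Q, h1, h2⟩

theorem aestronglyMeasurable_qf {T : ℕ} {f : Density T} {r : ℝ → Fin T → ℂ}
    (hf : ∀ i j, AEStronglyMeasurable (fun x => f x i j) freq)
    (hr : ∀ p, AEStronglyMeasurable (fun x => r x p) freq) :
    AEStronglyMeasurable (fun x => qf (f x) (r x)) freq := by
  simp only [qf_eq_sum]
  exact Complex.continuous_re.comp_aestronglyMeasurable
    (Finset.aestronglyMeasurable_fun_sum _ fun i _ => Finset.aestronglyMeasurable_fun_sum _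
      fun j _ => ((hr i).fun_mul (hf i j)).fun_mul (hr j).star)

section Pair

variable {T : ℕ} (Qf Qg : Density T)

/-- The pair of vector functions `r`, `s`, weighted by the factors of two densities. -/
def pairVec (r s : ℝ → Fin T → ℂ) (x : ℝ) : Fin T ⊕ Fin T → ℂ :=
  Sum.elim (r x ᵥ* Qf x) (s x ᵥ* Qg x)

variable {Qf Qg} {f g : Density T}

theorem sum_enorm_pairVec {r s : ℝ → Fin T → ℂ} {x : ℝ} (hf : f x = Qf x * (Qf x)ᴴ)
    (hg : g x = Qg x * (Qg x)ᴴ) :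
    ∑ m, ‖pairVec Qf Qg r s x m‖ₑ ^ 2
      = ENNReal.ofReal (qf (f x) (r x) + qf (g x) (s x)) := by
  rw [hf, hg, qf_mul_conjTranspose, qf_mul_conjTranspose, Fintype.sum_sum_type,
    ENNReal.ofReal_add (by positivity) (by positivity),
    ENNReal.ofReal_sum_of_nonneg fun _ _ => by positivity,
    ENNReal.ofReal_sum_of_nonneg fun _ _ => by positivity]
  simp only [ENNReal.ofReal_pow (norm_nonneg _), ofReal_norm]
  rfl

theorem aestronglyMeasurable_pairVec {r s : ℝ → Fin T → ℂ} (hf : IsFactor f Qf)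
    (hg : IsFactor g Qg) (hr : ∀ p, AEStronglyMeasurable (fun x => r x p) freq)
    (hs : ∀ p, AEStronglyMeasurable (fun x => s x p) freq) (m) :
    AEStronglyMeasurable (fun x => pairVec Qf Qg r s x m) freq := by
  cases m with
  | inl m =>
    exact Finset.aestronglyMeasurable_fun_sum Finset.univ fun i _ => (hr i).fun_mul (hf.meas i m)
  | inr m =>
    exact Finset.aestronglyMeasurable_fun_sum Finset.univ fun i _ => (hs i).fun_mul (hg.meas i m)

theorem sum_pairVec_mul_conj {r s r' s' : ℝ → Fin T → ℂ} {x : ℝ} (hf : f x = Qf x * (Qf x)ᴴ)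
    (hg : g x = Qg x * (Qg x)ᴴ) :
    ∑ m, pairVec Qf Qg r s x m * conj (pairVec Qf Qg r' s' x m)
      = r x ⬝ᵥ (f x *ᵥ star (r' x)) + s x ⬝ᵥ (g x *ᵥ star (s' x)) := by
  rw [hf, hg, Fintype.sum_sum_type, ← mulVec_mulVec, ← mulVec_mulVec, ← star_vecMul,
    ← star_vecMul, dotProduct_mulVec, dotProduct_mulVec]
  rfl

theorem memLp_pairVec {r s : ℝ → Fin T → ℂ} (hf : IsFactor f Qf)
    (hg : IsFactor g Qg) (hr : ∀ p, AEStronglyMeasurable (fun x => r x p) freq)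
    (hs : ∀ p, AEStronglyMeasurable (fun x => s x p) freq)
    (hfin : ∫⁻ x, ENNReal.ofReal (qf (f x) (r x) + qf (g x) (s x)) ∂freq < ∞) (m) :
    MemLp (fun x => pairVec Qf Qg r s x m) 2 freq := by
  refine ⟨aestronglyMeasurable_pairVec hf hg hr hs m, ?_⟩
  rw [eLpNorm_lt_top_iff_lintegral_rpow_enorm_lt_top two_ne_zero ENNReal.ofNat_ne_top]
  refine lt_of_le_of_lt (lintegral_mono_ae ?_) hfin
  filter_upwards [hf.eq, hg.eq] with x h1 h2
  rw [← sum_enorm_pairVec h1 h2]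
  simp only [ENNReal.toReal_ofNat, ENNReal.rpow_ofNat]
  exact Finset.single_le_sum (f := fun m => ‖pairVec Qf Qg r s x m‖ₑ ^ 2) (fun _ _ => zero_le)
    (Finset.mem_univ m)

theorem lintegral_qf_lt_top {f : Density T} (hf : IsSpectralDensity f) {r : ℝ → Fin T → ℂ}
    {C : ℝ} (hC : ∀ x p, ‖r x p‖ ≤ C) :
    ∫⁻ x, ENNReal.ofReal (qf (f x) (r x)) ∂freq < ∞ := by
  have h1 : Integrable (fun x => (f x).trace.re * (T * C) ^ 2) freq := by
    refine Integrable.mul_const ?_ _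
    exact (integrable_finsetSum _ fun i _ => hf.integrable i i).re
  refine lt_of_le_of_lt (lintegral_mono_ae ?_) h1.lintegral_lt_top
  filter_upwards [hf.posSemidef] with x hx
  refine ENNReal.ofReal_le_ofReal ((qf_le_re_trace_mul hx _).trans ?_)
  refine mul_le_mul_of_nonneg_left ?_ (re_trace_nonneg hx)
  refine pow_le_pow_left₀ (Finset.sum_nonneg fun _ _ => norm_nonneg _) ?_ 2
  refine (Finset.sum_le_sum fun i _ => hC x i).trans (le_of_eq ?_)
  simp

theorem memLp_pairVec_of_bounded {r s : ℝ → Fin T → ℂ} (hf : IsSpectralDensity f)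
    (hg : IsSpectralDensity g) (hQf : IsFactor f Qf)
    (hQg : IsFactor g Qg) (hr : ∀ p, AEStronglyMeasurable (fun x => r x p) freq)
    (hs : ∀ p, AEStronglyMeasurable (fun x => s x p) freq)
    {C D : ℝ} (hC : ∀ x p, ‖r x p‖ ≤ C) (hD : ∀ x p, ‖s x p‖ ≤ D) (m) :
    MemLp (fun x => pairVec Qf Qg r s x m) 2 freq := by
  refine memLp_pairVec hQf hQg hr hs ?_ m
  refine lt_of_le_of_lt (lintegral_mono fun x => ENNReal.ofReal_add_le) ?_
  rw [lintegral_add_left'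
    (aestronglyMeasurable_qf (fun i j => (hf.integrable i j).1) hr).aemeasurable.ennreal_ofReal]
  exact ENNReal.add_lt_top.2 ⟨lintegral_qf_lt_top hf hC, lintegral_qf_lt_top hg hD⟩

end Pair

theorem incr_add {T : ℕ} {Ω : Type} (n : ℕ) (s : ℤ) (ξ η : ℤ → Fin T → Ω → ℂ) (k : ℤ) (p : Fin T)
    (ω : Ω) : incr n s (ξ + η) k p ω = incr n s ξ k p ω + incr n s η k p ω := by
  simp [incr, mul_add, Finset.sum_add_distrib]

theorem incr_ee_mul {T : ℕ} {Ω : Type} (n : ℕ) (s : ℤ) (X : Ω → ℝ) (V : Fin T → Ω → ℂ) (k : ℤ)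
    (p : Fin T) (ω : Ω) :
    incr n s (fun k p ω => ee k (X ω) * V p ω) k p ω
      = ee k (X ω) * (1 - ee (-s) (X ω)) ^ n * V p ω := by
  rw [incr, sub_eq_neg_add, add_pow, Finset.mul_sum, Finset.sum_mul]
  refine Finset.sum_congr rfl fun l _ => ?_
  rw [show k - l * s = k + l * (-s) by ring, ee_add, ee_nat_mul, one_pow, neg_pow]
  ring

section Canonical

variable {T : ℕ} (n : ℕ) (Qf Qg : Density T)

/-- The random amplitudes of the harmonics of the increments in the canonical model. -/
def canF (p : Fin T) : ℝ × (Option (Fin T ⊕ Fin T) × Bool) → ℂ :=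
  phaseVar (pairVec Qf Qg (fun _ => Pi.single p 1) 0)

/-- The random amplitudes of the harmonics of the noise in the canonical model. -/
def canG (p : Fin T) : ℝ × (Option (Fin T ⊕ Fin T) × Bool) → ℂ :=
  phaseVar (pairVec Qf Qg 0 (fun _ => Pi.single p 1))

/-- The sequence with stationary increments of the canonical model. -/
def canXi (k : ℤ) (p : Fin T) (ω : ℝ × (Option (Fin T ⊕ Fin T) × Bool)) : ℂ :=
  ee k ω.1 * (canF Qf Qg p ω / (Complex.I * ω.1) ^ n)

/-- The stationary noise of the canonical model. -/
def canEta (k : ℤ) (p : Fin T) (ω : ℝ × (Option (Fin T ⊕ Fin T) × Bool)) : ℂ :=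
  ee k ω.1 * canG Qf Qg p ω

theorem phaseVar_pairVec (r s : ℝ → Fin T → ℂ) (ω : ℝ × (Option (Fin T ⊕ Fin T) × Bool)) :
    phaseVar (pairVec Qf Qg r s) ω
      = ∑ p, r ω.1 p * canF Qf Qg p ω + ∑ p, s ω.1 p * canG Qf Qg p ω := by
  obtain ⟨x, o, b⟩ := ω
  rcases o with _ | m | m
  · simp [canF, canG, phaseVar_apply]
  · simp only [canF, canG, phaseVar_apply, Option.elim_some, pairVec, Sum.elim_inl, vecMul,
      dotProduct, Pi.zero_apply, zero_mul, Finset.sum_const_zero, mul_zero, add_zero,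
      Pi.single_apply, ite_mul, one_mul, Finset.sum_ite_eq', Finset.mem_univ, if_true,
      Finset.mul_sum]
    exact Finset.sum_congr rfl fun i _ => by ring
  · simp only [canF, canG, phaseVar_apply, Option.elim_some, pairVec, Sum.elim_inr, vecMul,
      dotProduct, Pi.zero_apply, zero_mul, Finset.sum_const_zero, mul_zero, zero_add,
      Pi.single_apply, ite_mul, one_mul, Finset.sum_ite_eq', Finset.mem_univ, if_true,
      Finset.mul_sum]
    exact Finset.sum_congr rfl fun i _ => by ring

theorem incr_canXi (s k : ℤ) (p : Fin T) (ω) :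
    incr n s (canXi n Qf Qg) k p ω = phaseVar (pairVec Qf Qg
      (fun x => (ee k x * (1 - ee (-s) x) ^ n / (Complex.I * x) ^ n) • Pi.single p 1) 0) ω := by
  have := incr_ee_mul n s (fun ω : ℝ × (Option (Fin T ⊕ Fin T) × Bool) => ω.1)
    (fun p ω => canF Qf Qg p ω / (Complex.I * ω.1) ^ n) k p ω
  rw [phaseVar_pairVec]
  refine this.trans ?_
  simp [Pi.single_apply]
  ring

theorem canEta_eq (k : ℤ) (p : Fin T) (ω) :
    canEta Qf Qg k p ω = phaseVar (pairVec Qf Qg 0 (fun x => ee k x • Pi.single p 1)) ω := by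
  rw [phaseVar_pairVec]
  simp [Pi.single_apply, canEta]

theorem incr_canEta (s k : ℤ) (p : Fin T) (ω) :
    incr n s (canEta Qf Qg) k p ω
      = ee k ω.1 * (1 - ee (-s) ω.1) ^ n * canG Qf Qg p ω :=
  incr_ee_mul n s (fun ω : ℝ × (Option (Fin T ⊕ Fin T) × Bool) => ω.1)
    (fun p ω => canG Qf Qg p ω) k p ω

theorem norm_incr_factor_le (s k : ℤ) (x : ℝ) :
    ‖ee k x * (1 - ee (-s) x) ^ n / (Complex.I * x) ^ n‖ ≤ |(s : ℝ)| ^ n := by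
  rw [mul_div_assoc, norm_mul, norm_ee, one_mul, ← div_pow, norm_pow, norm_div]
  refine pow_le_pow_left₀ (by positivity) ?_ _
  refine div_le_of_le_mul₀ (norm_nonneg _) (abs_nonneg _) ?_
  have := Problem.norm_one_sub_ee_le (-s) x
  simpa [mul_comm] using this

theorem measurable_incr_factor (s k : ℤ) :
    Measurable fun x : ℝ => ee k x * (1 - ee (-s) x) ^ n / (Complex.I * x) ^ n := by
  have h1 := continuous_ee k
  have h2 := continuous_ee (-s)
  exact (h1.mul ((continuous_const.sub h2).pow n)).measurable.div (by fun_prop)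

theorem aestronglyMeasurable_smul_single {z : ℝ → ℂ} (hz : AEStronglyMeasurable z freq)
    (p q : Fin T) :
    AEStronglyMeasurable (fun x => (z x • (Pi.single p 1 : Fin T → ℂ)) q) freq := by
  simp only [Pi.smul_apply, smul_eq_mul]
  exact hz.mul_const _

theorem norm_smul_single_le {z : ℂ} {C : ℝ} (hz : ‖z‖ ≤ C) (p q : Fin T) :
    ‖(z • (Pi.single p 1 : Fin T → ℂ)) q‖ ≤ C := by
  rcases eq_or_ne q p with rfl | h
  · simpa using hz
  · simpa [h] using (norm_nonneg _).trans hz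

variable {Qf Qg} {f g : Density T}

/-- Inner products of coordinate vectors weighted by the factors reproduce `f` and `g`, and the two
blocks are orthogonal, which is the absence of correlation. Square integrability is claimed for the
increments only: `(1 - e^{-isx})^n / (ix)^n` is bounded, while `(ix)^{-n}` alone need not be. -/
theorem isModel_canonical (hf : IsSpectralDensity f) (hg : IsSpectralDensity g)
    (hQf : IsFactor f Qf) (hQg : IsFactor g Qg) :
    IsModel n f g (phaseLaw (Fin T ⊕ Fin T)) (canXi n Qf Qg) (canEta Qf Qg) := by
  have hL1 : ∀ (s k : ℤ) (p : Fin T) (m), MemLp (fun x => pairVec Qf Qg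
      (fun x => (ee k x * (1 - ee (-s) x) ^ n / (Complex.I * x) ^ n) • Pi.single p 1) 0 x m) 2 freq :=
    fun s k p m => memLp_pairVec_of_bounded (D := 0) hf hg hQf hQg
      (fun q => aestronglyMeasurable_smul_single
        (measurable_incr_factor n s k).aestronglyMeasurable p q)
      (fun q => aestronglyMeasurable_const)
      (fun x q => norm_smul_single_le (norm_incr_factor_le n s k x) p q) (fun x q => norm_zero.le) m
  have hL2 : ∀ (k : ℤ) (p : Fin T) (m), MemLp (fun x => pairVec Qf Qg
      0 (fun x => ee k x • Pi.single p 1) x m) 2 freq :=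
    fun k p m => memLp_pairVec_of_bounded (C := 0) hf hg hQf hQg
      (fun q => aestronglyMeasurable_const)
      (fun q => aestronglyMeasurable_smul_single
        (continuous_ee k).aestronglyMeasurable p q) (fun x q => norm_zero.le)
      (fun x q => norm_smul_single_le (norm_ee k x).le p q) m
  have e1 : ∀ s k p, incr n s (canXi n Qf Qg) k p = phaseVar (pairVec Qf Qg
      (fun x => (ee k x * (1 - ee (-s) x) ^ n / (Complex.I * x) ^ n) • Pi.single p 1) 0) :=
    fun s k p => funext fun ω => incr_canXi n Qf Qg s k p ω
  have e2 : ∀ k p, canEta Qf Qg k p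
      = phaseVar (pairVec Qf Qg 0 (fun x => ee k x • Pi.single p 1)) :=
    fun k p => funext fun ω => canEta_eq Qf Qg k p ω
  refine ⟨inferInstance, ?_, ?_, ?_, ?_, ?_, ?_, ?_, ?_⟩
  · intro k p
    have : canXi n Qf Qg k p = phaseVar (pairVec Qf Qg
        (fun x => (ee k x / (Complex.I * x) ^ n) • Pi.single p 1) 0) := by
      funext ω
      rw [phaseVar_pairVec, canXi]
      simp [Pi.single_apply]
      ring
    rw [this]
    refine aestronglyMeasurable_phaseVar fun m => aestronglyMeasurable_pairVec hQf hQg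
      (fun q => aestronglyMeasurable_smul_single ?_ p q) (fun q => aestronglyMeasurable_const) m
    exact ((continuous_ee k).measurable.div (by fun_prop)).aestronglyMeasurable
  · intro s k p
    rw [e1]
    exact memLp_phaseVar (hL1 s k p)
  · intro k p
    rw [e2]
    exact memLp_phaseVar (hL2 k p)
  · intro s k p
    rw [e1]
    exact integral_phaseVar (hL1 s k p)
  · intro k p
    rw [e2]
    exact integral_phaseVar (hL2 k p)
  · intro s₁ s₂ k m p q
    rw [e1, e1, integral_phaseVar_mul_conj (hL1 _ _ _) (hL1 _ _ _), mean, mean]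
    congr 1
    refine integral_congr_ae ?_
    filter_upwards [hQf.eq, hQg.eq] with x h1 h2
    rw [sum_pairVec_mul_conj h1 h2]
    have h3 : ∀ z : ℂ, star (z • (Pi.single q 1 : Fin T → ℂ)) = conj z • Pi.single q 1 := by
      intro z
      ext i
      rcases eq_or_ne i q with rfl | h <;> simp [*]
    have h4 : (Pi.single p 1 : Fin T → ℂ) ⬝ᵥ (f x *ᵥ Pi.single q 1) = f x p q := by
      simp
    rw [h3, mulVec_smul, dotProduct_smul, smul_dotProduct, h4]
    simp only [Pi.zero_apply, zero_dotProduct, add_zero, smul_eq_mul, map_div₀, map_mul, map_pow,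
      Problem.conj_one_sub_ee, conj_ee, neg_neg, Complex.conj_I, Complex.conj_ofReal]
    rw [← Problem.ix_pow_mul n x, ee_add]
    have h5 := ee_mul_ee_neg k x
    rw [neg_mul, div_mul_eq_mul_div, div_mul_eq_mul_div, div_mul_eq_mul_div, mul_div_assoc',
      div_div]
    congr 1; swap
    · ring
    linear_combination (ee m x * (1 - ee (-s₁) x) ^ n * (1 - ee s₂ x) ^ n * f x p q) * h5
  · intro k m p q
    rw [e2, e2, integral_phaseVar_mul_conj (hL2 _ _) (hL2 _ _), mean, mean]
    congr 1
    refine integral_congr_ae ?_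
    filter_upwards [hQf.eq, hQg.eq] with x h1 h2
    rw [sum_pairVec_mul_conj h1 h2]
    have h3 : ∀ z : ℂ, star (z • (Pi.single q 1 : Fin T → ℂ)) = conj z • Pi.single q 1 := by
      intro z
      ext i
      rcases eq_or_ne i q with rfl | h <;> simp [*]
    have h4 : (Pi.single p 1 : Fin T → ℂ) ⬝ᵥ (g x *ᵥ Pi.single q 1) = g x p q := by
      simp
    rw [h3, mulVec_smul, dotProduct_smul, smul_dotProduct, h4]
    simp only [Pi.zero_apply, zero_dotProduct, zero_add, smul_eq_mul, conj_ee]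
    rw [ee_add]
    have h5 := ee_mul_ee_neg k x
    linear_combination (ee m x * g x p q) * h5
  · intro s k j p q
    rw [e1, e2, integral_phaseVar_mul_conj (hL1 _ _ _) (hL2 _ _), mean]
    refine mul_eq_zero_of_right _ ?_
    rw [← integral_zero ℝ ℂ (μ := freq)]
    refine integral_congr_ae ?_
    filter_upwards [hQf.eq, hQg.eq] with x h1 h2
    rw [sum_pairVec_mul_conj h1 h2]
    simp

end Canonical

/-! ### Second moments determine the errors of finite combinations. -/

theorem eLpNorm_two_sq {Ω E : Type*} [MeasurableSpace Ω] [NormedAddCommGroup E] (P : Measure Ω)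
    (F : Ω → E) : eLpNorm F 2 P ^ 2 = ∫⁻ ω, ‖F ω‖ₑ ^ 2 ∂P := by
  have := eLpNorm_nnreal_pow_eq_lintegral (f := F) (μ := P) (p := 2) two_ne_zero
  simpa using this

theorem lintegral_sq_eq_integral_mul_conj {Ω : Type*} [MeasurableSpace Ω] {P : Measure Ω}
    {U : Ω → ℂ} (hU : MemLp U 2 P) :
    ∫⁻ ω, ‖U ω‖ₑ ^ 2 ∂P = ENNReal.ofReal (∫ ω, U ω * conj (U ω) ∂P).re := by
  have h1 : ∀ ω, U ω * conj (U ω) = ((‖U ω‖ ^ 2 : ℝ) : ℂ) := fun ω => by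
    rw [Complex.mul_conj']
    push_cast
    rfl
  simp only [h1]
  rw [integral_complex_ofReal, Complex.ofReal_re, ofReal_integral_eq_lintegral_ofReal]
  · simp only [ENNReal.ofReal_pow (norm_nonneg _), ofReal_norm]
  · exact hU.norm.integrable_sq
  · exact Filter.Eventually.of_forall fun ω => by positivity

/-- Corresponding combinations of two families with equal second moments have equal second
moments. -/
theorem lintegral_sq_eq_of_mem_span {ι : Type*} {Ω₁ Ω₂ : Type} [MeasurableSpace Ω₁] [MeasurableSpace Ω₂]
    {P₁ : Measure Ω₁} {P₂ : Measure Ω₂} {X : ι → Ω₁ → ℂ} {Y : ι → Ω₂ → ℂ}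
    (hX : ∀ i, MemLp (X i) 2 P₁) (hY : ∀ i, MemLp (Y i) 2 P₂)
    (h : ∀ i j, ∫ ω, X i ω * conj (X j ω) ∂P₁ = ∫ ω, Y i ω * conj (Y j ω) ∂P₂)
    {U : Ω₁ → ℂ} {V : Ω₂ → ℂ} (hUV : (U, V) ∈ Submodule.span ℂ (Set.range fun i => (X i, Y i))) :
    MemLp U 2 P₁ ∧ ∫⁻ ω, ‖U ω‖ₑ ^ 2 ∂P₁ = ∫⁻ ω, ‖V ω‖ₑ ^ 2 ∂P₂ := by
  obtain ⟨c, hc⟩ := (Finsupp.mem_span_range_iff_exists_finsupp).1 hUV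
  have gen : ∀ {Ω : Type} [MeasurableSpace Ω] {P : Measure Ω} {Z : ι → Ω → ℂ},
      (∀ i, MemLp (Z i) 2 P) → MemLp (fun ω => ∑ i ∈ c.support, c i * Z i ω) 2 P ∧
      ∫ ω, (∑ i ∈ c.support, c i * Z i ω) * conj (∑ i ∈ c.support, c i * Z i ω) ∂P
        = ∑ i ∈ c.support, ∑ j ∈ c.support, c i * conj (c j) * ∫ ω, Z i ω * conj (Z j ω) ∂P := by
    intro Ω _ P Z hZ
    refine ⟨memLp_finsetSum _ fun i _ => (hZ i).const_mul _, ?_⟩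
    have hi : ∀ i j, Integrable (fun ω => c i * conj (c j) * (Z i ω * conj (Z j ω))) P :=
      fun i j => ((hZ i).integrable_mul (hZ j).star).const_mul _
    have e : ∀ ω, (∑ i ∈ c.support, c i * Z i ω) * conj (∑ i ∈ c.support, c i * Z i ω)
        = ∑ i ∈ c.support, ∑ j ∈ c.support, c i * conj (c j) * (Z i ω * conj (Z j ω)) := by
      intro ω
      rw [map_sum, Finset.sum_mul_sum]
      refine Finset.sum_congr rfl fun i _ => Finset.sum_congr rfl fun j _ => ?_
      rw [map_mul]
      ring
    simp only [e]
    rw [integral_finsetSum _ fun i _ => integrable_finsetSum _ fun j _ => hi i j]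
    refine Finset.sum_congr rfl fun i _ => ?_
    rw [integral_finsetSum _ fun j _ => hi i j]
    simp only [integral_const_mul]
  have hU : U = fun ω => ∑ i ∈ c.support, c i * X i ω := by
    have := congrArg Prod.fst hc
    refine Eq.trans this.symm ?_
    rw [Finsupp.sum, Prod.fst_sum]
    funext ω
    simp
  have hV : V = fun ω => ∑ i ∈ c.support, c i * Y i ω := by
    have := congrArg Prod.snd hc
    refine Eq.trans this.symm ?_
    rw [Finsupp.sum, Prod.snd_sum]
    funext ω
    simp
  have g1 := gen hX
  have g2 := gen hY
  rw [hU, hV, lintegral_sq_eq_integral_mul_conj g1.1, lintegral_sq_eq_integral_mul_conj g2.1, g1.2,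
    g2.2]
  simp only [h]
  exact ⟨g1.1, trivial⟩

namespace Problem

variable {T : ℕ} (S : Problem T)

/-- The part of the error of the characteristic `h` which is due to the increments. -/
def resF (h : ℝ → Fin T → ℂ) (x : ℝ) : Fin T → ℂ := S.kern x • S.polyB x - h x

/-- The part of the error of the characteristic `h` which is due to the noise. -/
def resG (h : ℝ → Fin T → ℂ) (x : ℝ) : Fin T → ℂ :=
  (Complex.I * x) ^ S.n • S.resF h x - S.polyA x

/-- The density of the error of the characteristic `h` for the densities `f`, `g`. -/
def errDensity (f g : Density T) (h : ℝ → Fin T → ℂ) (x : ℝ) : ℝ :=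
  qf (f x) (S.resF h x) + qf (g x) (S.resG h x)

/-- The spectral expression of the mean square error. -/
def err (f g : Density T) (h : ℝ → Fin T → ℂ) : ℝ≥0∞ :=
  ENNReal.ofReal (1 / (2 * Real.pi)) * ∫⁻ x, ENNReal.ofReal (S.errDensity f g h x) ∂freq

/-- The error `A_N ξ - Â_N ξ` of the estimate which corresponds to a finite combination. -/
def comboError {Ω : Type} (ξ η : ℤ → Fin T → Ω → ℂ) (c : ℤ × Fin T →₀ ℂ) (ω : Ω) : ℂ :=
  S.target ξ ω + S.initial (ξ + η) ω - S.combo (ξ + η) c ω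

theorem comboError_eq {Ω : Type} (ξ η : ℤ → Fin T → Ω → ℂ) (c : ℤ × Fin T →₀ ℂ) (ω : Ω) :
    S.comboError ξ η c ω
      = ∑ k ∈ Finset.range (S.N + 1), ∑ p, S.b k p * incr S.n S.μ (ξ + η) k p ω
        - ∑ k ∈ Finset.range (S.N + 1), ∑ p, S.a k p * η k p ω
        - c.sum fun kp z => z * incr S.n S.μ (ξ + η) kp.1 kp.2 ω := by
  rw [comboError, ← S.target_add_initial, combo]
  have : S.target (ξ + η) ω = S.target ξ ω + S.target η ω := by
    simp [target, mul_add, Finset.sum_add_distrib]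
  rw [this, target, target]
  ring

/-- The values of `ξ` enter the error only through increments. So it is a combination of increments
of `ξ` and values of `η`, with the same coefficients in both models, and all covariances of these
are prescribed by `f` and `g`. -/
theorem lintegral_comboError_eq {Ω₁ Ω₂ : Type} [MeasurableSpace Ω₁] [MeasurableSpace Ω₂]
    {f g : Density T} {P₁ : Measure Ω₁} {P₂ : Measure Ω₂} {ξ₁ η₁ : ℤ → Fin T → Ω₁ → ℂ}
    {ξ₂ η₂ : ℤ → Fin T → Ω₂ → ℂ} (h₁ : IsModel S.n f g P₁ ξ₁ η₁) (h₂ : IsModel S.n f g P₂ ξ₂ η₂)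
    (c : ℤ × Fin T →₀ ℂ) :
    MemLp (S.comboError ξ₁ η₁ c) 2 P₁ ∧
    ∫⁻ ω, ‖S.comboError ξ₁ η₁ c ω‖ₑ ^ 2 ∂P₁ = ∫⁻ ω, ‖S.comboError ξ₂ η₂ c ω‖ₑ ^ 2 ∂P₂ := by
  let fam : ∀ {Ω : Type}, (ℤ → Fin T → Ω → ℂ) → (ℤ → Fin T → Ω → ℂ) →
      (ℤ × Fin T) ⊕ (ℤ × Fin T) → Ω → ℂ := fun ξ η =>
    Sum.elim (fun kp => incr S.n S.μ ξ kp.1 kp.2) (fun kp => η kp.1 kp.2)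
  have hL : ∀ {Ω : Type} [MeasurableSpace Ω] {P : Measure Ω} {ξ η : ℤ → Fin T → Ω → ℂ},
      IsModel S.n f g P ξ η → ∀ i, MemLp (fam ξ η i) 2 P := by
    rintro Ω _ P ξ η h (i | i)
    · exact h.incr_memLp _ _ _
    · exact h.noise_memLp _ _
  have hG : ∀ {Ω : Type} [MeasurableSpace Ω] {P : Measure Ω} {ξ η : ℤ → Fin T → Ω → ℂ},
      IsModel S.n f g P ξ η → ∀ i j, ∫ ω, fam ξ η i ω * conj (fam ξ η j ω) ∂P
        = match i, j with
          | .inl a, .inl b => mean fun x => ee (a.1 - b.1) x * (1 - ee (-S.μ) x) ^ S.n *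
              (1 - ee S.μ x) ^ S.n / (x : ℂ) ^ (2 * S.n) * f x a.2 b.2
          | .inr a, .inr b => mean fun x => ee (a.1 - b.1) x * g x a.2 b.2
          | _, _ => 0 := by
    rintro Ω _ P ξ η h (⟨k, p⟩ | ⟨k, p⟩) (⟨l, q⟩ | ⟨l, q⟩)
    · have := h.incr_cov S.μ S.μ l (k - l) p q
      rwa [add_sub_cancel] at this
    · exact h.uncorrelated _ _ _ _ _
    · have := congrArg conj (h.uncorrelated S.μ l k q p)
      rw [← integral_conj, map_zero] at this
      simp only [map_mul, Complex.conj_conj] at this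
      rw [← this]
      exact integral_congr_ae (Filter.Eventually.of_forall fun ω => mul_comm _ _)
    · have := h.noise_cov l (k - l) p q
      rwa [add_sub_cancel] at this
  refine lintegral_sq_eq_of_mem_span (hL h₁) (hL h₂)
    (fun i j => (hG h₁ i j).trans (hG h₂ i j).symm) ?_
  -- A span of pairs: membership of the pair of errors records that both are the same combination of
  -- the two families.
  set W := Submodule.span ℂ (Set.range fun i => (fam ξ₁ η₁ i, fam ξ₂ η₂ i))
  have m1 : ∀ k p, (incr S.n S.μ ξ₁ k p, incr S.n S.μ ξ₂ k p) ∈ W := fun k p =>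
    Submodule.subset_span ⟨.inl (k, p), rfl⟩
  have m2 : ∀ k p, (η₁ k p, η₂ k p) ∈ W := fun k p =>
    Submodule.subset_span ⟨.inr (k, p), rfl⟩
  have m3 : ∀ k p, (incr S.n S.μ η₁ k p, incr S.n S.μ η₂ k p) ∈ W := by
    intro k p
    have : (incr S.n S.μ η₁ k p, incr S.n S.μ η₂ k p)
        = ∑ l ∈ Finset.range (S.n + 1), ((-1) ^ l * (S.n.choose l : ℂ)) •
          (η₁ (k - l * S.μ) p, η₂ (k - l * S.μ) p) := by
      refine Prod.ext ?_ ?_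
      · rw [Prod.fst_sum]
        funext ω
        simp [incr]
      · rw [Prod.snd_sum]
        funext ω
        simp [incr]
    rw [this]
    exact W.sum_mem fun l _ => W.smul_mem _ (m2 _ _)
  have m4 : ∀ k p, (incr S.n S.μ (ξ₁ + η₁) k p, incr S.n S.μ (ξ₂ + η₂) k p) ∈ W := by
    intro k p
    convert W.add_mem (m1 k p) (m3 k p) using 1
    refine Prod.ext ?_ ?_ <;>
    · funext ω
      simp [incr_add]
  have : (S.comboError ξ₁ η₁ c, S.comboError ξ₂ η₂ c)
      = ∑ k ∈ Finset.range (S.N + 1), ∑ p, S.b k p •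
          (incr S.n S.μ (ξ₁ + η₁) k p, incr S.n S.μ (ξ₂ + η₂) k p)
        - ∑ k ∈ Finset.range (S.N + 1), ∑ p, S.a k p • (η₁ k p, η₂ k p)
        - ∑ kp ∈ c.support, c kp •
          (incr S.n S.μ (ξ₁ + η₁) kp.1 kp.2, incr S.n S.μ (ξ₂ + η₂) kp.1 kp.2) := by
    refine Prod.ext ?_ ?_
    · simp only [Prod.fst_sub, Prod.fst_sum]
      funext ω
      simp [comboError_eq, Finsupp.sum]
    · simp only [Prod.snd_sub, Prod.snd_sum]
      funext ω
      simp [comboError_eq, Finsupp.sum]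
  rw [this]
  refine W.sub_mem (W.sub_mem ?_ ?_) ?_
  · exact W.sum_mem fun k _ => W.sum_mem fun p _ => W.smul_mem _ (m4 _ _)
  · exact W.sum_mem fun k _ => W.sum_mem fun p _ => W.smul_mem _ (m2 _ _)
  · exact W.sum_mem fun k _ => W.smul_mem _ (m4 _ _)

end Problem

/-! ### The spectral formula for the mean square error. -/

theorem lintegral_phaseVar_pairVec {T : ℕ} {f g Qf Qg : Density T} (hQf : IsFactor f Qf)
    (hQg : IsFactor g Qg) {r s : ℝ → Fin T → ℂ}
    (hr : ∀ p, AEStronglyMeasurable (fun x => r x p) freq)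
    (hs : ∀ p, AEStronglyMeasurable (fun x => s x p) freq) :
    ∫⁻ ω, ‖phaseVar (pairVec Qf Qg r s) ω‖ₑ ^ 2 ∂phaseLaw _
      = ENNReal.ofReal (1 / (2 * Real.pi)) *
        ∫⁻ x, ENNReal.ofReal (qf (f x) (r x) + qf (g x) (s x)) ∂freq := by
  rw [lintegral_phaseVar fun m => aestronglyMeasurable_pairVec hQf hQg hr hs m]
  congr 1
  refine lintegral_congr_ae ?_
  filter_upwards [hQf.eq, hQg.eq] with x h1 h2
  exact sum_enorm_pairVec h1 h2

theorem aestronglyMeasurable_components {T : ℕ} {h : ℝ → Fin T → ℂ}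
    (hh : AEStronglyMeasurable h freq) (p : Fin T) :
    AEStronglyMeasurable (fun x => h x p) freq :=
  (continuous_apply p).comp_aestronglyMeasurable hh

namespace Problem

variable {T : ℕ} (S : Problem T)

theorem continuous_polyA : Continuous S.polyA := by
  unfold polyA
  exact continuous_finsetSum _ fun k _ => (continuous_ee k).smul continuous_const

theorem continuous_polyB : Continuous S.polyB := by
  unfold polyB
  exact continuous_finsetSum _ fun k _ => (continuous_ee k).smul continuous_const

theorem measurable_ix_pow (n : ℕ) : Measurable fun x : ℝ => (Complex.I * x) ^ n := by
  fun_prop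

theorem aestronglyMeasurable_resF {h : ℝ → Fin T → ℂ}
    (hh : ∀ p, AEStronglyMeasurable (fun x => h x p) freq) (p : Fin T) :
    AEStronglyMeasurable (fun x => S.resF h x p) freq := by
  simp only [resF, Pi.sub_apply, Pi.smul_apply, smul_eq_mul]
  exact (S.measurable_kern.aestronglyMeasurable.fun_mul
    ((continuous_apply p).comp S.continuous_polyB).aestronglyMeasurable).sub (hh p)

theorem aestronglyMeasurable_resG {h : ℝ → Fin T → ℂ}
    (hh : ∀ p, AEStronglyMeasurable (fun x => h x p) freq) (p : Fin T) :
    AEStronglyMeasurable (fun x => S.resG h x p) freq := by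
  simp only [resG, Pi.sub_apply, Pi.smul_apply, smul_eq_mul]
  exact ((measurable_ix_pow S.n).aestronglyMeasurable.fun_mul
    (S.aestronglyMeasurable_resF hh p)).sub
    ((continuous_apply p).comp S.continuous_polyA).aestronglyMeasurable

theorem comboChar_apply (c : ℤ × Fin T →₀ ℂ) (x : ℝ) (p : Fin T) :
    S.comboChar c x p
      = S.kern x * ∑ kp ∈ c.support, ee kp.1 x * Pi.single (M := fun _ => ℂ) kp.2 (c kp) p := by
  rw [comboChar, Finsupp.sum, Finset.sum_apply, Finset.mul_sum]
  refine Finset.sum_congr rfl fun kp _ => ?_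
  rcases eq_or_ne p kp.2 with rfl | h
  · simp
    ring
  · simp [h]

theorem measurable_comboChar (c : ℤ × Fin T →₀ ℂ) : Measurable (S.comboChar c) := by
  refine measurable_pi_iff.2 fun p => ?_
  simp only [comboChar_apply]
  refine S.measurable_kern.mul (Finset.measurable_fun_sum _ fun kp _ => ?_)
  exact (continuous_ee _).measurable.mul_const _

theorem aestronglyMeasurable_comboChar (c : ℤ × Fin T →₀ ℂ) :
    AEStronglyMeasurable (S.comboChar c) freq :=
  (S.measurable_comboChar c).aestronglyMeasurable

/-- As `|ix|^{2n} = x^{2n}`, the form of `f + x^{2n} g` at `h` is that of the pair `(h, (ix)^n h)`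
for the weights `f` and `g`: the noise enters the observed increments with the factor `(ix)^n`. -/
theorem qf_obsDensity (f g : Density T) (n : ℕ) (x : ℝ) (h : Fin T → ℂ) :
    qf (obsDensity n f g x) h = qf (f x) h + qf (g x) ((Complex.I * x) ^ n • h) := by
  rw [obsDensity, qf_add, qf_vec_smul]
  congr 1
  have : ((x : ℂ) ^ (2 * n)) = (((|x| ^ n) ^ 2 : ℝ) : ℂ) := by
    rw [← pow_mul, mul_comm n, pow_mul |x|, sq_abs, ← pow_mul]
    push_cast
    rfl
  rw [this, qf_smul]
  simp

theorem sqNorm_obsDensity (f g : Density T) (h : ℝ → Fin T → ℂ) :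
    sqNorm (obsDensity S.n f g) h = ∫⁻ x, ENNReal.ofReal
      (qf (f x) (h x) + qf (g x) ((Complex.I * x) ^ S.n • h x)) ∂freq :=
  lintegral_congr fun x => congrArg _ (qf_obsDensity f g S.n x (h x))

section Canonical

variable (Qf Qg : Density T)

theorem incr_canonical {x : ℝ} (hx : x ≠ 0) (k : ℤ) (p : Fin T) (θ) :
    incr S.n S.μ (canXi S.n Qf Qg + canEta Qf Qg) k p (x, θ)
      = ee k x * S.kern x * (canF Qf Qg p (x, θ) + (Complex.I * x) ^ S.n * canG Qf Qg p (x, θ)) := by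
  have hx' : (Complex.I * x) ^ S.n ≠ 0 :=
    pow_ne_zero _ (mul_ne_zero Complex.I_ne_zero (by exact_mod_cast hx))
  rw [incr_add, incr_canXi, incr_canEta, phaseVar_pairVec, kern]
  simp only [Pi.smul_apply, Pi.single_apply, smul_eq_mul, mul_ite, mul_one, mul_zero, ite_mul,
    zero_mul, Finset.sum_ite_eq', Finset.mem_univ, if_true, Pi.zero_apply, Finset.sum_const_zero,
    add_zero]
  field_simp

theorem combo_canonical {x : ℝ} (hx : x ≠ 0) (c : ℤ × Fin T →₀ ℂ) (θ) :
    S.combo (canXi S.n Qf Qg + canEta Qf Qg) c (x, θ)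
      = phaseVar (pairVec Qf Qg (S.comboChar c)
          fun x => (Complex.I * x) ^ S.n • S.comboChar c x) (x, θ) := by
  rw [phaseVar_pairVec, ← Finset.sum_add_distrib, combo, Finsupp.sum]
  simp only [incr_canonical S Qf Qg hx]
  simp only [Pi.smul_apply, comboChar_apply, smul_eq_mul]
  have h1 : ∀ p, S.kern x * (∑ kp ∈ c.support, ee kp.1 x * Pi.single (M := fun _ => ℂ) kp.2 (c kp) p)
      * canF Qf Qg p (x, θ) + (Complex.I * x) ^ S.n *
      (S.kern x * ∑ kp ∈ c.support, ee kp.1 x * Pi.single (M := fun _ => ℂ) kp.2 (c kp) p)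
      * canG Qf Qg p (x, θ)
      = ∑ kp ∈ c.support, ee kp.1 x * S.kern x * Pi.single (M := fun _ => ℂ) kp.2 (c kp) p *
        (canF Qf Qg p (x, θ) + (Complex.I * x) ^ S.n * canG Qf Qg p (x, θ)) := by
    intro p
    simp only [Finset.mul_sum, Finset.sum_mul]
    rw [← Finset.sum_add_distrib]
    exact Finset.sum_congr rfl fun kp _ => by ring
  simp only [h1]
  rw [Finset.sum_comm]
  refine Finset.sum_congr rfl fun kp _ => ?_
  simp only [Pi.single_apply, mul_ite, mul_zero, ite_mul, zero_mul, Finset.sum_ite_eq',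
    Finset.mem_univ, if_true]
  ring

/-- The functional of the increments contributes `κB` to the amplitudes of `ξ` and `(ix)^n κB` to
those of `η`, and the noise term subtracts `A` from the latter. So the error of `h` is the variable
of the pair of residuals, frequency by frequency. -/
theorem target_canonical {x : ℝ} (hx : x ≠ 0) (h : ℝ → Fin T → ℂ) (θ) :
    S.target (canXi S.n Qf Qg) (x, θ) + S.initial (canXi S.n Qf Qg + canEta Qf Qg) (x, θ)
      - phaseVar (pairVec Qf Qg h fun x => (Complex.I * x) ^ S.n • h x) (x, θ)
      = phaseVar (pairVec Qf Qg (S.resF h) (S.resG h)) (x, θ) := by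
  have h0 : S.target (canXi S.n Qf Qg + canEta Qf Qg) (x, θ)
      = S.target (canXi S.n Qf Qg) (x, θ) + S.target (canEta Qf Qg) (x, θ) := by
    simp [target, mul_add, Finset.sum_add_distrib]
  have h1 := S.target_add_initial (canXi S.n Qf Qg + canEta Qf Qg) (x, θ)
  have h2 : ∑ k ∈ Finset.range (S.N + 1), ∑ p, S.b k p *
      incr S.n S.μ (canXi S.n Qf Qg + canEta Qf Qg) k p (x, θ)
      = ∑ p, S.kern x * S.polyB x p *
        (canF Qf Qg p (x, θ) + (Complex.I * x) ^ S.n * canG Qf Qg p (x, θ)) := by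
    rw [Finset.sum_comm]
    refine Finset.sum_congr rfl fun p _ => ?_
    simp only [incr_canonical S Qf Qg hx, polyB, Finset.sum_apply, Pi.smul_apply, smul_eq_mul]
    rw [Finset.mul_sum, Finset.sum_mul]
    exact Finset.sum_congr rfl fun k _ => by ring
  have h3 : S.target (canEta Qf Qg) (x, θ) = ∑ p, S.polyA x p * canG Qf Qg p (x, θ) := by
    rw [target, Finset.sum_comm]
    refine Finset.sum_congr rfl fun p _ => ?_
    simp only [canEta, polyA, Finset.sum_apply, Pi.smul_apply, smul_eq_mul]
    rw [Finset.sum_mul]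
    exact Finset.sum_congr rfl fun k _ => by ring
  rw [phaseVar_pairVec, phaseVar_pairVec]
  have h4 : S.target (canXi S.n Qf Qg) (x, θ)
      + S.initial (canXi S.n Qf Qg + canEta Qf Qg) (x, θ)
      = ∑ p, S.kern x * S.polyB x p *
        (canF Qf Qg p (x, θ) + (Complex.I * x) ^ S.n * canG Qf Qg p (x, θ))
        - ∑ p, S.polyA x p * canG Qf Qg p (x, θ) := by
    rw [← h2, ← h1, ← h3, h0]
    ring
  rw [h4]
  simp only [← Finset.sum_add_distrib, ← Finset.sum_sub_distrib]
  refine Finset.sum_congr rfl fun p _ => ?_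
  simp only [resF, resG, Pi.sub_apply, Pi.smul_apply, smul_eq_mul]
  ring

end Canonical

variable {S} {f g : Density T} {h : ℝ → Fin T → ℂ}

theorem err_eq_lintegral_phaseVar {Qf Qg : Density T} (hQf : IsFactor f Qf) (hQg : IsFactor g Qg)
    (hh : AEStronglyMeasurable h freq) :
    S.err f g h
      = ∫⁻ ω, ‖phaseVar (pairVec Qf Qg (S.resF h) (S.resG h)) ω‖ₑ ^ 2 ∂phaseLaw _ :=
  (lintegral_phaseVar_pairVec hQf hQg
    (S.aestronglyMeasurable_resF (aestronglyMeasurable_components hh))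
    (S.aestronglyMeasurable_resG (aestronglyMeasurable_components hh))).symm

theorem sqNorm_eq_lintegral_phaseVar {Qf Qg : Density T} (hQf : IsFactor f Qf)
    (hQg : IsFactor g Qg) (hh : AEStronglyMeasurable h freq) :
    ENNReal.ofReal (1 / (2 * Real.pi)) * sqNorm (obsDensity S.n f g) h
      = ∫⁻ ω, ‖phaseVar (pairVec Qf Qg h fun x => (Complex.I * x) ^ S.n • h x) ω‖ₑ ^ 2
        ∂phaseLaw _ := by
  rw [sqNorm_obsDensity, lintegral_phaseVar_pairVec hQf hQg (aestronglyMeasurable_components hh)]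
  intro p
  simp only [Pi.smul_apply, smul_eq_mul]
  exact (measurable_ix_pow S.n).aestronglyMeasurable.fun_mul (aestronglyMeasurable_components hh p)

theorem ofReal_inv_two_pi_le_one : ENNReal.ofReal (1 / (2 * Real.pi)) ≤ 1 := by
  rw [ENNReal.ofReal_le_one, div_le_one (by positivity)]
  have := Real.pi_gt_three
  linarith

theorem phaseVar_pairVec_sub (Qf Qg : Density T) (r s r' s' : ℝ → Fin T → ℂ) (ω) :
    phaseVar (pairVec Qf Qg r s) ω - phaseVar (pairVec Qf Qg r' s') ω
      = phaseVar (pairVec Qf Qg (fun x => r x - r' x) (fun x => s x - s' x)) ω := by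
  simp only [phaseVar_pairVec, Pi.sub_apply, sub_mul, Finset.sum_sub_distrib]
  ring

/-- The spectral expression is attained by the canonical model. -/
theorem err_le_mse (hf : IsSpectralDensity f) (hg : IsSpectralDensity g) (hh : S.InObs f g h) :
    S.err f g h ≤ S.mse f g h := by
  obtain ⟨Qf, hQf⟩ := hf.exists_isFactor
  obtain ⟨Qg, hQg⟩ := hg.exists_isFactor
  have hM := isModel_canonical S.n hf hg hQf hQg
  -- The stochastic integral of `h` is explicit in the canonical model: it is the variable of the
  -- pair `(h, (ix)^n h)`.
  let Z : ℝ × (Option (Fin T ⊕ Fin T) × Bool) → ℂ :=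
    phaseVar (pairVec Qf Qg h fun x => (Complex.I * x) ^ S.n • h x)
  let Y : ℝ × (Option (Fin T ⊕ Fin T) × Bool) → ℂ := fun ω =>
    Z ω - S.initial (canXi S.n Qf Qg + canEta Qf Qg) ω
  have hhc := aestronglyMeasurable_components hh.1
  have hZ : AEStronglyMeasurable Z (phaseLaw _) :=
    aestronglyMeasurable_phaseVar fun m => aestronglyMeasurable_pairVec hQf hQg hhc
      (fun p => (measurable_ix_pow S.n).aestronglyMeasurable.fun_mul (hhc p)) m
  have hY : S.IsEstimate f g (phaseLaw _) (canXi S.n Qf Qg) (canEta Qf Qg) h Y := by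
    refine ⟨hZ.sub ?_, hh.1, ?_⟩
    · unfold initial
      refine Finset.aestronglyMeasurable_fun_sum _ fun j _ =>
        Finset.aestronglyMeasurable_fun_sum _ fun p _ => ?_
      exact ((hM.meas _ _).add (hM.noise_memLp _ _).1).const_mul _
    · intro ε hε
      obtain ⟨c, hc, hlt⟩ := hh.2 ε hε
      refine ⟨c, hc, hlt, lt_of_le_of_lt ?_ hlt⟩
      have e1 : ∫⁻ ω, ‖Y ω + S.initial (canXi S.n Qf Qg + canEta Qf Qg) ω
          - S.combo (canXi S.n Qf Qg + canEta Qf Qg) c ω‖ₑ ^ 2 ∂phaseLaw _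
          = ENNReal.ofReal (1 / (2 * Real.pi)) *
            sqNorm (obsDensity S.n f g) (fun x => h x - S.comboChar c x) := by
        rw [sqNorm_eq_lintegral_phaseVar hQf hQg (hh.1.fun_sub (S.aestronglyMeasurable_comboChar c))]
        refine lintegral_congr_ae ?_
        filter_upwards [ae_phaseLaw ae_ne_zero] with ω hω
        rw [S.combo_canonical Qf Qg hω]
        simp only [Y, Z, sub_add_cancel]
        rw [phaseVar_pairVec_sub]
        simp only [smul_sub]
      rw [e1]
      calc _ ≤ 1 * sqNorm (obsDensity S.n f g) (fun x => h x - S.comboChar c x) := by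
            gcongr
            exact ofReal_inv_two_pi_le_one
        _ = _ := one_mul _
  have e2 : ∫⁻ ω, ‖S.target (canXi S.n Qf Qg) ω - Y ω‖ₑ ^ 2 ∂phaseLaw _ = S.err f g h := by
    rw [err_eq_lintegral_phaseVar hQf hQg hh.1]
    refine lintegral_congr_ae ?_
    filter_upwards [ae_phaseLaw ae_ne_zero] with ω hω
    rw [← S.target_canonical Qf Qg hω h]
    simp only [Y, Z, Prod.mk.eta]
    congr 2
    ring
  rw [← e2, mse]
  refine le_iSup_of_le _ (le_iSup_of_le _ (le_iSup_of_le _ (le_iSup_of_le _ (le_iSup_of_le _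
    (le_iSup_of_le hM (le_iSup_of_le Y (le_iSup_of_le hY le_rfl)))))))

theorem comboError_canonical (Qf Qg : Density T) {ω} (hω : ω.1 ≠ 0) (c : ℤ × Fin T →₀ ℂ) :
    S.comboError (canXi S.n Qf Qg) (canEta Qf Qg) c ω
      = phaseVar (pairVec Qf Qg (S.resF (S.comboChar c)) (S.resG (S.comboChar c))) ω := by
  rw [comboError, S.combo_canonical Qf Qg hω, ← S.target_canonical Qf Qg hω]

/-- The root of the error is the distance of the target from `h` in the `L₂` space of the canonical
model, so this is the Minkowski inequality; the factor `1 / 2π ≤ 1` of the last term is dropped. -/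
theorem sqrt_err_le_add (hf : IsSpectralDensity f) (hg : IsSpectralDensity g)
    {h' : ℝ → Fin T → ℂ} (hh : AEStronglyMeasurable h freq) (hh' : AEStronglyMeasurable h' freq) :
    S.err f g h' ^ (1 / 2 : ℝ) ≤ S.err f g h ^ (1 / 2 : ℝ)
      + (sqNorm (obsDensity S.n f g) fun x => h x - h' x) ^ (1 / 2 : ℝ) := by
  obtain ⟨Qf, hQf⟩ := hf.exists_isFactor
  obtain ⟨Qg, hQg⟩ := hg.exists_isFactor
  have hroot : ∀ F : ℝ × (Option (Fin T ⊕ Fin T) × Bool) → ℂ,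
      (∫⁻ ω, ‖F ω‖ₑ ^ 2 ∂phaseLaw _) ^ (1 / 2 : ℝ) = eLpNorm F 2 (phaseLaw _) := by
    intro F
    rw [← eLpNorm_two_sq, ← ENNReal.rpow_natCast, ← ENNReal.rpow_mul]
    simp
  have hm : ∀ {u : ℝ → Fin T → ℂ}, AEStronglyMeasurable u freq → AEStronglyMeasurable
      (phaseVar (pairVec Qf Qg (S.resF u) (S.resG u))) (phaseLaw _) := fun {u} hu =>
    aestronglyMeasurable_phaseVar fun m => aestronglyMeasurable_pairVec hQf hQg
      (S.aestronglyMeasurable_resF (aestronglyMeasurable_components hu))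
      (S.aestronglyMeasurable_resG (aestronglyMeasurable_components hu)) m
  have e1 : (phaseVar (pairVec Qf Qg (fun x => h x - h' x)
      fun x => (Complex.I * x) ^ S.n • (h x - h' x)))
      = fun ω => phaseVar (pairVec Qf Qg (S.resF h') (S.resG h')) ω
        - phaseVar (pairVec Qf Qg (S.resF h) (S.resG h)) ω := by
    funext ω
    rw [phaseVar_pairVec_sub]
    refine phaseVar_congr ?_
    simp only [pairVec, resF, resG]
    congr 2
    · abel
    · rw [sub_sub_sub_cancel_right, ← smul_sub, sub_sub_sub_cancel_left]
  have e2 : (ENNReal.ofReal (1 / (2 * Real.pi)) *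
      sqNorm (obsDensity S.n f g) fun x => h x - h' x) ^ (1 / 2 : ℝ)
      ≤ (sqNorm (obsDensity S.n f g) fun x => h x - h' x) ^ (1 / 2 : ℝ) := by
    gcongr
    calc _ ≤ 1 * (sqNorm (obsDensity S.n f g) fun x => h x - h' x) := by
          gcongr
          exact ofReal_inv_two_pi_le_one
      _ = _ := one_mul _
  refine le_trans ?_ (add_le_add_right e2 _)
  rw [err_eq_lintegral_phaseVar hQf hQg hh, err_eq_lintegral_phaseVar hQf hQg hh', hroot, hroot,
    sqNorm_eq_lintegral_phaseVar hQf hQg (hh.fun_sub hh'), hroot, e1]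
  have := eLpNorm_add_le (hm hh) ((hm hh').sub (hm hh)) (p := 2) (by norm_num)
  rw [add_sub_cancel] at this
  exact this

/-- An estimate in an arbitrary model is a mean square limit of finite combinations, and the error
of a combination may be computed in the canonical model. The triangle inequality, used once in the
model and once in `L₂(p)`, carries the bound to the limit. -/
theorem mse_le_err (hf : IsSpectralDensity f) (hg : IsSpectralDensity g) :
    S.mse f g h ≤ S.err f g h := by
  obtain ⟨Qf, hQf⟩ := hf.exists_isFactor
  obtain ⟨Qg, hQg⟩ := hg.exists_isFactor
  have hM₀ := isModel_canonical S.n hf hg hQf hQg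
  rw [mse]
  refine iSup_le fun Ω => iSup_le fun _ => iSup_le fun P => iSup_le fun ξ => iSup_le fun η =>
    iSup_le fun hM => iSup_le fun Y => iSup_le fun hY => ?_
  rw [← eLpNorm_two_sq]
  have key : eLpNorm (fun ω => S.target ξ ω - Y ω) 2 P ≤ S.err f g h ^ (1 / 2 : ℝ) := by
    refine ENNReal.le_of_forall_pos_le_add fun δ hδ _ => ?_
    -- Half of `δ` is spent on approximating the estimate, half on approximating `h`; the definition
    -- bounds squares of norms.
    have hδ' : (0 : ℝ≥0∞) < ((δ / 2 : NNReal) : ℝ≥0∞) ^ 2 := by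
      have : 0 < δ / 2 := by positivity
      exact ENNReal.pow_pos (by exact_mod_cast this) 2
    obtain ⟨c, hc, hc1, hc2⟩ := hY.2.2 _ hδ'
    rw [← eLpNorm_two_sq] at hc2
    have hc2' := lt_of_not_ge fun hle => absurd hc2 (pow_le_pow_left' hle 2).not_gt
    obtain ⟨hL, hE⟩ := S.lintegral_comboError_eq hM hM₀ c
    have hE' : ∫⁻ ω, ‖S.comboError ξ η c ω‖ₑ ^ 2 ∂P = S.err f g (S.comboChar c) := by
      rw [hE, err_eq_lintegral_phaseVar hQf hQg (S.aestronglyMeasurable_comboChar c)]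
      refine lintegral_congr_ae ?_
      filter_upwards [ae_phaseLaw ae_ne_zero] with ω hω
      rw [comboError_canonical Qf Qg hω]
    have htm : AEStronglyMeasurable (S.target ξ) P := by
      unfold target
      exact Finset.aestronglyMeasurable_fun_sum _ fun k _ =>
        Finset.aestronglyMeasurable_fun_sum _ fun p _ => (hM.meas _ _).const_mul _
    have e1 : (fun ω => S.target ξ ω - Y ω) = S.comboError ξ η c
        - fun ω => Y ω + S.initial (ξ + η) ω - S.combo (ξ + η) c ω := by
      funext ω
      simp only [comboError, Pi.sub_apply]
      ring
    have e2 : (fun ω => Y ω + S.initial (ξ + η) ω - S.combo (ξ + η) c ω)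
        = (S.comboError ξ η c - S.target ξ) + Y := by
      funext ω
      simp only [comboError, Pi.sub_apply, Pi.add_apply]
      ring
    have hEm : AEStronglyMeasurable
        (fun ω => Y ω + S.initial (ξ + η) ω - S.combo (ξ + η) c ω) P := by
      rw [e2]
      exact (hL.1.sub htm).add hY.1
    rw [e1]
    refine (eLpNorm_sub_le hL.1 hEm (by norm_num)).trans ?_
    have h1 : eLpNorm (S.comboError ξ η c) 2 P = S.err f g (S.comboChar c) ^ (1 / 2 : ℝ) := by
      rw [← hE', ← eLpNorm_two_sq, ← ENNReal.rpow_natCast, ← ENNReal.rpow_mul]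
      simp
    have h2 : (sqNorm (obsDensity S.n f g) fun x => h x - S.comboChar c x) ^ (1 / 2 : ℝ)
        ≤ ((δ / 2 : NNReal) : ℝ≥0∞) := by
      refine (ENNReal.rpow_le_rpow hc1.le (by norm_num)).trans (le_of_eq ?_)
      rw [← ENNReal.rpow_natCast, ← ENNReal.rpow_mul]
      simp
    rw [h1]
    calc _ ≤ (S.err f g h ^ (1 / 2 : ℝ) + ((δ / 2 : NNReal) : ℝ≥0∞)) + ((δ / 2 : NNReal) : ℝ≥0∞) :=
          add_le_add ((sqrt_err_le_add hf hg hY.2.1 (S.aestronglyMeasurable_comboChar c)).trans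
            (add_le_add_right h2 _)) hc2'.le
      _ = _ := by
          rw [add_assoc, ← ENNReal.coe_add, add_halves]
  calc _ ≤ (S.err f g h ^ (1 / 2 : ℝ)) ^ 2 := by gcongr
    _ = _ := by
      rw [← ENNReal.rpow_natCast, ← ENNReal.rpow_mul]
      simp

theorem mse_eq_err (hf : IsSpectralDensity f) (hg : IsSpectralDensity g) (hh : S.InObs f g h) :
    S.mse f g h = S.err f g h :=
  le_antisymm (mse_le_err hf hg) (err_le_mse hf hg hh)

end Problem

/-! ### Characteristics as elements of a Hilbert space. -/

section Embedding

variable {T : ℕ} (Qf Qg : Density T)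

/-- The pair `pairVec` as a vector function with the Euclidean norm. -/
def emb (r s : ℝ → Fin T → ℂ) (x : ℝ) : EuclideanSpace ℂ (Fin T ⊕ Fin T) :=
  WithLp.toLp 2 (pairVec Qf Qg r s x)

variable {Qf Qg} {f g : Density T}

theorem enorm_emb_sq {r s : ℝ → Fin T → ℂ} {x : ℝ} (hf : f x = Qf x * (Qf x)ᴴ)
    (hg : g x = Qg x * (Qg x)ᴴ) :
    ‖emb Qf Qg r s x‖ₑ ^ 2 = ENNReal.ofReal (qf (f x) (r x) + qf (g x) (s x)) := by
  rw [← sum_enorm_pairVec hf hg, ← ofReal_norm, ← ENNReal.ofReal_pow (norm_nonneg _),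
    EuclideanSpace.norm_sq_eq, ENNReal.ofReal_sum_of_nonneg fun _ _ => by positivity]
  simp only [ENNReal.ofReal_pow (norm_nonneg _), ofReal_norm]
  rfl

theorem aestronglyMeasurable_emb {r s : ℝ → Fin T → ℂ} (hf : IsFactor f Qf)
    (hg : IsFactor g Qg) (hr : ∀ p, AEStronglyMeasurable (fun x => r x p) freq)
    (hs : ∀ p, AEStronglyMeasurable (fun x => s x p) freq) :
    AEStronglyMeasurable (emb Qf Qg r s) freq := by
  refine (PiLp.continuous_toLp 2 _).comp_aestronglyMeasurable ?_
  exact (aemeasurable_pi_iff.2 fun m =>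
    (aestronglyMeasurable_pairVec hf hg hr hs m).aemeasurable).aestronglyMeasurable

theorem lintegral_emb (hf : IsFactor f Qf) (hg : IsFactor g Qg) (r s : ℝ → Fin T → ℂ) :
    ∫⁻ x, ‖emb Qf Qg r s x‖ₑ ^ 2 ∂freq
      = ∫⁻ x, ENNReal.ofReal (qf (f x) (r x) + qf (g x) (s x)) ∂freq := by
  refine lintegral_congr_ae ?_
  filter_upwards [hf.eq, hg.eq] with x h1 h2 using enorm_emb_sq h1 h2

theorem memLp_emb {r s : ℝ → Fin T → ℂ} (hf : IsFactor f Qf)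
    (hg : IsFactor g Qg) (hr : ∀ p, AEStronglyMeasurable (fun x => r x p) freq)
    (hs : ∀ p, AEStronglyMeasurable (fun x => s x p) freq)
    (hfin : ∫⁻ x, ENNReal.ofReal (qf (f x) (r x) + qf (g x) (s x)) ∂freq < ∞) :
    MemLp (emb Qf Qg r s) 2 freq := by
  refine ⟨aestronglyMeasurable_emb hf hg hr hs, ?_⟩
  rw [← lintegral_emb hf hg, ← eLpNorm_two_sq] at hfin
  by_contra h
  rw [not_lt, top_le_iff] at h
  simp [h] at hfin

theorem emb_sub (r s r' s' : ℝ → Fin T → ℂ) (x : ℝ) :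
    emb Qf Qg r s x - emb Qf Qg r' s' x
      = emb Qf Qg (fun x => r x - r' x) (fun x => s x - s' x) x := by
  rw [emb, emb, emb, ← WithLp.toLp_sub]
  congr 1
  funext m
  cases m <;> simp [pairVec, sub_vecMul]

theorem lintegral_bounded_lt_top (hf : IsSpectralDensity f) (hg : IsSpectralDensity g)
    {r s : ℝ → Fin T → ℂ} (hr : ∀ p, AEStronglyMeasurable (fun x => r x p) freq) {C D : ℝ}
    (hC : ∀ x p, ‖r x p‖ ≤ C) (hD : ∀ x ∈ Set.Ioc (-Real.pi) Real.pi, ∀ p, ‖s x p‖ ≤ D) :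
    ∫⁻ x, ENNReal.ofReal (qf (f x) (r x) + qf (g x) (s x)) ∂freq < ∞ := by
  refine lt_of_le_of_lt (lintegral_mono fun x => ENNReal.ofReal_add_le) ?_
  rw [lintegral_add_left'
    (aestronglyMeasurable_qf (fun i j => (hf.integrable i j).1) hr).aemeasurable.ennreal_ofReal]
  refine ENNReal.add_lt_top.2 ⟨lintegral_qf_lt_top hf hC, ?_⟩
  -- `s` is bounded only on the frequency interval (in the application it contains `(ix)^n`), so it
  -- is cut off outside before the global bound applies.
  have h1 : ∫⁻ x, ENNReal.ofReal (qf (g x) (s x)) ∂freq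
      = ∫⁻ x, ENNReal.ofReal (qf (g x)
        ((Set.Ioc (-Real.pi) Real.pi).indicator s x)) ∂freq := by
    refine setLIntegral_congr_fun measurableSet_Ioc fun x hx => ?_
    simp only [Set.indicator_of_mem hx]
  rw [h1]
  refine lintegral_qf_lt_top hg (C := max D 0) fun x p => ?_
  by_cases hx : x ∈ Set.Ioc (-Real.pi) Real.pi
  · rw [Set.indicator_of_mem hx]
    exact (hD x hx p).trans (le_max_left _ _)
  · rw [Set.indicator_of_notMem hx, Pi.zero_apply, norm_zero]
    exact le_max_right _ _

namespace Problem

variable (S : Problem T) (Qf Qg)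

/-- The `L₂` representative of a spectral characteristic. -/
def embChar (h : ℝ → Fin T → ℂ) : ℝ → EuclideanSpace ℂ (Fin T ⊕ Fin T) :=
  emb Qf Qg h fun x => (Complex.I * x) ^ S.n • h x

/-- The `L₂` representative of the functional of the unobserved increments. -/
def embTarget : ℝ → EuclideanSpace ℂ (Fin T ⊕ Fin T) :=
  emb Qf Qg (S.resF 0) (S.resG 0)

theorem embChar_eq_sum (h : ℝ → Fin T → ℂ) (x : ℝ) :
    S.embChar Qf Qg h x = ∑ p, h x p • S.embChar Qf Qg (fun _ => Pi.single p 1) x := by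
  ext m
  simp only [embChar, emb, WithLp.ofLp_sum, WithLp.ofLp_smul, Finset.sum_apply, Pi.smul_apply,
    smul_eq_mul]
  cases m with
  | inl m => simp [pairVec, vecMul, dotProduct]
  | inr m =>
    simp [pairVec, vecMul, dotProduct, Pi.single_apply]
    exact Finset.sum_congr rfl fun i _ => by ring

theorem embChar_sub (h h' : ℝ → Fin T → ℂ) (x : ℝ) :
    S.embChar Qf Qg h x - S.embChar Qf Qg h' x = S.embChar Qf Qg (fun x => h x - h' x) x := by
  rw [embChar, embChar, embChar, emb_sub]
  simp only [smul_sub]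

theorem embTarget_sub (h : ℝ → Fin T → ℂ) (x : ℝ) :
    S.embTarget Qf Qg x - S.embChar Qf Qg h x = emb Qf Qg (S.resF h) (S.resG h) x := by
  rw [embTarget, embChar, emb_sub]
  congr 1
  · funext x
    simp [resF]
  · funext x
    simp only [resG, resF, Pi.zero_apply, sub_zero, smul_sub]
    abel

variable {Qf Qg S}

theorem lintegral_embChar (hQf : IsFactor f Qf) (hQg : IsFactor g Qg) (h : ℝ → Fin T → ℂ) :
    ∫⁻ x, ‖S.embChar Qf Qg h x‖ₑ ^ 2 ∂freq = sqNorm (obsDensity S.n f g) h := by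
  rw [sqNorm_obsDensity, embChar, lintegral_emb hQf hQg]

theorem err_eq_lintegral_emb (hQf : IsFactor f Qf) (hQg : IsFactor g Qg) (h : ℝ → Fin T → ℂ) :
    S.err f g h = ENNReal.ofReal (1 / (2 * Real.pi)) *
      ∫⁻ x, ‖S.embTarget Qf Qg x - S.embChar Qf Qg h x‖ₑ ^ 2 ∂freq := by
  simp only [embTarget_sub]
  rw [lintegral_emb hQf hQg]
  rfl

theorem memLp_embChar (hQf : IsFactor f Qf) (hQg : IsFactor g Qg) {h : ℝ → Fin T → ℂ}
    (hh : AEStronglyMeasurable h freq) (hfin : sqNorm (obsDensity S.n f g) h < ∞) :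
    MemLp (S.embChar Qf Qg h) 2 freq := by
  rw [sqNorm_obsDensity] at hfin
  refine memLp_emb hQf hQg (aestronglyMeasurable_components hh) (fun p => ?_) hfin
  exact (measurable_ix_pow S.n).aestronglyMeasurable.fun_mul (aestronglyMeasurable_components hh p)

theorem norm_ix_pow_le (n : ℕ) {x : ℝ} (hx : x ∈ Set.Ioc (-Real.pi) Real.pi) :
    ‖(Complex.I * x) ^ n‖ ≤ Real.pi ^ n := by
  rw [norm_pow]
  refine pow_le_pow_left₀ (norm_nonneg _) ?_ n
  simpa [abs_le] using ⟨hx.1.le, hx.2⟩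

theorem sqNorm_lt_top_of_bounded (hf : IsSpectralDensity f) (hg : IsSpectralDensity g)
    {h : ℝ → Fin T → ℂ} (hh : AEStronglyMeasurable h freq) {C : ℝ} (hC : ∀ x p, ‖h x p‖ ≤ C) :
    sqNorm (obsDensity S.n f g) h < ∞ := by
  rw [sqNorm_obsDensity]
  refine lintegral_bounded_lt_top (D := Real.pi ^ S.n * C) hf hg
    (aestronglyMeasurable_components hh) hC fun x hx p => ?_
  rw [Pi.smul_apply, smul_eq_mul, norm_mul]
  exact mul_le_mul (norm_ix_pow_le S.n hx) (hC x p) (norm_nonneg _) (by positivity)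

theorem norm_kern_smul_polyB_le (x : ℝ) (p : Fin T) :
    ‖(S.kern x • S.polyB x) p‖ ≤ (S.μ : ℝ) ^ S.n * ∑ k ∈ Finset.range (S.N + 1), ‖S.b k p‖ := by
  rw [Pi.smul_apply, smul_eq_mul, norm_mul]
  refine mul_le_mul (S.norm_kern_le x) ?_ (norm_nonneg _) (by positivity)
  rw [polyB, Finset.sum_apply]
  refine (norm_sum_le _ _).trans (Finset.sum_le_sum fun k _ => ?_)
  simp [norm_ee]

theorem norm_polyA_le (x : ℝ) (p : Fin T) :
    ‖S.polyA x p‖ ≤ ∑ k ∈ Finset.range (S.N + 1), ‖S.a k p‖ := by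
  rw [polyA, Finset.sum_apply]
  refine (norm_sum_le _ _).trans (Finset.sum_le_sum fun k _ => ?_)
  simp [norm_ee]

theorem memLp_embTarget (hf : IsSpectralDensity f) (hg : IsSpectralDensity g)
    (hQf : IsFactor f Qf) (hQg : IsFactor g Qg) : MemLp (S.embTarget Qf Qg) 2 freq := by
  refine memLp_emb hQf hQg (S.aestronglyMeasurable_resF fun p => aestronglyMeasurable_const)
    (S.aestronglyMeasurable_resG fun p => aestronglyMeasurable_const) ?_
  set C := ∑ p : Fin T, (S.μ : ℝ) ^ S.n * ∑ k ∈ Finset.range (S.N + 1), ‖S.b k p‖ with hC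
  set D := ∑ p : Fin T, ∑ k ∈ Finset.range (S.N + 1), ‖S.a k p‖ with hD
  have h1 : ∀ x p, ‖S.resF 0 x p‖ ≤ C := by
    intro x p
    simp only [resF, Pi.zero_apply, sub_zero]
    refine (norm_kern_smul_polyB_le x p).trans ?_
    exact Finset.single_le_sum (f := fun p => (S.μ : ℝ) ^ S.n *
      ∑ k ∈ Finset.range (S.N + 1), ‖S.b k p‖) (fun _ _ => by positivity) (Finset.mem_univ p)
  refine lintegral_bounded_lt_top (D := Real.pi ^ S.n * C + D) hf hg
    (S.aestronglyMeasurable_resF fun p => aestronglyMeasurable_const) h1 fun x hx p => ?_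
  rw [resG, Pi.sub_apply, Pi.smul_apply, smul_eq_mul]
  refine (norm_sub_le _ _).trans (add_le_add ?_ ?_)
  · rw [norm_mul]
    exact mul_le_mul (norm_ix_pow_le S.n hx) (h1 x p) (norm_nonneg _) (by positivity)
  · exact (norm_polyA_le x p).trans (Finset.single_le_sum
      (f := fun p => ∑ k ∈ Finset.range (S.N + 1), ‖S.a k p‖)
      (fun _ _ => by positivity) (Finset.mem_univ p))

theorem norm_harmonic_le (k : ℤ) (p : Fin T) (x : ℝ) (q : Fin T) :
    ‖((ee k x * S.kern x) • (Pi.single p 1 : Fin T → ℂ)) q‖ ≤ (S.μ : ℝ) ^ S.n := by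
  refine norm_smul_single_le ?_ p q
  rw [norm_mul, norm_ee, one_mul]
  exact S.norm_kern_le x

theorem aestronglyMeasurable_harmonic (k : ℤ) (p : Fin T) :
    AEStronglyMeasurable (fun x => (ee k x * S.kern x) • (Pi.single p 1 : Fin T → ℂ)) freq :=
  ((continuous_ee k).aestronglyMeasurable.fun_mul
    S.measurable_kern.aestronglyMeasurable).smul_const _

theorem memLp_harmonic (hf : IsSpectralDensity f) (hg : IsSpectralDensity g)
    (hQf : IsFactor f Qf) (hQg : IsFactor g Qg) (kp : ℤ × Fin T) :
    MemLp (S.embChar Qf Qg fun x => (ee kp.1 x * S.kern x) • Pi.single kp.2 1) 2 freq :=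
  memLp_embChar hQf hQg (aestronglyMeasurable_harmonic kp.1 kp.2)
    (sqNorm_lt_top_of_bounded hf hg (aestronglyMeasurable_harmonic kp.1 kp.2)
      fun x q => norm_harmonic_le kp.1 kp.2 x q)

theorem comboChar_eq_sum (c : ℤ × Fin T →₀ ℂ) (x : ℝ) :
    S.comboChar c x
      = ∑ kp ∈ c.support, c kp • ((ee kp.1 x * S.kern x) • (Pi.single kp.2 1 : Fin T → ℂ)) := by
  rw [comboChar, Finsupp.sum]
  refine Finset.sum_congr rfl fun kp _ => ?_
  ext p
  rcases eq_or_ne p kp.2 with rfl | h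
  · simp
  · simp [h]

theorem embChar_comboChar (c : ℤ × Fin T →₀ ℂ) (x : ℝ) :
    S.embChar Qf Qg (S.comboChar c) x = ∑ kp ∈ c.support,
      c kp • S.embChar Qf Qg (fun x => (ee kp.1 x * S.kern x) • Pi.single kp.2 1) x := by
  have h1 : ∀ kp : ℤ × Fin T,
      S.embChar Qf Qg (fun x => (ee kp.1 x * S.kern x) • Pi.single kp.2 1) x
      = ∑ p, ((ee kp.1 x * S.kern x) • (Pi.single kp.2 1 : Fin T → ℂ)) p •
        S.embChar Qf Qg (fun _ => Pi.single p 1) x := fun kp => S.embChar_eq_sum _ _ _ _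
  rw [embChar_eq_sum]
  simp only [h1, Finset.smul_sum]
  rw [Finset.sum_comm]
  refine Finset.sum_congr rfl fun p _ => ?_
  rw [comboChar_eq_sum, Finset.sum_apply, Finset.sum_smul]
  refine Finset.sum_congr rfl fun kp _ => ?_
  rw [Pi.smul_apply, smul_assoc]

theorem memLp_comboChar (hf : IsSpectralDensity f) (hg : IsSpectralDensity g)
    (hQf : IsFactor f Qf) (hQg : IsFactor g Qg) (c : ℤ × Fin T →₀ ℂ) :
    MemLp (S.embChar Qf Qg (S.comboChar c)) 2 freq := by
  have : S.embChar Qf Qg (S.comboChar c) = fun x => ∑ kp ∈ c.support,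
      c kp • S.embChar Qf Qg (fun x => (ee kp.1 x * S.kern x) • Pi.single kp.2 1) x :=
    funext fun x => embChar_comboChar c x
  rw [this]
  exact memLp_finsetSum _ fun kp _ => (memLp_harmonic (S := S) hf hg hQf hQg kp).const_smul (c kp)

theorem InObs.memLp (hf : IsSpectralDensity f) (hg : IsSpectralDensity g)
    (hQf : IsFactor f Qf) (hQg : IsFactor g Qg) {h : ℝ → Fin T → ℂ} (hh : S.InObs f g h) :
    MemLp (S.embChar Qf Qg h) 2 freq := by
  obtain ⟨c, hc, hlt⟩ := hh.2 1 one_pos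
  have h1 := memLp_embChar hQf hQg (hh.1.fun_sub (S.aestronglyMeasurable_comboChar c))
    (hlt.trans ENNReal.one_lt_top)
  convert h1.add (memLp_comboChar hf hg hQf hQg c) using 1
  funext x
  rw [Pi.add_apply, ← embChar_sub, sub_add_cancel]

/-- The harmonics of the increments as elements of the Hilbert space. -/
def harmonic (hf : IsSpectralDensity f) (hg : IsSpectralDensity g)
    (hQf : IsFactor f Qf) (hQg : IsFactor g Qg) (kp : ℤ × Fin T) :
    Lp (EuclideanSpace ℂ (Fin T ⊕ Fin T)) 2 freq :=
  (memLp_harmonic (S := S) hf hg hQf hQg kp).toLp _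

theorem toLp_comboChar (hf : IsSpectralDensity f) (hg : IsSpectralDensity g)
    (hQf : IsFactor f Qf) (hQg : IsFactor g Qg) (c : ℤ × Fin T →₀ ℂ) :
    (memLp_comboChar (S := S) hf hg hQf hQg c).toLp _
      = Finsupp.linearCombination ℂ (harmonic (S := S) hf hg hQf hQg) c := by
  rw [Finsupp.linearCombination_apply, Finsupp.sum]
  have h1 : ∀ kp ∈ c.support, c kp • harmonic (S := S) hf hg hQf hQg kp
      = ((memLp_harmonic (S := S) hf hg hQf hQg kp).const_smul (c kp)).toLp _ := fun kp _ =>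
    (MemLp.toLp_const_smul _ _).symm
  rw [Finset.sum_congr rfl h1]
  refine Lp.ext ?_
  refine (MemLp.coeFn_toLp _).trans ?_
  refine Filter.EventuallyEq.trans ?_ (Lp.coeFn_finsetSum _ _).symm
  have h2 : ∀ᵐ x ∂freq, ∀ kp ∈ c.support,
      (((memLp_harmonic (S := S) hf hg hQf hQg kp).const_smul (c kp)).toLp _ :
        ℝ → EuclideanSpace ℂ (Fin T ⊕ Fin T)) x
      = c kp • S.embChar Qf Qg (fun x => (ee kp.1 x * S.kern x) • Pi.single kp.2 1) x := by
    rw [Filter.eventually_all_finset]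
    intro kp _
    exact MemLp.coeFn_toLp _
  filter_upwards [h2] with x hx
  rw [embChar_comboChar, Finset.sum_apply]
  exact Finset.sum_congr rfl fun kp hkp => (hx kp hkp).symm

/-- The closed subspace of the observed harmonics. -/
def obsSpace (hf : IsSpectralDensity f) (hg : IsSpectralDensity g)
    (hQf : IsFactor f Qf) (hQg : IsFactor g Qg) :
    Submodule ℂ (Lp (EuclideanSpace ℂ (Fin T ⊕ Fin T)) 2 freq) :=
  Submodule.span ℂ (harmonic (S := S) hf hg hQf hQg '' {kp | kp.1 ∈ S.obsTimes})

theorem mem_obsSpace_iff (hf : IsSpectralDensity f) (hg : IsSpectralDensity g)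
    (hQf : IsFactor f Qf) (hQg : IsFactor g Qg)
    {y : Lp (EuclideanSpace ℂ (Fin T ⊕ Fin T)) 2 freq} :
    y ∈ obsSpace (S := S) hf hg hQf hQg ↔ ∃ c, S.IsObserved c ∧
      (memLp_comboChar (S := S) hf hg hQf hQg c).toLp _ = y := by
  rw [obsSpace, Finsupp.mem_span_image_iff_linearCombination]
  constructor
  · rintro ⟨c, hc, h⟩
    exact ⟨c, hc, (toLp_comboChar hf hg hQf hQg c).trans h⟩
  · rintro ⟨c, hc, h⟩
    exact ⟨c, hc, (toLp_comboChar hf hg hQf hQg c).symm.trans h⟩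

theorem enorm_toLp_sub_sq {E : Type*} [NormedAddCommGroup E] {u v : ℝ → E} (hu : MemLp u 2 freq)
    (hv : MemLp v 2 freq) :
    ‖hu.toLp u - hv.toLp v‖ₑ ^ 2 = ∫⁻ x, ‖u x - v x‖ₑ ^ 2 ∂freq := by
  rw [← MemLp.toLp_sub, Lp.enorm_toLp, eLpNorm_two_sq]
  rfl

/-- `sqNorm` of a difference is the squared distance of the embedded functions, so admissibility is
membership in a closed subspace; this makes orthogonality arguments available. -/
theorem inObs_iff (hf : IsSpectralDensity f) (hg : IsSpectralDensity g)
    (hQf : IsFactor f Qf) (hQg : IsFactor g Qg) {h : ℝ → Fin T → ℂ}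
    (hh : AEStronglyMeasurable h freq) (hL : MemLp (S.embChar Qf Qg h) 2 freq) :
    S.InObs f g h ↔ hL.toLp _ ∈ (obsSpace (S := S) hf hg hQf hQg).topologicalClosure := by
  have key : ∀ c, sqNorm (obsDensity S.n f g) (fun x => h x - S.comboChar c x)
      = ‖hL.toLp _ - (memLp_comboChar (S := S) hf hg hQf hQg c).toLp _‖ₑ ^ 2 := by
    intro c
    rw [enorm_toLp_sub_sq, ← lintegral_embChar hQf hQg]
    simp only [embChar_sub]
  rw [← SetLike.mem_coe, Submodule.topologicalClosure_coe, EMetric.mem_closure_iff, InObs]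
  simp only [hh, true_and, SetLike.mem_coe, mem_obsSpace_iff, key]
  constructor
  · intro h1 ε hε
    obtain ⟨c, hc, hlt⟩ := h1 (ε ^ 2) (ENNReal.pow_pos hε 2)
    refine ⟨_, ⟨c, hc, rfl⟩, ?_⟩
    rw [edist_eq_enorm_sub]
    exact lt_of_not_ge fun hle => absurd hlt (pow_le_pow_left' hle 2).not_gt
  · intro h1 ε hε
    -- Below one, the square of a distance is at most the distance.
    obtain ⟨_, ⟨c, hc, rfl⟩, hlt⟩ := h1 (min ε 1) (lt_min hε one_pos)
    refine ⟨c, hc, ?_⟩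
    rw [edist_eq_enorm_sub] at hlt
    rw [sq]
    exact lt_of_le_of_lt (mul_le_of_le_one_left' (hlt.le.trans (min_le_right _ _)))
      (hlt.trans_le (min_le_left _ _))

end Problem

end Embedding

/-! ### Admissibility and optimality through orthogonality. -/

namespace Problem

variable {T : ℕ} {S : Problem T} {f g : Density T}

theorem inner_emb {Qf Qg : Density T} {r s r' s' : ℝ → Fin T → ℂ} {x : ℝ}
    (hf : f x = Qf x * (Qf x)ᴴ) (hg : g x = Qg x * (Qg x)ᴴ) :
    inner ℂ (emb Qf Qg r' s' x) (emb Qf Qg r s x)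
      = r x ⬝ᵥ (f x *ᵥ star (r' x)) + s x ⬝ᵥ (g x *ᵥ star (s' x)) := by
  rw [← sum_pairVec_mul_conj hf hg, PiLp.inner_apply]
  rfl

/-- The image of a multiple of a coordinate vector. -/
theorem embChar_smul_single (Qf Qg : Density T) (z : ℝ → ℂ) (p : Fin T) (x : ℝ) :
    S.embChar Qf Qg (fun x => z x • Pi.single p 1) x
      = z x • S.embChar Qf Qg (fun _ => Pi.single p 1) x := by
  rw [embChar_eq_sum, embChar_eq_sum, Finset.smul_sum]
  refine Finset.sum_congr rfl fun q _ => ?_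
  rw [smul_smul, Pi.smul_apply, smul_eq_mul]

/-- The Pythagorean theorem for the extended norm. -/
theorem _root_.RobustInterpolation.enorm_sub_sq_of_inner_eq_zero {E : Type*}
    [NormedAddCommGroup E] [InnerProductSpace ℂ E] {t a b : E} (h : inner ℂ (t - a) (b - a) = 0) :
    ‖t - b‖ₑ ^ 2 = ‖t - a‖ₑ ^ 2 + ‖b - a‖ₑ ^ 2 := by
  have h1 : ‖t - b‖ ^ 2 = ‖t - a‖ ^ 2 + ‖b - a‖ ^ 2 := by
    have e : t - b = (t - a) - (b - a) := by abel
    rw [e, @norm_sub_sq ℂ, h]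
    simp
  simp only [← ofReal_norm, ← ENNReal.ofReal_pow (norm_nonneg _)]
  rw [← ENNReal.ofReal_add (by positivity) (by positivity), h1]

/-- A characteristic with the Fourier coefficients of the observed times is admissible. -/
theorem inObs_of_fourier (hf : IsSpectralDensity f) (hg : IsSpectralDensity g)
    {h u : ℝ → Fin T → ℂ} (hh : AEStronglyMeasurable h freq)
    (hfin : sqNorm (obsDensity S.n f g) h < ∞) (hhu : ∀ᵐ x ∂freq, h x = S.kern x • u x)
    (hu : ∀ p, Integrable (fun x => u x p) freq)
    (h0 : ∀ p, ∀ j : ℕ, j < S.N + S.μ * S.n + 1 → ∫ x, ee (-j) x * u x p ∂freq = 0) :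
    S.InObs f g h := by
  obtain ⟨Qf, hQf⟩ := hf.exists_isFactor
  obtain ⟨Qg, hQg⟩ := hg.exists_isFactor
  have hL := memLp_embChar hQf hQg hh hfin
  -- The closure is the double orthogonal complement, so it suffices to test with `Φ` orthogonal to
  -- the observed harmonics.
  rw [inObs_iff hf hg hQf hQg hh hL, ← Submodule.orthogonal_orthogonal_eq_closure,
    Submodule.mem_orthogonal]
  intro Φ hΦ
  -- The inner product of `Φ` with `e^{ikx} κ δ_p` is `e^{ikx} ψ p`. So the coefficients of `ψ p`
  -- vanish at observed times and those of `u p` in the gap: complementary sets, as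
  -- `integral_mul_eq_zero_of_fourier` requires.
  let ψ : Fin T → ℝ → ℂ := fun p x =>
    inner ℂ (Φ x) (S.embChar Qf Qg (fun x => (ee 0 x * S.kern x) • Pi.single p 1) x)
  have hgen : ∀ (k : ℤ) p x,
      inner ℂ (Φ x) (S.embChar Qf Qg (fun x => (ee k x * S.kern x) • Pi.single p 1) x)
        = ee k x * ψ p x := by
    intro k p x
    have e : S.embChar Qf Qg (fun x => (ee k x * S.kern x) • Pi.single p 1) x
        = ee k x • S.embChar Qf Qg (fun x => (ee 0 x * S.kern x) • Pi.single p 1) x := by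
      rw [embChar_smul_single, embChar_smul_single, smul_smul, ee_zero, one_mul]
    rw [e, inner_smul_right]
  have hint : ∀ p, Integrable (ψ p) freq := by
    intro p
    have h1 := L2.integrable_inner (𝕜 := ℂ) Φ (harmonic (S := S) hf hg hQf hQg (0, p))
    refine h1.congr ?_
    filter_upwards [MemLp.coeFn_toLp (memLp_harmonic (S := S) hf hg hQf hQg (0, p))] with x hx
    rw [harmonic, hx]
  have horth : ∀ p, ∀ k : ℤ, k < 0 ∨ ((S.N + S.μ * S.n + 1 : ℕ) : ℤ) ≤ k →
      ∫ x, ee k x * ψ p x ∂freq = 0 := by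
    intro p k hk
    have hmem : harmonic (S := S) hf hg hQf hQg (k, p) ∈ obsSpace (S := S) hf hg hQf hQg := by
      refine Submodule.subset_span ⟨(k, p), ?_, rfl⟩
      rcases hk with hk | hk
      · exact Or.inl (by simp only; omega)
      · refine Or.inr ?_
        push_cast at hk
        exact hk
    have h1 := (Submodule.mem_orthogonal' _ _).1 hΦ _ hmem
    rw [L2.inner_def] at h1
    rw [← h1]
    refine integral_congr_ae ?_
    filter_upwards [MemLp.coeFn_toLp (memLp_harmonic (S := S) hf hg hQf hQg (k, p))] with x hx
    rw [harmonic, hx, hgen]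
  have key := fun p => integral_mul_eq_zero_of_fourier (hu p) (hint p) (h0 p) (horth p)
  rw [L2.inner_def]
  have e : ∀ᵐ x ∂freq, ∑ p, u x p * ψ p x = inner ℂ (Φ x) (hL.toLp _ x) := by
    filter_upwards [MemLp.coeFn_toLp hL, hhu] with x hx hx2
    rw [hx, embChar_eq_sum, inner_sum]
    refine Finset.sum_congr rfl fun p _ => ?_
    rw [inner_smul_right, hx2, Pi.smul_apply, smul_eq_mul]
    simp only [ψ]
    rw [embChar_smul_single, inner_smul_right, ee_zero, one_mul, embChar_eq_sum,
      Finset.sum_eq_single p]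
    · rw [Pi.single_eq_same, one_smul]
      ring
    · intro q _ hq
      rw [Pi.single_eq_of_ne hq, zero_smul]
    · simp
  rw [← integral_congr_ae e, integral_finsetSum _ fun p _ => (key p).1]
  exact Finset.sum_eq_zero fun p _ => (key p).2

/-- The Pythagorean theorem for a characteristic whose error is orthogonal to the observed
harmonics. -/
theorem err_eq_add_of_orthogonal (hf : IsSpectralDensity f) (hg : IsSpectralDensity g)
    {h₀ h : ℝ → Fin T → ℂ} (hh₀ : S.InObs f g h₀)
    (horth : ∀ p, ∀ k ∈ S.obsTimes, ∫ x, ee (-k) x * (conj (S.kern x) *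
      (S.resF h₀ x ᵥ* f x + (-(Complex.I * x)) ^ S.n • (S.resG h₀ x ᵥ* g x)) p) ∂freq = 0)
    (hh : S.InObs f g h) :
    S.err f g h = S.err f g h₀ + ENNReal.ofReal (1 / (2 * Real.pi)) *
      sqNorm (obsDensity S.n f g) fun x => h x - h₀ x := by
  obtain ⟨Qf, hQf⟩ := hf.exists_isFactor
  obtain ⟨Qg, hQg⟩ := hg.exists_isFactor
  have hL₀ := hh₀.memLp hf hg hQf hQg
  have hL := hh.memLp hf hg hQf hQg
  have hT := memLp_embTarget (S := S) hf hg hQf hQg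
  set K := obsSpace (S := S) hf hg hQf hQg with hK
  -- The hypothesis `horth` is the inner product of the error with a single harmonic. It extends to
  -- the span by linearity, and to the closure further below.
  have hperp : hT.toLp _ - hL₀.toLp _ ∈ Kᗮ := by
    rw [hK, obsSpace, Submodule.mem_orthogonal]
    intro v hv
    induction hv using Submodule.span_induction with
    | mem v hv =>
      obtain ⟨⟨k, p⟩, hk, rfl⟩ := hv
      rw [L2.inner_def, ← horth p k hk]
      refine integral_congr_ae ?_
      filter_upwards [MemLp.coeFn_toLp (memLp_harmonic (S := S) hf hg hQf hQg (k, p)),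
        MemLp.coeFn_toLp hT, MemLp.coeFn_toLp hL₀, Lp.coeFn_sub (hT.toLp _) (hL₀.toLp _),
        hQf.eq, hQg.eq] with x h1 h2 h3 h4 h5 h6
      rw [harmonic, h1, h4, Pi.sub_apply, h2, h3, embTarget_sub, embChar, inner_emb h5 h6]
      have e1 : ∀ (z : ℂ) (A : Matrix (Fin T) (Fin T) ℂ) (r : Fin T → ℂ),
          r ⬝ᵥ (A *ᵥ star (z • (Pi.single p 1 : Fin T → ℂ))) = conj z * (r ᵥ* A) p := by
        intro z A r
        have : star (z • (Pi.single p 1 : Fin T → ℂ)) = conj z • Pi.single p 1 := by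
          ext i
          rcases eq_or_ne i p with rfl | h <;> simp [*]
        rw [this, mulVec_smul, dotProduct_smul, smul_eq_mul, dotProduct_mulVec]
        simp
      rw [e1, smul_smul, e1]
      simp only [map_mul, map_pow, conj_ee, Complex.conj_I, Complex.conj_ofReal, Pi.add_apply,
        Pi.smul_apply, smul_eq_mul, neg_mul]
      ring
    | zero => simp
    | add a b _ _ ha hb => rw [inner_add_left, ha, hb, add_zero]
    | smul c a _ ha => rw [inner_smul_left, ha, mul_zero]
  have hmem : hL.toLp _ - hL₀.toLp _ ∈ K.topologicalClosure :=
    Submodule.sub_mem _ ((inObs_iff hf hg hQf hQg hh.1 hL).1 hh)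
      ((inObs_iff hf hg hQf hQg hh₀.1 hL₀).1 hh₀)
  have hin : inner ℂ (hT.toLp _ - hL₀.toLp _) (hL.toLp _ - hL₀.toLp _) = 0 := by
    rw [← Submodule.orthogonal_closure] at hperp
    exact (Submodule.mem_orthogonal' _ _).1 hperp _ hmem
  have hpyth' := enorm_sub_sq_of_inner_eq_zero hin
  rw [enorm_toLp_sub_sq, enorm_toLp_sub_sq, enorm_toLp_sub_sq] at hpyth'
  rw [err_eq_lintegral_emb hQf hQg, err_eq_lintegral_emb hQf hQg, ← lintegral_embChar hQf hQg,
    hpyth', mul_add]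
  simp only [embChar_sub]

end Problem

/-! ### The explicit characteristic and its Fourier coefficients. -/

theorem aestronglyMeasurable_det {ι : Type*} [Fintype ι] [DecidableEq ι] {A : ℝ → Matrix ι ι ℂ}
    (hA : ∀ i j, AEStronglyMeasurable (fun x => A x i j) freq) :
    AEStronglyMeasurable (fun x => (A x).det) freq := by
  simp only [det_apply']
  exact Finset.aestronglyMeasurable_fun_sum _ fun σ _ => aestronglyMeasurable_const.fun_mul
    (Finset.aestronglyMeasurable_fun_prod _ fun i _ => hA _ _)

theorem aestronglyMeasurable_inv_apply {ι : Type*} [Fintype ι] [DecidableEq ι]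
    {A : ℝ → Matrix ι ι ℂ} (hA : ∀ i j, AEStronglyMeasurable (fun x => A x i j) freq) (i j : ι) :
    AEStronglyMeasurable (fun x => (A x)⁻¹ i j) freq := by
  simp only [inv_def, Ring.inverse_eq_inv', Matrix.smul_apply, smul_eq_mul, adjugate_apply]
  refine (aestronglyMeasurable_det hA).aemeasurable.inv.aestronglyMeasurable.fun_mul
    (aestronglyMeasurable_det fun k l => ?_)
  simp only [updateRow_apply]
  split_ifs
  · exact aestronglyMeasurable_const
  · exact hA k l

theorem aestronglyMeasurable_mul_apply {ι : Type*} [Fintype ι] {A B : ℝ → Matrix ι ι ℂ}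
    (hA : ∀ i j, AEStronglyMeasurable (fun x => A x i j) freq)
    (hB : ∀ i j, AEStronglyMeasurable (fun x => B x i j) freq) (i j : ι) :
    AEStronglyMeasurable (fun x => (A x * B x) i j) freq := by
  simp only [mul_apply]
  exact Finset.aestronglyMeasurable_fun_sum _ fun k _ => (hA i k).fun_mul (hB k j)

theorem aestronglyMeasurable_vecMul_apply {ι : Type*} [Fintype ι] {A : ℝ → Matrix ι ι ℂ}
    {h : ℝ → ι → ℂ} (hh : ∀ i, AEStronglyMeasurable (fun x => h x i) freq)
    (hA : ∀ i j, AEStronglyMeasurable (fun x => A x i j) freq) (j : ι) :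
    AEStronglyMeasurable (fun x => (h x ᵥ* A x) j) freq := by
  simp only [vecMul, dotProduct]
  exact Finset.aestronglyMeasurable_fun_sum _ fun k _ => (hh k).fun_mul (hA k j)

theorem aestronglyMeasurable_obsDensity {T : ℕ} {f g : Density T} (n : ℕ)
    (hf : IsSpectralDensity f) (hg : IsSpectralDensity g) (i j : Fin T) :
    AEStronglyMeasurable (fun x => obsDensity n f g x i j) freq := by
  simp only [obsDensity, Matrix.add_apply, Matrix.smul_apply, smul_eq_mul]
  have h : Measurable fun x : ℝ => (x : ℂ) ^ (2 * n) := by fun_prop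
  exact (hf.integrable i j).1.fun_add (h.aestronglyMeasurable.fun_mul (hg.integrable i j).1)

theorem posSemidef_pow_smul {T : ℕ} {A : Matrix (Fin T) (Fin T) ℂ} (hA : A.PosSemidef) (n : ℕ)
    (x : ℝ) : (((x : ℂ) ^ (2 * n)) • A).PosSemidef := by
  refine hA.smul ?_
  have : ((x : ℂ) ^ (2 * n)) = (((x ^ n) ^ 2 : ℝ) : ℂ) := by
    push_cast
    rw [← pow_mul, mul_comm]
  rw [this]
  exact Complex.zero_le_real.2 (sq_nonneg _)

theorem posSemidef_obsDensity {T : ℕ} {f g : Density T} {x : ℝ} (n : ℕ)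
    (hf : (f x).PosSemidef) (hg : (g x).PosSemidef) : (obsDensity n f g x).PosSemidef :=
  hf.add (posSemidef_pow_smul hg n x)

namespace Problem

variable {T : ℕ} {S : Problem T} {f g : Density T}

theorem sqNorm_sub_lt_top (hf : IsSpectralDensity f) (hg : IsSpectralDensity g)
    {h h' : ℝ → Fin T → ℂ} (hh : AEStronglyMeasurable h freq) (hh' : AEStronglyMeasurable h' freq)
    (h1 : sqNorm (obsDensity S.n f g) h < ∞) (h2 : sqNorm (obsDensity S.n f g) h' < ∞) :
    sqNorm (obsDensity S.n f g) (fun x => h x - h' x) < ∞ := by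
  obtain ⟨Qf, hQf⟩ := hf.exists_isFactor
  obtain ⟨Qg, hQg⟩ := hg.exists_isFactor
  have h3 := (memLp_embChar hQf hQg hh h1).sub (memLp_embChar hQf hQg hh' h2)
  rw [← lintegral_embChar hQf hQg, ← eLpNorm_two_sq]
  have e : S.embChar Qf Qg (fun x => h x - h' x) = S.embChar Qf Qg h - S.embChar Qf Qg h' := by
    funext x
    rw [Pi.sub_apply, embChar_sub]
  rw [e]
  exact ENNReal.pow_lt_top h3.2

theorem Minimality.ae_posDef (hf : IsSpectralDensity f) (hg : IsSpectralDensity g)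
    (hm : S.Minimality f g) : ∀ᵐ x ∂freq, (obsDensity S.n f g x).PosDef := by
  filter_upwards [hf.posSemidef, hg.posSemidef, hm.1] with x h1 h2 h3
  exact (posSemidef_obsDensity S.n h1 h2).posDef_iff_isUnit.2
    ((Matrix.isUnit_iff_isUnit_det _).2 h3)

theorem Minimality.integrable_trace (hm : S.Minimality f g) :
    Integrable (fun x => S.invWeight x * (obsDensity S.n f g x)⁻¹.trace.re) freq := by
  refine hm.2.re.congr (Filter.Eventually.of_forall fun x => ?_)
  simp

theorem Minimality.integrable_entry (hf : IsSpectralDensity f) (hg : IsSpectralDensity g)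
    (hm : S.Minimality f g) (i j : Fin T) :
    Integrable (fun x => (S.invWeight x : ℂ) * (obsDensity S.n f g x)⁻¹ i j) freq := by
  refine hm.integrable_trace.mono' ?_ ?_
  · exact (Complex.measurable_ofReal.comp S.measurable_invWeight).aestronglyMeasurable.fun_mul
      (aestronglyMeasurable_inv_apply (aestronglyMeasurable_obsDensity S.n hf hg) i j)
  · filter_upwards [hm.ae_posDef hf hg] with x hx
    rw [norm_mul, Complex.norm_real, Real.norm_of_nonneg (S.invWeight_nonneg x)]
    exact mul_le_mul_of_nonneg_left (norm_entry_le_re_trace hx.inv.posSemidef i j)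
      (S.invWeight_nonneg x)

theorem ofReal_invWeight (x : ℝ) :
    (S.invWeight x : ℂ) = (x : ℂ) ^ (2 * S.n) / (S.fac x * conj (S.fac x)) := by
  rw [Complex.mul_conj', norm_fac, invWeight]
  push_cast
  rw [← pow_mul, mul_comm S.n]

theorem Generic.kern_mul_invWeight {x : ℝ} (hx : S.Generic x) :
    S.kern x * S.invWeight x = (-(Complex.I * x)) ^ S.n / S.fac x := by
  rw [ofReal_invWeight, kern_eq, ← ix_pow_mul]
  field_simp [hx.ix_ne, hx.fac_ne, hx.conj_fac_ne]

/-- The square of the modulus is at most the product of the form of `g` at `A` and `w⁻¹ tr p⁻¹`, by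
`qf_vecMul_mul_inv_le` and `sq_norm_le_qf_mul`. Hence the modulus is at most the sum of the two
factors: the first is integrable because `A` is bounded, the second by minimality. -/
theorem integrable_noise_part (hf : IsSpectralDensity f) (hg : IsSpectralDensity g)
    (hm : S.Minimality f g) (i : Fin T) :
    Integrable (fun x => (S.invWeight x : ℂ) * S.fac x *
      (S.polyA x ᵥ* (g x * (obsDensity S.n f g x)⁻¹)) i) freq := by
  have hA : ∀ i, AEStronglyMeasurable (fun x => S.polyA x i) freq := fun i =>
    ((continuous_apply i).comp S.continuous_polyA).aestronglyMeasurable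
  have h1 : Integrable (fun x => qf (g x) (S.polyA x)) freq := by
    refine ⟨aestronglyMeasurable_qf (fun i j => (hg.integrable i j).1) hA, ?_⟩
    rw [hasFiniteIntegral_iff_ofReal]
    · refine lintegral_qf_lt_top (C := ∑ p, ∑ k ∈ Finset.range (S.N + 1), ‖S.a k p‖) hg
        fun x p => (norm_polyA_le x p).trans ?_
      exact Finset.single_le_sum (f := fun p => ∑ k ∈ Finset.range (S.N + 1), ‖S.a k p‖)
        (fun _ _ => by positivity) (Finset.mem_univ p)
    · filter_upwards [hg.posSemidef] with x hx using qf_nonneg hx _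
  refine (h1.add hm.integrable_trace).mono' ?_ ?_
  · refine ((Complex.measurable_ofReal.comp S.measurable_invWeight).aestronglyMeasurable.fun_mul
      S.continuous_fac.aestronglyMeasurable).fun_mul ?_
    exact aestronglyMeasurable_vecMul_apply hA (aestronglyMeasurable_mul_apply
      (fun i j => (hg.integrable i j).1)
      (aestronglyMeasurable_inv_apply (aestronglyMeasurable_obsDensity S.n hf hg))) i
  · filter_upwards [hm.ae_posDef hf hg, hf.posSemidef, hg.posSemidef, S.ae_generic]
      with x hp hF hG hx
    set q := S.polyA x ᵥ* (g x * (obsDensity S.n f g x)⁻¹) with hq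
    have hx2 : (0 : ℝ) < x ^ (2 * S.n) := by
      rw [pow_mul]
      exact pow_pos (pow_pos (abs_pos.2 hx.1) 2 |>.trans_eq (sq_abs x)) _
    have hr : ((x : ℂ) ^ (2 * S.n)) = ((x ^ (2 * S.n) : ℝ) : ℂ) := by push_cast; rfl
    have e1 : (((x ^ (2 * S.n) : ℝ) : ℂ) • q)
        = S.polyA x ᵥ* ((((x : ℂ) ^ (2 * S.n)) • g x) * (obsDensity S.n f g x)⁻¹) := by
      rw [Matrix.smul_mul, vecMul_smul, hr]
    have h2 := qf_vecMul_mul_inv_le hF (posSemidef_pow_smul hG S.n x) hp (S.polyA x)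
    have h3 := sq_norm_le_qf_mul hp (((x ^ (2 * S.n) : ℝ) : ℂ) • q) i
    rw [← obsDensity, ← e1, hr, qf_smul] at h2
    have ht := re_trace_nonneg hp.inv.posSemidef
    have h4 := h3.trans (mul_le_mul_of_nonneg_right h2 ht)
    rw [Pi.smul_apply, smul_eq_mul, norm_mul, Complex.norm_real, Real.norm_of_nonneg hx2.le,
      mul_pow, sq, mul_assoc, mul_assoc] at h4
    have h5 : x ^ (2 * S.n) * ‖q i‖ ^ 2
        ≤ qf (g x) (S.polyA x) * (obsDensity S.n f g x)⁻¹.trace.re :=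
      le_of_mul_le_mul_left h4 hx2
    have hw := S.invWeight_nonneg x
    have h6 : ‖(S.invWeight x : ℂ) * S.fac x * q i‖ ^ 2
        = S.invWeight x * (x ^ (2 * S.n) * ‖q i‖ ^ 2) := by
      rw [norm_mul, norm_mul, Complex.norm_real, Real.norm_of_nonneg hw, mul_pow, mul_pow,
        norm_fac, ← pow_mul, mul_comm S.n]
      have : S.invWeight x * ‖1 - ee S.μ x‖ ^ (2 * S.n) = x ^ (2 * S.n) :=
        div_mul_cancel₀ _ (pow_ne_zero _ (norm_ne_zero_iff.2 hx.2))
      rw [← this]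
      ring
    have h7 := mul_le_mul_of_nonneg_left h5 hw
    have h8 := qf_nonneg hG (S.polyA x)
    rw [Pi.add_apply]
    refine abs_le_of_sq_le_sq' ?_ (add_nonneg h8 (mul_nonneg hw ht)) |>.2
    rw [h6]
    nlinarith [mul_nonneg hw ht, sq_nonneg (qf (g x) (S.polyA x)),
      sq_nonneg (S.invWeight x * (obsDensity S.n f g x)⁻¹.trace.re),
      mul_nonneg h8 (mul_nonneg hw ht)]

/-- The vector `|x|^{2n} |1 - e^{ixμ}|^{-2n} q p⁻¹`, for `q = rowF` and `p = f + x^{2n} g`. -/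
def rowY (S : Problem T) (f g : Density T) (x : ℝ) : Fin T → ℂ :=
  (S.invWeight x : ℂ) • (S.rowF f g x ᵥ* (obsDensity S.n f g x)⁻¹)

theorem polyC_eq (f g : Density T) (x : ℝ) (p : Fin T) : S.polyC f g x p
    = ∑ k : Fin (S.N + S.μ * S.n + 1), S.vecC f g (k, p) * ee (k : ℕ) x :=
  Finset.sum_congr rfl fun _ _ => mul_comm _ _

theorem continuous_polyC (f g : Density T) : Continuous (S.polyC f g) := by
  unfold polyC
  exact continuous_pi fun p => continuous_finsetSum _ fun k _ => (continuous_ee _).mul_const _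

theorem norm_polyC_le (f g : Density T) (x : ℝ) (p : Fin T) :
    ‖S.polyC f g x p‖ ≤ ∑ k : Fin (S.N + S.μ * S.n + 1), ‖S.vecC f g (k, p)‖ := by
  rw [polyC_eq]
  refine (norm_sum_le _ _).trans (Finset.sum_le_sum fun k _ => ?_)
  rw [norm_mul, norm_ee, mul_one]

theorem rowY_apply (f g : Density T) (x : ℝ) (p : Fin T) :
    S.rowY f g x p = (S.invWeight x : ℂ) * S.fac x *
      (S.polyA x ᵥ* (g x * (obsDensity S.n f g x)⁻¹)) p
      + ∑ q, S.polyC f g x q * ((S.invWeight x : ℂ) * (obsDensity S.n f g x)⁻¹ q p) := by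
  rw [rowY, rowF, add_vecMul, smul_vecMul, vecMul_vecMul, Pi.smul_apply, Pi.add_apply,
    Pi.smul_apply, smul_eq_mul, smul_eq_mul, mul_add, mul_assoc]
  congr 1
  rw [vecMul, dotProduct, Finset.mul_sum]
  exact Finset.sum_congr rfl fun q _ => by ring

theorem integrable_rowY (hf : IsSpectralDensity f) (hg : IsSpectralDensity g)
    (hm : S.Minimality f g) (p : Fin T) : Integrable (fun x => S.rowY f g x p) freq := by
  simp only [rowY_apply]
  refine (integrable_noise_part hf hg hm p).fun_add (integrable_finsetSum _ fun q _ => ?_)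
  refine (hm.integrable_entry hf hg q p).bdd_mul
    ((continuous_apply q).comp (continuous_polyC f g)).aestronglyMeasurable
    (Filter.Eventually.of_forall fun x => norm_polyC_le f g x q)

/-- The noise part of `rowY` gives `vecTa`; expanding `C` in exponentials turns the rest into `matP`
applied to the coefficients. So the system for `C` prescribes the coefficients of `rowY` in the gap.
-/
theorem mean_rowY (hf : IsSpectralDensity f) (hg : IsSpectralDensity g) (hm : S.Minimality f g)
    (j : Fin (S.N + S.μ * S.n + 1)) (p : Fin T) :
    mean (fun x => ee (-(j : ℕ)) x * S.rowY f g x p)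
      = (S.vecTa f g + S.matP f g *ᵥ S.vecC f g) (j, p) := by
  have e : ∀ x, ee (-(j : ℕ)) x * S.rowY f g x p
      = ee (-(j : ℕ)) x * ((S.invWeight x : ℂ) * S.fac x *
      (S.polyA x ᵥ* (g x * (obsDensity S.n f g x)⁻¹)) p)
      + ∑ k : S.Idx, S.vecC f g k * (ee ((k.1 : ℤ) - j) x *
        ((S.invWeight x : ℂ) * (obsDensity S.n f g x)⁻¹ k.2 p)) := by
    intro x
    rw [rowY_apply, mul_add, Fintype.sum_prod_type_right, Finset.mul_sum]
    congr 1
    refine Finset.sum_congr rfl fun q _ => ?_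
    rw [polyC, Finset.sum_mul, Finset.mul_sum]
    refine Finset.sum_congr rfl fun k _ => ?_
    rw [sub_eq_add_neg, ee_add]
    ring
  have hi : ∀ k : S.Idx, Integrable (fun x => ee ((k.1 : ℤ) - j) x *
      ((S.invWeight x : ℂ) * (obsDensity S.n f g x)⁻¹ k.2 p)) freq := fun k =>
    integrable_ee_mul (hm.integrable_entry hf hg k.2 p) _
  simp only [mean, e]
  rw [integral_add (integrable_ee_mul (integrable_noise_part hf hg hm p) _)
    (integrable_finsetSum _ fun k _ => (hi k).const_mul _),
    integral_finsetSum _ fun k _ => (hi k).const_mul _, mul_add, Pi.add_apply]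
  congr 1
  · simp only [vecTa, mean, mul_assoc]
  · simp only [integral_const_mul, mulVec, dotProduct, Finset.mul_sum, matP, mean, mul_assoc]
    exact Finset.sum_congr rfl fun k _ => by ring

end Problem

theorem qf_pos {ι : Type*} [Fintype ι] {A : Matrix ι ι ℂ} (hA : A.PosDef) {h : ι → ℂ}
    (hh : h ≠ 0) : 0 < qf A h := by
  have h1 := hA.dotProduct_mulVec_pos (x := star h) (by simpa using hh)
  rw [star_star] at h1
  exact (Complex.lt_def.1 h1).1

namespace Problem

variable {T : ℕ} {S : Problem T} {f g : Density T}

/-- If `z` is in the kernel, the Hermitian form of `matP` at `z` vanishes. That form is the mean of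
`w⁻¹ Zᵀ p⁻¹ conj Z` for the trigonometric polynomial `Z` with coefficients `z`; as `p⁻¹` is positive
definite, `Z = 0` almost everywhere, so `z = 0`. -/
theorem det_matP_ne_zero (hf : IsSpectralDensity f) (hg : IsSpectralDensity g)
    (hm : S.Minimality f g) : (S.matP f g).det ≠ 0 := by
  rw [Ne, ← exists_mulVec_eq_zero_iff]
  rintro ⟨z, hz, h0⟩
  let Z : ℝ → Fin T → ℂ := fun x p => ∑ k : Fin (S.N + S.μ * S.n + 1), ee (k : ℕ) x * z (k, p)
  have e : ∀ x, (S.invWeight x : ℂ) * (Z x ⬝ᵥ ((obsDensity S.n f g x)⁻¹ *ᵥ star (Z x)))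
      = ∑ j : S.Idx, ∑ k : S.Idx, (conj (z j) * z k) * (ee ((k.1 : ℤ) - j.1) x *
        ((S.invWeight x : ℂ) * (obsDensity S.n f g x)⁻¹ k.2 j.2)) := by
    intro x
    have hZ : ∀ p q, Z x q * conj (Z x p) = ∑ j : Fin (S.N + S.μ * S.n + 1),
        ∑ k : Fin (S.N + S.μ * S.n + 1),
          (conj (z (j, p)) * z (k, q)) * ee ((k : ℤ) - (j : ℕ)) x := by
      intro p q
      simp only [Z, map_sum, map_mul, conj_ee]
      rw [mul_comm, Finset.sum_mul_sum]
      refine Finset.sum_congr rfl fun j _ => Finset.sum_congr rfl fun k _ => ?_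
      rw [sub_eq_add_neg, ee_add]
      ring
    simp only [Fintype.sum_prod_type_right, dotProduct, mulVec, Pi.star_apply, RCLike.star_def,
      Finset.mul_sum]
    rw [Finset.sum_comm]
    refine Finset.sum_congr rfl fun p _ => ?_
    rw [Finset.sum_comm (γ := Fin (S.N + S.μ * S.n + 1))]
    refine Finset.sum_congr rfl fun q _ => ?_
    calc _ = (S.invWeight x * (obsDensity S.n f g x)⁻¹ q p) * (Z x q * conj (Z x p)) := by ring
      _ = _ := by
        rw [hZ, Finset.mul_sum]
        refine Finset.sum_congr rfl fun j _ => ?_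
        rw [Finset.mul_sum]
        exact Finset.sum_congr rfl fun k _ => by ring
  have hi : ∀ j k : S.Idx, Integrable (fun x => ee ((k.1 : ℤ) - j.1) x *
      ((S.invWeight x : ℂ) * (obsDensity S.n f g x)⁻¹ k.2 j.2)) freq := fun j k =>
    integrable_ee_mul (hm.integrable_entry hf hg k.2 j.2) _
  have hint : Integrable (fun x => (S.invWeight x : ℂ) *
      (Z x ⬝ᵥ ((obsDensity S.n f g x)⁻¹ *ᵥ star (Z x)))) freq := by
    simp only [e]
    exact integrable_finsetSum _ fun j _ => integrable_finsetSum _ fun k _ =>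
      (hi j k).const_mul _
  have h1 : ∫ x, (S.invWeight x : ℂ) *
      (Z x ⬝ᵥ ((obsDensity S.n f g x)⁻¹ *ᵥ star (Z x))) ∂freq = 0 := by
    simp only [e]
    rw [integral_finsetSum _ fun j _ => integrable_finsetSum _ fun k _ => (hi j k).const_mul _]
    refine Finset.sum_eq_zero fun j _ => ?_
    rw [integral_finsetSum _ fun k _ => (hi j k).const_mul _]
    have h2 := congrFun h0 j
    rw [mulVec, dotProduct, Pi.zero_apply] at h2
    simp only [matP, mean] at h2
    have hpi : (1 / (2 * Real.pi) : ℂ) ≠ 0 := by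
      simp [Real.pi_ne_zero]
    simp only [integral_const_mul, mul_assoc] at h2 ⊢
    rw [← Finset.mul_sum]
    refine mul_eq_zero_of_right _ ((mul_eq_zero_iff_left hpi).1 ?_)
    rw [← h2, Finset.mul_sum]
    exact Finset.sum_congr rfl fun k _ => by ring
  have h2 : ∫ x, S.invWeight x * qf (obsDensity S.n f g x)⁻¹ (Z x) ∂freq = 0 := by
    have := congrArg Complex.re h1
    rw [← Complex.reCLM_apply, ← ContinuousLinearMap.integral_comp_comm _ hint] at this
    simpa [qf] using this
  have hint2 : Integrable (fun x => S.invWeight x * qf (obsDensity S.n f g x)⁻¹ (Z x)) freq := by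
    simpa [qf] using hint.re
  have h3 := (integral_eq_zero_iff_of_nonneg_ae (by
    filter_upwards [hm.ae_posDef hf hg] with x hx
    exact mul_nonneg (S.invWeight_nonneg x) (qf_nonneg hx.inv.posSemidef _)) hint2).1 h2
  have h4 : ∀ᵐ x ∂freq, Z x = 0 := by
    filter_upwards [h3, hm.ae_posDef hf hg, S.ae_generic] with x hx hp hgen
    by_contra hne
    have := qf_pos hp.inv hne
    have hw : 0 < S.invWeight x := by
      rw [invWeight_eq]
      exact inv_pos.2 hgen.weight_pos
    exact (mul_pos hw this).ne' hx
  refine hz (funext fun kp => ?_)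
  have h5 : (fun k => z (k, kp.2)) = 0 := eq_zero_of_trig_sum_ae_eq_zero <| by
    filter_upwards [h4] with x hx using congrFun hx kp.2
  exact congrFun h5 kp.1

theorem integrable_polyB (p : Fin T) : Integrable (fun x => S.polyB x p) freq := by
  simp only [polyB, Finset.sum_apply, Pi.smul_apply, smul_eq_mul]
  exact integrable_finsetSum _ fun k _ => (integrable_ee _).mul_const _

theorem integral_ee_mul_polyB (j : ℕ) (p : Fin T) :
    ∫ x, ee (-j) x * S.polyB x p ∂freq = 2 * Real.pi * S.b j p := by
  have e : ∀ x, ee (-j) x * S.polyB x p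
      = ∑ k ∈ Finset.range (S.N + 1), S.b k p * ee ((k : ℤ) - j) x := by
    intro x
    rw [polyB, Finset.sum_apply, Finset.mul_sum]
    refine Finset.sum_congr rfl fun k _ => ?_
    rw [sub_eq_add_neg, ee_add, Pi.smul_apply, smul_eq_mul]
    ring
  simp only [e]
  rw [integral_finsetSum _ fun k _ => (integrable_ee _).const_mul _]
  simp only [integral_const_mul, integral_ee, sub_eq_zero, Nat.cast_inj, mul_ite, mul_zero]
  rw [Finset.sum_ite_eq' ]
  split_ifs with h
  · ring
  · rw [S.b_eq_zero (by simpa using h), mul_zero]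

/-- The difference of `B` and `rowY` has no harmonics with the indices of the gap. -/
theorem integral_ee_mul_polyB_sub_rowY (hf : IsSpectralDensity f) (hg : IsSpectralDensity g)
    (hm : S.Minimality f g) (p : Fin T) {j : ℕ} (hj : j < S.N + S.μ * S.n + 1) :
    ∫ x, ee (-j) x * (S.polyB x - S.rowY f g x) p ∂freq = 0 := by
  have h1 := mean_rowY hf hg hm ⟨j, hj⟩ p
  have h2 : S.vecTa f g + S.matP f g *ᵥ S.vecC f g = S.vecDa := by
    rw [vecC, mulVec_mulVec, Matrix.mul_nonsing_inv _ (det_matP_ne_zero hf hg hm).isUnit,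
      one_mulVec]
    abel
  have h3 : S.vecDa (⟨j, hj⟩, p) = S.b j p := by
    rw [vecDa]
    simp only
    split_ifs with h
    · rfl
    · rw [S.b_eq_zero (by omega)]
  rw [h2, h3, mean] at h1
  simp only [Pi.sub_apply, mul_sub]
  rw [integral_sub (integrable_ee_mul (integrable_polyB p) _)
    (integrable_ee_mul (integrable_rowY hf hg hm p) _), integral_ee_mul_polyB, ← h1]
  have := Complex.ofReal_ne_zero.2 Real.pi_ne_zero
  field_simp
  ring

/-- Since `κ w⁻¹ = (-ix)^n / (1 - e^{ixμ})^n`, the kernel factors out of all three terms. This is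
the form needed in `inObs_of_fourier`, as the bracket has no harmonics in the gap. -/
theorem specChar_eq {x : ℝ} (hx : S.Generic x) :
    S.specChar f g x = S.kern x • (S.polyB x - S.rowY f g x) := by
  rw [specChar, smul_sub, rowY, rowF, smul_smul, hx.kern_mul_invWeight, add_vecMul, smul_vecMul,
    vecMul_vecMul, smul_add, smul_smul, div_mul_cancel₀ _ hx.fac_ne, sub_sub]

theorem resF_specChar {x : ℝ} (hx : S.Generic x) :
    S.resF (S.specChar f g) x = S.kern x • S.rowY f g x := by
  rw [resF, specChar_eq hx, ← smul_sub, sub_sub_cancel]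

theorem resF_specChar_eq {x : ℝ} (hx : S.Generic x) :
    S.resF (S.specChar f g) x = ((-(Complex.I * x)) ^ S.n / S.fac x) •
      (S.rowF f g x ᵥ* (obsDensity S.n f g x)⁻¹) := by
  rw [resF_specChar hx, rowY, smul_smul, hx.kern_mul_invWeight]

theorem ix_pow_mul' (n : ℕ) (x : ℝ) :
    (Complex.I * x) ^ n * (-(Complex.I * x)) ^ n = (x : ℂ) ^ (2 * n) := by
  rw [mul_comm, ix_pow_mul]

/-- Writing `A = (A p) p⁻¹`, the terms `x^{2n} A g` cancel; this is how `f` takes the place of `g`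
in the row vector. -/
theorem resG_specChar_eq {x : ℝ} (hx : S.Generic x) (hp : IsUnit (obsDensity S.n f g x).det) :
    S.resG (S.specChar f g) x = -(S.fac x)⁻¹ •
      (S.rowG f g x ᵥ* (obsDensity S.n f g x)⁻¹) := by
  have e : S.polyA x = (S.polyA x ᵥ* obsDensity S.n f g x) ᵥ* (obsDensity S.n f g x)⁻¹ := by
    rw [vecMul_vecMul, Matrix.mul_nonsing_inv _ hp, vecMul_one]
  rw [resG, resF_specChar_eq hx, smul_smul, mul_div_assoc', ix_pow_mul']
  conv_lhs => rw [e]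
  rw [← smul_vecMul, ← sub_vecMul, ← smul_vecMul]
  congr 1
  rw [rowF, rowG, obsDensity, vecMul_add, vecMul_smul]
  have h := hx.fac_ne
  ext p
  simp only [Pi.sub_apply, Pi.smul_apply, Pi.add_apply, smul_eq_mul]
  field_simp
  ring

/-- The normal equations: `p` cancels `p⁻¹`, then the noise terms cancel, and only `C` is left. Its
frequencies lie in the gap, so the error is orthogonal to every observed harmonic. -/
theorem resF_vecMul_add {x : ℝ} (hx : S.Generic x) (hp : IsUnit (obsDensity S.n f g x).det) :
    conj (S.kern x) • (S.resF (S.specChar f g) x ᵥ* f x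
      + (-(Complex.I * x)) ^ S.n • (S.resG (S.specChar f g) x ᵥ* g x)) = S.polyC f g x := by
  have h1 : S.resF (S.specChar f g) x ᵥ* f x
      + (-(Complex.I * x)) ^ S.n • (S.resG (S.specChar f g) x ᵥ* g x)
      = S.resF (S.specChar f g) x ᵥ* obsDensity S.n f g x
        - (-(Complex.I * x)) ^ S.n • (S.polyA x ᵥ* g x) := by
    rw [resG, obsDensity, vecMul_add, vecMul_smul, sub_vecMul, smul_vecMul, smul_sub, smul_smul,
      ix_pow_mul]
    abel
  rw [h1, resF_specChar_eq hx, smul_vecMul, vecMul_vecMul, Matrix.nonsing_inv_mul _ hp, vecMul_one,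
    rowF, conj_kern]
  have h := hx.fac_ne
  have h2 : (-(Complex.I * (x : ℂ))) ^ S.n ≠ 0 :=
    pow_ne_zero _ (neg_ne_zero.2 (mul_ne_zero Complex.I_ne_zero (by exact_mod_cast hx.1)))
  ext p
  simp only [Pi.sub_apply, Pi.smul_apply, Pi.add_apply, smul_eq_mul]
  field_simp
  ring

theorem aestronglyMeasurable_specChar (hf : IsSpectralDensity f) (hg : IsSpectralDensity g)
    (hm : S.Minimality f g) : AEStronglyMeasurable (S.specChar f g) freq := by
  have h1 : AEStronglyMeasurable (fun x => S.kern x • (S.polyB x - S.rowY f g x)) freq := by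
    refine (aemeasurable_pi_iff.2 fun p => AEStronglyMeasurable.aemeasurable ?_).aestronglyMeasurable
    simp only [Pi.sub_apply, Pi.smul_apply, smul_eq_mul]
    exact S.measurable_kern.aestronglyMeasurable.fun_mul
      ((((continuous_apply p).comp S.continuous_polyB).aestronglyMeasurable).fun_sub
        (integrable_rowY hf hg hm p).1)
  refine h1.congr ?_
  filter_upwards [S.ae_generic] with x hx using (specChar_eq hx).symm

end Problem

/-! ### Optimality of the explicit characteristic. -/

namespace Problem

variable {T : ℕ} {S : Problem T} {f g : Density T}

/-- The bound `qf_vecMul_mul_inv_le` with `F = f`, `G = x^{2n} g`, divided by `x^{2n}`, leaves the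
form of `g` at the bounded function `A`. -/
theorem sqNorm_noise_part_lt_top (hf : IsSpectralDensity f) (hg : IsSpectralDensity g)
    (hm : S.Minimality f g) : sqNorm (obsDensity S.n f g) (fun x => (-(Complex.I * x)) ^ S.n •
      (S.polyA x ᵥ* (g x * (obsDensity S.n f g x)⁻¹))) < ∞ := by
  refine lt_of_le_of_lt (lintegral_mono_ae (g := fun x => ENNReal.ofReal
    (qf (g x) (S.polyA x))) ?_) ?_
  · filter_upwards [hm.ae_posDef hf hg, hf.posSemidef, hg.posSemidef, S.ae_generic]
      with x hp hF hG hx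
    refine ENNReal.ofReal_le_ofReal ?_
    change qf (obsDensity S.n f g x) _ ≤ _
    have hr : ((x : ℂ) ^ (2 * S.n)) = ((x ^ (2 * S.n) : ℝ) : ℂ) := by push_cast; rfl
    have hx2 : (0 : ℝ) < x ^ (2 * S.n) := by
      rw [pow_mul]
      exact pow_pos (pow_pos (abs_pos.2 hx.1) 2 |>.trans_eq (sq_abs x)) _
    have h2 := qf_vecMul_mul_inv_le hF (posSemidef_pow_smul hG S.n x) hp (S.polyA x)
    rw [← obsDensity, Matrix.smul_mul, vecMul_smul, hr, qf_smul, qf_vec_smul] at h2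
    rw [qf_vec_smul]
    have e1 : ‖(-(Complex.I * (x : ℂ))) ^ S.n‖ ^ 2 = x ^ (2 * S.n) := by
      rw [norm_pow, norm_neg, norm_mul, Complex.norm_I, one_mul, Complex.norm_real,
        ← pow_mul, mul_comm S.n, pow_mul, Real.norm_eq_abs, sq_abs, ← pow_mul]
    rw [e1]
    rw [Complex.norm_real, Real.norm_of_nonneg hx2.le, sq, mul_assoc] at h2
    exact le_of_mul_le_mul_left h2 hx2
  · refine lintegral_qf_lt_top (C := ∑ p, ∑ k ∈ Finset.range (S.N + 1), ‖S.a k p‖) hg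
      fun x p => (norm_polyA_le x p).trans ?_
    exact Finset.single_le_sum (f := fun p => ∑ k ∈ Finset.range (S.N + 1), ‖S.a k p‖)
      (fun _ _ => by positivity) (Finset.mem_univ p)

/-- The integrand is `w⁻¹` times the form of `p⁻¹` at the bounded function `C`, hence at most a
constant times the integrand of the minimality condition. -/
theorem sqNorm_gap_part_lt_top (hf : IsSpectralDensity f) (hg : IsSpectralDensity g)
    (hm : S.Minimality f g) : sqNorm (obsDensity S.n f g) (fun x =>
      ((-(Complex.I * x)) ^ S.n / S.fac x) •
      (S.polyC f g x ᵥ* (obsDensity S.n f g x)⁻¹)) < ∞ := by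
  set K := ∑ p : Fin T, ∑ k : Fin (S.N + S.μ * S.n + 1), ‖S.vecC f g (k, p)‖
  have hK : ∀ x, ∑ p, ‖S.polyC f g x p‖ ≤ K := fun x =>
    Finset.sum_le_sum fun p _ => norm_polyC_le f g x p
  refine lt_of_le_of_lt (lintegral_mono_ae ?_) (hm.integrable_trace.mul_const (K ^ 2)).lintegral_lt_top
  filter_upwards [hm.ae_posDef hf hg, S.ae_generic] with x hp hx
  refine ENNReal.ofReal_le_ofReal ?_
  change qf (obsDensity S.n f g x) _ ≤ _
  rw [← hx.kern_mul_invWeight, qf_vec_smul, qf_vecMul_inv hp, norm_mul, mul_pow, norm_kern_sq,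
    Complex.norm_real, Real.norm_of_nonneg (S.invWeight_nonneg x)]
  have e1 : S.weight x * S.invWeight x ^ 2 = S.invWeight x := by
    rw [invWeight_eq]
    have := hx.weight_pos.ne'
    field_simp
  rw [e1, mul_assoc]
  refine mul_le_mul_of_nonneg_left ?_ (S.invWeight_nonneg x)
  refine (qf_le_re_trace_mul hp.inv.posSemidef _).trans (mul_le_mul_of_nonneg_left ?_
    (re_trace_nonneg hp.inv.posSemidef))
  exact pow_le_pow_left₀ (Finset.sum_nonneg fun _ _ => norm_nonneg _) (hK x) 2

theorem sqNorm_specChar_lt_top (hf : IsSpectralDensity f) (hg : IsSpectralDensity g)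
    (hm : S.Minimality f g) : sqNorm (obsDensity S.n f g) (S.specChar f g) < ∞ := by
  have hA : ∀ i, AEStronglyMeasurable (fun x => S.polyA x i) freq := fun i =>
    ((continuous_apply i).comp S.continuous_polyA).aestronglyMeasurable
  have hinv := aestronglyMeasurable_inv_apply (aestronglyMeasurable_obsDensity S.n hf hg)
  have hpi : ∀ h : ℝ → Fin T → ℂ, (∀ p, AEStronglyMeasurable (fun x => h x p) freq) →
      AEStronglyMeasurable h freq := fun h hh =>
    (aemeasurable_pi_iff.2 fun p => (hh p).aemeasurable).aestronglyMeasurable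
  have m1 : AEStronglyMeasurable (fun x => S.kern x • S.polyB x) freq :=
    S.measurable_kern.aestronglyMeasurable.smul S.continuous_polyB.aestronglyMeasurable
  have hmn : Measurable fun x : ℝ => (-(Complex.I * (x : ℂ))) ^ S.n := by fun_prop
  have m2 : AEStronglyMeasurable (fun x : ℝ => (-(Complex.I * x)) ^ S.n •
      (S.polyA x ᵥ* (g x * (obsDensity S.n f g x)⁻¹))) freq :=
    hmn.aestronglyMeasurable.smul (hpi _ (aestronglyMeasurable_vecMul_apply hA
      (aestronglyMeasurable_mul_apply (fun i j => (hg.integrable i j).1) hinv)))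
  have m3 : AEStronglyMeasurable (fun x : ℝ => ((-(Complex.I * x)) ^ S.n / S.fac x) •
      (S.polyC f g x ᵥ* (obsDensity S.n f g x)⁻¹)) freq :=
    (hmn.div S.continuous_fac.measurable).aestronglyMeasurable.smul
      (hpi _ (aestronglyMeasurable_vecMul_apply
        (fun i => ((continuous_apply i).comp (continuous_polyC f g)).aestronglyMeasurable) hinv))
  have n1 : sqNorm (obsDensity S.n f g) (fun x => S.kern x • S.polyB x) < ∞ := by
    refine sqNorm_lt_top_of_bounded hf hg m1 (C := ∑ p : Fin T, (S.μ : ℝ) ^ S.n *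
      ∑ k ∈ Finset.range (S.N + 1), ‖S.b k p‖) fun x p => (norm_kern_smul_polyB_le x p).trans ?_
    exact Finset.single_le_sum (f := fun p => (S.μ : ℝ) ^ S.n *
      ∑ k ∈ Finset.range (S.N + 1), ‖S.b k p‖) (fun _ _ => by positivity) (Finset.mem_univ p)
  exact sqNorm_sub_lt_top hf hg (m1.sub m2) m3
    (sqNorm_sub_lt_top hf hg m1 m2 n1 (sqNorm_noise_part_lt_top hf hg hm))
    (sqNorm_gap_part_lt_top hf hg hm)

theorem inObs_specChar (hf : IsSpectralDensity f) (hg : IsSpectralDensity g)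
    (hm : S.Minimality f g) : S.InObs f g (S.specChar f g) := by
  refine inObs_of_fourier (u := fun x => S.polyB x - S.rowY f g x) hf hg
    (aestronglyMeasurable_specChar hf hg hm) (sqNorm_specChar_lt_top hf hg hm) ?_
    (fun p => (integrable_polyB p).sub (integrable_rowY hf hg hm p))
    (fun p j hj => integral_ee_mul_polyB_sub_rowY hf hg hm p hj)
  filter_upwards [S.ae_generic] with x hx using specChar_eq hx

/-- The Pythagorean theorem for the explicit characteristic. -/
theorem err_eq_add_specChar (hf : IsSpectralDensity f) (hg : IsSpectralDensity g)
    (hm : S.Minimality f g) {h : ℝ → Fin T → ℂ} (hh : S.InObs f g h) :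
    S.err f g h = S.err f g (S.specChar f g) + ENNReal.ofReal (1 / (2 * Real.pi)) *
      sqNorm (obsDensity S.n f g) fun x => h x - S.specChar f g x := by
  refine err_eq_add_of_orthogonal hf hg (inObs_specChar hf hg hm) (fun p k hk => ?_) hh
  have e : ∀ᵐ x ∂freq, ee (-k) x * (conj (S.kern x) * (S.resF (S.specChar f g) x ᵥ* f x
      + (-(Complex.I * x)) ^ S.n • (S.resG (S.specChar f g) x ᵥ* g x)) p)
      = ∑ j : Fin (S.N + S.μ * S.n + 1), S.vecC f g (j, p) * ee ((j : ℕ) - k) x := by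
    filter_upwards [S.ae_generic, hm.1] with x hx hp
    have := congrFun (resF_vecMul_add hx hp) p
    rw [Pi.smul_apply, smul_eq_mul] at this
    rw [this, polyC_eq, Finset.mul_sum]
    refine Finset.sum_congr rfl fun j _ => ?_
    rw [sub_eq_add_neg, ee_add]
    ring
  rw [integral_congr_ae e, integral_finsetSum _ fun j _ => (integrable_ee _).const_mul _]
  refine Finset.sum_eq_zero fun j _ => ?_
  rw [integral_const_mul, integral_ee, if_neg, mul_zero]
  have hj := j.2
  intro h
  rcases hk with hk | hk
  · omega
  · have : ((S.N + S.μ * S.n + 1 : ℕ) : ℤ) ≤ k := by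
      push_cast
      exact hk
    omega

theorem err_specChar_le (hf : IsSpectralDensity f) (hg : IsSpectralDensity g)
    (hm : S.Minimality f g) {h : ℝ → Fin T → ℂ} (hh : S.InObs f g h) :
    S.err f g (S.specChar f g) ≤ S.err f g h := by
  rw [err_eq_add_specChar hf hg hm hh]
  exact le_self_add

theorem mse_specChar (hf : IsSpectralDensity f) (hg : IsSpectralDensity g)
    (hm : S.Minimality f g) :
    S.mse f g (S.specChar f g) = S.minMse f g := by
  have h0 := inObs_specChar hf hg hm
  refine le_antisymm (le_iInf₂ fun h hh => ?_) (iInf₂_le _ h0)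
  rw [mse_eq_err hf hg h0, mse_eq_err hf hg hh]
  exact err_specChar_le hf hg hm hh

theorem minMse_eq_err (hf : IsSpectralDensity f) (hg : IsSpectralDensity g)
    (hm : S.Minimality f g) : S.minMse f g = S.err f g (S.specChar f g) := by
  rw [← mse_specChar hf hg hm, mse_eq_err hf hg (inObs_specChar hf hg hm)]

theorem err_lt_top (hf : IsSpectralDensity f) (hg : IsSpectralDensity g) {h : ℝ → Fin T → ℂ}
    (hh : S.InObs f g h) : S.err f g h < ∞ := by
  obtain ⟨Qf, hQf⟩ := hf.exists_isFactor
  obtain ⟨Qg, hQg⟩ := hg.exists_isFactor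
  rw [err_eq_lintegral_emb hQf hQg]
  refine ENNReal.mul_lt_top ENNReal.ofReal_lt_top ?_
  have := (memLp_embTarget (S := S) hf hg hQf hQg).sub (hh.memLp hf hg hQf hQg)
  simp only [← Pi.sub_apply (S.embTarget Qf Qg)]
  rw [← eLpNorm_two_sq]
  exact ENNReal.pow_lt_top this.2

end Problem

/-! ### The equations as statements on Gram matrices; saddle points. -/

theorem gram_apply {T : ℕ} (q : Fin T → ℂ) (i j : Fin T) : gram q i j = conj (q i) * q j := rfl

theorem gram_vecMul {T : ℕ} (q : Fin T → ℂ) (A : Matrix (Fin T) (Fin T) ℂ) :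
    gram (q ᵥ* A) = Aᴴ * gram q * A := by
  rw [gram, gram, star_vecMul, mul_vecMulVec, vecMulVec_mul]

theorem gram_smul {T : ℕ} (z : ℂ) (q : Fin T → ℂ) : gram (z • q) = ((‖z‖ ^ 2 : ℝ) : ℂ) • gram q := by
  ext i j
  rw [Matrix.smul_apply, gram_apply, gram_apply, Pi.smul_apply, Pi.smul_apply]
  push_cast
  rw [← Complex.conj_mul']
  simp only [smul_eq_mul, map_mul]
  ring

theorem qf_eq_trace {T : ℕ} (A : Matrix (Fin T) (Fin T) ℂ) (q : Fin T → ℂ) :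
    qf A q = (A * gram q).trace.re := by
  rw [gram, mul_vecMulVec, trace_vecMulVec, qf, dotProduct_comm]

/-- Inverting `p` on both sides isolates the multiplier; applied to `q* q`, this turns the row
vectors of the equations into the residuals. -/
theorem mul_eq_mul_mul_iff {T : ℕ} {p G M : Matrix (Fin T) (Fin T) ℂ} {r : ℂ} (hr : r ≠ 0)
    (hp : IsUnit p.det) :
    G = (r • p) * M * (r • p) ↔ (r ^ 2)⁻¹ • (p⁻¹ * G * p⁻¹) = M := by
  have hr2 : r ^ 2 ≠ 0 := pow_ne_zero 2 hr
  have e : (r • p) * M * (r • p) = r ^ 2 • (p * M * p) := by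
    rw [Matrix.smul_mul, Matrix.smul_mul, Matrix.mul_smul, smul_smul, sq]
  rw [e, inv_smul_eq_iff₀ hr2]
  constructor
  · rintro rfl
    rw [Matrix.mul_smul, Matrix.smul_mul, Matrix.mul_assoc p, Matrix.nonsing_inv_mul_cancel_left _ _ hp,
      Matrix.mul_nonsing_inv_cancel_right _ _ hp]
  · intro h
    have h2 := congrArg (fun A => p * A * p) h
    rw [Matrix.mul_assoc p⁻¹, Matrix.mul_nonsing_inv_cancel_left _ _ hp,
      Matrix.nonsing_inv_mul_cancel_right _ _ hp] at h2
    rw [h2, Matrix.mul_smul, Matrix.smul_mul]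

namespace Problem

variable {T : ℕ} {S : Problem T} {f g : Density T}

theorem gram_resF {x : ℝ} (hx : S.Generic x) :
    gram (S.resF (S.specChar f g) x) = (S.weight x : ℂ) • gram (S.rowY f g x) := by
  rw [resF_specChar hx, gram_smul, norm_kern_sq]

/-- The first equation says that the Gram matrix of `rowY` is the constant multiplier. -/
theorem eqF_iff (hf : IsSpectralDensity f) (hg : IsSpectralDensity g) (hm : S.Minimality f g)
    (M : Matrix (Fin T) (Fin T) ℂ) :
    S.EqF f g M ↔ ∀ᵐ x ∂freq, gram (S.rowY f g x) = M := by
  refine Filter.eventually_congr ?_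
  filter_upwards [hm.ae_posDef hf hg, S.ae_generic] with x hp hx
  have hd := (Matrix.isUnit_iff_isUnit_det _).1 hp.isUnit
  have hw := hx.weight_pos
  rw [sideF, mul_eq_mul_mul_iff (by exact_mod_cast hw.ne') hd, rowY, gram_smul, gram_vecMul,
    hp.inv.isHermitian.eq, Complex.norm_real, Real.norm_of_nonneg (S.invWeight_nonneg x),
    invWeight_eq, inv_pow]
  push_cast
  rfl

/-- The second equation says that the Gram matrix of the residual of the noise is the multiplier. -/
theorem eqG_iff (hf : IsSpectralDensity f) (hg : IsSpectralDensity g) (hm : S.Minimality f g)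
    (R : Density T) :
    S.EqG f g R ↔ ∀ᵐ x ∂freq, gram (S.resG (S.specChar f g) x) = R x := by
  refine Filter.eventually_congr ?_
  filter_upwards [hm.ae_posDef hf hg, S.ae_generic] with x hp hx
  have hd := (Matrix.isUnit_iff_isUnit_det _).1 hp.isUnit
  have hr : ((‖1 - ee S.μ x‖ : ℂ) ^ S.n) ≠ 0 :=
    pow_ne_zero _ (by exact_mod_cast norm_ne_zero_iff.2 hx.2)
  rw [sideG, mul_eq_mul_mul_iff hr hd, resG_specChar_eq hx hd, gram_smul, gram_vecMul,
    hp.inv.isHermitian.eq, norm_neg, norm_inv, norm_fac, inv_pow]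
  push_cast
  rfl

/-- The residuals depend on `(f, g)` only, so the error is linear in the pair `(f', g')` where it is
evaluated, and the two Gram matrices are its coefficients. Maximising it over a class is a linear
problem. -/
theorem errDensity_specChar (f' g' : Density T) {x : ℝ} (hx : S.Generic x) :
    S.errDensity f' g' (S.specChar f g) x
      = S.weight x * (f' x * gram (S.rowY f g x)).trace.re
        + (g' x * gram (S.resG (S.specChar f g) x)).trace.re := by
  rw [errDensity, qf_eq_trace, qf_eq_trace, gram_resF hx, Matrix.mul_smul, trace_smul, smul_eq_mul,
    Complex.re_ofReal_mul]

theorem sqNorm_congr {p : Density T} {h h' : ℝ → Fin T → ℂ} (e : ∀ᵐ x ∂freq, h x = h' x) :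
    sqNorm p h = sqNorm p h' := by
  refine lintegral_congr_ae ?_
  filter_upwards [e] with x hx
  rw [hx]

/-- If `rowY` is bounded, then the explicit characteristic is admissible for all the densities. -/
theorem inObs_specChar_of_bounded (hf : IsSpectralDensity f) (hg : IsSpectralDensity g)
    (hm : S.Minimality f g) {K : ℝ} (hK : ∀ᵐ x ∂freq, ∀ p, ‖S.rowY f g x p‖ ≤ K)
    {f' g' : Density T} (hf' : IsSpectralDensity f') (hg' : IsSpectralDensity g') :
    S.InObs f' g' (S.specChar f g) := by
  classical
  refine inObs_of_fourier (u := fun x => S.polyB x - S.rowY f g x) hf' hg'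
    (aestronglyMeasurable_specChar hf hg hm) ?_ ?_
    (fun p => (integrable_polyB p).sub (integrable_rowY hf hg hm p))
    (fun p j hj => integral_ee_mul_polyB_sub_rowY hf hg hm p hj)
  · let h : ℝ → Fin T → ℂ := fun x => if ∀ p, ‖S.specChar f g x p‖ ≤ (S.μ : ℝ) ^ S.n *
      (∑ p, ∑ k ∈ Finset.range (S.N + 1), ‖S.b k p‖ + K) then S.specChar f g x else 0
    have e : ∀ᵐ x ∂freq, S.specChar f g x = h x := by
      filter_upwards [hK, S.ae_generic] with x hx hgen
      refine (if_pos fun p => ?_).symm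
      rw [specChar_eq hgen, Pi.smul_apply, smul_eq_mul, norm_mul]
      refine mul_le_mul (S.norm_kern_le x) ?_ (norm_nonneg _) (by positivity)
      rw [Pi.sub_apply]
      refine (norm_sub_le _ _).trans (add_le_add ?_ (hx p))
      rw [polyB, Finset.sum_apply]
      refine (norm_sum_le _ _).trans ?_
      refine le_trans (le_of_eq (by simp [norm_ee])) (Finset.single_le_sum
        (f := fun p => ∑ k ∈ Finset.range (S.N + 1), ‖S.b k p‖)
        (fun _ _ => by positivity) (Finset.mem_univ p))
    rw [sqNorm_congr e]
    refine sqNorm_lt_top_of_bounded hf' hg' ((aestronglyMeasurable_specChar hf hg hm).congr e)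
      (C := |(S.μ : ℝ) ^ S.n * (∑ p, ∑ k ∈ Finset.range (S.N + 1), ‖S.b k p‖ + K)|) fun x p => ?_
    simp only [h]
    split_ifs with hc
    · exact (hc p).trans (le_abs_self _)
    · rw [Pi.zero_apply, norm_zero]
      exact abs_nonneg _
  · filter_upwards [S.ae_generic] with x hx using specChar_eq hx

/-- The diagonal entry is `‖q i‖ ^ 2`, and `t ≤ t ^ 2 + 1`. -/
theorem norm_le_of_gram {q : Fin T → ℂ} {K : ℝ} (h : ∀ i, ‖gram q i i‖ ≤ K) (i : Fin T) :
    ‖q i‖ ≤ K + 1 := by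
  have := h i
  rw [gram_apply, norm_mul, RCLike.norm_conj] at this
  nlinarith [norm_nonneg (q i), sq_nonneg (‖q i‖ - 1)]

/-- The saddle point property. -/
theorem saddle {D : Set (Density T × Density T)} (hD : ∀ f g, (f, g) ∈ D →
    IsSpectralDensity f ∧ IsSpectralDensity g) (hm : S.Minimality f g) (hfg : (f, g) ∈ D)
    (h0 : S.specChar f g ∈ S.robustSet D)
    (hle : ∀ f' g', (f', g') ∈ D → S.mse f' g' (S.specChar f g) ≤ S.mse f g (S.specChar f g)) :
    S.LeastFavorable D f g ∧ S.ZeroMemSubdifferential D (S.specChar f g) f g ∧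
      S.IsMinimax D (S.specChar f g) := by
  obtain ⟨hf, hg⟩ := hD f g hfg
  have hopt := mse_specChar hf hg hm
  refine ⟨⟨hfg, fun f' g' h => ?_⟩, fun f' g' => ?_, h0, fun h hh => ?_⟩
  -- The optimal error at `(f', g')` is at most that of the explicit characteristic there, hence at
  -- most its error at `(f, g)`, which is optimal.
  · exact (iInf₂_le _ (h0 f' g' h)).trans ((hle f' g' h).trans hopt.le)
  · rw [extremalFunctional, extremalFunctional, if_pos hfg]
    split_ifs with h
    · exact EReal.neg_le_neg_iff.2 (EReal.coe_ennreal_le_coe_ennreal_iff.2 (hle f' g' h))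
    · exact le_top
  -- A competitor is no better already at the single pair `(f, g)`.
  · refine iSup_le fun f' => iSup_le fun g' => iSup_le fun h' => (hle f' g' h').trans ?_
    refine (hopt.le.trans (iInf₂_le h (hh f g hfg))).trans ?_
    exact le_iSup₂_of_le f g (le_iSup_of_le hfg le_rfl)

theorem le_of_zeroMemSubdifferential {D : Set (Density T × Density T)} {h₀ : ℝ → Fin T → ℂ}
    (hfg : (f, g) ∈ D) (h : S.ZeroMemSubdifferential D h₀ f g) {f' g' : Density T}
    (h' : (f', g') ∈ D) : S.mse f' g' h₀ ≤ S.mse f g h₀ := by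
  have := h f' g'
  rw [extremalFunctional, extremalFunctional, if_pos hfg, if_pos h', EReal.neg_le_neg_iff] at this
  exact EReal.coe_ennreal_le_coe_ennreal_iff.1 this

end Problem

/-! ### Sufficiency of the equations. -/

/-- The method of Lagrange multipliers for `L₁` neighbourhoods, sufficiency. -/
theorem integral_le_of_multipliers {ι : Type*} [Fintype ι] {r r₀ : ℝ → ℝ} {L L₀ θ : ι → ℝ → ℂ}
    {c D : ι → ℝ} (hr : AEStronglyMeasurable r freq)
    (hL : ∀ m, Integrable (L m) freq) (hL₀ : ∀ m, Integrable (L₀ m) freq)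
    (hrL : ∀ᵐ x ∂freq, r x = ∑ m, c m * (θ m x * L m x).re)
    (hrL₀ : ∀ᵐ x ∂freq, r₀ x = ∑ m, c m * (θ m x * L₀ m x).re)
    (hθ : ∀ m, ∀ᵐ x ∂freq, ‖θ m x‖ ≤ 1 ∧ (θ m x * L₀ m x).re = ‖L₀ m x‖)
    (hc : ∀ m, 0 ≤ c m) (hD : ∀ m, meanR (fun x => ‖L m x‖) ≤ D m)
    (hD₀ : ∀ m, c m ≠ 0 → meanR (fun x => ‖L₀ m x‖) = D m) :
    ∫ x, r x ∂freq ≤ ∫ x, r₀ x ∂freq := by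
  have hθ' := ae_all_iff.2 hθ
  have habs : ∀ᵐ x ∂freq, |r x| ≤ ∑ m, c m * ‖L m x‖ := by
    filter_upwards [hrL, hθ'] with x h1 h2
    rw [h1]
    refine (Finset.abs_sum_le_sum_abs _ _).trans (Finset.sum_le_sum fun m _ => ?_)
    rw [abs_mul, abs_of_nonneg (hc m)]
    refine mul_le_mul_of_nonneg_left ((Complex.abs_re_le_norm _).trans ?_) (hc m)
    rw [norm_mul]
    exact mul_le_of_le_one_left (norm_nonneg _) (h2 m).1
  have hint : ∀ m, Integrable (fun x => c m * ‖L m x‖) freq := fun m => (hL m).norm.const_mul _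
  have hint₀ : ∀ m, Integrable (fun x => c m * ‖L₀ m x‖) freq := fun m => (hL₀ m).norm.const_mul _
  have hsum := integrable_finsetSum Finset.univ fun m _ => hint m
  -- `r` is at most `∑ c ‖L‖`, with equality for `r₀` and `L₀`. Where `c m ≠ 0`, complementary
  -- slackness makes `L₀` attain the bound that `L` obeys.
  calc ∫ x, r x ∂freq ≤ ∫ x, ∑ m, c m * ‖L m x‖ ∂freq := by
        refine integral_mono_ae (hsum.mono' hr habs) hsum ?_
        filter_upwards [habs] with x hx using (le_abs_self _).trans hx
    _ = ∑ m, c m * ∫ x, ‖L m x‖ ∂freq := by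
        rw [integral_finsetSum _ fun m _ => hint m]
        simp only [integral_const_mul]
    _ ≤ ∑ m, c m * ∫ x, ‖L₀ m x‖ ∂freq := by
        refine Finset.sum_le_sum fun m _ => ?_
        rcases eq_or_ne (c m) 0 with h | h
        · simp [h]
        refine mul_le_mul_of_nonneg_left ?_ (hc m)
        have h1 := (hD m).trans (hD₀ m h).ge
        have := Real.pi_pos
        rw [meanR, meanR] at h1
        exact le_of_mul_le_mul_left h1 (by positivity)
    _ = ∫ x, r₀ x ∂freq := by
        simp only [← integral_const_mul]
        rw [← integral_finsetSum _ fun m _ => hint₀ m]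
        refine integral_congr_ae ?_
        filter_upwards [hrL₀, hθ'] with x h1 h2
        rw [h1]
        exact Finset.sum_congr rfl fun m _ => by rw [(h2 m).2]

theorem IsSignOf.ae_mul {γ : ℝ → ℝ} {t : ℝ → ℂ} (h : IsSignOf γ t)
    (ht : ∀ᵐ x ∂freq, (t x).im = 0) :
    ∀ᵐ x ∂freq, ‖(γ x : ℂ)‖ ≤ 1 ∧ ((γ x : ℂ) * t x).re = ‖t x‖ := by
  filter_upwards [h, ht] with x h1 h2
  refine ⟨by rw [Complex.norm_real]; exact h1.1, ?_⟩
  have e : t x = ((t x).re : ℂ) := Complex.ext rfl h2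
  rcases eq_or_ne (t x) 0 with h0 | h0
  · simp [h0]
  · rw [h1.2 h0, Complex.re_ofReal_mul]
    conv_rhs => rw [e, Complex.norm_real, Real.norm_eq_abs]
    rcases lt_trichotomy (t x).re 0 with h3 | h3 | h3
    · rw [Real.sign_of_neg h3, abs_of_neg h3, neg_one_mul]
    · simp [h3]
    · rw [Real.sign_of_pos h3, abs_of_pos h3, one_mul]

/-- The conjugate is there because `tr (A R) = ∑ R_ij conj A_ij` for Hermitian `A`. -/
theorem IsPhaseOf.ae_mul {γ t : ℝ → ℂ} (h : IsPhaseOf γ t) :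
    ∀ᵐ x ∂freq, ‖γ x‖ ≤ 1 ∧ (γ x * conj (t x)).re = ‖conj (t x)‖ := by
  filter_upwards [h] with x h1
  refine ⟨h1.1, ?_⟩
  rcases eq_or_ne (t x) 0 with h0 | h0
  · simp [h0]
  · have hn : (‖t x‖ : ℂ) ≠ 0 := by simpa using h0
    rw [h1.2 h0, div_mul_eq_mul_div, Complex.mul_conj', RCLike.norm_conj, sq,
      mul_div_cancel_left₀ _ hn, Complex.ofReal_re]

section Hermitian

variable {T : ℕ} {A B : Matrix (Fin T) (Fin T) ℂ}

theorem im_diag_eq_zero (hA : A.IsHermitian) (i : Fin T) : (A i i).im = 0 :=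
  Complex.conj_eq_iff_im.1 (hA.apply i i)

theorem im_trace_eq_zero (hA : A.IsHermitian) : A.trace.im = 0 := by
  rw [trace, Complex.im_sum]
  exact Finset.sum_eq_zero fun i _ => im_diag_eq_zero hA i

theorem pairing_eq_trace (B A : Matrix (Fin T) (Fin T) ℂ) : pairing B A = (A * Bᵀ).trace := by
  simp only [pairing, trace, diag_apply, mul_apply, transpose_apply]
  exact Finset.sum_congr rfl fun i _ => Finset.sum_congr rfl fun j _ => mul_comm _ _

theorem im_pairing_eq_zero (hB : B.IsHermitian) (hA : A.IsHermitian) : (pairing B A).im = 0 := by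
  refine Complex.conj_eq_iff_im.1 ?_
  rw [pairing, map_sum, Finset.sum_comm]
  simp only [map_sum, map_mul]
  exact Finset.sum_congr rfl fun i _ => Finset.sum_congr rfl fun j _ =>
    congrArg₂ _ (hB.apply j i) (hA.apply j i)

end Hermitian

section Measurability

variable {T : ℕ} {f : Density T}

theorem aestronglyMeasurable_re_trace_mul {A B : Density T}
    (hA : ∀ i j, AEStronglyMeasurable (fun x => A x i j) freq)
    (hB : ∀ i j, AEStronglyMeasurable (fun x => B x i j) freq) :
    AEStronglyMeasurable (fun x => (A x * B x).trace.re) freq := by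
  refine Complex.continuous_re.comp_aestronglyMeasurable ?_
  simp only [trace, diag_apply]
  exact Finset.aestronglyMeasurable_fun_sum _ fun i _ => aestronglyMeasurable_mul_apply hA hB i i

theorem integrable_pairing (hf : ∀ i j, Integrable (fun x => f x i j) freq)
    (B : Matrix (Fin T) (Fin T) ℂ) : Integrable (fun x => pairing B (f x)) freq := by
  simp only [pairing]
  exact integrable_finsetSum _ fun i _ => integrable_finsetSum _ fun j _ => (hf i j).const_mul _

theorem integrable_trace (hf : ∀ i j, Integrable (fun x => f x i j) freq) :
    Integrable (fun x => (f x).trace) freq := by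
  simp only [trace]
  exact integrable_finsetSum _ fun i _ => hf i i

theorem integrable_re_trace_mul (hf : ∀ i j, Integrable (fun x => f x i j) freq) {R : Density T}
    (hR : ∀ i j, AEStronglyMeasurable (fun x => R x i j) freq) {K : ℝ}
    (hK : ∀ᵐ x ∂freq, ∀ i j, ‖R x i j‖ ≤ K) :
    Integrable (fun x => (f x * R x).trace.re) freq := by
  refine Integrable.re (f := fun x => (f x * R x).trace) ?_
  simp only [trace, diag_apply, mul_apply]
  refine integrable_finsetSum _ fun i _ => integrable_finsetSum _ fun j _ =>
    (hf i j).mul_bdd (hR j i) ?_ (c := K)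
  filter_upwards [hK] with x hx using hx j i

theorem IsSpectralDensity.integrable_sub_apply {g : Density T} (hf : IsSpectralDensity f)
    (hg : IsSpectralDensity g) (i j : Fin T) : Integrable (fun x => (f x - g x) i j) freq :=
  (hf.integrable i j).sub (hg.integrable i j)

theorem IsSpectralDensity.ae_isHermitian_sub {g : Density T} (hf : IsSpectralDensity f)
    (hg : IsSpectralDensity g) : ∀ᵐ x ∂freq, (f x - g x).IsHermitian := by
  filter_upwards [hf.posSemidef, hg.posSemidef] with x h1 h2
  exact h1.isHermitian.sub h2.isHermitian

end Measurability

namespace Problem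

variable {T : ℕ} {S : Problem T} {f g : Density T}

theorem integrable_weight_mul {L : ℝ → ℂ} (hL : Integrable L freq) :
    Integrable (fun x => (S.weight x : ℂ) * L x) freq := by
  refine hL.bdd_mul (c := ((S.μ : ℝ) ^ S.n) ^ 2)
    (Complex.measurable_ofReal.comp S.measurable_weight).aestronglyMeasurable
    (Filter.Eventually.of_forall fun x => ?_)
  rw [Complex.norm_real, Real.norm_of_nonneg (S.weight_nonneg x)]
  exact S.weight_le x

/-- The functional `f ↦ ∫ w tr (f M)` is a combination of weighted moments, so it takes equal values
when these moments agree. -/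
theorem integral_weight_trace_congr {ι : Type*} [Fintype ι] {L L₀ : ι → ℝ → ℂ} {c : ι → ℂ}
    {f' : Density T} {M : Matrix (Fin T) (Fin T) ℂ}
    (hL : ∀ m, Integrable (L m) freq) (hL₀ : ∀ m, Integrable (L₀ m) freq)
    (h : ∀ x, (f x * M).trace = ∑ m, c m * L m x)
    (h₀ : ∀ x, (f' x * M).trace = ∑ m, c m * L₀ m x)
    (he : ∀ m, mean (fun x => S.weight x * L m x) = mean fun x => S.weight x * L₀ m x) :
    ∫ x, S.weight x * (f x * M).trace.re ∂freq = ∫ x, S.weight x * (f' x * M).trace.re ∂freq := by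
  have key : ∀ {f : Density T} {L : ι → ℝ → ℂ}, (∀ m, Integrable (L m) freq) →
      (∀ x, (f x * M).trace = ∑ m, c m * L m x) → ∫ x, S.weight x * (f x * M).trace.re ∂freq
        = (∑ m, c m * ∫ x, S.weight x * L m x ∂freq).re := by
    intro f L hL h
    have hi := fun m => (integrable_weight_mul (S := S) (hL m)).const_mul (c m)
    simp only [← integral_const_mul]
    rw [← integral_finsetSum _ fun m _ => hi m, ← Complex.reCLM_apply,
      ← ContinuousLinearMap.integral_comp_comm _ (integrable_finsetSum _ fun m _ => hi m)]
    refine integral_congr_ae (Filter.Eventually.of_forall fun x => ?_)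
    simp only [h, Complex.reCLM_apply]
    rw [← Complex.re_ofReal_mul, Finset.mul_sum]
    exact congrArg _ (Finset.sum_congr rfl fun m _ => by ring)
  rw [key hL h, key hL₀ h₀]
  refine congrArg _ (Finset.sum_congr rfl fun m _ => ?_)
  have h1 := he m
  have hpi : (1 / (2 * Real.pi) : ℂ) ≠ 0 := by simp [Real.pi_ne_zero]
  rw [mean, mean] at h1
  rw [mul_left_cancel₀ hpi h1]

/-- The multipliers of the moment constraints are orthogonal to the admissible variations. -/
theorem MultiplierF.exists_gram_eq {c : ClassData T} {k : Fin 4} (hf : f ∈ S.classF c k)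
    (hg : IsSpectralDensity g) (hm : S.Minimality f g) (h : S.MultiplierF c f g k) :
    ∃ M, (∀ᵐ x ∂freq, gram (S.rowY f g x) = M) ∧ ∀ f' ∈ S.classF c k,
      ∫ x, S.weight x * (f' x * M).trace.re ∂freq = ∫ x, S.weight x * (f x * M).trace.re ∂freq := by
  fin_cases k
  · obtain ⟨α, hα⟩ := h
    refine ⟨_, (eqF_iff hf.1 hg hm _).1 hα, fun f' hf' => ?_⟩
    refine integral_weight_trace_congr (ι := Fin T × Fin T) (L := fun m x => f' x m.1 m.2)
      (L₀ := fun m x => f x m.1 m.2) (c := fun m => vecMulVec α (star α) m.2 m.1)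
      (fun m => hf'.1.integrable _ _) (fun m => hf.1.integrable _ _) (fun x => ?_) (fun x => ?_)
      fun m => (hf'.2 m.1 m.2).trans (hf.2 m.1 m.2).symm
    all_goals
      rw [Fintype.sum_prod_type]
      simp only [trace, diag_apply, mul_apply]
      exact Finset.sum_congr rfl fun i _ => Finset.sum_congr rfl fun j _ => mul_comm _ _
  · obtain ⟨α, hα⟩ := h
    refine ⟨_, (eqF_iff hf.1 hg hm _).1 hα, fun f' hf' => ?_⟩
    refine integral_weight_trace_congr (ι := Unit) (L := fun _ x => (f' x).trace)
      (L₀ := fun _ x => (f x).trace) (c := fun _ => ((α ^ 2 : ℝ) : ℂ))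
      (fun _ => integrable_trace hf'.1.integrable) (fun _ => integrable_trace hf.1.integrable)
      (fun x => ?_) (fun x => ?_) fun m => (show _ = _ from hf'.2).trans (show _ = _ from hf.2).symm
    all_goals simp
  · obtain ⟨α, hα⟩ := h
    refine ⟨_, (eqF_iff hf.1 hg hm _).1 hα, fun f' hf' => ?_⟩
    refine integral_weight_trace_congr (ι := Fin T) (L := fun m x => f' x m m)
      (L₀ := fun m x => f x m m) (c := fun m => ((α m ^ 2 : ℝ) : ℂ))
      (fun m => hf'.1.integrable _ _) (fun m => hf.1.integrable _ _) (fun x => ?_) (fun x => ?_)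
      fun m => (hf'.2 m).trans (hf.2 m).symm
    all_goals
      simp only [trace, diag_apply, mul_diagonal]
      exact Finset.sum_congr rfl fun i _ => mul_comm _ _
  · obtain ⟨α, hα⟩ := h
    refine ⟨_, (eqF_iff hf.1 hg hm _).1 hα, fun f' hf' => ?_⟩
    refine integral_weight_trace_congr (ι := Unit) (L := fun _ x => pairing c.B₁ (f' x))
      (L₀ := fun _ x => pairing c.B₁ (f x)) (c := fun _ => ((α ^ 2 : ℝ) : ℂ))
      (fun _ => integrable_pairing hf'.1.integrable _)
      (fun _ => integrable_pairing hf.1.integrable _)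
      (fun x => ?_) (fun x => ?_) fun m => (show _ = _ from hf'.2).trans (show _ = _ from hf.2).symm
    all_goals simp [pairing_eq_trace]

end Problem

theorem exists_entry_bound {T : ℕ} {R : Density T}
    (h : ∀ i j, ∃ K, ∀ᵐ x ∂freq, ‖R x i j‖ ≤ K) : ∃ K, ∀ᵐ x ∂freq, ∀ i j, ‖R x i j‖ ≤ K := by
  choose K hK using h
  refine ⟨∑ i, ∑ j, |K i j|, ?_⟩
  filter_upwards [ae_all_iff.2 fun i => ae_all_iff.2 fun j => hK i j] with x hx i j
  refine ((hx i j).trans (le_abs_self _)).trans ?_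
  exact (Finset.single_le_sum (f := fun j => |K i j|) (fun _ _ => abs_nonneg _)
    (Finset.mem_univ j)).trans (Finset.single_le_sum (f := fun i => ∑ j, |K i j|)
      (fun _ _ => Finset.sum_nonneg fun _ _ => abs_nonneg _) (Finset.mem_univ i))

theorem norm_ofReal_mul_mul_le {c γ : ℝ} (hγ : |γ| ≤ 1) (hc : 0 ≤ c) (z : ℂ) :
    ‖((c * γ : ℝ) : ℂ) * z‖ ≤ c * ‖z‖ := by
  rw [norm_mul, Complex.norm_real, Real.norm_eq_abs, abs_mul, abs_of_nonneg hc]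
  exact mul_le_mul_of_nonneg_right (mul_le_of_le_one_right hc hγ) (norm_nonneg _)

namespace Problem

variable {T : ℕ} {S : Problem T} {f g : Density T}

theorem aestronglyMeasurable_gram {q : ℝ → Fin T → ℂ}
    (hq : ∀ p, AEStronglyMeasurable (fun x => q x p) freq) (i j : Fin T) :
    AEStronglyMeasurable (fun x => gram (q x) i j) freq := by
  simp only [gram_apply]
  exact (hq i).star.fun_mul (hq j)

theorem aestronglyMeasurable_gram_resG (hf : IsSpectralDensity f) (hg : IsSpectralDensity g)
    (hm : S.Minimality f g) (i j : Fin T) :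
    AEStronglyMeasurable (fun x => gram (S.resG (S.specChar f g) x) i j) freq :=
  aestronglyMeasurable_gram (fun p => S.aestronglyMeasurable_resG
    (aestronglyMeasurable_components (aestronglyMeasurable_specChar hf hg hm)) p) i j

/-- The multipliers of the neighbourhood constraints attain the maximum of the linear functional
they define. -/
theorem MultiplierG.integral_le {c : ClassData T} {k : Fin 4} (hg₁ : IsSpectralDensity c.g₁)
    (hB₂ : c.B₂.PosSemidef) (hf : IsSpectralDensity f)
    (hg : g ∈ classG c k) (hm : S.Minimality f g) (h : S.MultiplierG c f g k) :
    (∃ K, ∀ᵐ x ∂freq, ∀ i j, ‖gram (S.resG (S.specChar f g) x) i j‖ ≤ K) ∧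
    ∀ g' ∈ classG c k,
      ∫ x, ((g' x - c.g₁ x) * gram (S.resG (S.specChar f g) x)).trace.re ∂freq
        ≤ ∫ x, ((g x - c.g₁ x) * gram (S.resG (S.specChar f g) x)).trace.re ∂freq := by
  have hmeas : ∀ g' ∈ classG c k, AEStronglyMeasurable
      (fun x => ((g' x - c.g₁ x) * gram (S.resG (S.specChar f g) x)).trace.re) freq := fun g' hg' =>
    aestronglyMeasurable_re_trace_mul (fun i j => (hg'.1.integrable_sub_apply hg₁ i j).1)
      (aestronglyMeasurable_gram_resG hf hg.1 hm)
  have hherm := hg.1.ae_isHermitian_sub hg₁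
  fin_cases k
  · obtain ⟨β, γ, hγ, hE, hβ⟩ := h
    have hE' := (eqG_iff hf hg.1 hm _).1 hE
    have hs := hγ.ae_mul (hherm.mono fun x hx => im_trace_eq_zero hx)
    refine ⟨exists_entry_bound fun i j => ⟨β ^ 2 * ‖(1 : Matrix (Fin T) (Fin T) ℂ) i j‖, ?_⟩,
      fun g' hg' => ?_⟩
    · filter_upwards [hE', hγ] with x h1 h2
      rw [h1, Matrix.smul_apply, smul_eq_mul]
      exact norm_ofReal_mul_mul_le h2.1 (sq_nonneg β) _
    have key : ∀ A : Density T, ∀ᵐ x ∂freq,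
        ((A x) * gram (S.resG (S.specChar f g) x)).trace.re
          = ∑ _m : Unit, β ^ 2 * ((γ x : ℂ) * (A x).trace).re := fun A => by
      filter_upwards [hE'] with x h1
      simp only [h1, Matrix.mul_smul, Matrix.mul_one, trace_smul, smul_eq_mul, Finset.univ_unique,
        Finset.sum_singleton]
      rw [Complex.ofReal_mul, mul_assoc, Complex.re_ofReal_mul]
    exact integral_le_of_multipliers (ι := Unit) (L := fun _ x => (g' x - c.g₁ x).trace)
      (L₀ := fun _ x => (g x - c.g₁ x).trace) (θ := fun _ x => (γ x : ℂ)) (c := fun _ => β ^ 2)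
      (D := fun _ => c.δ) (hmeas g' hg')
      (fun _ => integrable_trace (hg'.1.integrable_sub_apply hg₁))
      (fun _ => integrable_trace (hg.1.integrable_sub_apply hg₁)) (key _) (key _)
      (fun _ => hs) (fun _ => sq_nonneg β) (fun _ => hg'.2)
      (fun _ h => hβ (by simpa using h))
  · obtain ⟨β, γ, hγ, hE, hβ⟩ := h
    have hE' := (eqG_iff hf hg.1 hm _).1 hE
    have hs := fun m => (hγ m).ae_mul (hherm.mono fun x hx => im_diag_eq_zero hx m)
    refine ⟨exists_entry_bound fun i j => ⟨β i ^ 2, ?_⟩, fun g' hg' => ?_⟩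
    · filter_upwards [hE', hγ i] with x h1 h2
      rw [h1, diagonal_apply]
      split_ifs
      · simpa using norm_ofReal_mul_mul_le h2.1 (sq_nonneg (β i)) 1
      · simpa using sq_nonneg (β i)
    have key : ∀ A : Density T, ∀ᵐ x ∂freq,
        ((A x) * gram (S.resG (S.specChar f g) x)).trace.re
          = ∑ m, β m ^ 2 * ((γ m x : ℂ) * (A x) m m).re := fun A => by
      filter_upwards [hE'] with x h1
      simp only [h1, trace, diag_apply, mul_diagonal, Complex.re_sum]
      refine Finset.sum_congr rfl fun m _ => ?_
      rw [mul_comm, Complex.ofReal_mul, mul_assoc, Complex.re_ofReal_mul]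
    exact integral_le_of_multipliers (L := fun m x => (g' x - c.g₁ x) m m)
      (L₀ := fun m x => (g x - c.g₁ x) m m) (θ := fun m x => (γ m x : ℂ)) (c := fun m => β m ^ 2)
      (D := c.δk) (hmeas g' hg')
      (fun m => hg'.1.integrable_sub_apply hg₁ m m)
      (fun m => hg.1.integrable_sub_apply hg₁ m m) (key _) (key _)
      hs (fun m => sq_nonneg (β m)) hg'.2 (fun m h => hβ m (by simpa using h))
  · obtain ⟨β, γ, hγ, hE, hβ⟩ := h
    have hE' := (eqG_iff hf hg.1 hm _).1 hE
    have hs := hγ.ae_mul (hherm.mono fun x hx => im_pairing_eq_zero hB₂.isHermitian hx)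
    refine ⟨exists_entry_bound fun i j => ⟨β ^ 2 * ‖c.B₂ᵀ i j‖, ?_⟩, fun g' hg' => ?_⟩
    · filter_upwards [hE', hγ] with x h1 h2
      rw [h1, Matrix.smul_apply, smul_eq_mul]
      exact norm_ofReal_mul_mul_le h2.1 (sq_nonneg β) _
    have key : ∀ A : Density T, ∀ᵐ x ∂freq,
        ((A x) * gram (S.resG (S.specChar f g) x)).trace.re
          = ∑ _m : Unit, β ^ 2 * ((γ x : ℂ) * pairing c.B₂ (A x)).re := fun A => by
      filter_upwards [hE'] with x h1
      simp only [h1, Matrix.mul_smul, trace_smul, smul_eq_mul, Finset.univ_unique,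
        Finset.sum_singleton, pairing_eq_trace]
      rw [Complex.ofReal_mul, mul_assoc, Complex.re_ofReal_mul]
    exact integral_le_of_multipliers (ι := Unit) (L := fun _ x => pairing c.B₂ (g' x - c.g₁ x))
      (L₀ := fun _ x => pairing c.B₂ (g x - c.g₁ x)) (θ := fun _ x => (γ x : ℂ))
      (c := fun _ => β ^ 2) (D := fun _ => c.δ) (hmeas g' hg')
      (fun _ => integrable_pairing (hg'.1.integrable_sub_apply hg₁) _)
      (fun _ => integrable_pairing (hg.1.integrable_sub_apply hg₁) _) (key _) (key _)
      (fun _ => hs) (fun _ => sq_nonneg β) (fun _ => hg'.2)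
      (fun _ h => hβ (by simpa using h))
  · obtain ⟨β, γ, hβ0, hγ, hE, hβ⟩ := h
    have hE' := (eqG_iff hf hg.1 hm _).1 hE
    refine ⟨exists_entry_bound fun i j => ⟨β i j, ?_⟩, fun g' hg' => ?_⟩
    · filter_upwards [hE', hγ i j] with x h1 h2
      rw [h1, of_apply, norm_mul, Complex.norm_real, Real.norm_of_nonneg (hβ0 i j)]
      exact mul_le_of_le_one_right (hβ0 i j) h2.1
    have key : ∀ A : Density T, (∀ᵐ x ∂freq, (A x).IsHermitian) → ∀ᵐ x ∂freq,
        ((A x) * gram (S.resG (S.specChar f g) x)).trace.re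
          = ∑ m : Fin T × Fin T, β m.1 m.2 * (γ m.1 m.2 x * conj (A x m.1 m.2)).re := fun A hA => by
      filter_upwards [hE', hA] with x h1 h2
      simp only [h1, trace, diag_apply, mul_apply, of_apply, Complex.re_sum]
      rw [Fintype.sum_prod_type_right]
      refine Finset.sum_congr rfl fun i _ => Finset.sum_congr rfl fun j _ => ?_
      rw [← RCLike.star_def, h2.apply i j, ← Complex.re_ofReal_mul]
      ring_nf
    have hconj : ∀ {A : Density T}, (∀ i j, Integrable (fun x => A x i j) freq) →
        ∀ m : Fin T × Fin T, Integrable (fun x => conj (A x m.1 m.2)) freq := fun hA m =>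
      Complex.conjCLE.toContinuousLinearMap.integrable_comp (hA m.1 m.2)
    exact integral_le_of_multipliers (ι := Fin T × Fin T) (L := fun m x => conj ((g' x - c.g₁ x) m.1 m.2))
      (L₀ := fun m x => conj ((g x - c.g₁ x) m.1 m.2)) (θ := fun m x => γ m.1 m.2 x)
      (c := fun m => β m.1 m.2) (D := fun m => c.δij m.1 m.2) (hmeas g' hg')
      (hconj (A := fun x => g' x - c.g₁ x) (hg'.1.integrable_sub_apply hg₁))
      (hconj (A := fun x => g x - c.g₁ x) (hg.1.integrable_sub_apply hg₁))
      (key (fun x => g' x - c.g₁ x) (hg'.1.ae_isHermitian_sub hg₁))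
      (key (fun x => g x - c.g₁ x) hherm)
      (fun m => (hγ m.1 m.2).ae_mul) (fun m => hβ0 _ _)
      (fun m => by simpa only [RCLike.norm_conj] using hg'.2 m.1 m.2)
      (fun m h => by simpa only [RCLike.norm_conj] using hβ m.1 m.2 h)

theorem errDensity_nonneg {x : ℝ} (hf : (f x).PosSemidef) (hg : (g x).PosSemidef)
    (h : ℝ → Fin T → ℂ) : 0 ≤ S.errDensity f g h x :=
  add_nonneg (qf_nonneg hf _) (qf_nonneg hg _)

theorem aestronglyMeasurable_errDensity (hf : IsSpectralDensity f) (hg : IsSpectralDensity g)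
    {h : ℝ → Fin T → ℂ} (hh : AEStronglyMeasurable h freq) :
    AEStronglyMeasurable (S.errDensity f g h) freq :=
  (aestronglyMeasurable_qf (fun i j => (hf.integrable i j).1)
    (S.aestronglyMeasurable_resF (aestronglyMeasurable_components hh))).add
  (aestronglyMeasurable_qf (fun i j => (hg.integrable i j).1)
    (S.aestronglyMeasurable_resG (aestronglyMeasurable_components hh)))

theorem err_eq_ofReal (hf : IsSpectralDensity f) (hg : IsSpectralDensity g) {h : ℝ → Fin T → ℂ}
    (hi : Integrable (S.errDensity f g h) freq) :
    S.err f g h = ENNReal.ofReal (1 / (2 * Real.pi)) *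
      ENNReal.ofReal (∫ x, S.errDensity f g h x ∂freq) := by
  rw [err, ofReal_integral_eq_lintegral_ofReal hi]
  filter_upwards [hf.posSemidef, hg.posSemidef] with x h1 h2 using errDensity_nonneg h1 h2 h

theorem integrable_errDensity (hf : IsSpectralDensity f) (hg : IsSpectralDensity g)
    {h : ℝ → Fin T → ℂ} (hh : AEStronglyMeasurable h freq) (hfin : S.err f g h < ∞) :
    Integrable (S.errDensity f g h) freq := by
  refine ⟨aestronglyMeasurable_errDensity hf hg hh, ?_⟩
  rw [hasFiniteIntegral_iff_ofReal]
  · rw [err] at hfin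
    have hpi : ENNReal.ofReal (1 / (2 * Real.pi)) ≠ 0 := by
      have := Real.pi_pos
      simpa using this
    by_contra hc
    rw [not_lt, top_le_iff] at hc
    rw [hc, ENNReal.mul_top hpi] at hfin
    exact lt_irrefl _ hfin
  · filter_upwards [hf.posSemidef, hg.posSemidef] with x h1 h2 using errDensity_nonneg h1 h2 h

/-- Solutions of the equations are saddle points. -/
theorem saddle_of_multipliers {c : ClassData T} {k : Fin 4} (hg₁ : IsSpectralDensity c.g₁)
    (hB₂ : c.B₂.PosSemidef) (hf : f ∈ S.classF c k) (hg : g ∈ classG c k)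
    (hm : S.Minimality f g) (hF : S.MultiplierF c f g k) (hG : S.MultiplierG c f g k) :
    S.LeastFavorable (S.classF c k ×ˢ classG c k) f g ∧
      S.ZeroMemSubdifferential (S.classF c k ×ˢ classG c k) (S.specChar f g) f g ∧
      S.IsMinimax (S.classF c k ×ˢ classG c k) (S.specChar f g) := by
  obtain ⟨M, hM, hFle⟩ := hF.exists_gram_eq hf hg.1 hm
  obtain ⟨⟨K, hK⟩, hGle⟩ := hG.integral_le hg₁ hB₂ hf.1 hg hm
  -- The first equation makes the Gram matrix constant, so `rowY` is bounded and admissibility for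
  -- the whole class follows.
  have hbd : ∀ᵐ x ∂freq, ∀ p, ‖S.rowY f g x p‖ ≤ (∑ i, ‖M i i‖) + 1 := by
    filter_upwards [hM] with x hx p
    refine norm_le_of_gram (fun i => ?_) p
    rw [hx]
    exact Finset.single_le_sum (f := fun i => ‖M i i‖) (fun _ _ => norm_nonneg _)
      (Finset.mem_univ i)
  have hobs : S.specChar f g ∈ S.robustSet (S.classF c k ×ˢ classG c k) := fun f' g' h =>
    inObs_specChar_of_bounded hf.1 hg.1 hm hbd h.1.1 h.2.1
  have hRm := aestronglyMeasurable_gram_resG hf.1 hg.1 hm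
  -- `g'` is split into `g' - g₁`, on which the multipliers act, and the centre `g₁`, which
  -- contributes the same amount for every `g'`.
  have key : ∀ f' ∈ S.classF c k, ∀ g' ∈ classG c k,
      Integrable (S.errDensity f' g' (S.specChar f g)) freq ∧
      ∫ x, S.errDensity f' g' (S.specChar f g) x ∂freq
        = ∫ x, S.weight x * (f' x * M).trace.re ∂freq
          + (∫ x, ((g' x - c.g₁ x) * gram (S.resG (S.specChar f g) x)).trace.re ∂freq
          + ∫ x, (c.g₁ x * gram (S.resG (S.specChar f g) x)).trace.re ∂freq) := by
    intro f' hf' g' hg'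
    have e : ∀ᵐ x ∂freq, S.errDensity f' g' (S.specChar f g) x
        = S.weight x * (f' x * M).trace.re
          + (((g' x - c.g₁ x) * gram (S.resG (S.specChar f g) x)).trace.re
          + (c.g₁ x * gram (S.resG (S.specChar f g) x)).trace.re) := by
      filter_upwards [hM, S.ae_generic] with x h1 h2
      rw [errDensity_specChar f' g' h2, h1, Matrix.sub_mul, trace_sub, Complex.sub_re,
        sub_add_cancel]
    have i1 : Integrable (fun x => S.weight x * (f' x * M).trace.re) freq := by
      have h1 := integrable_re_trace_mul (R := fun _ => M) hf'.1.integrable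
        (fun i j => aestronglyMeasurable_const) (K := ∑ i, ∑ j, ‖M i j‖)
        (Filter.Eventually.of_forall fun x i j => (Finset.single_le_sum (f := fun j => ‖M i j‖)
          (fun _ _ => norm_nonneg _) (Finset.mem_univ j)).trans (Finset.single_le_sum
          (f := fun i => ∑ j, ‖M i j‖) (fun _ _ => Finset.sum_nonneg fun _ _ => norm_nonneg _)
          (Finset.mem_univ i)))
      refine h1.bdd_mul (c := ((S.μ : ℝ) ^ S.n) ^ 2) S.measurable_weight.aestronglyMeasurable
        (Filter.Eventually.of_forall fun x => ?_)
      rw [Real.norm_of_nonneg (S.weight_nonneg x)]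
      exact S.weight_le x
    have i2 := integrable_re_trace_mul (hg'.1.integrable_sub_apply hg₁) hRm hK
    have i3 := integrable_re_trace_mul hg₁.integrable hRm hK
    refine ⟨(i1.add (i2.add i3)).congr (e.mono fun x hx => hx.symm), ?_⟩
    rw [integral_congr_ae e, integral_add i1 (i2.fun_add i3), integral_add i2 i3]
  refine saddle (fun f' g' h => ⟨h.1.1, h.2.1⟩) hm ⟨hf, hg⟩ hobs fun f' g' h => ?_
  obtain ⟨hi, he⟩ := key f' h.1 g' h.2
  obtain ⟨hi₀, he₀⟩ := key f hf g hg
  rw [mse_eq_err h.1.1 h.2.1 (hobs f' g' h), mse_eq_err hf.1 hg.1 (hobs f g ⟨hf, hg⟩),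
    err_eq_ofReal h.1.1 h.2.1 hi, err_eq_ofReal hf.1 hg.1 hi₀, he, he₀, hFle f' h.1]
  refine mul_le_mul_right (ENNReal.ofReal_le_ofReal ?_) _
  have := hGle g' h.2
  linarith

end Problem

/-! ### Least favorable pairs satisfy the saddle inequality. -/

/-- The segment between two densities. -/
def segm {T : ℕ} (t : ℝ) (f₀ f : Density T) : Density T :=
  fun x => ((1 - t : ℝ) : ℂ) • f₀ x + (t : ℂ) • f x

theorem qf_segm {T : ℕ} (t : ℝ) (f₀ f : Density T) (x : ℝ) (h : Fin T → ℂ) :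
    qf (segm t f₀ f x) h = (1 - t) * qf (f₀ x) h + t * qf (f x) h := by
  rw [segm, qf_add, qf_smul, qf_smul]

theorem ofReal_combo {t a b : ℝ} (ht : 0 ≤ t) (ht1 : t ≤ 1) (ha : 0 ≤ a) (hb : 0 ≤ b) :
    ENNReal.ofReal ((1 - t) * a + t * b)
      = ENNReal.ofReal (1 - t) * ENNReal.ofReal a + ENNReal.ofReal t * ENNReal.ofReal b := by
  rw [ENNReal.ofReal_add (mul_nonneg (by linarith) ha) (mul_nonneg ht hb),
    ENNReal.ofReal_mul (by linarith), ENNReal.ofReal_mul ht]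

theorem isSpectralDensity_segm {T : ℕ} {f₀ f : Density T} {t : ℝ} (ht : 0 ≤ t) (ht1 : t ≤ 1)
    (hf₀ : IsSpectralDensity f₀) (hf : IsSpectralDensity f) : IsSpectralDensity (segm t f₀ f) := by
  refine ⟨fun i j => ((hf₀.integrable i j).const_mul _).add ((hf.integrable i j).const_mul _), ?_⟩
  filter_upwards [hf₀.posSemidef, hf.posSemidef] with x h1 h2
  exact (h1.smul (Complex.zero_le_real.2 (by linarith))).add (h2.smul (Complex.zero_le_real.2 ht))

theorem mean_combo {L₀ L : ℝ → ℂ} {t : ℝ} {z : ℂ} (hL₀ : Integrable L₀ freq) (hL : Integrable L freq)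
    (h₀ : mean L₀ = z) (h : mean L = z) :
    mean (fun x => ((1 - t : ℝ) : ℂ) * L₀ x + (t : ℂ) * L x) = z := by
  rw [mean, integral_add (hL₀.const_mul _) (hL.const_mul _), integral_const_mul,
    integral_const_mul]
  rw [mean] at h₀ h
  push_cast
  linear_combination (1 - t : ℂ) * h₀ + (t : ℂ) * h

theorem meanR_combo_le {L₀ L M : ℝ → ℂ} {t D : ℝ} (ht : 0 ≤ t) (ht1 : t ≤ 1)
    (hL₀ : Integrable L₀ freq) (hL : Integrable L freq)
    (hM : ∀ x, M x = ((1 - t : ℝ) : ℂ) * L₀ x + (t : ℂ) * L x)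
    (h₀ : meanR (fun x => ‖L₀ x‖) ≤ D) (h : meanR (fun x => ‖L x‖) ≤ D) :
    meanR (fun x => ‖M x‖) ≤ D := by
  have e : ∫ x, ‖M x‖ ∂freq ≤ (1 - t) * ∫ x, ‖L₀ x‖ ∂freq + t * ∫ x, ‖L x‖ ∂freq := by
    rw [← integral_const_mul, ← integral_const_mul,
      ← integral_add (hL₀.norm.const_mul _) (hL.norm.const_mul _)]
    refine integral_mono_of_nonneg (Filter.Eventually.of_forall fun x => norm_nonneg _)
      ((hL₀.norm.const_mul _).add (hL.norm.const_mul _)) (Filter.Eventually.of_forall fun x => ?_)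
    simp only [hM]
    refine (norm_add_le _ _).trans (le_of_eq ?_)
    rw [norm_mul, norm_mul, Complex.norm_real, Complex.norm_real, Real.norm_of_nonneg ht,
      Real.norm_of_nonneg (by linarith : 0 ≤ 1 - t)]
  have hpi : 0 < 1 / (2 * Real.pi) := by
    have := Real.pi_pos
    positivity
  have e2 := mul_le_mul_of_nonneg_left e hpi.le
  rw [meanR] at *
  nlinarith

theorem segm_sub {T : ℕ} (t : ℝ) (f₀ f g : Density T) (x : ℝ) :
    segm t f₀ f x - g x = ((1 - t : ℝ) : ℂ) • (f₀ x - g x) + (t : ℂ) • (f x - g x) := by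
  rw [segm]
  push_cast
  module

theorem pairing_combo {T : ℕ} (B F G : Matrix (Fin T) (Fin T) ℂ) (a b : ℂ) :
    pairing B (a • F + b • G) = a * pairing B F + b * pairing B G := by
  simp [pairing_eq_trace, Matrix.add_mul]

theorem classG_segm {T : ℕ} {c : ClassData T} {k : Fin 4} {g₀ g : Density T} {t : ℝ}
    (hg₁ : IsSpectralDensity c.g₁) (ht : 0 ≤ t) (ht1 : t ≤ 1)
    (h₀ : g₀ ∈ classG c k) (h : g ∈ classG c k) : segm t g₀ g ∈ classG c k := by
  refine ⟨isSpectralDensity_segm ht ht1 h₀.1 h.1, ?_⟩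
  have i₀ := h₀.1.integrable_sub_apply hg₁
  have i := h.1.integrable_sub_apply hg₁
  obtain ⟨-, h₀⟩ := h₀
  obtain ⟨-, h⟩ := h
  fin_cases k
  · refine meanR_combo_le ht ht1 (integrable_trace i₀) (integrable_trace i) (fun x => ?_) h₀ h
    rw [segm_sub, trace_add, trace_smul, trace_smul, smul_eq_mul, smul_eq_mul]
  · exact fun k => meanR_combo_le ht ht1 (i₀ k k) (i k k) (fun x => by rw [segm_sub]; rfl)
      (h₀ k) (h k)
  · refine meanR_combo_le ht ht1 (integrable_pairing i₀ _) (integrable_pairing i _)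
      (fun x => ?_) h₀ h
    rw [segm_sub, pairing_combo]
  · exact fun k l => meanR_combo_le ht ht1 (i₀ k l) (i k l) (fun x => by rw [segm_sub]; rfl)
      (h₀ k l) (h k l)

/-- Here `m` is the optimal error at the starting pair, `m + s` and `e` the errors of a competitor
at the start and at the end of the segment. Omitting `s` and dividing by `t` gives the first bound;
omitting `e` and using `1 - t ≥ 1/2` and `t² ≤ t` gives the second. -/
theorem ennreal_segment_bounds {m s e : ℝ≥0∞} {t : ℝ} (hm : m ≠ ∞) (ht : 0 < t) (ht2 : t ≤ 1 / 2)
    (h : ENNReal.ofReal (1 - t) * (m + s) + ENNReal.ofReal t * e ≤ m + ENNReal.ofReal (t ^ 2)) :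
    e ≤ m + ENNReal.ofReal t ∧ s ≤ 2 * (m + 1) * ENNReal.ofReal t := by
  have hfin : m + ENNReal.ofReal (t ^ 2) ≠ ∞ := ENNReal.add_ne_top.2 ⟨hm, ENNReal.ofReal_ne_top⟩
  have h1 : ENNReal.ofReal (1 - t) * (m + s) ≠ ∞ := ne_top_of_le_ne_top hfin (le_self_add.trans h)
  have h2 : ENNReal.ofReal t * e ≠ ∞ := ne_top_of_le_ne_top hfin (le_add_self.trans h)
  have hs : s ≠ ∞ := by
    rintro rfl
    rw [add_top, ENNReal.mul_top] at h1
    · exact h1 rfl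
    · simpa using by linarith
  have he : e ≠ ∞ := by
    rintro rfl
    rw [ENNReal.mul_top] at h2
    · exact h2 rfl
    · simpa using ht
  lift m to NNReal using hm
  lift s to NNReal using hs
  lift e to NNReal using he
  have h3 := ENNReal.toReal_mono hfin h
  rw [ENNReal.toReal_add h1 h2, ENNReal.toReal_mul, ENNReal.toReal_mul,
    ENNReal.toReal_add (by simp) (by simp), ENNReal.toReal_add (by simp) (by simp),
    ENNReal.toReal_ofReal (by linarith), ENNReal.toReal_ofReal ht.le,
    ENNReal.toReal_ofReal (by positivity)] at h3
  simp only [ENNReal.coe_toReal] at h3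
  have m0 := m.2
  have s0 := s.2
  constructor
  · rw [← ENNReal.toReal_le_toReal (by simp) (by simp), ENNReal.toReal_add (by simp) (by simp),
      ENNReal.toReal_ofReal ht.le]
    simp only [ENNReal.coe_toReal]
    refine le_of_mul_le_mul_left (a := t) ?_ ht
    nlinarith [mul_nonneg (by linarith : 0 ≤ 1 - t) s.coe_nonneg]
  · rw [← ENNReal.toReal_le_toReal (by simp) (by finiteness), ENNReal.toReal_mul,
      ENNReal.toReal_mul, ENNReal.toReal_add (by simp) (by simp), ENNReal.toReal_ofReal ht.le]
    simp only [ENNReal.coe_toReal, ENNReal.toReal_ofNat, ENNReal.toReal_one]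
    nlinarith [mul_nonneg ht.le e.coe_nonneg, mul_nonneg (by linarith : 0 ≤ 1 / 2 - t) s.coe_nonneg]

namespace Problem

variable {T : ℕ} {S : Problem T} {f g f₀ g₀ : Density T} {t : ℝ}

theorem classF_segm {c : ClassData T} {k : Fin 4} (ht : 0 ≤ t) (ht1 : t ≤ 1)
    (h₀ : f₀ ∈ S.classF c k) (h : f ∈ S.classF c k) : segm t f₀ f ∈ S.classF c k := by
  refine ⟨isSpectralDensity_segm ht ht1 h₀.1 h.1, ?_⟩
  have key : ∀ {L₀ L M : ℝ → ℂ} {z : ℂ}, Integrable L₀ freq → Integrable L freq →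
      (∀ x, M x = ((1 - t : ℝ) : ℂ) * L₀ x + (t : ℂ) * L x) →
      mean (fun x => S.weight x * L₀ x) = z → mean (fun x => S.weight x * L x) = z →
      mean (fun x => S.weight x * M x) = z := by
    intro L₀ L M z hL₀ hL hM h1 h2
    have := mean_combo (t := t) (integrable_weight_mul (S := S) hL₀) (integrable_weight_mul hL) h1 h2
    rw [← this]
    congr 1
    funext x
    rw [hM]
    ring
  have i₀ := h₀.1.integrable
  have i := h.1.integrable
  obtain ⟨-, h₀⟩ := h₀
  obtain ⟨-, h⟩ := h
  fin_cases k
  · exact fun k l => key (i₀ k l) (i k l) (fun x => rfl) (h₀ k l) (h k l)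
  · refine key (integrable_trace i₀) (integrable_trace i) (fun x => ?_) h₀ h
    rw [segm, trace_add, trace_smul, trace_smul, smul_eq_mul, smul_eq_mul]
  · exact fun k => key (i₀ k k) (i k k) (fun x => rfl) (h₀ k) (h k)
  · exact key (integrable_pairing i₀ _) (integrable_pairing i _) (fun x => pairing_combo _ _ _ _ _)
      h₀ h

theorem err_segm (ht : 0 ≤ t) (ht1 : t ≤ 1) (hf₀ : IsSpectralDensity f₀)
    (hg₀ : IsSpectralDensity g₀) (hf : IsSpectralDensity f) (hg : IsSpectralDensity g)
    {h : ℝ → Fin T → ℂ} (hh : AEStronglyMeasurable h freq) :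
    S.err (segm t f₀ f) (segm t g₀ g) h
      = ENNReal.ofReal (1 - t) * S.err f₀ g₀ h + ENNReal.ofReal t * S.err f g h := by
  have m₀ := (aestronglyMeasurable_errDensity (S := S) hf₀ hg₀ hh).aemeasurable.ennreal_ofReal
  have m := (aestronglyMeasurable_errDensity (S := S) hf hg hh).aemeasurable.ennreal_ofReal
  rw [err, err, err, mul_left_comm, mul_left_comm (ENNReal.ofReal t), ← mul_add,
    ← lintegral_const_mul'' _ m₀, ← lintegral_const_mul'' _ m,
    ← lintegral_add_left' (m₀.const_mul _)]
  congr 1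
  refine lintegral_congr_ae ?_
  filter_upwards [hf₀.posSemidef, hg₀.posSemidef, hf.posSemidef, hg.posSemidef] with x h1 h2 h3 h4
  rw [← ofReal_combo ht ht1 (errDensity_nonneg h1 h2 h) (errDensity_nonneg h3 h4 h)]
  congr 1
  rw [errDensity, errDensity, errDensity, qf_segm, qf_segm]
  ring

/-- The segment dominates `1 - t` times its starting densities, so approximation in its norm implies
approximation at the start. -/
theorem InObs.of_segm (ht : 0 ≤ t) (ht1 : t < 1)
    (hf : IsSpectralDensity f) (hg : IsSpectralDensity g)
    {h : ℝ → Fin T → ℂ} (hh : S.InObs (segm t f₀ f) (segm t g₀ g) h) : S.InObs f₀ g₀ h := by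
  refine ⟨hh.1, fun ε hε => ?_⟩
  have hpos : ENNReal.ofReal (1 - t) ≠ 0 := by simpa using ht1
  obtain ⟨c, hc, hlt⟩ := hh.2 (ENNReal.ofReal (1 - t) * ε) (by positivity)
  refine ⟨c, hc, ?_⟩
  rw [← ENNReal.mul_lt_mul_iff_right hpos ENNReal.ofReal_ne_top]
  refine lt_of_le_of_lt ?_ hlt
  rw [sqNorm_obsDensity, sqNorm_obsDensity, ← lintegral_const_mul' _ _ ENNReal.ofReal_ne_top]
  refine lintegral_mono_ae ?_
  filter_upwards [hf.posSemidef, hg.posSemidef] with x h1 h2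
  rw [← ENNReal.ofReal_mul (by linarith)]
  refine ENNReal.ofReal_le_ofReal ?_
  rw [qf_segm, qf_segm]
  nlinarith [mul_nonneg ht (qf_nonneg h1 (h x - S.comboChar c x)),
    mul_nonneg ht (qf_nonneg h2 ((Complex.I * x) ^ S.n • (h x - S.comboChar c x)))]

end Problem

theorem continuous_qf {ι : Type*} [Fintype ι] (A : Matrix ι ι ℂ) : Continuous (qf A) := by
  have : qf A = fun h => (∑ i, ∑ j, h i * A i j * conj (h j)).re := funext (qf_eq_sum A)
  rw [this]
  fun_prop

namespace Problem

variable {T : ℕ} {S : Problem T} {f g f₀ g₀ : Density T} {t : ℝ}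

/-- The competitors which are nearly optimal on the segments from `(f₀, g₀)` to `(f, g)`. -/
theorem exists_competitor {D : Set (Density T × Density T)} (hf₀ : IsSpectralDensity f₀)
    (hg₀ : IsSpectralDensity g₀) (hf : IsSpectralDensity f) (hg : IsSpectralDensity g)
    (hm : S.Minimality f₀ g₀) (hLF : S.LeastFavorable D f₀ g₀) (ht : 0 < t) (ht2 : t ≤ 1 / 2)
    (hD : (segm t f₀ f, segm t g₀ g) ∈ D) :
    ∃ h, AEStronglyMeasurable h freq ∧
      S.err f g h ≤ S.err f₀ g₀ (S.specChar f₀ g₀) + ENNReal.ofReal t ∧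
      ENNReal.ofReal (1 / (2 * Real.pi)) *
        sqNorm (obsDensity S.n f₀ g₀) (fun x => h x - S.specChar f₀ g₀ x)
        ≤ 2 * (S.err f₀ g₀ (S.specChar f₀ g₀) + 1) * ENNReal.ofReal t := by
  have hmin := minMse_eq_err hf₀ hg₀ hm
  have hfin := (err_lt_top hf₀ hg₀ (inObs_specChar hf₀ hg₀ hm)).ne
  have ht1 : t ≤ 1 := by linarith
  have hft := isSpectralDensity_segm ht.le ht1 hf₀ hf
  have hgt := isSpectralDensity_segm ht.le ht1 hg₀ hg
  -- The accuracy `t²` is of smaller order than the displacement `t`, so it is harmless after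
  -- division by `t`.
  have hlt : S.minMse (segm t f₀ f) (segm t g₀ g)
      < S.err f₀ g₀ (S.specChar f₀ g₀) + ENNReal.ofReal (t ^ 2) := by
    refine lt_of_le_of_lt ((hLF.2 _ _ hD).trans hmin.le) (ENNReal.lt_add_right hfin ?_)
    simpa using ht.ne'
  rw [minMse] at hlt
  obtain ⟨h, hlt⟩ := iInf_lt_iff.1 hlt
  obtain ⟨hobs, hlt⟩ := iInf_lt_iff.1 hlt
  rw [mse_eq_err hft hgt hobs, err_segm ht.le ht1 hf₀ hg₀ hf hg hobs.1,
    err_eq_add_specChar hf₀ hg₀ hm (hobs.of_segm ht.le (by linarith) hf hg)] at hlt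
  exact ⟨h, hobs.1, ennreal_segment_bounds hfin ht ht2 hlt.le⟩

/-- Fatou's lemma: the error density is nonnegative and depends continuously on the value of the
characteristic. -/
theorem err_le_liminf (hf : IsSpectralDensity f) (hg : IsSpectralDensity g)
    {h : ℕ → ℝ → Fin T → ℂ} {h₀ : ℝ → Fin T → ℂ} (hh : ∀ k, AEStronglyMeasurable (h k) freq)
    (hlim : ∀ᵐ x ∂freq, Filter.Tendsto (fun k => h k x) Filter.atTop (nhds (h₀ x))) :
    S.err f g h₀ ≤ Filter.liminf (fun k => S.err f g (h k)) Filter.atTop := by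
  have hpi : ENNReal.ofReal (1 / (2 * Real.pi)) ≠ ∞ := ENNReal.ofReal_ne_top
  simp only [err]
  simp only [← lintegral_const_mul' _ _ hpi]
  refine le_trans (lintegral_mono_ae ?_) (lintegral_liminf_le' fun k =>
    (aestronglyMeasurable_errDensity hf hg (hh k)).aemeasurable.ennreal_ofReal.const_mul _)
  filter_upwards [hlim] with x hx
  refine le_of_eq (Filter.Tendsto.liminf_eq ?_).symm
  refine ENNReal.Tendsto.const_mul ?_ (Or.inr hpi)
  refine (ENNReal.continuous_ofReal.tendsto _).comp ?_
  have h1 : Filter.Tendsto (fun k => S.resF (h k) x) Filter.atTop (nhds (S.resF h₀ x)) :=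
    tendsto_const_nhds.sub hx
  have h2 : Filter.Tendsto (fun k => S.resG (h k) x) Filter.atTop (nhds (S.resG h₀ x)) :=
    (h1.const_smul _).sub tendsto_const_nhds
  exact (((continuous_qf (f x)).tendsto _).comp h1).add (((continuous_qf (g x)).tendsto _).comp h2)

/-- At a least favorable pair, the linearised problem has the saddle point property. -/
theorem err_le_of_leastFavorable {D : Set (Density T × Density T)} (hf₀ : IsSpectralDensity f₀)
    (hg₀ : IsSpectralDensity g₀) (hf : IsSpectralDensity f) (hg : IsSpectralDensity g)
    (hm : S.Minimality f₀ g₀) (hLF : S.LeastFavorable D f₀ g₀)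
    (hD : ∀ t, 0 ≤ t → t ≤ 1 → (segm t f₀ f, segm t g₀ g) ∈ D) :
    S.err f g (S.specChar f₀ g₀) ≤ S.err f₀ g₀ (S.specChar f₀ g₀) := by
  set h₀ := S.specChar f₀ g₀ with hh₀
  set m := S.err f₀ g₀ h₀ with hmdef
  -- A summable choice: the squared distances of the competitors from the explicit characteristic
  -- are of order `t k`, so their sum is finite and the competitors converge almost everywhere
  -- without passing to a subsequence.
  let t : ℕ → ℝ := fun k => 1 / 2 * (1 / 2) ^ k
  have htpos : ∀ k, 0 < t k := fun k => by positivity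
  have ht2 : ∀ k, t k ≤ 1 / 2 := fun k =>
    mul_le_of_le_one_right (by norm_num) (pow_le_one₀ (by norm_num) (by norm_num))
  have hsum : Summable t := summable_geometric_two.mul_left _
  have hmfin : m ≠ ∞ := (err_lt_top hf₀ hg₀ (inObs_specChar hf₀ hg₀ hm)).ne
  choose h hmeas herr hnorm using fun k => exists_competitor hf₀ hg₀ hf hg hm hLF (htpos k) (ht2 k)
    (hD _ (htpos k).le (by linarith [ht2 k]))
  have hpi : ENNReal.ofReal (1 / (2 * Real.pi)) ≠ 0 := by
    have := Real.pi_pos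
    simpa using this
  have hmeasq : ∀ k, AEMeasurable (fun x =>
      ENNReal.ofReal (qf (obsDensity S.n f₀ g₀ x) (h k x - h₀ x))) freq := fun k =>
    (aestronglyMeasurable_qf (aestronglyMeasurable_obsDensity S.n hf₀ hg₀) fun p =>
      (aestronglyMeasurable_components (hmeas k) p).fun_sub (aestronglyMeasurable_components
        (aestronglyMeasurable_specChar hf₀ hg₀ hm) p)).aemeasurable.ennreal_ofReal
  have hfin : ∑' k, sqNorm (obsDensity S.n f₀ g₀) (fun x => h k x - h₀ x) ≠ ∞ := by
    have h1 : ENNReal.ofReal (1 / (2 * Real.pi)) *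
        ∑' k, sqNorm (obsDensity S.n f₀ g₀) (fun x => h k x - h₀ x) ≠ ∞ := by
      rw [← ENNReal.tsum_mul_left]
      refine ne_top_of_le_ne_top ?_ (ENNReal.tsum_le_tsum hnorm)
      rw [ENNReal.tsum_mul_left]
      exact ENNReal.mul_ne_top (by finiteness) hsum.tsum_ofReal_ne_top
    intro h2
    rw [h2, ENNReal.mul_top hpi] at h1
    exact h1 rfl
  have hfin' : ∫⁻ x, ∑' k, ENNReal.ofReal (qf (obsDensity S.n f₀ g₀ x) (h k x - h₀ x)) ∂freq ≠ ∞ := by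
    rw [lintegral_tsum hmeasq]
    exact hfin
  have hlim : ∀ᵐ x ∂freq, Filter.Tendsto (fun k => h k x) Filter.atTop (nhds (h₀ x)) := by
    filter_upwards [ae_lt_top' (AEMeasurable.tsum hmeasq) hfin', hm.ae_posDef hf₀ hg₀] with x hx hp
    have h1 := ENNReal.tendsto_atTop_zero_of_tsum_ne_top hx.ne
    have h2 : Filter.Tendsto (fun k => qf (obsDensity S.n f₀ g₀ x) (h k x - h₀ x))
        Filter.atTop (nhds 0) := by
      have := (ENNReal.tendsto_toReal ENNReal.zero_ne_top).comp h1
      refine this.congr fun k => ?_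
      exact ENNReal.toReal_ofReal (qf_nonneg hp.posSemidef _)
    rw [tendsto_pi_nhds]
    intro i
    rw [tendsto_iff_norm_sub_tendsto_zero]
    have h3 : Filter.Tendsto (fun k => ‖h k x i - h₀ x i‖ ^ 2) Filter.atTop (nhds 0) := by
      refine squeeze_zero (fun k => sq_nonneg _)
        (fun k => sq_norm_le_qf_mul hp (h k x - h₀ x) i) ?_
      simpa using h2.mul_const ((obsDensity S.n f₀ g₀ x)⁻¹.trace.re)
    have h4 := (Real.continuous_sqrt.tendsto 0).comp h3
    rw [Real.sqrt_zero] at h4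
    exact h4.congr fun k => Real.sqrt_sq (norm_nonneg _)
  -- The competitors have error at most `m + t k` at `(f, g)`. Fatou's lemma passes this to the
  -- limit without requiring `h₀` to be admissible for `(f, g)`.
  refine (err_le_liminf hf hg hmeas hlim).trans ?_
  have hto : Filter.Tendsto (fun k => m + ENNReal.ofReal (t k)) Filter.atTop (nhds m) := by
    have := ENNReal.tendsto_ofReal hsum.tendsto_atTop_zero
    simpa using this.const_add m
  rw [← hto.liminf_eq]
  exact Filter.liminf_le_liminf (Filter.Eventually.of_forall herr)

end Problem

/-! ### Variational lemmas. -/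

/-- The variational lemma for a single linear constraint. -/
theorem ae_const_of_variation {κ F : ℝ → ℝ} (hκ : Integrable κ freq) (hpos : ∀ᵐ x ∂freq, 0 < κ x)
    (hF : AEStronglyMeasurable F freq)
    (h : ∀ φ : ℝ → ℝ, AEStronglyMeasurable φ freq → (∀ x, |φ x| ≤ 1) →
      ∫ x, κ x * φ x ∂freq = 0 → ∫ x, κ x * φ x * F x ∂freq ≤ 0) :
    ∃ c, ∀ᵐ x ∂freq, F x = c := by
  have hbd : ∀ {u : ℝ → ℝ} {C : ℝ}, AEStronglyMeasurable u freq → (∀ x, |u x| ≤ C) →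
      Integrable (fun x => κ x * u x) freq := fun hu hC =>
    hκ.mul_bdd hu (Filter.Eventually.of_forall hC)
  -- `F` is only measurable; the factor `1 / (1 + F²)` keeps itself and its products with `F` and
  -- `F²` bounded.
  have hden : ∀ x, 0 < 1 + F x ^ 2 := fun x => by positivity
  have hdm : AEStronglyMeasurable (fun x => (1 + F x ^ 2)⁻¹) freq :=
    ((hF.pow 2).const_add 1 |>.aemeasurable.inv).aestronglyMeasurable
  have b0 : ∀ x, |(1 + F x ^ 2)⁻¹| ≤ 1 := fun x => by
    rw [abs_of_pos (inv_pos.2 (hden x))]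
    exact inv_le_one_of_one_le₀ (by nlinarith [sq_nonneg (F x)])
  have b1 : ∀ x, |F x * (1 + F x ^ 2)⁻¹| ≤ 1 := fun x => by
    rw [abs_mul, abs_of_pos (inv_pos.2 (hden x)), ← div_eq_mul_inv, div_le_one (hden x)]
    nlinarith [sq_nonneg (|F x| - 1), sq_abs (F x)]
  have b2 : ∀ x, |F x * (F x * (1 + F x ^ 2)⁻¹)| ≤ 1 := fun x => by
    rw [← mul_assoc, ← sq, abs_mul, abs_of_pos (inv_pos.2 (hden x)), ← div_eq_mul_inv,
      div_le_one (hden x), abs_of_nonneg (sq_nonneg _)]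
    linarith
  have i0 := hbd hdm b0
  have i1 := hbd (hF.fun_mul hdm) b1
  have i2 := hbd (hF.fun_mul (hF.fun_mul hdm)) b2
  set I := ∫ x, κ x * (1 + F x ^ 2)⁻¹ ∂freq with hI
  set J := ∫ x, κ x * (F x * (1 + F x ^ 2)⁻¹) ∂freq with hJ
  have hIpos : 0 ≤ I := integral_nonneg_of_ae (by
    filter_upwards [hpos] with x hx using mul_nonneg hx.le (inv_pos.2 (hden x)).le)
  have hI0 : I ≠ 0 := by
    intro h0
    rw [hI, integral_eq_zero_iff_of_nonneg_ae (by
      filter_upwards [hpos] with x hx using mul_nonneg hx.le (inv_pos.2 (hden x)).le) i0] at h0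
    have h1 : ∀ᵐ _ ∂freq, False := by
      filter_upwards [h0, hpos] with x h1 h2
      exact (mul_pos h2 (inv_pos.2 (hden x))).ne' h1
    rw [Filter.eventually_false_iff_eq_bot, ae_eq_bot] at h1
    have h2 : ∫ x, ee 0 x ∂freq = 0 := by rw [h1, integral_zero_measure]
    rw [integral_ee] at h2
    simp [Real.pi_ne_zero] at h2
  -- The mean of `F` for the weight `κ / (1 + F²)`. With it the test function `φ`, proportional to
  -- `(F - c) / (1 + F²)`, obeys the constraint, and the hypothesis becomes `∫ κ (F - c)² / (1 + F²)
  -- ≤ 0`. The factor `1 / (1 + |c|)` gives `|φ| ≤ 1`.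
  set c := J / I with hc
  have hk : 0 < (1 + |c|)⁻¹ := by positivity
  let φ : ℝ → ℝ := fun x => (1 + |c|)⁻¹ * (F x * (1 + F x ^ 2)⁻¹ - c * (1 + F x ^ 2)⁻¹)
  have hφm : AEStronglyMeasurable φ freq :=
    ((hF.fun_mul hdm).fun_sub (hdm.const_mul c)).const_mul _
  have hφb : ∀ x, |φ x| ≤ 1 := fun x => by
    rw [abs_mul, abs_of_pos hk, inv_mul_le_iff₀ (by positivity), mul_one]
    refine (abs_sub _ _).trans (add_le_add (b1 x) ?_)
    rw [abs_mul]
    exact mul_le_of_le_one_right (abs_nonneg _) (b0 x)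
  have e1 : ∫ x, κ x * φ x ∂freq = 0 := by
    have : ∀ x, κ x * φ x = (1 + |c|)⁻¹ * (κ x * (F x * (1 + F x ^ 2)⁻¹)
        - c * (κ x * (1 + F x ^ 2)⁻¹)) := fun x => by simp only [φ]; ring
    simp only [this]
    rw [integral_const_mul, integral_sub i1 (i0.const_mul c), integral_const_mul, ← hI, ← hJ, hc,
      div_mul_cancel₀ _ hI0, sub_self, mul_zero]
  have e2 := h φ hφm hφb e1
  have i3 : Integrable (fun x => κ x * φ x) freq := hbd hφm hφb
  have i4 : Integrable (fun x => κ x * φ x * F x) freq := by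
    have : ∀ x, κ x * φ x * F x = (1 + |c|)⁻¹ * (κ x * (F x * (F x * (1 + F x ^ 2)⁻¹))
        - c * (κ x * (F x * (1 + F x ^ 2)⁻¹))) := fun x => by simp only [φ]; ring
    simp only [this]
    exact (i2.sub (i1.const_mul c)).const_mul _
  have e3 : ∀ x, (1 + |c|)⁻¹ * (κ x * (1 + F x ^ 2)⁻¹) * (F x - c) ^ 2
      = κ x * φ x * F x - c * (κ x * φ x) := fun x => by simp only [φ]; ring
  have e4 : ∫ x, (κ x * φ x * F x - c * (κ x * φ x)) ∂freq ≤ 0 := by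
    rw [integral_sub i4 (i3.const_mul c), integral_const_mul, e1]
    linarith
  have hnn : 0 ≤ᵐ[freq] fun x => κ x * φ x * F x - c * (κ x * φ x) := by
    filter_upwards [hpos] with x hx
    rw [← e3]
    exact mul_nonneg (mul_nonneg hk.le (mul_nonneg hx.le (inv_pos.2 (hden x)).le)) (sq_nonneg _)
  have e5 := (integral_eq_zero_iff_of_nonneg_ae hnn (i4.sub (i3.const_mul c))).1
    (le_antisymm e4 (integral_nonneg_of_ae hnn))
  refine ⟨c, ?_⟩
  filter_upwards [e5, hpos] with x h1 h2
  rw [← e3] at h1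
  have h3 : (F x - c) ^ 2 = 0 :=
    (mul_eq_zero_iff_left (mul_pos hk (mul_pos h2 (inv_pos.2 (hden x)))).ne').1 h1
  exact sub_eq_zero.1 (pow_eq_zero_iff two_ne_zero |>.1 h3)

section Multiplier

variable {E : Type*} [NormedAddCommGroup E] [InnerProductSpace ℝ E]

theorem inner_normalize_le {t r : E} : inner ℝ r (‖t‖⁻¹ • t) ≤ ‖r‖ := by
  refine (real_inner_le_norm _ _).trans (mul_le_of_le_one_right (norm_nonneg _) ?_)
  rw [norm_smul, norm_inv, norm_norm]
  exact inv_mul_le_one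

/-- The variational lemma for an inactive `L₁` neighbourhood. -/
theorem ae_eq_zero_of_inactive {t r : ℝ → E} {lam : ℝ → ℝ} {D : ℝ}
    (hr : AEStronglyMeasurable r freq) (ht : Integrable t freq)
    (hlam : Integrable lam freq) (hpos : ∀ᵐ x ∂freq, 0 < lam x)
    (h : ∀ φ : ℝ → E, AEStronglyMeasurable φ freq → (∀ᵐ x ∂freq, ‖φ x‖ ≤ lam x) →
      ∫ x, ‖t x + φ x‖ ∂freq ≤ D →
      Integrable (fun x => (inner ℝ (r x) (φ x) : ℝ)) freq ∧ ∫ x, (inner ℝ (r x) (φ x) : ℝ) ∂freq ≤ 0)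
    (hD : ∫ x, ‖t x‖ ∂freq < D) : ∀ᵐ x ∂freq, r x = 0 := by
  set I := ∫ x, lam x ∂freq with hI
  have hI0 : 0 ≤ I := integral_nonneg_of_ae (hpos.mono fun x hx => hx.le)
  -- So small that the slack of the constraint absorbs any perturbation of norm at most `s lam`.
  set s := min 1 ((D - ∫ x, ‖t x‖ ∂freq) / (1 + I)) with hs
  have hs0 : 0 < s := lt_min one_pos (div_pos (by linarith) (by linarith))
  have hs1 : s ≤ 1 := min_le_left _ _
  have hsI : s * I ≤ D - ∫ x, ‖t x‖ ∂freq := by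
    have : s * (1 + I) ≤ D - ∫ x, ‖t x‖ ∂freq := by
      rw [← le_div_iff₀ (by linarith)]
      exact min_le_right _ _
    nlinarith
  have hd : ∀ x, 0 < 1 + ‖r x‖ := fun x => by positivity
  -- A multiple of `r` damped to norm at most `s lam`; its inner product with `r` is nonnegative and
  -- vanishes only where `r` does.
  let φ : ℝ → E := fun x => (s * lam x * (1 + ‖r x‖)⁻¹) • r x
  have hφm : AEStronglyMeasurable φ freq :=
    ((hlam.1.const_mul s).fun_mul ((hr.norm.const_add 1).aemeasurable.inv).aestronglyMeasurable).smul
      hr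
  have hφ1 : ∀ᵐ x ∂freq, ‖φ x‖ ≤ s * lam x := by
    filter_upwards [hpos] with x hx
    rw [norm_smul, Real.norm_of_nonneg (mul_nonneg (mul_nonneg hs0.le hx.le) (inv_pos.2 (hd x)).le),
      mul_assoc]
    refine mul_le_of_le_one_right (mul_nonneg hs0.le hx.le) ?_
    rw [inv_mul_le_iff₀ (hd x)]
    linarith
  have hφi : Integrable φ freq := (hlam.const_mul s).mono' hφm hφ1
  obtain ⟨h1, h2⟩ := h φ hφm (by
    filter_upwards [hφ1, hpos] with x h1 h2 using h1.trans (mul_le_of_le_one_left h2.le hs1)) (by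
    have h3 : ∫ x, ‖t x + φ x‖ ∂freq ≤ ∫ x, (‖t x‖ + s * lam x) ∂freq := by
      refine integral_mono_ae (ht.add hφi).norm (ht.norm.add (hlam.const_mul s)) ?_
      filter_upwards [hφ1] with x hx
      exact (norm_add_le _ _).trans (add_le_add le_rfl hx)
    rw [integral_add ht.norm (hlam.const_mul s), integral_const_mul] at h3
    linarith)
  have e : ∀ x, (inner ℝ (r x) (φ x) : ℝ) = s * lam x * (1 + ‖r x‖)⁻¹ * ‖r x‖ ^ 2 := fun x => by
    rw [inner_smul_right, real_inner_self_eq_norm_sq]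
  have hnn : 0 ≤ᵐ[freq] fun x => (inner ℝ (r x) (φ x) : ℝ) := by
    filter_upwards [hpos] with x hx
    rw [e]
    have := hd x
    positivity
  filter_upwards [(integral_eq_zero_iff_of_nonneg_ae hnn h1).1
    (le_antisymm h2 (integral_nonneg_of_ae hnn)), hpos] with x h3 h4
  rw [e] at h3
  have h5 : ‖r x‖ ^ 2 = 0 :=
    (mul_eq_zero_iff_left (mul_pos (mul_pos hs0 h4) (inv_pos.2 (hd x))).ne').1 h3
  simpa using h5

/-- The method of Lagrange multipliers for an `L₁` neighbourhood, necessity. -/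
theorem exists_multiplier {t r : ℝ → E} {lam : ℝ → ℝ} {D : ℝ}
    (hr : AEStronglyMeasurable r freq) (ht : Integrable t freq)
    (hlam : Integrable lam freq) (hpos : ∀ᵐ x ∂freq, 0 < lam x)
    (h : ∀ φ : ℝ → E, AEStronglyMeasurable φ freq → (∀ᵐ x ∂freq, ‖φ x‖ ≤ lam x) →
      ∫ x, ‖t x + φ x‖ ∂freq ≤ D →
      Integrable (fun x => (inner ℝ (r x) (φ x) : ℝ)) freq ∧ ∫ x, (inner ℝ (r x) (φ x) : ℝ) ∂freq ≤ 0)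
    (hD0 : 0 < D) (hD : ∫ x, ‖t x‖ ∂freq ≤ D) :
    ∃ b : ℝ, 0 ≤ b ∧ (∀ᵐ x ∂freq, ‖r x‖ ≤ b ∧ (t x ≠ 0 → r x = (b * ‖t x‖⁻¹) • t x)) ∧
      (b ≠ 0 → ∫ x, ‖t x‖ ∂freq = D) := by
  rcases hD.lt_or_eq with hlt | heq
  · refine ⟨0, le_rfl, ?_, fun h => absurd rfl h⟩
    filter_upwards [ae_eq_zero_of_inactive hr ht hlam hpos h hlt] with x hx
    simp [hx]
  -- In the active case norm must be freed before anything can be added. Shrinking `t` by `a` along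
  -- its direction `e` frees `a`; the cap `‖t‖` prevents overshooting, the cap `lam / 2` leaves half
  -- of the allowance for another perturbation.
  let a : ℝ → ℝ := fun x => min (lam x / 2) ‖t x‖
  let e : ℝ → E := fun x => ‖t x‖⁻¹ • t x
  have hem : AEStronglyMeasurable e freq :=
    (ht.1.norm.aemeasurable.inv).aestronglyMeasurable.smul ht.1
  have he1 : ∀ x, ‖e x‖ ≤ 1 := fun x => by
    rw [norm_smul, norm_inv, norm_norm]
    exact inv_mul_le_one
  have ham : AEStronglyMeasurable a freq := (hlam.div_const 2).1.inf ht.1.norm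
  have ha0 : ∀ᵐ x ∂freq, 0 ≤ a x := by
    filter_upwards [hpos] with x hx using le_min (by linarith) (norm_nonneg _)
  have hai : Integrable a freq := ht.norm.mono' ham (by
    filter_upwards [ha0] with x hx
    rw [Real.norm_of_nonneg hx]
    exact min_le_right _ _)
  have hte : ∀ x, t x = ‖t x‖ • e x := fun x => by
    rcases eq_or_ne (t x) 0 with h0 | h0
    · simp [e, h0]
    · rw [smul_smul, mul_inv_cancel₀ (norm_ne_zero_iff.2 h0), one_smul]
  set κ := ∫ x, a x ∂freq with hκ
  have hκ0 : 0 < κ := by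
    refine lt_of_le_of_ne (integral_nonneg_of_ae ha0) fun h0 => ?_
    have h1 := (integral_eq_zero_iff_of_nonneg_ae ha0 hai).1 h0.symm
    have h2 : ∀ᵐ x ∂freq, ‖t x‖ = 0 := by
      filter_upwards [h1, hpos] with x h2 h3
      rcases min_choice (lam x / 2) ‖t x‖ with h4 | h4
      · have : a x = lam x / 2 := h4
        rw [this, Pi.zero_apply] at h2
        linarith
      · exact h4.symm.trans h2
    rw [integral_congr_ae h2, integral_zero] at heq
    exact hD0.ne heq
  -- A perturbation `χ` of total norm at most `θ κ` is paid for by shrinking `t` by `θ a`.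
  have key : ∀ (χ : ℝ → E) (θ : ℝ), 0 ≤ θ → θ ≤ 1 → AEStronglyMeasurable χ freq →
      (∀ᵐ x ∂freq, ‖χ x‖ ≤ lam x / 2) → ∫ x, ‖χ x‖ ∂freq ≤ θ * κ →
      Integrable (fun x => (inner ℝ (r x) (χ x - (θ * a x) • e x) : ℝ)) freq ∧
      ∫ x, (inner ℝ (r x) (χ x - (θ * a x) • e x) : ℝ) ∂freq ≤ 0 := by
    intro χ θ hθ0 hθ1 hχm hχ hχθ
    have hχi : Integrable χ freq := (hlam.div_const 2).mono' hχm hχ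
    have hm : AEStronglyMeasurable (fun x => χ x - (θ * a x) • e x) freq :=
      hχm.fun_sub ((ham.const_mul θ).smul hem)
    refine h _ hm ?_ ?_
    · filter_upwards [hχ, ha0] with x h1 h2
      refine (norm_sub_le _ _).trans ?_
      rw [norm_smul, Real.norm_of_nonneg (mul_nonneg hθ0 h2)]
      have h3 : θ * a x * ‖e x‖ ≤ a x :=
        (mul_le_of_le_one_right (mul_nonneg hθ0 h2) (he1 x)).trans (mul_le_of_le_one_left h2 hθ1)
      have h4 : a x ≤ lam x / 2 := min_le_left _ _
      linarith
    · have h5 : ∫ x, ‖t x + (χ x - (θ * a x) • e x)‖ ∂freq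
          ≤ ∫ x, (‖χ x‖ + (‖t x‖ - θ * a x)) ∂freq := by
        refine integral_mono_of_nonneg (Filter.Eventually.of_forall fun x => norm_nonneg _)
          (hχi.norm.add (ht.norm.sub (hai.const_mul θ))) ?_
        filter_upwards [ha0] with x h2
        have h6 : t x + (χ x - (θ * a x) • e x) = χ x + (‖t x‖ - θ * a x) • e x := by
          conv_lhs => rw [hte x]
          module
        have h7 : 0 ≤ ‖t x‖ - θ * a x := by
          have : a x ≤ ‖t x‖ := min_le_right _ _
          nlinarith [mul_le_of_le_one_left h2 hθ1]
        rw [h6]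
        refine (norm_add_le _ _).trans (add_le_add le_rfl ?_)
        rw [norm_smul, Real.norm_of_nonneg h7]
        exact mul_le_of_le_one_right h7 (he1 x)
      have hsub : Integrable (fun x => ‖t x‖ - θ * a x) freq := ht.norm.sub (hai.const_mul θ)
      rw [integral_add hχi.norm hsub,
        integral_sub ht.norm (hai.const_mul θ), integral_const_mul, heq] at h5
      linarith
  let q : ℝ → ℝ := fun x => inner ℝ (r x) (e x)
  -- Pure shrinking: `χ = 0` and `θ = 1`.
  obtain ⟨hqi, hq0⟩ : Integrable (fun x => a x * q x) freq ∧ 0 ≤ ∫ x, a x * q x ∂freq := by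
    have := key (fun _ => 0) 1 zero_le_one le_rfl aestronglyMeasurable_const (by
      filter_upwards [hpos] with x hx
      rw [norm_zero]
      linarith) (by simpa using hκ0.le)
    simp only [one_mul, zero_sub, inner_neg_right, inner_smul_right] at this
    refine ⟨by simpa using this.1.neg, ?_⟩
    rw [integral_neg] at this
    linarith [this.2]
  -- The multiplier is the price of the norm: the loss in the functional per unit of norm freed by
  -- shrinking.
  set b := (∫ x, a x * q x ∂freq) / κ with hb
  have hb0 : 0 ≤ b := div_nonneg hq0 hκ0.le
  have hbκ : b * κ = ∫ x, a x * q x ∂freq := div_mul_cancel₀ _ hκ0.ne'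
  set I := ∫ x, lam x ∂freq with hI
  have hI0 : 0 ≤ I := integral_nonneg_of_ae (hpos.mono fun x hx => hx.le)
  -- The bound `1 / 2` keeps `χ` below `lam / 2`; the other keeps its total norm below `κ`, so that
  -- `θ ≤ 1`.
  set s := min (1 / 2) (κ / (1 + I)) with hs
  have hs0 : 0 < s := lt_min (by norm_num) (div_pos hκ0 (by linarith))
  have hs1 : s ≤ 1 / 2 := min_le_left _ _
  have hsI : s * I ≤ κ := by
    have : s * (1 + I) ≤ κ := by
      rw [← le_div_iff₀ (by linarith)]
      exact min_le_right _ _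
    nlinarith
  have hd : ∀ x, 0 < 1 + ‖r x‖ := fun x => by positivity
  let m : ℝ → ℝ := fun x => max (‖r x‖ - b) 0
  have hm0 : ∀ x, 0 ≤ m x := fun x => le_max_right _ _
  have hmr : ∀ x, m x ≤ ‖r x‖ := fun x => max_le (by linarith) (norm_nonneg _)
  -- It pushes along `r` only where `‖r‖ > b`, where the gain exceeds the price; the factor `(1 +
  -- ‖r‖)^{-2}` compensates `m` and `r`. Since the net gain cannot be positive, `‖r‖ ≤ b` almost
  -- everywhere.
  let χ : ℝ → E := fun x => (s * lam x * m x * ((1 + ‖r x‖) ^ 2)⁻¹) • r x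
  have hχm : AEStronglyMeasurable χ freq := by
    have h1 : AEStronglyMeasurable (fun x => ((1 + ‖r x‖) ^ 2)⁻¹) freq :=
      (((hr.norm.const_add 1).pow 2).aemeasurable.inv).aestronglyMeasurable
    have h2 : AEStronglyMeasurable m freq := (hr.norm.fun_sub aestronglyMeasurable_const).sup aestronglyMeasurable_const
    exact ((((hlam.1.const_mul s).fun_mul h2).fun_mul h1).smul hr)
  have hχ1 : ∀ᵐ x ∂freq, ‖χ x‖ ≤ s * lam x := by
    filter_upwards [hpos] with x hx
    have h1 := hd x
    have h2 := hm0 x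
    rw [norm_smul, Real.norm_of_nonneg (by positivity), mul_assoc, mul_assoc]
    refine mul_le_of_le_one_right (by positivity) ?_
    rw [mul_left_comm, inv_mul_le_iff₀ (by positivity), mul_one]
    nlinarith [hmr x, norm_nonneg (r x)]
  have hχi : Integrable χ freq := (hlam.const_mul s).mono' hχm hχ1
  have hχκ : ∫ x, ‖χ x‖ ∂freq ≤ κ := by
    refine (integral_mono_ae hχi.norm (hlam.const_mul s) hχ1).trans ?_
    rw [integral_const_mul]
    exact hsI
  obtain ⟨k1, k2⟩ := key χ ((∫ x, ‖χ x‖ ∂freq) / κ)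
    (div_nonneg (integral_nonneg fun x => norm_nonneg _) hκ0.le) ((div_le_one hκ0).2 hχκ) hχm (by
      filter_upwards [hχ1, hpos] with x h1 h2
      nlinarith) (div_mul_cancel₀ _ hκ0.ne').ge
  set θ := (∫ x, ‖χ x‖ ∂freq) / κ with hθ
  have hθκ : θ * κ = ∫ x, ‖χ x‖ ∂freq := div_mul_cancel₀ _ hκ0.ne'
  have e1 : ∀ x, (inner ℝ (r x) (χ x - (θ * a x) • e x) : ℝ)
      = inner ℝ (r x) (χ x) - θ * (a x * q x) := fun x => by
    rw [inner_sub_right, inner_smul_right (r x) (e x), mul_assoc θ]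
  simp only [e1] at k1 k2
  have k3 : Integrable (fun x => (inner ℝ (r x) (χ x) : ℝ)) freq := by
    simpa only [sub_add_cancel] using k1.fun_add (hqi.const_mul θ)
  rw [integral_sub k3 (hqi.const_mul θ), integral_const_mul, ← hbκ, mul_left_comm, hθκ] at k2
  have hr_le : ∀ᵐ x ∂freq, ‖r x‖ ≤ b := by
    have e2 : ∀ᵐ x ∂freq, (inner ℝ (r x) (χ x) : ℝ) - b * ‖χ x‖
        = s * lam x * m x * ((1 + ‖r x‖) ^ 2)⁻¹ * ‖r x‖ * (‖r x‖ - b) := by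
      filter_upwards [hpos] with x hx
      have h1 := hd x
      have h2 := hm0 x
      rw [inner_smul_right, real_inner_self_eq_norm_sq, norm_smul,
        Real.norm_of_nonneg (by positivity)]
      ring
    have hmm : ∀ x, m x * (‖r x‖ - b) = m x ^ 2 := fun x => by
      rcases le_total (‖r x‖ - b) 0 with h | h
      · simp [m, max_eq_right h]
      · simp only [m, max_eq_left h, sq]
    have hnn : 0 ≤ᵐ[freq] fun x => (inner ℝ (r x) (χ x) : ℝ) - b * ‖χ x‖ := by
      filter_upwards [e2, hpos] with x h1 h2
      rw [h1]
      have h3 : s * lam x * m x * ((1 + ‖r x‖) ^ 2)⁻¹ * ‖r x‖ * (‖r x‖ - b)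
          = s * lam x * ((1 + ‖r x‖) ^ 2)⁻¹ * ‖r x‖ * (m x * (‖r x‖ - b)) := by ring
      rw [h3, hmm]
      have := hd x
      positivity
    have h0 := (integral_eq_zero_iff_of_nonneg_ae hnn (k3.sub (hχi.norm.const_mul b))).1
      (le_antisymm (by
        rw [integral_sub k3 (hχi.norm.const_mul b), integral_const_mul]
        exact k2) (integral_nonneg_of_ae hnn))
    filter_upwards [h0, e2, hpos] with x h1 h2 h3
    by_contra hlt
    rw [not_le] at hlt
    have h4 : m x = ‖r x‖ - b := max_eq_left (by linarith)
    rw [h2, Pi.zero_apply, h4] at h1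
    have h5 : 0 < ‖r x‖ - b := by linarith
    have h6 : 0 < ‖r x‖ := by linarith
    have := hd x
    exact (by positivity : 0 < s * lam x * (‖r x‖ - b) * ((1 + ‖r x‖) ^ 2)⁻¹ * ‖r x‖ * (‖r x‖ - b)).ne'
      h1
  refine ⟨b, hb0, ?_, fun _ => heq⟩
  -- `q ≤ ‖r‖ ≤ b`, while `b` is the mean of `q` for the weight `a`. So `q = b` where `t ≠ 0`, and
  -- equality in the Cauchy–Schwarz inequality gives `r = b e` there.
  have hnn : 0 ≤ᵐ[freq] fun x => b * a x - a x * q x := by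
    filter_upwards [hr_le, ha0] with x h1 h2
    have : q x ≤ ‖r x‖ := inner_normalize_le
    have h3 : 0 ≤ a x * (b - q x) := mul_nonneg h2 (by linarith)
    simpa only [Pi.zero_apply, mul_sub, mul_comm b] using h3
  have h0 := (integral_eq_zero_iff_of_nonneg_ae hnn ((hai.const_mul b).sub hqi)).1 (by
    rw [integral_sub (hai.const_mul b) hqi, integral_const_mul, ← hκ, hbκ, sub_self])
  filter_upwards [h0, hr_le, hpos] with x h1 h2 h3
  refine ⟨h2, fun hne => ?_⟩
  have h4 : 0 < a x := lt_min (by linarith) (norm_pos_iff.2 hne)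
  have h5 : q x = b := by
    have h6 : a x * (b - q x) = 0 := by
      rw [mul_sub, mul_comm (a x) b]
      exact h1
    rcases mul_eq_zero.1 h6 with h7 | h7 <;> linarith
  have h8 : ‖r x - b • e x‖ ^ 2 ≤ 0 := by
    rw [norm_sub_sq_real, inner_smul_right, norm_smul, Real.norm_of_nonneg hb0]
    have h9 : (inner ℝ (r x) (e x) : ℝ) = b := h5
    rw [h9]
    have h10 : (b * ‖e x‖) ^ 2 ≤ b ^ 2 :=
      pow_le_pow_left₀ (by positivity) (mul_le_of_le_one_right hb0 (he1 x)) 2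
    have h11 : ‖r x‖ ^ 2 ≤ b ^ 2 := pow_le_pow_left₀ (norm_nonneg _) h2 2
    nlinarith
  have h12 : r x - b • e x = 0 := by
    have := le_antisymm h8 (sq_nonneg _)
    simpa using this
  rw [sub_eq_zero.1 h12, smul_smul]

end Multiplier

/-! ### Perturbations that preserve positivity. -/

section Margin

variable {T : ℕ}

/-- The entries of a Hermitian perturbation which are bounded by the margin of a positive definite
matrix do not destroy positivity. -/
def margin (A : Matrix (Fin T) (Fin T) ℂ) : ℝ := ((T ^ 2 + 1) * (1 + |A⁻¹.trace.re|))⁻¹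

theorem margin_pos (A : Matrix (Fin T) (Fin T) ℂ) : 0 < margin A := by
  unfold margin
  positivity

theorem margin_le_one (A : Matrix (Fin T) (Fin T) ℂ) : margin A ≤ 1 := by
  refine inv_le_one_of_one_le₀ ?_
  nlinarith [abs_nonneg A⁻¹.trace.re, sq_nonneg (T : ℝ), mul_nonneg (sq_nonneg (T : ℝ)) (abs_nonneg A⁻¹.trace.re)]

theorem abs_qf_le {A : Matrix (Fin T) (Fin T) ℂ} {K : ℝ} (hA : ∀ i j, ‖A i j‖ ≤ K)
    (h : Fin T → ℂ) : |qf A h| ≤ K * (∑ i, ‖h i‖) ^ 2 := by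
  rw [qf_eq_sum, sq, Finset.sum_mul_sum, Finset.mul_sum]
  refine (Complex.abs_re_le_norm _).trans ((norm_sum_le _ _).trans ?_)
  refine Finset.sum_le_sum fun i _ => (norm_sum_le _ _).trans ?_
  rw [Finset.mul_sum]
  refine Finset.sum_le_sum fun j _ => ?_
  rw [norm_mul, norm_mul, RCLike.norm_conj]
  nlinarith [hA i j, mul_nonneg (norm_nonneg (h i)) (norm_nonneg (h j))]

theorem im_qf_eq_zero {A : Matrix (Fin T) (Fin T) ℂ} (hA : A.IsHermitian) (h : Fin T → ℂ) :
    (h ⬝ᵥ (A *ᵥ star h)).im = 0 := by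
  refine Complex.conj_eq_iff_im.1 ?_
  rw [← RCLike.star_def, ← star_dotProduct_star, star_mulVec, star_star, hA.eq, ← dotProduct_mulVec]

theorem posSemidef_of_qf_nonneg {A : Matrix (Fin T) (Fin T) ℂ} (hA : A.IsHermitian)
    (h : ∀ v, 0 ≤ qf A v) : A.PosSemidef := by
  refine PosSemidef.of_dotProduct_mulVec_nonneg hA fun v => ?_
  have h1 := h (star v)
  have h2 := im_qf_eq_zero hA (star v)
  rw [qf] at h1
  rw [star_star] at h1 h2
  exact Complex.le_def.2 ⟨h1, h2.symm⟩

/-- By `sq_norm_le_qf_mul`, `(∑ ‖v i‖)²` is at most `T²` times the form of `A` at `v` times the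
trace of `A⁻¹`; the margin makes the form of the perturbation no larger than that of `A`. -/
theorem posSemidef_add_of_le_margin {A Δ : Matrix (Fin T) (Fin T) ℂ} (hA : A.PosDef)
    (hΔ : Δ.IsHermitian) (h : ∀ i j, ‖Δ i j‖ ≤ margin A) : (A + Δ).PosSemidef := by
  refine posSemidef_of_qf_nonneg (hA.isHermitian.add hΔ) fun v => ?_
  have h1 := abs_qf_le h v
  have ht := re_trace_nonneg hA.inv.posSemidef
  have hq := qf_nonneg hA.posSemidef v
  have h2 : ∑ i, ‖v i‖ ≤ T * Real.sqrt (qf A v * A⁻¹.trace.re) := by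
    refine (Finset.sum_le_sum fun i _ => Real.le_sqrt_of_sq_le (sq_norm_le_qf_mul hA v i)).trans ?_
    simp
  have h3 : (∑ i, ‖v i‖) ^ 2 ≤ T ^ 2 * (qf A v * A⁻¹.trace.re) := by
    refine (pow_le_pow_left₀ (Finset.sum_nonneg fun _ _ => norm_nonneg _) h2 2).trans (le_of_eq ?_)
    rw [mul_pow, Real.sq_sqrt (mul_nonneg hq ht)]
  have h4 : margin A * (T ^ 2 * (qf A v * A⁻¹.trace.re)) ≤ qf A v := by
    rw [margin, abs_of_nonneg ht, inv_mul_le_iff₀ (by positivity)]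
    nlinarith [mul_nonneg hq ht, mul_nonneg (sq_nonneg (T : ℝ)) hq]
  have h5 := mul_le_mul_of_nonneg_left h3 (margin_pos A).le
  rw [qf_add]
  linarith [neg_abs_le (qf Δ v)]

theorem aestronglyMeasurable_margin {f : Density T} (hf : IsSpectralDensity f) :
    AEStronglyMeasurable (fun x => margin (f x)) freq := by
  have h1 : AEStronglyMeasurable (fun x => (f x)⁻¹.trace.re) freq := by
    refine Complex.continuous_re.comp_aestronglyMeasurable ?_
    simp only [trace, diag_apply]
    exact Finset.aestronglyMeasurable_fun_sum _ fun i _ =>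
      aestronglyMeasurable_inv_apply (fun i j => (hf.integrable i j).1) i i
  unfold margin
  exact (((h1.norm.const_add 1).const_mul _).aemeasurable.inv).aestronglyMeasurable

/-- The margin is at most one by construction, so nothing is needed about the integrability of the
trace of `f⁻¹`. -/
theorem integrable_margin {f : Density T} (hf : IsSpectralDensity f) :
    Integrable (fun x => margin (f x)) freq :=
  (integrable_const (1 : ℝ)).mono' (aestronglyMeasurable_margin hf)
    (Filter.Eventually.of_forall fun x => by
      rw [Real.norm_of_nonneg (margin_pos _).le]
      exact margin_le_one _)

theorem integrable_of_le_margin {f : Density T} {u : ℝ → ℂ} (hu : AEStronglyMeasurable u freq)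
    (h : ∀ᵐ x ∂freq, ‖u x‖ ≤ margin (f x)) : Integrable u freq :=
  (integrable_const (1 : ℝ)).mono' hu (h.mono fun _ hx => hx.trans (margin_le_one _))

/-- A perturbation of a spectral density which respects the margin of positivity. -/
structure IsVariation (f Δ : Density T) : Prop where
  meas : ∀ i j, AEStronglyMeasurable (fun x => Δ x i j) freq
  herm : ∀ᵐ x ∂freq, (Δ x).IsHermitian
  le : ∀ᵐ x ∂freq, ∀ i j, ‖Δ x i j‖ ≤ margin (f x)

theorem IsVariation.integrable {f Δ : Density T} (h : IsVariation f Δ) (i j : Fin T) :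
    Integrable (fun x => Δ x i j) freq :=
  integrable_of_le_margin (h.meas i j) (h.le.mono fun _ hx => hx i j)

theorem IsVariation.isSpectralDensity {f Δ : Density T} (hf : IsSpectralDensity f)
    (hp : ∀ᵐ x ∂freq, (f x).PosDef) (h : IsVariation f Δ) :
    IsSpectralDensity fun x => f x + Δ x := by
  refine ⟨fun i j => (hf.integrable i j).add (h.integrable i j), ?_⟩
  filter_upwards [hp, h.herm, h.le] with x h1 h2 h3 using posSemidef_add_of_le_margin h1 h2 h3

/-- The density of a Hermitian matrix, normalised and multiplied by a bounded function. -/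
theorem isVariation_smul {f : Density T} {φ : ℝ → ℝ} {H : Matrix (Fin T) (Fin T) ℂ}
    (hH : H.IsHermitian) (hφm : AEStronglyMeasurable φ freq)
    (hφ : ∀ᵐ x ∂freq, |φ x| * (∑ i, ∑ j, ‖H i j‖) ≤ margin (f x)) :
    IsVariation f fun x => (φ x : ℂ) • H := by
  refine ⟨fun i j => ?_, Filter.Eventually.of_forall fun x => ?_, ?_⟩
  · exact (Complex.continuous_ofReal.comp_aestronglyMeasurable hφm).fun_mul
      aestronglyMeasurable_const
  · rw [IsHermitian, conjTranspose_smul, hH.eq, RCLike.star_def, Complex.conj_ofReal]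
  · filter_upwards [hφ] with x hx i j
    rw [Matrix.smul_apply, smul_eq_mul, norm_mul, Complex.norm_real, Real.norm_eq_abs]
    refine le_trans (mul_le_mul_of_nonneg_left ?_ (abs_nonneg _)) hx
    exact (Finset.single_le_sum (f := fun j => ‖H i j‖) (fun _ _ => norm_nonneg _)
      (Finset.mem_univ j)).trans (Finset.single_le_sum (f := fun i => ∑ j, ‖H i j‖)
        (fun _ _ => Finset.sum_nonneg fun _ _ => norm_nonneg _) (Finset.mem_univ i))

end Margin

/-! ### The Frobenius inner product on Hermitian matrices. -/

section Frobenius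

variable {T : ℕ} {A B : Matrix (Fin T) (Fin T) ℂ}

theorem re_trace_mul_self_eq (hA : A.IsHermitian) : (A * A).trace.re = ∑ i, ∑ j, ‖A i j‖ ^ 2 := by
  simp only [trace, diag_apply, mul_apply, Complex.re_sum]
  refine Finset.sum_congr rfl fun i _ => Finset.sum_congr rfl fun j _ => ?_
  rw [← hA.apply j i, RCLike.star_def, Complex.mul_conj', ← Complex.ofReal_pow, Complex.ofReal_re]

theorem re_trace_mul_self_nonneg (hA : A.IsHermitian) : 0 ≤ (A * A).trace.re := by
  rw [re_trace_mul_self_eq hA]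
  positivity

theorem eq_zero_of_re_trace_mul_self (hA : A.IsHermitian) (h : (A * A).trace.re ≤ 0) : A = 0 := by
  rw [re_trace_mul_self_eq hA] at h
  have h1 := le_antisymm h (by positivity)
  rw [Finset.sum_eq_zero_iff_of_nonneg fun i _ => by positivity] at h1
  ext i j
  have h2 := h1 i (Finset.mem_univ i)
  rw [Finset.sum_eq_zero_iff_of_nonneg fun i _ => by positivity] at h2
  simpa using h2 j (Finset.mem_univ j)

theorem re_trace_mul_comm (A B : Matrix (Fin T) (Fin T) ℂ) :
    (A * B).trace.re = (B * A).trace.re := by rw [trace_mul_comm]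

theorem re_trace_mul_gram_nonneg (hA : A.PosSemidef) (q : Fin T → ℂ) :
    0 ≤ (A * gram q).trace.re := by
  rw [← qf_eq_trace]
  exact qf_nonneg hA q

theorem isHermitian_gram (q : Fin T → ℂ) : (gram q).IsHermitian := by
  ext i j
  rw [conjTranspose_apply, gram_apply, gram_apply, RCLike.star_def, map_mul, Complex.conj_conj,
    mul_comm]

/-- The coefficient of the orthogonal projection to the line of `B`. -/
def projCoeff (B A : Matrix (Fin T) (Fin T) ℂ) : ℝ := (A * B).trace.re / (B * B).trace.re

/-- If `tr B² = 0` the coefficient is a division by zero, but then `B = 0` and the claim is trivial.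
-/
theorem re_trace_sub_projCoeff (hB : B.IsHermitian) :
    ((A - (projCoeff B A : ℂ) • B) * B).trace.re = 0 := by
  rw [Matrix.sub_mul, trace_sub, Matrix.smul_mul, trace_smul, smul_eq_mul, Complex.sub_re,
    Complex.re_ofReal_mul, projCoeff]
  rcases eq_or_ne (B * B).trace.re 0 with h | h
  · rw [eq_zero_of_re_trace_mul_self hB h.le]
    simp
  · rw [div_mul_cancel₀ _ h, sub_self]

theorem isHermitian_sub_smul (hA : A.IsHermitian) (hB : B.IsHermitian) (c : ℝ) :
    (A - (c : ℂ) • B).IsHermitian := by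
  refine hA.sub ?_
  rw [IsHermitian, conjTranspose_smul, hB.eq, RCLike.star_def, Complex.conj_ofReal]

/-- The residual is orthogonal to `B`. Hence, if the residual is an admissible direction, a first
order condition on its pairing with `A` bounds its own norm and makes it vanish. -/
theorem re_trace_sub_projCoeff_mul (hB : B.IsHermitian) :
    ((A - (projCoeff B A : ℂ) • B) * A).trace.re
      = ((A - (projCoeff B A : ℂ) • B) * (A - (projCoeff B A : ℂ) • B)).trace.re := by
  have h := re_trace_sub_projCoeff (A := A) hB
  rw [Matrix.mul_sub, trace_sub, Matrix.mul_smul, trace_smul, smul_eq_mul, Complex.sub_re,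
    Complex.re_ofReal_mul, h, mul_zero, sub_zero]

theorem projCoeff_gram_nonneg (hB : B.PosSemidef) (q : Fin T → ℂ) :
    0 ≤ projCoeff B (gram q) := by
  refine div_nonneg ?_ (re_trace_mul_self_nonneg hB.isHermitian)
  rw [re_trace_mul_comm]
  exact re_trace_mul_gram_nonneg hB q

theorem re_trace_sub_diagonal_mul (A : Matrix (Fin T) (Fin T) ℂ) :
    ((A - diagonal A.diag) * A).trace.re
      = ((A - diagonal A.diag) * (A - diagonal A.diag)).trace.re := by
  have h : ((A - diagonal A.diag) * diagonal A.diag).trace = 0 := by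
    simp [trace, mul_diagonal]
  conv_rhs => rw [Matrix.mul_sub, trace_sub, h, sub_zero]

theorem isHermitian_sub_diagonal (hA : A.IsHermitian) : (A - diagonal A.diag).IsHermitian := by
  refine hA.sub ?_
  rw [IsHermitian, diagonal_conjTranspose]
  congr 1
  funext i
  exact hA.apply i i

end Frobenius

/-! ### Necessity of the equations: moment constraints. -/

theorem mean_const_mul (z : ℂ) (F : ℝ → ℂ) : mean (fun x => z * F x) = z * mean F := by
  rw [mean, mean, integral_const_mul]
  ring

theorem mean_add {F G : ℝ → ℂ} (hF : Integrable F freq) (hG : Integrable G freq) :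
    mean (fun x => F x + G x) = mean F + mean G := by
  rw [mean, mean, mean, integral_add hF hG, mul_add]

theorem pairing_add {T : ℕ} (B F G : Matrix (Fin T) (Fin T) ℂ) :
    pairing B (F + G) = pairing B F + pairing B G := by
  simp [pairing_eq_trace, Matrix.add_mul]

theorem pairing_smul {T : ℕ} (B F : Matrix (Fin T) (Fin T) ℂ) (z : ℂ) :
    pairing B (z • F) = z * pairing B F := by
  simp [pairing_eq_trace]

/-- The data of the homogeneous moment constraints. -/
def ClassData.homogeneous {T : ℕ} (c : ClassData T) : ClassData T :=
  { c with P := 0, p := 0, pk := 0 }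

namespace Problem

variable {T : ℕ} {S : Problem T} {f g : Density T}

/-- Integrability belongs to the conclusion: in the necessity part the Gram matrices are not known
to be bounded, so it has to come from finiteness of the errors. -/
theorem integral_errDensity_sub {h : ℝ → Fin T → ℂ} (hh : AEStronglyMeasurable h freq)
    {f' g' : Density T} (hf : IsSpectralDensity f) (hg : IsSpectralDensity g)
    (hf' : IsSpectralDensity f') (hg' : IsSpectralDensity g') (hfin : S.err f g h < ∞)
    (hle : S.err f' g' h ≤ S.err f g h) :
    Integrable (fun x => S.errDensity f' g' h x - S.errDensity f g h x) freq ∧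
      ∫ x, (S.errDensity f' g' h x - S.errDensity f g h x) ∂freq ≤ 0 := by
  have i := integrable_errDensity hf hg hh hfin
  have i' := integrable_errDensity hf' hg' hh (hle.trans_lt hfin)
  refine ⟨i'.sub i, ?_⟩
  rw [err_eq_ofReal hf' hg' i', err_eq_ofReal hf hg i] at hle
  have hpi : ENNReal.ofReal (1 / (2 * Real.pi)) ≠ 0 := by
    have := Real.pi_pos
    simpa using this
  rw [ENNReal.mul_le_mul_iff_right hpi ENNReal.ofReal_ne_top, ENNReal.ofReal_le_ofReal_iff] at hle
  · rw [integral_sub i' i]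
    linarith
  · refine integral_nonneg_of_ae ?_
    filter_upwards [hf.posSemidef, hg.posSemidef] with x h1 h2 using errDensity_nonneg h1 h2 h

/-- The condition that the explicit characteristic has its largest error at the pair itself. -/
def IsSaddle (S : Problem T) (D : Set (Density T × Density T)) (f g : Density T) : Prop :=
  ∀ f' g', (f', g') ∈ D → S.err f' g' (S.specChar f g) ≤ S.err f g (S.specChar f g)

/-- The error is linear in the densities, so the perturbation changes it by exactly this functional;
no small parameter is needed. -/
theorem IsSaddle.variation_left {c : ClassData T} {k : Fin 4} {Δ : Density T}
    (h : S.IsSaddle (S.classF c k ×ˢ classG c k) f g) (hf : f ∈ S.classF c k)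
    (hg : g ∈ classG c k) (hm : S.Minimality f g)
    (hΔ : (fun x => f x + Δ x) ∈ S.classF c k) :
    Integrable (fun x => S.weight x * (Δ x * gram (S.rowY f g x)).trace.re) freq ∧
      ∫ x, S.weight x * (Δ x * gram (S.rowY f g x)).trace.re ∂freq ≤ 0 := by
  have key := integral_errDensity_sub (aestronglyMeasurable_specChar hf.1 hg.1 hm) hf.1 hg.1 hΔ.1
    hg.1 (err_lt_top hf.1 hg.1 (inObs_specChar hf.1 hg.1 hm)) (h _ _ ⟨hΔ, hg⟩)
  have e : ∀ᵐ x ∂freq, S.errDensity (fun x => f x + Δ x) g (S.specChar f g) x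
      - S.errDensity f g (S.specChar f g) x
      = S.weight x * (Δ x * gram (S.rowY f g x)).trace.re := by
    filter_upwards [S.ae_generic] with x hx
    rw [errDensity_specChar _ _ hx, errDensity_specChar _ _ hx, Matrix.add_mul, trace_add,
      Complex.add_re]
    ring
  exact ⟨key.1.congr e, (integral_congr_ae e).symm.trans_le key.2⟩

theorem IsSaddle.variation_right {c : ClassData T} {k : Fin 4} {Δ : Density T}
    (h : S.IsSaddle (S.classF c k ×ˢ classG c k) f g) (hf : f ∈ S.classF c k)
    (hg : g ∈ classG c k) (hm : S.Minimality f g)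
    (hΔ : (fun x => g x + Δ x) ∈ classG c k) :
    Integrable (fun x => (Δ x * gram (S.resG (S.specChar f g) x)).trace.re) freq ∧
      ∫ x, (Δ x * gram (S.resG (S.specChar f g) x)).trace.re ∂freq ≤ 0 := by
  have key := integral_errDensity_sub (aestronglyMeasurable_specChar hf.1 hg.1 hm) hf.1 hg.1 hf.1
    hΔ.1 (err_lt_top hf.1 hg.1 (inObs_specChar hf.1 hg.1 hm)) (h _ _ ⟨hf, hΔ⟩)
  have e : ∀ᵐ x ∂freq, S.errDensity f (fun x => g x + Δ x) (S.specChar f g) x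
      - S.errDensity f g (S.specChar f g) x
      = (Δ x * gram (S.resG (S.specChar f g) x)).trace.re := by
    filter_upwards [S.ae_generic] with x hx
    rw [errDensity_specChar _ _ hx, errDensity_specChar _ _ hx, Matrix.add_mul, trace_add,
      Complex.add_re]
    ring
  exact ⟨key.1.congr e, (integral_congr_ae e).symm.trans_le key.2⟩

theorem classF_add {c : ClassData T} {k : Fin 4} {Δ : Density T} (hf : f ∈ S.classF c k)
    (hp : ∀ᵐ x ∂freq, (f x).PosDef) (hΔ : IsVariation f Δ)
    (h0 : S.MomentConstraint c.homogeneous Δ k) : (fun x => f x + Δ x) ∈ S.classF c k := by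
  refine ⟨hΔ.isSpectralDensity hf.1 hp, ?_⟩
  have key : ∀ {L L' M : ℝ → ℂ} {z : ℂ}, Integrable L freq → Integrable L' freq →
      (∀ x, M x = L x + L' x) → mean (fun x => S.weight x * L x) = z →
      mean (fun x => S.weight x * L' x) = 0 → mean (fun x => S.weight x * M x) = z := by
    intro L L' M z hL hL' hM h1 h2
    simp only [hM, mul_add]
    rw [mean_add (integrable_weight_mul hL) (integrable_weight_mul hL'), h1, h2, add_zero]
  have i := hf.1.integrable
  have i' := hΔ.integrable
  obtain ⟨-, hf⟩ := hf
  fin_cases k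
  · exact fun k l => key (i k l) (i' k l) (fun x => rfl) (hf k l) (h0 k l)
  · exact key (integrable_trace i) (integrable_trace i') (fun x => trace_add _ _) hf
      (h0.trans Complex.ofReal_zero)
  · exact fun k => key (i k k) (i' k k) (fun x => rfl) (hf k) ((h0 k).trans Complex.ofReal_zero)
  · exact key (integrable_pairing i _) (integrable_pairing i' _) (fun x => pairing_add _ _ _) hf
      (h0.trans Complex.ofReal_zero)

/-- A fixed matrix times a scalar of zero weighted mean satisfies all four homogeneous constraints.
So one argument shows in every case that the Gram matrix is constant. -/
theorem momentConstraint_homogeneous_smul {c : ClassData T} {k : Fin 4} {φ : ℝ → ℝ}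
    (H : Matrix (Fin T) (Fin T) ℂ) (h : ∫ x, S.weight x * φ x ∂freq = 0) :
    S.MomentConstraint c.homogeneous (fun x => (φ x : ℂ) • H) k := by
  have h0 : mean (fun x => ((S.weight x * φ x : ℝ) : ℂ)) = 0 := by
    rw [mean, integral_complex_ofReal, h, Complex.ofReal_zero, mul_zero]
  have key : ∀ z : ℂ, mean (fun x => S.weight x * ((φ x : ℂ) * z)) = 0 := fun z => by
    have e : ∀ x, (S.weight x : ℂ) * ((φ x : ℂ) * z) = z * ((S.weight x * φ x : ℝ) : ℂ) := fun x => by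
      push_cast
      ring
    simp only [e]
    rw [mean_const_mul, h0, mul_zero]
  fin_cases k
  · exact fun k l => key (H k l)
  · refine Eq.trans ?_ Complex.ofReal_zero.symm
    simp only [trace_smul]
    exact key _
  · exact fun k => (key (H k k)).trans Complex.ofReal_zero.symm
  · refine Eq.trans ?_ Complex.ofReal_zero.symm
    simp only [pairing_smul]
    exact key _

theorem exists_const_re_trace {c : ClassData T} {k : Fin 4}
    (h : S.IsSaddle (S.classF c k ×ˢ classG c k) f g) (hf : f ∈ S.classF c k)
    (hg : g ∈ classG c k) (hm : S.Minimality f g) (hp : ∀ᵐ x ∂freq, (f x).PosDef)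
    {H : Matrix (Fin T) (Fin T) ℂ} (hH : H.IsHermitian) :
    ∃ C, ∀ᵐ x ∂freq, (H * gram (S.rowY f g x)).trace.re = C := by
  set K := ∑ i, ∑ j, ‖H i j‖ with hK
  have hK0 : 0 ≤ K := by positivity
  have hmar := integrable_margin hf.1
  have hκ : Integrable (fun x => S.weight x * (margin (f x) / (K + 1))) freq := by
    refine (hmar.div_const _).bdd_mul (c := ((S.μ : ℝ) ^ S.n) ^ 2)
      S.measurable_weight.aestronglyMeasurable (Filter.Eventually.of_forall fun x => ?_)
    rw [Real.norm_of_nonneg (S.weight_nonneg x)]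
    exact S.weight_le x
  refine ae_const_of_variation hκ ?_ ?_ fun φ hφm hφ hφ0 => ?_
  · filter_upwards [S.ae_generic] with x hx
    exact mul_pos hx.weight_pos (div_pos (margin_pos _) (by linarith))
  · exact aestronglyMeasurable_re_trace_mul (fun i j => aestronglyMeasurable_const)
      (aestronglyMeasurable_gram fun p => (integrable_rowY hf.1 hg.1 hm p).1)
  · let ψ : ℝ → ℝ := fun x => margin (f x) / (K + 1) * φ x
    have hψm : AEStronglyMeasurable ψ freq := (hmar.div_const _).1.fun_mul hφm
    have hv : IsVariation f fun x => (ψ x : ℂ) • H := by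
      refine isVariation_smul hH hψm (Filter.Eventually.of_forall fun x => ?_)
      have hmp := margin_pos (f x)
      rw [← hK, abs_mul, abs_of_pos (div_pos hmp (by linarith))]
      calc margin (f x) / (K + 1) * |φ x| * K ≤ margin (f x) / (K + 1) * 1 * (K + 1) := by
            gcongr
            · exact hφ x
            · linarith
        _ = margin (f x) := by
            field_simp
    have h1 := (h.variation_left hf hg hm (classF_add hf hp hv
      (momentConstraint_homogeneous_smul H (by simpa only [ψ, mul_assoc] using hφ0)))).2
    refine le_trans (le_of_eq (integral_congr_ae (Filter.Eventually.of_forall fun x => ?_))) h1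
    simp only [Matrix.smul_mul, trace_smul, smul_eq_mul, Complex.re_ofReal_mul, ψ]
    ring

theorem freq_ne_zero : freq ≠ 0 := by
  intro h
  have h1 := integral_ee 0
  rw [h, integral_zero_measure, if_pos rfl] at h1
  simp [Real.pi_ne_zero] at h1

/-- Hermitian matrices supported on the places `(i, j)` and `(j, i)` detect the real and imaginary
part of each entry. The constant matrix is a Gram matrix because it is the value at some frequency.
-/
theorem exists_const_gram {c : ClassData T} {k : Fin 4}
    (h : S.IsSaddle (S.classF c k ×ˢ classG c k) f g) (hf : f ∈ S.classF c k)
    (hg : g ∈ classG c k) (hm : S.Minimality f g) (hp : ∀ᵐ x ∂freq, (f x).PosDef) :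
    ∃ y : Fin T → ℂ, ∀ᵐ x ∂freq, gram (S.rowY f g x) = gram y := by
  have hre : ∀ i j, ∃ C, ∀ᵐ x ∂freq, (gram (S.rowY f g x) i j).re = C := by
    intro i j
    have hH : (single i j (1 : ℂ) + single j i 1).IsHermitian := by
      rw [IsHermitian, conjTranspose_add, conjTranspose_single, conjTranspose_single, star_one,
        add_comm]
    obtain ⟨C, hC⟩ := exists_const_re_trace h hf hg hm hp hH
    refine ⟨C / 2, ?_⟩
    filter_upwards [hC] with x hx
    rw [Matrix.add_mul, trace_add, trace_single_mul, trace_single_mul, Complex.add_re, one_smul,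
      one_smul, ← (isHermitian_gram (S.rowY f g x)).apply j i, RCLike.star_def, Complex.conj_re]
      at hx
    linarith
  have him : ∀ i j, ∃ C, ∀ᵐ x ∂freq, (gram (S.rowY f g x) i j).im = C := by
    intro i j
    have hH : (single i j Complex.I + single j i (-Complex.I)).IsHermitian := by
      rw [IsHermitian, conjTranspose_add, conjTranspose_single, conjTranspose_single, star_neg,
        RCLike.star_def, Complex.conj_I, neg_neg, add_comm]
    obtain ⟨C, hC⟩ := exists_const_re_trace h hf hg hm hp hH
    refine ⟨C / 2, ?_⟩
    filter_upwards [hC] with x hx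
    rw [Matrix.add_mul, trace_add, trace_single_mul, trace_single_mul, Complex.add_re,
      ← (isHermitian_gram (S.rowY f g x)).apply j i, RCLike.star_def] at hx
    simp at hx
    linarith
  choose Cr hCr using hre
  choose Ci hCi using him
  have hall : ∀ᵐ x ∂freq, ∀ i j, (gram (S.rowY f g x) i j).re = Cr i j ∧
      (gram (S.rowY f g x) i j).im = Ci i j := by
    filter_upwards [ae_all_iff.2 fun i => ae_all_iff.2 fun j => hCr i j,
      ae_all_iff.2 fun i => ae_all_iff.2 fun j => hCi i j] with x h1 h2 i j using ⟨h1 i j, h2 i j⟩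
  have : (ae freq).NeBot := ae_neBot.2 freq_ne_zero
  obtain ⟨x₀, hx₀⟩ := hall.exists
  refine ⟨S.rowY f g x₀, ?_⟩
  filter_upwards [hall] with x hx
  ext i j
  exact Complex.ext ((hx i j).1.trans (hx₀ i j).1.symm) ((hx i j).2.trans (hx₀ i j).2.symm)

/-- The constant Gram matrix is orthogonal to the matrices which satisfy the homogeneous moment
constraints. -/
theorem re_trace_mul_gram_le {c : ClassData T} {k : Fin 4}
    (h : S.IsSaddle (S.classF c k ×ˢ classG c k) f g) (hf : f ∈ S.classF c k)
    (hg : g ∈ classG c k) (hm : S.Minimality f g) (hp : ∀ᵐ x ∂freq, (f x).PosDef)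
    {y : Fin T → ℂ} (hy : ∀ᵐ x ∂freq, gram (S.rowY f g x) = gram y)
    {H : Matrix (Fin T) (Fin T) ℂ} (hH : H.IsHermitian)
    (h0 : ∀ φ : ℝ → ℝ, S.MomentConstraint c.homogeneous (fun x => (φ x : ℂ) • H) k) :
    (H * gram y).trace.re ≤ 0 := by
  set K := ∑ i, ∑ j, ‖H i j‖ with hK
  have hK0 : 0 ≤ K := by positivity
  have hmar := integrable_margin hf.1
  have hκ : Integrable (fun x => S.weight x * (margin (f x) / (K + 1))) freq := by
    refine (hmar.div_const _).bdd_mul (c := ((S.μ : ℝ) ^ S.n) ^ 2)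
      S.measurable_weight.aestronglyMeasurable (Filter.Eventually.of_forall fun x => ?_)
    rw [Real.norm_of_nonneg (S.weight_nonneg x)]
    exact S.weight_le x
  have hv : IsVariation f fun x => ((margin (f x) / (K + 1) : ℝ) : ℂ) • H := by
    refine isVariation_smul hH (hmar.div_const _).1 (Filter.Eventually.of_forall fun x => ?_)
    have hmp := margin_pos (f x)
    rw [← hK, abs_of_pos (div_pos hmp (by linarith)), div_mul_eq_mul_div, div_le_iff₀ (by linarith)]
    nlinarith
  have h1 := (h.variation_left hf hg hm (classF_add hf hp hv (h0 _))).2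
  have e : ∀ᵐ x ∂freq, S.weight x * ((((margin (f x) / (K + 1) : ℝ) : ℂ) • H) *
      gram (S.rowY f g x)).trace.re
      = S.weight x * (margin (f x) / (K + 1)) * (H * gram y).trace.re := by
    filter_upwards [hy] with x hx
    rw [hx, Matrix.smul_mul, trace_smul, smul_eq_mul, Complex.re_ofReal_mul, mul_assoc]
  rw [integral_congr_ae e, integral_mul_const] at h1
  have hpos : ∀ᵐ x ∂freq, 0 < S.weight x * (margin (f x) / (K + 1)) := by
    filter_upwards [S.ae_generic] with x hx
    exact mul_pos hx.weight_pos (div_pos (margin_pos _) (by linarith))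
  have hI : 0 < ∫ x, S.weight x * (margin (f x) / (K + 1)) ∂freq := by
    refine lt_of_le_of_ne (integral_nonneg_of_ae (hpos.mono fun x hx => hx.le)) fun h2 => ?_
    have h3 := (integral_eq_zero_iff_of_nonneg_ae (hpos.mono fun x hx => hx.le) hκ).1 h2.symm
    have : (ae freq).NeBot := ae_neBot.2 freq_ne_zero
    obtain ⟨x, hx1, hx2⟩ := (h3.and hpos).exists
    exact hx2.ne' hx1
  exact nonpos_of_mul_nonpos_right h1 hI

/-- Lagrange multipliers of the moment constraints. -/
theorem IsSaddle.multiplierF {c : ClassData T} {k : Fin 4} (hB₁ : c.B₁.PosSemidef)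
    (h : S.IsSaddle (S.classF c k ×ˢ classG c k) f g) (hf : f ∈ S.classF c k)
    (hg : g ∈ classG c k) (hm : S.Minimality f g) (hp : ∀ᵐ x ∂freq, (f x).PosDef) :
    S.MultiplierF c f g k := by
  obtain ⟨y, hy⟩ := exists_const_gram h hf hg hm hp
  have key := fun H : Matrix (Fin T) (Fin T) ℂ => re_trace_mul_gram_le (H := H) h hf hg hm hp hy
  -- The residual of the Gram matrix after projection to `B` is an admissible direction, so its
  -- squared norm is at most zero. The coefficient is a quotient of nonnegative traces, hence a
  -- square.
  have hline : ∀ B : Matrix (Fin T) (Fin T) ℂ, B.PosSemidef →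
      (∀ H : Matrix (Fin T) (Fin T) ℂ, H.IsHermitian → (H * B).trace.re = 0 → ∀ φ : ℝ → ℝ,
        S.MomentConstraint c.homogeneous (fun x => (φ x : ℂ) • H) k) →
      ∃ α : ℝ, gram y = ((α ^ 2 : ℝ) : ℂ) • B := by
    intro B hB hH
    have hherm := isHermitian_sub_smul (isHermitian_gram y) hB.isHermitian (projCoeff B (gram y))
    have h1 := key _ hherm (hH _ hherm (re_trace_sub_projCoeff hB.isHermitian))
    rw [re_trace_sub_projCoeff_mul hB.isHermitian] at h1
    refine ⟨Real.sqrt (projCoeff B (gram y)), ?_⟩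
    rw [Real.sq_sqrt (projCoeff_gram_nonneg hB y)]
    exact sub_eq_zero.1 (eq_zero_of_re_trace_mul_self hherm h1)
  have hzero : ∀ z : ℂ, z = 0 → ∀ φ : ℝ → ℝ, mean (fun x => S.weight x * ((φ x : ℂ) * z)) = 0 := by
    rintro z rfl φ
    simp [mean]
  fin_cases k
  -- When all entries of the moment are fixed, constancy is the whole condition.
  · refine ⟨star y, (eqF_iff hf.1 hg.1 hm _).2 (hy.mono fun x hx => hx.trans ?_)⟩
    rw [star_star]
    rfl
  · obtain ⟨α, hα⟩ := hline 1 PosSemidef.one fun H hH h0 φ => by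
      refine Eq.trans ?_ Complex.ofReal_zero.symm
      simp only [trace_smul]
      rw [Matrix.mul_one] at h0
      exact hzero _ (Complex.ext h0 (im_trace_eq_zero hH)) φ
    exact ⟨α, (eqF_iff hf.1 hg.1 hm _).2 (hy.mono fun x hx => hx.trans hα)⟩
  · have hherm := isHermitian_sub_diagonal (isHermitian_gram y)
    have h1 := key _ hherm fun φ k => by
      refine Eq.trans ?_ Complex.ofReal_zero.symm
      refine hzero ((gram y - diagonal (gram y).diag) k k) ?_ φ
      simp
    rw [re_trace_sub_diagonal_mul] at h1
    have h2 := sub_eq_zero.1 (eq_zero_of_re_trace_mul_self hherm h1)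
    refine ⟨fun k => ‖y k‖, (eqF_iff hf.1 hg.1 hm _).2 (hy.mono fun x hx => hx.trans ?_)⟩
    rw [h2]
    congr 1
    funext k
    rw [diag_apply, gram_apply, Complex.conj_mul']
    push_cast
    rfl
  · obtain ⟨α, hα⟩ := hline c.B₁ᵀ hB₁.transpose fun H hH h0 φ => by
      refine Eq.trans ?_ Complex.ofReal_zero.symm
      simp only [pairing_smul]
      refine hzero _ (Complex.ext ?_ (im_pairing_eq_zero hB₁.isHermitian hH)) φ
      rw [pairing_eq_trace]
      exact h0
    exact ⟨α, (eqF_iff hf.1 hg.1 hm _).2 (hy.mono fun x hx => hx.trans hα)⟩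

end Problem

/-! ### Necessity of the equations: neighbourhood constraints. -/

theorem meanR_le_iff {F : ℝ → ℝ} {D : ℝ} : meanR F ≤ D ↔ ∫ x, F x ∂freq ≤ 2 * Real.pi * D := by
  have := Real.pi_pos
  rw [meanR, div_mul_eq_mul_div, one_mul, div_le_iff₀ (by positivity), mul_comm D]

theorem meanR_eq_iff {F : ℝ → ℝ} {D : ℝ} : meanR F = D ↔ ∫ x, F x ∂freq = 2 * Real.pi * D := by
  have := Real.pi_pos
  rw [meanR, div_mul_eq_mul_div, one_mul, div_eq_iff (by positivity), mul_comm D]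

/-- The multiplier of a real functional, as a square times a sign. -/
theorem exists_sign {t r : ℝ → ℝ} {τ : ℝ → ℂ} {b : ℝ} (hτ : ∀ᵐ x ∂freq, τ x = t x)
    (hb : 0 ≤ b) (h : ∀ᵐ x ∂freq, ‖r x‖ ≤ b ∧ (t x ≠ 0 → r x = (b * ‖t x‖⁻¹) • t x)) :
    ∃ (β : ℝ) (γ : ℝ → ℝ), β ^ 2 = b ∧ IsSignOf γ τ ∧ ∀ᵐ x ∂freq, r x = β ^ 2 * γ x := by
  have hsign : ∀ s : ℝ, s ≠ 0 → Real.sign s = |s|⁻¹ * s := fun s hs => by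
    rcases lt_or_gt_of_ne hs with h | h
    · rw [Real.sign_of_neg h, abs_of_neg h, inv_neg, neg_mul, inv_mul_cancel₀ hs]
    · rw [Real.sign_of_pos h, abs_of_pos h, inv_mul_cancel₀ hs]
  -- For `b = 0` the function `r` vanishes and carries no sign, so `γ` is read off `t`.
  refine ⟨Real.sqrt b, fun x => if b = 0 then Real.sign (t x) else r x / b, Real.sq_sqrt hb, ?_, ?_⟩
  · filter_upwards [hτ, h] with x h1 h2
    rw [h1, Complex.ofReal_re, Complex.ofReal_ne_zero]
    refine ⟨?_, fun h3 => ?_⟩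
    · split_ifs with hb0
      · rcases Real.sign_apply_eq (t x) with h | h | h <;> simp [h]
      · rw [abs_div, abs_of_nonneg hb]
        exact div_le_one_of_le₀ h2.1 hb
    · split_ifs with hb0
      · rfl
      · rw [h2.2 h3, hsign _ h3, smul_eq_mul, mul_assoc, mul_div_cancel_left₀ _ hb0,
          Real.norm_eq_abs]
  · filter_upwards [h] with x h2
    rw [Real.sq_sqrt hb]
    split_ifs with hb0
    · have := h2.1
      rw [hb0] at this
      rw [hb0, zero_mul]
      exact norm_le_zero_iff.1 this
    · rw [mul_div_cancel₀ _ hb0]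

/-- The multiplier of a complex functional, as a constant times a phase. -/
theorem exists_phase {t r : ℝ → ℂ} {b : ℝ}
    (h : ∀ᵐ x ∂freq, ‖r x‖ ≤ b ∧ (t x ≠ 0 → r x = (b * ‖t x‖⁻¹) • t x)) :
    ∃ γ : ℝ → ℂ, IsPhaseOf γ t ∧ ∀ᵐ x ∂freq, r x = b * γ x := by
  refine ⟨fun x => if b = 0 then t x / ‖t x‖ else r x / b, ?_, ?_⟩
  · filter_upwards [h] with x h2
    refine ⟨?_, fun h3 => ?_⟩
    · split_ifs with hb0
      · rw [norm_div, Complex.norm_real, norm_norm]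
        exact div_self_le_one _
      · have hb : 0 ≤ b := (norm_nonneg _).trans h2.1
        rw [norm_div, Complex.norm_real, Real.norm_of_nonneg hb]
        exact div_le_one_of_le₀ h2.1 hb
    · split_ifs with hb0
      · rfl
      · have : (b : ℂ) ≠ 0 := by exact_mod_cast hb0
        rw [h2.2 h3, Complex.real_smul]
        push_cast
        field_simp
  · filter_upwards [h] with x h2
    split_ifs with hb0
    · have := h2.1
      rw [hb0] at this
      rw [hb0, Complex.ofReal_zero, zero_mul]
      exact norm_le_zero_iff.1 this
    · have : (b : ℂ) ≠ 0 := by exact_mod_cast hb0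
      rw [mul_div_cancel₀ _ this]

theorem im_trace_mul_eq_zero {T : ℕ} {A B : Matrix (Fin T) (Fin T) ℂ} (hA : A.IsHermitian)
    (hB : B.IsHermitian) : (A * B).trace.im = 0 := by
  refine Complex.conj_eq_iff_im.1 ?_
  rw [← RCLike.star_def, ← trace_conjTranspose, conjTranspose_mul, hA.eq, hB.eq, trace_mul_comm]

/-- A Hermitian matrix function, scaled to respect the margin of positivity. -/
def scaled {T : ℕ} (g A : Density T) : Density T :=
  fun x => ((margin (g x) / (1 + ∑ i, ∑ j, ‖A x i j‖) : ℝ) : ℂ) • A x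

theorem scale_pos {T : ℕ} (g A : Density T) (x : ℝ) :
    0 < margin (g x) / (1 + ∑ i, ∑ j, ‖A x i j‖) :=
  div_pos (margin_pos _) (by positivity)

theorem isVariation_scaled {T : ℕ} {g A : Density T} (hg : IsSpectralDensity g)
    (hA : ∀ i j, AEStronglyMeasurable (fun x => A x i j) freq)
    (hH : ∀ᵐ x ∂freq, (A x).IsHermitian) : IsVariation g (scaled g A) := by
  refine ⟨fun i j => ?_, ?_, Filter.Eventually.of_forall fun x i j => ?_⟩
  · refine (Complex.continuous_ofReal.comp_aestronglyMeasurable ?_).fun_mul (hA i j)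
    have h1 : AEStronglyMeasurable (fun x => 1 + ∑ i, ∑ j, ‖A x i j‖) freq :=
      (Finset.aestronglyMeasurable_fun_sum _ fun i _ => Finset.aestronglyMeasurable_fun_sum _
        fun j _ => (hA i j).norm).const_add 1
    exact ((aestronglyMeasurable_margin hg).aemeasurable.div h1.aemeasurable).aestronglyMeasurable
  · filter_upwards [hH] with x hx
    rw [scaled, IsHermitian, conjTranspose_smul, hx.eq, RCLike.star_def, Complex.conj_ofReal]
  · rw [scaled, Matrix.smul_apply, smul_eq_mul, norm_mul, Complex.norm_real,
      Real.norm_of_nonneg (scale_pos g A x).le, div_mul_eq_mul_div, div_le_iff₀ (by positivity)]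
    refine mul_le_mul_of_nonneg_left ?_ (margin_pos _).le
    have : ‖A x i j‖ ≤ ∑ i, ∑ j, ‖A x i j‖ :=
      (Finset.single_le_sum (f := fun j => ‖A x i j‖) (fun _ _ => norm_nonneg _)
        (Finset.mem_univ j)).trans (Finset.single_le_sum (f := fun i => ∑ j, ‖A x i j‖)
          (fun _ _ => Finset.sum_nonneg fun _ _ => norm_nonneg _) (Finset.mem_univ i))
    linarith

namespace Problem

variable {T : ℕ} {S : Problem T} {f g : Density T} {c : ClassData T} {k : Fin 4}

/-- If the component of the multiplier in the direction of admissible variations has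
nonnegative variation, then it vanishes. -/
theorem IsSaddle.ae_eq_zero_of_scaled (h : S.IsSaddle (S.classF c k ×ˢ classG c k) f g)
    (hf : f ∈ S.classF c k) (hg : g ∈ classG c k) (hm : S.Minimality f g) {A : Density T}
    (hH : ∀ᵐ x ∂freq, (A x).IsHermitian)
    (hA : ∀ᵐ x ∂freq, (A x * gram (S.resG (S.specChar f g) x)).trace.re = (A x * A x).trace.re)
    (hΔ : (fun x => g x + scaled g A x) ∈ classG c k) : ∀ᵐ x ∂freq, A x = 0 := by
  obtain ⟨h1, h2⟩ := h.variation_right hf hg hm hΔ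
  have e : ∀ᵐ x ∂freq, (scaled g A x * gram (S.resG (S.specChar f g) x)).trace.re
      = margin (g x) / (1 + ∑ i, ∑ j, ‖A x i j‖) * (A x * A x).trace.re := by
    filter_upwards [hA] with x hx
    rw [scaled, Matrix.smul_mul, trace_smul, smul_eq_mul, Complex.re_ofReal_mul, hx]
  have hnn : 0 ≤ᵐ[freq] fun x => (scaled g A x * gram (S.resG (S.specChar f g) x)).trace.re := by
    filter_upwards [e, hH] with x h3 h4
    rw [h3]
    exact mul_nonneg (scale_pos g A x).le (re_trace_mul_self_nonneg h4)
  filter_upwards [(integral_eq_zero_iff_of_nonneg_ae hnn h1).1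
    (le_antisymm h2 (integral_nonneg_of_ae hnn)), e, hH] with x h3 h4 h5
  rw [h4, Pi.zero_apply] at h3
  exact eq_zero_of_re_trace_mul_self h5 ((mul_eq_zero_iff_left (scale_pos g A x).ne').1 h3).le

/-- The multiplier of a real functional. -/
theorem IsSaddle.exists_real_multiplier (h : S.IsSaddle (S.classF c k ×ˢ classG c k) f g)
    (hf : f ∈ S.classF c k) (hg : g ∈ classG c k) (hm : S.Minimality f g)
    {H : Matrix (Fin T) (Fin T) ℂ} (hH : H.IsHermitian) {t : ℝ → ℝ} {D : ℝ}
    (ht : Integrable t freq) (hD0 : 0 < D) (hD : ∫ x, ‖t x‖ ∂freq ≤ D)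
    (hclass : ∀ φ : ℝ → ℝ, IsVariation g (fun x => (φ x : ℂ) • H) →
      ∫ x, ‖t x + φ x‖ ∂freq ≤ D → (fun x => g x + (φ x : ℂ) • H) ∈ classG c k) :
    ∃ b : ℝ, 0 ≤ b ∧ (∀ᵐ x ∂freq, ‖(H * gram (S.resG (S.specChar f g) x)).trace.re‖ ≤ b ∧
      (t x ≠ 0 → (H * gram (S.resG (S.specChar f g) x)).trace.re = (b * ‖t x‖⁻¹) • t x)) ∧
      (b ≠ 0 → ∫ x, ‖t x‖ ∂freq = D) := by
  set K := ∑ i, ∑ j, ‖H i j‖ with hK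
  have hK0 : 0 ≤ K := by positivity
  have hmar := integrable_margin hg.1
  refine exists_multiplier (lam := fun x => margin (g x) / (K + 1)) ?_ ht (hmar.div_const _)
    (Filter.Eventually.of_forall fun x => div_pos (margin_pos _) (by linarith))
    (fun φ hφm hφ hφD => ?_) hD0 hD
  · exact aestronglyMeasurable_re_trace_mul (fun i j => aestronglyMeasurable_const)
      (aestronglyMeasurable_gram_resG hf.1 hg.1 hm)
  · have hv : IsVariation g fun x => (φ x : ℂ) • H := by
      refine isVariation_smul hH hφm ?_
      filter_upwards [hφ] with x hx
      have hmp := margin_pos (g x)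
      calc |φ x| * K ≤ margin (g x) / (K + 1) * (K + 1) := by
            refine mul_le_mul hx (by linarith) hK0 (div_pos hmp (by linarith)).le
        _ = margin (g x) := div_mul_cancel₀ _ (by linarith)
    have key := h.variation_right hf hg hm (hclass φ hv hφD)
    simp only [Matrix.smul_mul, trace_smul, smul_eq_mul, Complex.re_ofReal_mul] at key
    simpa only [Real.inner_apply, mul_comm] using key

end Problem

/-- The Hermitian matrix with the entries `z`, `conj z` at the places `(i, j)`, `(j, i)`. -/
def symmSingle {T : ℕ} (i j : Fin T) (z : ℂ) : Matrix (Fin T) (Fin T) ℂ :=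
  single i j z + single j i (conj z)

section SymmSingle

variable {T : ℕ} {i j : Fin T}

theorem isHermitian_symmSingle (i j : Fin T) (z : ℂ) : (symmSingle i j z).IsHermitian := by
  rw [IsHermitian, symmSingle, conjTranspose_add, conjTranspose_single, conjTranspose_single,
    RCLike.star_def, Complex.conj_conj, add_comm]

theorem symmSingle_apply_same (h : i ≠ j) (z : ℂ) : symmSingle i j z i j = z := by
  simp [symmSingle, Matrix.add_apply, h]

theorem symmSingle_apply_swap (h : i ≠ j) (z : ℂ) : symmSingle i j z j i = conj z := by
  simp [symmSingle, Matrix.add_apply, h]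

theorem symmSingle_apply_of_ne {a b : Fin T} (h : ¬(a = i ∧ b = j)) (h' : ¬(a = j ∧ b = i))
    (z : ℂ) : symmSingle i j z a b = 0 := by
  rw [symmSingle, Matrix.add_apply, single_apply, single_apply, if_neg, if_neg, add_zero]
  · exact fun h1 => h' ⟨h1.1.symm, h1.2.symm⟩
  · exact fun h1 => h ⟨h1.1.symm, h1.2.symm⟩

/-- The two places contribute equal real parts. The result is a real inner product on `ℂ`, so
`exists_multiplier` applies with `E = ℂ`. -/
theorem re_trace_symmSingle_mul (z : ℂ) {R : Matrix (Fin T) (Fin T) ℂ} (hR : R.IsHermitian) :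
    (symmSingle i j z * R).trace.re = 2 * inner ℝ (R i j) z := by
  rw [symmSingle, Matrix.add_mul, trace_add, trace_single_mul, trace_single_mul, Complex.add_re,
    ← hR.apply j i, RCLike.star_def, smul_eq_mul, smul_eq_mul, Complex.inner, Complex.mul_re,
    Complex.mul_re]
  simp only [Complex.conj_re, Complex.conj_im]
  ring

theorem isVariation_symmSingle {g : Density T} {φ : ℝ → ℂ} (h : i ≠ j)
    (hφm : AEStronglyMeasurable φ freq) (hφ : ∀ᵐ x ∂freq, ‖φ x‖ ≤ margin (g x)) :
    IsVariation g fun x => symmSingle i j (φ x) := by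
  refine ⟨fun a b => ?_, Filter.Eventually.of_forall fun x => isHermitian_symmSingle i j _, ?_⟩
  · by_cases h1 : a = i ∧ b = j
    · obtain ⟨rfl, rfl⟩ := h1
      simpa only [symmSingle_apply_same h] using hφm
    by_cases h2 : a = j ∧ b = i
    · obtain ⟨rfl, rfl⟩ := h2
      simpa only [symmSingle_apply_swap h] using
        Complex.continuous_conj.comp_aestronglyMeasurable hφm
    · simpa only [symmSingle_apply_of_ne h1 h2] using aestronglyMeasurable_const
  · filter_upwards [hφ] with x hx a b
    by_cases h1 : a = i ∧ b = j
    · obtain ⟨rfl, rfl⟩ := h1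
      rwa [symmSingle_apply_same h]
    by_cases h2 : a = j ∧ b = i
    · obtain ⟨rfl, rfl⟩ := h2
      rwa [symmSingle_apply_swap h, RCLike.norm_conj]
    · rw [symmSingle_apply_of_ne h1 h2, norm_zero]
      exact (margin_pos _).le

end SymmSingle

theorem IsSpectralDensity.integrable_trace_mul_const {T : ℕ} {g g₁ : Density T}
    (hg : IsSpectralDensity g) (hg₁ : IsSpectralDensity g₁) (B : Matrix (Fin T) (Fin T) ℂ) :
    Integrable (fun x => ((g x - g₁ x) * B).trace) freq := by
  simp only [trace, diag_apply, mul_apply]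
  exact integrable_finsetSum _ fun i _ => integrable_finsetSum _ fun j _ =>
    (hg.integrable_sub_apply hg₁ i j).mul_const _

namespace Problem

variable {T : ℕ} {S : Problem T} {f g : Density T} {c : ClassData T} {k : Fin 4}

/-- The multiplier of the neighbourhood given by the functional of a Hermitian matrix. -/
theorem IsSaddle.exists_line_multiplier (hg₁ : IsSpectralDensity c.g₁)
    (h : S.IsSaddle (S.classF c k ×ˢ classG c k) f g)
    (hf : f ∈ S.classF c k) (hg : g ∈ classG c k) (hm : S.Minimality f g)
    {B : Matrix (Fin T) (Fin T) ℂ} (hB : B.IsHermitian) {D : ℝ} (hD0 : 0 < D)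
    (hD : ∫ x, ‖((g x - c.g₁ x) * B).trace‖ ∂freq ≤ D)
    (hclass : ∀ Δ : Density T, IsVariation g Δ →
      ∫ x, ‖((g x + Δ x - c.g₁ x) * B).trace‖ ∂freq ≤ D → (fun x => g x + Δ x) ∈ classG c k) :
    ∃ (β : ℝ) (γ : ℝ → ℝ), IsSignOf γ (fun x => ((g x - c.g₁ x) * B).trace) ∧
      (∀ᵐ x ∂freq, gram (S.resG (S.specChar f g) x) = ((β ^ 2 * γ x : ℝ) : ℂ) • B) ∧
      (β ≠ 0 → ∫ x, ‖((g x - c.g₁ x) * B).trace‖ ∂freq = D) := by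
  set R : Density T := fun x => gram (S.resG (S.specChar f g) x)
  have hR_apply : ∀ x, R x = gram (S.resG (S.specChar f g) x) := fun _ => rfl
  have hRm : ∀ i j, AEStronglyMeasurable (fun x => R x i j) freq :=
    aestronglyMeasurable_gram_resG hf.1 hg.1 hm
  have hcm : AEStronglyMeasurable (fun x => projCoeff B (R x)) freq := by
    have h1 : AEStronglyMeasurable (fun x => (R x * B).trace.re) freq :=
      aestronglyMeasurable_re_trace_mul (B := fun _ => B) hRm
        fun i j => aestronglyMeasurable_const
    exact h1.mul_const (B * B).trace.re⁻¹
  -- The component of `R` orthogonal to `B` leaves `tr ((g - g₁) B)` unchanged; scaled down it is an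
  -- admissible variation, so it vanishes.
  have hRB : ∀ᵐ x ∂freq, R x = (projCoeff B (R x) : ℂ) • B := by
    have hherm : ∀ x, (R x - (projCoeff B (R x) : ℂ) • B).IsHermitian := fun x =>
      isHermitian_sub_smul (isHermitian_gram _) hB _
    have key := h.ae_eq_zero_of_scaled hf hg hm (A := fun x => R x - (projCoeff B (R x) : ℂ) • B)
      (Filter.Eventually.of_forall hherm)
      (Filter.Eventually.of_forall fun x => re_trace_sub_projCoeff_mul hB) ?_
    · exact key.mono fun x hx => sub_eq_zero.1 hx
    · refine hclass _ (isVariation_scaled hg.1 (fun i j => (hRm i j).fun_sub ?_)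
        (Filter.Eventually.of_forall hherm)) ?_
      · exact (Complex.continuous_ofReal.comp_aestronglyMeasurable hcm).fun_mul
          aestronglyMeasurable_const
      · refine le_of_eq_of_le (integral_congr_ae (Filter.Eventually.of_forall fun x => ?_)) hD
        have h0 : ((R x - (projCoeff B (R x) : ℂ) • B) * B).trace = 0 :=
          Complex.ext (re_trace_sub_projCoeff hB) (im_trace_mul_eq_zero (hherm x) hB)
        simp only [scaled]
        rw [add_sub_right_comm, Matrix.add_mul, trace_add, Matrix.smul_mul, trace_smul, h0,
          smul_zero, add_zero]
  -- For `B = 0` the functional vanishes and so does `R`; the multiplier is zero.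
  rcases eq_or_ne (B * B).trace.re 0 with h0 | h0
  · have hB0 := eq_zero_of_re_trace_mul_self hB h0.le
    refine ⟨0, 0, Filter.Eventually.of_forall fun x => ?_, ?_, fun h => absurd rfl h⟩
    · simp [hB0]
    · filter_upwards [hRB] with x hx
      rw [← hR_apply, hx, hB0, smul_zero, smul_zero]
  have hτ : ∀ᵐ x ∂freq, ((g x - c.g₁ x) * B).trace = (((g x - c.g₁ x) * B).trace.re : ℂ) := by
    filter_upwards [hg.1.ae_isHermitian_sub hg₁] with x hx
    exact Complex.ext rfl (im_trace_mul_eq_zero hx hB)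
  have hnorm : ∫ x, ‖((g x - c.g₁ x) * B).trace.re‖ ∂freq
      = ∫ x, ‖((g x - c.g₁ x) * B).trace‖ ∂freq :=
    integral_congr_ae (hτ.mono fun x hx => by
      dsimp only
      rw [hx, Complex.ofReal_re, Complex.norm_real])
  -- Normalised so that adding `φ` times this matrix to `g` adds exactly `φ` to the functional.
  have hH : (((((B * B).trace.re)⁻¹ : ℝ) : ℂ) • B).IsHermitian := by
    rw [IsHermitian, conjTranspose_smul, hB.eq, RCLike.star_def, Complex.conj_ofReal]
  have ht : Integrable (fun x => ((g x - c.g₁ x) * B).trace.re) freq :=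
    (hg.1.integrable_trace_mul_const hg₁ B).re
  obtain ⟨b, hb, h1, h2⟩ := h.exists_real_multiplier hf hg hm hH ht hD0 (hnorm.trans_le hD) fun φ hφ hφD => by
    refine hclass _ hφ (le_of_eq_of_le (integral_congr_ae ?_) hφD)
    filter_upwards [hτ] with x hx
    have h3 : ((B * B).trace : ℂ) = ((B * B).trace.re : ℂ) :=
      Complex.ext rfl (im_trace_mul_eq_zero hB hB)
    rw [add_sub_right_comm, Matrix.add_mul, trace_add, Matrix.smul_mul, trace_smul,
      Matrix.smul_mul, trace_smul, hx, h3]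
    simp only [Complex.ofReal_re, smul_eq_mul]
    rw [← Complex.ofReal_mul, inv_mul_cancel₀ h0, Complex.ofReal_one, mul_one,
      ← Complex.ofReal_add, Complex.norm_real]
  obtain ⟨β, γ, hβ, hγ, hr⟩ := exists_sign hτ hb h1
  refine ⟨β, γ, hγ, ?_, fun hβ0 => hnorm.symm.trans (h2 ?_)⟩
  · filter_upwards [hRB, hr] with x h3 h4
    have h5 : projCoeff B (R x) = β ^ 2 * γ x := by
      rw [← h4, ← hR_apply, Matrix.smul_mul, trace_smul, smul_eq_mul, Complex.re_ofReal_mul,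
        re_trace_mul_comm B (R x), projCoeff, div_eq_inv_mul]
    rw [← h5, ← hR_apply]
    exact h3
  · rw [← hβ]
    exact pow_ne_zero 2 hβ0

/-- The multiplier of the neighbourhood of a diagonal entry. -/
theorem IsSaddle.exists_diag_multiplier (hg₁ : IsSpectralDensity c.g₁)
    (h : S.IsSaddle (S.classF c k ×ˢ classG c k) f g)
    (hf : f ∈ S.classF c k) (hg : g ∈ classG c k) (hm : S.Minimality f g)
    (i : Fin T) {D : ℝ} (hD0 : 0 < D) (hD : ∫ x, ‖(g x - c.g₁ x) i i‖ ∂freq ≤ D)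
    (hclass : ∀ φ : ℝ → ℝ, IsVariation g (fun x => (φ x : ℂ) • (single i i 1 : Matrix (Fin T) (Fin T) ℂ)) →
      ∫ x, ‖(g x + (φ x : ℂ) • (single i i 1 : Matrix (Fin T) (Fin T) ℂ) - c.g₁ x) i i‖ ∂freq ≤ D →
      (fun x => g x + (φ x : ℂ) • (single i i 1 : Matrix (Fin T) (Fin T) ℂ)) ∈ classG c k) :
    ∃ b : ℝ, 0 ≤ b ∧ (∀ᵐ x ∂freq, ‖(gram (S.resG (S.specChar f g) x) i i).re‖ ≤ b ∧
      (((g x - c.g₁ x) i i).re ≠ 0 → (gram (S.resG (S.specChar f g) x) i i).re =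
        (b * ‖((g x - c.g₁ x) i i).re‖⁻¹) • ((g x - c.g₁ x) i i).re)) ∧
      (b ≠ 0 → ∫ x, ‖(g x - c.g₁ x) i i‖ ∂freq = D) := by
  have hτ : ∀ᵐ x ∂freq, (g x - c.g₁ x) i i = (((g x - c.g₁ x) i i).re : ℂ) := by
    filter_upwards [hg.1.ae_isHermitian_sub hg₁] with x hx
    exact Complex.ext rfl (im_diag_eq_zero hx i)
  have hnorm : ∫ x, ‖((g x - c.g₁ x) i i).re‖ ∂freq = ∫ x, ‖(g x - c.g₁ x) i i‖ ∂freq :=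
    integral_congr_ae (hτ.mono fun x hx => by
      dsimp only
      rw [hx, Complex.ofReal_re, Complex.norm_real])
  have hH : (single i i (1 : ℂ)).IsHermitian := by
    rw [IsHermitian, conjTranspose_single, star_one]
  have ht : Integrable (fun x => ((g x - c.g₁ x) i i).re) freq :=
    (hg.1.integrable_sub_apply hg₁ i i).re
  obtain ⟨b, hb, h1, h2⟩ := h.exists_real_multiplier hf hg hm hH ht hD0 (hnorm.trans_le hD) fun φ hφ hφD => by
    refine hclass _ hφ (le_of_eq_of_le (integral_congr_ae ?_) hφD)
    filter_upwards [hτ] with x hx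
    rw [add_sub_right_comm, Matrix.add_apply, hx, Matrix.smul_apply, single_apply_same, smul_eq_mul,
      mul_one, ← Complex.ofReal_add, Complex.norm_real, Complex.ofReal_re]
  refine ⟨b, hb, ?_, fun hb0 => hnorm.symm.trans (h2 hb0)⟩
  filter_upwards [h1] with x hx
  simpa only [trace_single_mul, one_smul] using hx

/-- The multiplier of the neighbourhood of an entry off the diagonal. -/
theorem IsSaddle.exists_offDiag_multiplier (hg₁ : IsSpectralDensity c.g₁)
    (h : S.IsSaddle (S.classF c k ×ˢ classG c k) f g)
    (hf : f ∈ S.classF c k) (hg : g ∈ classG c k) (hm : S.Minimality f g)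
    {i j : Fin T} (hij : i ≠ j) {D : ℝ} (hD0 : 0 < D)
    (hD : ∫ x, ‖(g x - c.g₁ x) i j‖ ∂freq ≤ D)
    (hclass : ∀ φ : ℝ → ℂ, IsVariation g (fun x => symmSingle i j (φ x)) →
      ∫ x, ‖(g x - c.g₁ x) i j + φ x‖ ∂freq ≤ D →
      (fun x => g x + symmSingle i j (φ x)) ∈ classG c k) :
    ∃ b : ℝ, 0 ≤ b ∧ (∀ᵐ x ∂freq, ‖gram (S.resG (S.specChar f g) x) i j‖ ≤ b ∧
      ((g x - c.g₁ x) i j ≠ 0 → gram (S.resG (S.specChar f g) x) i j =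
        (b * ‖(g x - c.g₁ x) i j‖⁻¹) • (g x - c.g₁ x) i j)) ∧
      (b ≠ 0 → ∫ x, ‖(g x - c.g₁ x) i j‖ ∂freq = D) := by
  refine exists_multiplier (lam := fun x => margin (g x))
    (aestronglyMeasurable_gram_resG hf.1 hg.1 hm i j) (hg.1.integrable_sub_apply hg₁ i j)
    (integrable_margin hg.1) (Filter.Eventually.of_forall fun x => margin_pos _)
    (fun φ hφm hφ hφD => ?_) hD0 hD
  obtain ⟨h1, h2⟩ := h.variation_right hf hg hm
    (hclass φ (isVariation_symmSingle hij hφm hφ) hφD)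
  simp only [re_trace_symmSingle_mul _ (isHermitian_gram _)] at h1 h2
  rw [integral_const_mul] at h2
  refine ⟨?_, by linarith⟩
  have h3 := h1.const_mul (1 / 2)
  refine h3.congr (Filter.Eventually.of_forall fun x => ?_)
  dsimp only
  ring

theorem classG_add {Δ : Density T} (hg : g ∈ classG c k) (hp : ∀ᵐ x ∂freq, (g x).PosDef)
    (hΔ : IsVariation g Δ) (h0 : NbhdConstraint c (fun x => g x + Δ x) k) :
    (fun x => g x + Δ x) ∈ classG c k :=
  ⟨hΔ.isSpectralDensity hg.1 hp, h0⟩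

/-- Lagrange multipliers of the neighbourhood constraints. -/
theorem IsSaddle.multiplierG (hg₁ : IsSpectralDensity c.g₁) (hB₂ : c.B₂.PosSemidef)
    (hc : c.RadiiPos k) (h : S.IsSaddle (S.classF c k ×ˢ classG c k) f g) (hf : f ∈ S.classF c k)
    (hg : g ∈ classG c k) (hm : S.Minimality f g) (hp : ∀ᵐ x ∂freq, (g x).PosDef) :
    S.MultiplierG c f g k := by
  have hpi := Real.two_pi_pos
  have hgN := hg.2
  fin_cases k
  · obtain ⟨β, γ, h1, h2, h3⟩ := h.exists_line_multiplier hg₁ hf hg hm (B := 1) isHermitian_one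
      (mul_pos hpi hc) (by simpa only [Matrix.mul_one] using meanR_le_iff.1 hgN)
      fun Δ hΔ hD => classG_add hg hp hΔ
        (meanR_le_iff.2 (by simpa only [Matrix.mul_one] using hD))
    simp only [Matrix.mul_one] at h1 h3
    exact ⟨β, γ, h1, (eqG_iff hf.1 hg.1 hm _).2 h2, fun hβ => meanR_eq_iff.2 (h3 hβ)⟩
  -- Off-diagonal perturbations do not affect the constraint, so the off-diagonal part of the Gram
  -- matrix vanishes.
  · have hRd : ∀ᵐ x ∂freq, gram (S.resG (S.specChar f g) x)
        = diagonal (gram (S.resG (S.specChar f g) x)).diag := by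
      have hherm := fun x => isHermitian_sub_diagonal (isHermitian_gram (S.resG (S.specChar f g) x))
      refine (h.ae_eq_zero_of_scaled hf hg hm (A := fun x => gram (S.resG (S.specChar f g) x)
        - diagonal (gram (S.resG (S.specChar f g) x)).diag) (Filter.Eventually.of_forall hherm)
        (Filter.Eventually.of_forall fun x => re_trace_sub_diagonal_mul _)
        (classG_add hg hp (isVariation_scaled hg.1 (fun i j => ?_)
          (Filter.Eventually.of_forall hherm)) fun k => ?_)).mono fun x hx => sub_eq_zero.1 hx
      · have := aestronglyMeasurable_gram_resG hf.1 hg.1 hm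
        rcases eq_or_ne i j with rfl | hij
        · simpa using aestronglyMeasurable_const
        · simpa [diagonal_apply_ne _ hij] using this i j
      · have e : ∀ x, (g x + scaled g (fun x => gram (S.resG (S.specChar f g) x)
            - diagonal (gram (S.resG (S.specChar f g) x)).diag) x - c.g₁ x) k k
            = (g x - c.g₁ x) k k := fun x => by
          have h0 : (gram (S.resG (S.specChar f g) x)
              - diagonal (gram (S.resG (S.specChar f g) x)).diag) k k = 0 := by simp
          rw [add_sub_right_comm, Matrix.add_apply, scaled, Matrix.smul_apply, h0, smul_zero,
            add_zero]
        simpa only [e] using hgN k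
    have hex := fun i => h.exists_diag_multiplier hg₁ hf hg hm i (mul_pos hpi (hc i))
      (meanR_le_iff.1 (hgN i)) fun φ hφ hD => classG_add hg hp hφ fun j => by
        rcases eq_or_ne j i with rfl | hij
        · exact meanR_le_iff.2 hD
        · have e : ∀ x, (g x + (φ x : ℂ) • (single i i 1 : Matrix (Fin T) (Fin T) ℂ) - c.g₁ x) j j = (g x - c.g₁ x) j j :=
            fun x => by
              rw [add_sub_right_comm, Matrix.add_apply, Matrix.smul_apply,
                single_apply_of_ne _ _ _ _ _ fun h => hij h.1.symm, smul_zero, add_zero]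
          simpa only [e] using hgN j
    choose b hb h1 h2 using hex
    have hτ : ∀ i, ∀ᵐ x ∂freq, (g x - c.g₁ x) i i = (((g x - c.g₁ x) i i).re : ℂ) := fun i => by
      filter_upwards [hg.1.ae_isHermitian_sub hg₁] with x hx
      exact Complex.ext rfl (im_diag_eq_zero hx i)
    choose β γ hβ hγ hr using fun i => exists_sign (hτ i) (hb i) (h1 i)
    refine ⟨β, γ, hγ, (eqG_iff hf.1 hg.1 hm _).2 ?_, fun i hi => meanR_eq_iff.2 (h2 i ?_)⟩
    · filter_upwards [hRd, ae_all_iff.2 hr] with x h3 h4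
      rw [h3]
      congr 1
      funext i
      rw [diag_apply, ← h4 i]
      exact Complex.ext rfl (im_diag_eq_zero (isHermitian_gram _) i)
    · rw [← hβ i]
      exact pow_ne_zero 2 hi
  · obtain ⟨β, γ, h1, h2, h3⟩ := h.exists_line_multiplier hg₁ hf hg hm hB₂.transpose.isHermitian
      (mul_pos hpi hc) (by simpa only [← pairing_eq_trace] using meanR_le_iff.1 hgN)
      fun Δ hΔ hD => classG_add hg hp hΔ
        (meanR_le_iff.2 (by simpa only [← pairing_eq_trace] using hD))
    simp only [← pairing_eq_trace] at h1 h3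
    exact ⟨β, γ, h1, (eqG_iff hf.1 hg.1 hm _).2 h2, fun hβ => meanR_eq_iff.2 (h3 hβ)⟩
  · have hherm := hg.1.ae_isHermitian_sub hg₁
    have hex : ∀ i j, ∃ b : ℝ, 0 ≤ b ∧ (∀ᵐ x ∂freq, ‖gram (S.resG (S.specChar f g) x) i j‖ ≤ b ∧
        ((g x - c.g₁ x) i j ≠ 0 → gram (S.resG (S.specChar f g) x) i j =
          (b * ‖(g x - c.g₁ x) i j‖⁻¹) • (g x - c.g₁ x) i j)) ∧
        (b ≠ 0 → ∫ x, ‖(g x - c.g₁ x) i j‖ ∂freq = 2 * Real.pi * c.δij i j) := by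
      intro i j
      rcases eq_or_ne i j with rfl | hij
      -- A diagonal entry admits real perturbations only; the real multiplier is then read as a
      -- complex one.
      · obtain ⟨b, hb, h1, h2⟩ := h.exists_diag_multiplier hg₁ hf hg hm i
          (mul_pos hpi (hc i i).1) (meanR_le_iff.1 (hgN i i)) fun φ hφ hD =>
            classG_add hg hp hφ fun a b => by
              by_cases hab : a = i ∧ b = i
              · obtain ⟨rfl, rfl⟩ := hab
                exact meanR_le_iff.2 hD
              · have e : ∀ x, (g x + (φ x : ℂ) • (single i i 1 : Matrix (Fin T) (Fin T) ℂ) - c.g₁ x) a b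
                    = (g x - c.g₁ x) a b := fun x => by
                  rw [add_sub_right_comm, Matrix.add_apply, Matrix.smul_apply,
                    single_apply_of_ne _ _ _ _ _ fun h => hab ⟨h.1.symm, h.2.symm⟩, smul_zero,
                    add_zero]
                simpa only [e] using hgN a b
        refine ⟨b, hb, ?_, h2⟩
        filter_upwards [h1, hherm] with x h3 h4
        have e1 : (g x - c.g₁ x) i i = (((g x - c.g₁ x) i i).re : ℂ) :=
          Complex.ext rfl (im_diag_eq_zero h4 i)
        have e2 : gram (S.resG (S.specChar f g) x) i i
            = ((gram (S.resG (S.specChar f g) x) i i).re : ℂ) :=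
          Complex.ext rfl (im_diag_eq_zero (isHermitian_gram _) i)
        rw [e1, e2, Complex.norm_real, Complex.norm_real, Complex.ofReal_ne_zero]
        refine ⟨h3.1, fun h5 => ?_⟩
        rw [h3.2 h5, Complex.real_smul, smul_eq_mul, Complex.ofReal_mul]
      · refine h.exists_offDiag_multiplier hg₁ hf hg hm hij (mul_pos hpi (hc i j).1)
          (meanR_le_iff.1 (hgN i j)) fun φ hφ hD => classG_add hg hp hφ fun a b => ?_
        by_cases h1 : a = i ∧ b = j
        · obtain ⟨rfl, rfl⟩ := h1
          refine meanR_le_iff.2 (le_of_eq_of_le ?_ hD)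
          simp only [add_sub_right_comm, Matrix.add_apply, symmSingle_apply_same hij]
        by_cases h2 : a = j ∧ b = i
        · obtain ⟨rfl, rfl⟩ := h2
          -- A Hermitian perturbation moves the entries `(i, j)` and `(j, i)` together; both
          -- constraints survive because their radii agree.
          rw [← (hc b a).2]
          refine meanR_le_iff.2 (le_of_eq_of_le (integral_congr_ae ?_) hD)
          filter_upwards [hherm] with x hx
          rw [add_sub_right_comm, Matrix.add_apply, symmSingle_apply_swap hij, ← hx.apply a b,
            RCLike.star_def, ← map_add, RCLike.norm_conj]
        · have e : ∀ x, (g x + symmSingle i j (φ x) - c.g₁ x) a b = (g x - c.g₁ x) a b :=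
            fun x => by
              rw [add_sub_right_comm, Matrix.add_apply, symmSingle_apply_of_ne h1 h2, add_zero]
          simpa only [e] using hgN a b
    choose β hβ h1 h2 using hex
    choose γ hγ hr using fun i j => exists_phase (h1 i j)
    refine ⟨β, γ, hβ, hγ, (eqG_iff hf.1 hg.1 hm _).2 ?_, fun i j hij =>
      meanR_eq_iff.2 (h2 i j hij)⟩
    filter_upwards [ae_all_iff.2 fun i => ae_all_iff.2 fun j => hr i j] with x hx
    ext i j
    exact hx i j

end Problem

/-! ### From least favorable pairs to the saddle inequality; the theorem. -/

namespace Problem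

variable {T : ℕ} {S : Problem T} {f g : Density T} {c : ClassData T} {k : Fin 4}

/-- Both classes are convex, so the segment to any other pair stays in the class. -/
theorem LeastFavorable.isSaddle (hg₁ : IsSpectralDensity c.g₁) (hf : f ∈ S.classF c k)
    (hg : g ∈ classG c k) (hm : S.Minimality f g)
    (h : S.LeastFavorable (S.classF c k ×ˢ classG c k) f g) :
    S.IsSaddle (S.classF c k ×ˢ classG c k) f g := fun _ _ h' =>
  err_le_of_leastFavorable hf.1 hg.1 h'.1.1 h'.2.1 hm h fun _ ht ht1 =>
    ⟨classF_segm ht ht1 hf h'.1, classG_segm hg₁ ht ht1 hg h'.2⟩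

end Problem

end

end RobustInterpolation

open RobustInterpolation in
theorem theorem4p1 {T : ℕ} (S : Problem T) (c : ClassData T)
    (hg₁ : IsSpectralDensity c.g₁) (hB₁ : c.B₁.PosSemidef) (hB₂ : c.B₂.PosSemidef)
    (k : Fin 4) (f₀ g₀ : Density T)
    (hf₀ : f₀ ∈ S.classF c k) (hg₀ : g₀ ∈ classG c k) (hmin : S.Minimality f₀ g₀) :
    -- the explicit formula gives the optimal spectral characteristic for `(f₀, g₀)`
    (S.InObs f₀ g₀ (S.specChar f₀ g₀) ∧
      S.mse f₀ g₀ (S.specChar f₀ g₀) = S.minMse f₀ g₀) ∧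
    -- solutions of the equations are least favorable, and the formula is minimax-robust
    (S.MultiplierF c f₀ g₀ k → S.MultiplierG c f₀ g₀ k →
      S.LeastFavorable (S.classF c k ×ˢ classG c k) f₀ g₀ ∧
      S.ZeroMemSubdifferential (S.classF c k ×ˢ classG c k) (S.specChar f₀ g₀) f₀ g₀ ∧
      S.IsMinimax (S.classF c k ×ˢ classG c k) (S.specChar f₀ g₀)) ∧
    -- nondegenerate least favorable densities solve the equations
    (c.RadiiPos k → (∀ᵐ x ∂freq, (f₀ x).PosDef ∧ (g₀ x).PosDef) →
      S.LeastFavorable (S.classF c k ×ˢ classG c k) f₀ g₀ →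
      S.MultiplierF c f₀ g₀ k ∧ S.MultiplierG c f₀ g₀ k) ∧
    -- for all least favorable densities, the formula is minimax-robust when it is admissible
    (S.specChar f₀ g₀ ∈ S.robustSet (S.classF c k ×ˢ classG c k) →
      (S.LeastFavorable (S.classF c k ×ˢ classG c k) f₀ g₀ ↔
        S.ZeroMemSubdifferential (S.classF c k ×ˢ classG c k) (S.specChar f₀ g₀) f₀ g₀) ∧
      (S.LeastFavorable (S.classF c k ×ˢ classG c k) f₀ g₀ →
        S.IsMinimax (S.classF c k ×ˢ classG c k) (S.specChar f₀ g₀))) := by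
  have hD : ∀ f g, (f, g) ∈ S.classF c k ×ˢ classG c k → IsSpectralDensity f ∧ IsSpectralDensity g :=
    fun f g h => ⟨h.1.1, h.2.1⟩
  refine ⟨⟨Problem.inObs_specChar hf₀.1 hg₀.1 hmin, Problem.mse_specChar hf₀.1 hg₀.1 hmin⟩,
    Problem.saddle_of_multipliers hg₁ hB₂ hf₀ hg₀ hmin, fun hc hp hLF => ?_, fun h0 => ?_⟩
  · have h := Problem.LeastFavorable.isSaddle hg₁ hf₀ hg₀ hmin hLF
    exact ⟨h.multiplierF hB₁ hf₀ hg₀ hmin (hp.mono fun _ hx => hx.1),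
      h.multiplierG hg₁ hB₂ hc hf₀ hg₀ hmin (hp.mono fun _ hx => hx.2)⟩
  -- Admissibility for the class turns the inequality between the spectral expressions `err` into
  -- one between the errors `mse`.
  · have hle : S.LeastFavorable (S.classF c k ×ˢ classG c k) f₀ g₀ →
        ∀ f g, (f, g) ∈ S.classF c k ×ˢ classG c k →
          S.mse f g (S.specChar f₀ g₀) ≤ S.mse f₀ g₀ (S.specChar f₀ g₀) := fun hLF f g h => by
      rw [Problem.mse_eq_err h.1.1 h.2.1 (h0 f g h),
        Problem.mse_eq_err hf₀.1 hg₀.1 (h0 f₀ g₀ ⟨hf₀, hg₀⟩)]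
      exact Problem.LeastFavorable.isSaddle hg₁ hf₀ hg₀ hmin hLF f g h
    have hmem : (f₀, g₀) ∈ S.classF c k ×ˢ classG c k := ⟨hf₀, hg₀⟩
    have key := Problem.saddle hD hmin hmem h0
    exact ⟨⟨fun hLF => (key (hle hLF)).2.1, fun hz => (key fun f g h =>
      Problem.le_of_zeroMemSubdifferential hmem hz h).1⟩, fun hLF => (key (hle hLF)).2.2⟩
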